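/- Let $d\in\{1,2\}$, $t_0>\frac d2$, and let $\theta:\mathbb R\to\mathbb R$ be a nonnegative, compactly supported, smooth, even function equal to one near $0$. Write $D=-i\nabla$, $\Lambda=\sqrt{1+|D|^2}$ (acting on the horizontal variable $X\in\mathbb R^d$), $S=\mathbb R^d\times(-1,0)$ and $\nabla^\mu_{X,z}=(\sqrt\mu\,\nabla_X,\partial_z)^t$. For parameters $\varepsilon,\beta,\mu,\delta>0$ and real-valued $\zeta,b\in H^{t_0+1}(\mathbb R^d)$ put, on $S$, $$\sigma(X,z)=\big[\theta(\delta z|D|)\varepsilon\zeta(X)-\theta(\delta(z+1)|D|)\beta b(X)\big]z+\varepsilon\,\theta(\delta z|D|)\zeta(X),$$ $$P(\Sigma)=I_{d+1}+\begin{pmatrix}\partial_z\sigma\, I_d & -\sqrt\mu\,\nabla_X\sigma\\ -\sqrt\mu\,(\nabla_X\sigma)^t & \dfrac{-\partial_z\sigma+\mu|\nabla_X\sigma|^2}{1+\partial_z\sigma}\end{pmatrix}.$$ Let $H^1_{0,surf}(S)$ be the closure in $H^1(S)$ of the smooth functions on $\mathbb R^d\times[-1,0)$ with compact support. For $B\in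 H^{-1/2}(\mathbb R^d)$, a variational solution of the problem $$\nabla^\mu_{X,z}\cdot P(\Sigma)\nabla^\mu_{X,z}\phi=0\ \text{ in } S,\qquad \phi_{|z=0}=0,\qquad \mathbf e_z\cdot P(\Sigma)\nabla^\mu_{X,z}\phi_{|z=-1}=B$$ is a function $\phi\in H^1_{0,surf}(S)$ such that for all $\varphi\in H^1_{0,surf}(S)$ $$\int_S\nabla^\mu_{X,z}\phi\cdot P(\Sigma)\nabla^\mu_{X,z}\varphi=-\langle B,\varphi_{|z=-1}\rangle_{H^{-1/2}-H^{1/2}}.$$ **Theorem.** Let $h_{\min},\mu_{\max}>0$ and $R_\zeta,R_b\in\mathbb R$. There is $\delta_0>0$, depending only on $d,t_0,\theta,h_{\min},\mu_{\max},R_\zeta,R_b$, such that for every $\delta\in(0,\delta_0]$ and every $0\le s\le t_0+\frac12$ there is a constant $M$, depending only on $d,t_0,s,\theta,\delta$ and $h_{\min},\mu_{\max},R_\zeta,R_b$, with the following property. Let $0<\varepsilon,\beta\le1$, $0<\mu\le\mu_{\max}$, and let $\zeta,b\in H^{t_0+1}(\mathbb R^d)$ satisfy $\varepsilon|\zeta|_{H^{t_0+1}}\le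 R_\zeta$, $\beta|b|_{H^{t_0+1}}\le R_b$ and $\varepsilon\zeta+1-\beta b\ge h_{\min}$. Then for every $B\in H^{s-\frac12}(\mathbb R^d)$ the problem above has a unique variational solution $B^{\mathfrak d}$; moreover $\Lambda^s\nabla^\mu_{X,z}B^{\mathfrak d}\in L^2(S)$ and $$\big|\Lambda^s\nabla^\mu_{X,z}B^{\mathfrak d}\big|_{L^2(S)}\le M\,\Big|\frac1{\sqrt{1+\sqrt\mu|D|}}\,B\Big|_{H^s}.$$ If furthermore $s\ge\max(0,1-t_0)$, then $\Lambda^{s-1}\partial_z\nabla^\mu_{X,z}B^{\mathfrak d}\in L^2(S)$ and $$\big|\Lambda^{s-1}\partial_z\nabla^\mu_{X,z}B^{\mathfrak d}\big|_{L^2(S)}\le M\,\Big|\frac1{\sqrt{1+\sqrt\mu|D|}}\,B\Big|_{H^s}.$$ -/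

import Mathlib

open MeasureTheory Filter Topology
open scoped ENNReal ContDiff FourierTransform SchwartzMap

noncomputable section

namespace FlatStrip

/-! ### Fourier side of tempered distributions on `ℝ^d`

The Fourier transform of Mathlib is `∫ e^{-2iπ X·ξ} f(X) dX`, hence `|D|` is the multiplication of
the Fourier transform by `2π|ξ|`, and Plancherel's identity has constant one. -/

/-- The horizontal space `ℝ^d`, with the Euclidean norm. -/
abbrev Hor (d : ℕ) : Type := EuclideanSpace ℝ (Fin d)

/-- The symbol of `|D|`, where `D = -i∇`. -/
def absD {d : ℕ} (ξ : Hor d) : ℝ := 2 * Real.pi * ‖ξ‖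

/-- The symbol of `Λ^r = (1 + |D|^2)^{r/2}`. -/
def lam {d : ℕ} (r : ℝ) (ξ : Hor d) : ℝ := (1 + absD ξ ^ 2) ^ (r / 2)

/-- `g` is a function that represents the tempered distribution `T`. -/
def Represents {d : ℕ} (T : 𝓢'(Hor d, ℂ)) (g : Hor d → ℂ) : Prop :=
  ∀ ψ : 𝓢(Hor d, ℂ), Integrable (fun ξ => g ξ * ψ ξ) ∧ T ψ = ∫ ξ, g ξ * ψ ξ

open Classical in
/-- The Fourier transform of `T` as a function (defined almost everywhere), for `T` whose Fourier
transform is a function; this is so for every `T` in a Sobolev space `H^r`, `r ∈ ℝ`. -/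
def fhat {d : ℕ} (T : 𝓢'(Hor d, ℂ)) : Hor d → ℂ :=
  if h : ∃ g, Represents (𝓕 T) g then h.choose else 0

/-- `|m(D) T|_{L²}`, for a symbol `m` with `m(D) T ∈ L²`. -/
def multNorm {d : ℕ} (m : Hor d → ℝ) (T : 𝓢'(Hor d, ℂ)) : ℝ :=
  √(∫ ξ, ‖(m ξ : ℂ) * fhat T ξ‖ ^ 2)

/-- The norm `|T|_{H^r} = |Λ^r T|_{L²}`, for `T ∈ H^r`. -/
def sobNorm {d : ℕ} (r : ℝ) (T : 𝓢'(Hor d, ℂ)) : ℝ := multNorm (lam r) T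

/-- The norm `|(1 + √μ |D|)^{-1/2} B|_{H^s}`, for `B ∈ H^{s-1/2}`. -/
def dataNorm {d : ℕ} (μ s : ℝ) (B : 𝓢'(Hor d, ℂ)) : ℝ :=
  multNorm (fun ξ => lam s ξ * (1 / √(1 + √μ * absD ξ))) B

/-- A real-valued square integrable function, seen as a tempered distribution. -/
def toDist {d : ℕ} (f : Lp ℝ 2 (volume : Measure (Hor d))) : 𝓢'(Hor d, ℂ) :=
  Lp.toTemperedDistribution (Complex.ofRealCLM.compLp f)

/-- The (bilinear) duality bracket `⟨B, ψ⟩` between `H^{-1/2}` and `H^{1/2}`, written on the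
Fourier side. -/
def bracket {d : ℕ} (B : 𝓢'(Hor d, ℂ)) (ψ : Lp ℂ 2 (volume : Measure (Hor d))) : ℂ :=
  ∫ ξ, fhat B ξ * (𝓕 ψ : Lp ℂ 2 (volume : Measure (Hor d))) (-ξ)

/-! ### The flat strip -/

/-- The ambient space `ℝ^d × ℝ` of the points `(X, z)`. -/
abbrev Amb (d : ℕ) : Type := Hor d × ℝ

/-- The flat strip `S = ℝ^d × (-1, 0)`. -/
def S (d : ℕ) : Set (Amb d) := {p | -1 < p.2 ∧ p.2 < 0}

/-- The Lebesgue measure on the flat strip. -/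
def volS (d : ℕ) : Measure (Amb d) := volume.restrict (S d)

/-- Indices of the coordinates: `inl i` is the `i`-th horizontal one, `inr ()` is `z`. -/
abbrev Idx (d : ℕ) : Type := Fin d ⊕ Unit

/-- The coordinate directions of `ℝ^d × ℝ`. -/
def dir {d : ℕ} : Idx d → Amb d
  | Sum.inl i => (EuclideanSpace.single i 1, 0)
  | Sum.inr _ => (0, 1)

/-- The classical partial derivatives. -/
def pd {d : ℕ} {F : Type} [NormedAddCommGroup F] [NormedSpace ℝ F]
    (j : Idx d) (f : Amb d → F) (p : Amb d) : F :=
  fderiv ℝ f p (dir j)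

/-- Smooth functions with compact support in `U`. -/
def IsTest {d : ℕ} (U : Set (Amb d)) (ϕ : Amb d → ℂ) : Prop :=
  ContDiff ℝ ∞ ϕ ∧ HasCompactSupport ϕ ∧ tsupport ϕ ⊆ U

/-- The restrictions to `S` of these functions form the space `𝓓(S ∪ {z = -1})`: smooth up to the
bottom, with compact support that does not meet the surface `{z = 0}`. -/
def IsTestBottom {d : ℕ} (ϕ : Amb d → ℂ) : Prop := IsTest {p | p.2 < 0} ϕ

/-- `g ∈ L²(S)` is the weak derivative `∂_j u` in `S`. -/
def IsWeakPartial {d : ℕ} (j : Idx d) (u g : Amb d → ℂ) : Prop :=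
  MemLp g 2 (volS d) ∧
    ∀ ϕ, IsTest (S d) ϕ → ∫ p, u p * pd j ϕ p ∂(volS d) = -∫ p, g p * ϕ p ∂(volS d)

open Classical in
/-- The weak derivative `∂_j u ∈ L²(S)` (defined almost everywhere in `S`), if it exists. -/
def weakPartial {d : ℕ} (j : Idx d) (u : Amb d → ℂ) : Amb d → ℂ :=
  if h : ∃ g, IsWeakPartial j u g then h.choose else 0

/-- The Sobolev space `H¹(S)`. -/
def MemH1 {d : ℕ} (u : Amb d → ℂ) : Prop :=
  MemLp u 2 (volS d) ∧ ∀ j, ∃ g, IsWeakPartial j u g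

/-- `ϕ n → u` in `H¹(S)`, for smooth `ϕ n`. -/
def TendstoH1 {d : ℕ} (ϕ : ℕ → Amb d → ℂ) (u : Amb d → ℂ) : Prop :=
  Tendsto (fun n => eLpNorm (fun p => ϕ n p - u p) 2 (volS d)) atTop (𝓝 0) ∧
    ∀ j, Tendsto (fun n => eLpNorm (fun p => pd j (ϕ n) p - weakPartial j u p) 2 (volS d))
      atTop (𝓝 0)

/-- The space `H¹_{0,surf}(S)`: the closure of `𝓓(S ∪ {z = -1})` in `H¹(S)`. -/
def MemH10surf {d : ℕ} (u : Amb d → ℂ) : Prop :=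
  MemH1 u ∧ ∃ ϕ : ℕ → Amb d → ℂ, (∀ n, IsTestBottom (ϕ n)) ∧ TendstoH1 ϕ u

/-- `τ` is the trace of `u` at the bottom `{z = -1}`. -/
def IsBottomTrace {d : ℕ} (u : Amb d → ℂ) (τ : Lp ℂ 2 (volume : Measure (Hor d))) : Prop :=
  ∃ ϕ : ℕ → Amb d → ℂ, (∀ n, IsTestBottom (ϕ n)) ∧ TendstoH1 ϕ u ∧
    Tendsto (fun n => eLpNorm (fun X => ϕ n (X, -1) - τ X) 2 volume) atTop (𝓝 0)

open Classical in
/-- The trace `u_{|z = -1}` of a function of `H¹_{0,surf}(S)`. -/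
def bottomTrace {d : ℕ} (u : Amb d → ℂ) : Lp ℂ 2 (volume : Measure (Hor d)) :=
  if h : ∃ τ, IsBottomTrace u τ then h.choose else 0

/-- The components of a scaled gradient: the horizontal ones are multiplied by `√μ`. -/
def scale {d : ℕ} (μ : ℝ) : Idx d → ℝ
  | Sum.inl _ => √μ
  | Sum.inr _ => 1

/-- The components of `∇^μ u = (√μ ∇_X u, ∂_z u)`, for `u ∈ H¹(S)`. -/
def gradMu {d : ℕ} (μ : ℝ) (u : Amb d → ℂ) (j : Idx d) (p : Amb d) : ℂ :=
  (scale μ j : ℂ) * weakPartial j u p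

/-- The norm of a (vector-valued) function in `L²(S)`. -/
def normL2S {d : ℕ} (W : Idx d → Amb d → ℂ) : ℝ :=
  √(∑ j, ∫ p, ‖W j p‖ ^ 2 ∂(volS d))

/-! ### The operators `Λ^r` on the strip -/

/-- `Λ^r ϕ`, where `Λ^r` acts on the horizontal variable of a test function `ϕ`. -/
def lamX {d : ℕ} (r : ℝ) (ϕ : Amb d → ℂ) (p : Amb d) : ℂ :=
  𝓕⁻ (fun ξ : Hor d => (lam r ξ : ℂ) * 𝓕 (fun Y : Hor d => ϕ (Y, p.2)) ξ) p.1

/-- `Λ^r u = w ∈ L²(S)` in the sense of distributions in `S`. -/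
def IsLam {d : ℕ} (r : ℝ) (u w : Amb d → ℂ) : Prop :=
  MemLp w 2 (volS d) ∧
    ∀ ϕ, IsTest (S d) ϕ → ∫ p, w p * ϕ p ∂(volS d) = ∫ p, u p * lamX r ϕ p ∂(volS d)

/-- `Λ^r ∂_z u = w ∈ L²(S)` in the sense of distributions in `S`. -/
def IsLamDz {d : ℕ} (r : ℝ) (u w : Amb d → ℂ) : Prop :=
  MemLp w 2 (volS d) ∧
    ∀ ϕ, IsTest (S d) ϕ → ∫ p, w p * ϕ p ∂(volS d) =
      -∫ p, u p * lamX r (pd (Sum.inr ()) ϕ) p ∂(volS d)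

/-! ### The diffeomorphism and the transformed problem -/

/-- Admissible cut-off functions: nonnegative, compactly supported, smooth, even, and equal to one
near the origin. -/
def IsCutoff (θ : ℝ → ℝ) : Prop :=
  (∀ x, 0 ≤ θ x) ∧ HasCompactSupport θ ∧ ContDiff ℝ ∞ θ ∧ (∀ x, θ (-x) = θ x) ∧
    ∀ᶠ x in 𝓝 0, θ x = 1

/-- The (real-valued) function `θ(τ |D|) f`. -/
def smoothing {d : ℕ} (θ : ℝ → ℝ) (τ : ℝ) (f : Lp ℝ 2 (volume : Measure (Hor d)))
    (X : Hor d) : ℝ :=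
  (𝓕⁻ (fun ξ : Hor d => (θ (τ * absD ξ) : ℂ) * fhat (toDist f) ξ) X).re

/-- The function `σ` for which `(X, z) ↦ (X, z + σ(X, z))` maps the flat strip to the fluid
domain `{-1 + β b < z < ε ζ}`. -/
def sigma {d : ℕ} (θ : ℝ → ℝ) (δ ε β : ℝ) (ζ b : Lp ℝ 2 (volume : Measure (Hor d)))
    (p : Amb d) : ℝ :=
  (ε * smoothing θ (δ * p.2) ζ p.1 - β * smoothing θ (δ * (p.2 + 1)) b p.1) * p.2
    + ε * smoothing θ (δ * p.2) ζ p.1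

/-- The matrix `Q(Σ)` built on `σ`. -/
def matQ {d : ℕ} (μ : ℝ) (σ : Amb d → ℝ) (p : Amb d) : Matrix (Idx d) (Idx d) ℝ :=
  Matrix.fromBlocks
    (pd (Sum.inr ()) σ p • (1 : Matrix (Fin d) (Fin d) ℝ))
    (Matrix.of fun i _ => -√μ * pd (Sum.inl i) σ p)
    (Matrix.of fun _ i => -√μ * pd (Sum.inl i) σ p)
    (Matrix.of fun _ _ =>
      (-pd (Sum.inr ()) σ p + μ * ∑ i : Fin d, pd (Sum.inl i) σ p ^ 2)
        / (1 + pd (Sum.inr ()) σ p))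

/-- The matrix `P(Σ) = I + Q(Σ)`. -/
def matP {d : ℕ} (μ : ℝ) (σ : Amb d → ℝ) (p : Amb d) : Matrix (Idx d) (Idx d) ℝ :=
  1 + matQ μ σ p

/-- `u` is a variational solution of the problem
`∇^μ · P ∇^μ u = 0` in `S`, `u = 0` at `z = 0`, `e_z · P ∇^μ u = B` at `z = -1`. -/
def IsVariationalSolution {d : ℕ} (μ : ℝ) (P : Amb d → Matrix (Idx d) (Idx d) ℝ)
    (B : 𝓢'(Hor d, ℂ)) (u : Amb d → ℂ) : Prop :=
  MemH10surf u ∧ ∀ v, MemH10surf v →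
    ∫ p, ∑ i, gradMu μ u i p * ∑ j, (P p i j : ℂ) * gradMu μ v j p ∂(volS d)
      = -bracket B (bottomTrace v)

end FlatStrip

end

open FlatStrip TemperedDistribution

open MeasureTheory Filter Topology
open scoped ComplexConjugate ENNReal ContDiff FourierTransform SchwartzMap Real
open ENNReal (mul_lt_top mul_ne_top ofReal ofReal_add ofReal_le_ofReal ofReal_le_ofReal_iff
  ofReal_lt_top ofReal_mul ofReal_natCast ofReal_ne_top ofReal_ofNat ofReal_one ofReal_pow
  ofReal_sum_of_nonneg ofReal_toReal pow_lt_top pow_ne_top rpow_mul rpow_two toReal_mono toReal_mul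
  toReal_nonneg toReal_pow)
open Complex (I abs_re_le_norm conjCLE conj_ofReal continuous_conj exp exp_add measurable_ofReal
  norm_I norm_exp_ofReal_mul_I norm_real ofRealCLM ofReal_inv ofReal_ne_zero ofReal_zero reCLM
  re_le_norm re_ofReal_mul re_sum real_smul sub_re zero_re)
open Real (continuous_fourierChar div_rpow fourierChar fourierInv_eq fourierInv_eq' fourier_eq
  mul_rpow norm_eq_abs norm_of_nonneg rpow_add rpow_le_rpow rpow_neg rpow_pos_of_pos sq_sqrt
  sqrt_mul sqrt_nonneg sqrt_pos)
open Finset (aemeasurable_fun_sum card_univ mem_univ mul_sum range single_le_sum sum_add_distrib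
  sum_congr sum_const sum_div sum_le_sum sum_mul sum_neg_distrib sum_nonneg sum_singleton
  sum_sub_distrib univ_unique)
open Set (Icc Iio Ioc Ioi Ioo indicator_of_mem indicator_of_notMem mem_Ioi uIoc uIoc_of_le univ)
open Sum (elim elim_inl elim_inr inl inr)
open ContinuousLinearMap (comp_apply integral_apply opNorm_le_bound snd)
noncomputable section
namespace FlatStrip
variable {d : ℕ} {u φ : Amb d → ℂ} {h : Hor d → ℝ≥0∞} {m : Hor d → ℝ} {b : Hor d → ℂ}
  {q : Fin d → Amb d → ℝ} {J : Amb d → ℝ} {U : Set (Amb d)} {y : ℝ → ℂ} {t K c r s C τ μ z R e E L κ : ℝ}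


/-- Schwartz functions of the horizontal variable. -/
abbrev Sch (d : ℕ) := 𝓢(Hor d, ℂ)

/-- `L²(S)`. -/
abbrev L2S (d : ℕ) : Type := Lp ℂ 2 (volS d)

/-- Square integrable functions on the strip, with candidates for their gradients. -/
abbrev GraphSp (d : ℕ) : Type := PiLp 2 fun _ : Option (Idx d) => L2S d

variable {x : GraphSp d} {W F : Idx d → L2S d} {σ : Amb d → ℝ} {ψ v g f : Amb d → ℂ} {χ β : ℝ → ℂ}
  {θ : ℝ → ℝ} {μmax : ℝ} {B : 𝓢'(Hor d, ℂ)} {A : Hor d → ℂ} {Y w : Hor d → ℝ≥0∞}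
  {Q : Fin d → Hor d → ℂ}

theorem mul_le_r {a b c : ℝ≥0∞} (h : b ≤ c) : a * b ≤ a * c := mul_le_mul' le_rfl h

theorem mul_le_l {a b c : ℝ≥0∞} (h : a ≤ b) : a * c ≤ b * c := mul_le_mul' h le_rfl

theorem measurable_Lp {α : Type*} [MeasurableSpace α] {μ : Measure α} (f : Lp ℂ 2 μ) :
    Measurable f := (Lp.stronglyMeasurable f).measurable

theorem lintegral_cmul {α : Type*} [MeasurableSpace α] {μ : Measure α} {r : ℝ≥0∞} {f : α → ℝ≥0∞}
    (hr : r ≠ ⊤ := by finiteness) : ∫⁻ x, r * f x ∂μ = r * ∫⁻ x, f x ∂μ :=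
  lintegral_const_mul' _ _ hr

/-! ### The weights `lam` -/

theorem absD_nonneg (ξ : Hor d) : 0 ≤ absD ξ := by unfold absD; positivity

theorem one_le_base (ξ : Hor d) : 1 ≤ 1 + absD ξ ^ 2 := by nlinarith [sq_nonneg (absD ξ)]

theorem lam_pos (r : ℝ) (ξ : Hor d) : 0 < lam r ξ :=
  rpow_pos_of_pos (lt_of_lt_of_le one_pos (one_le_base ξ)) _

theorem lam_add (r r' : ℝ) (ξ : Hor d) : lam (r + r') ξ = lam r ξ * lam r' ξ := by
  unfold lam; rw [← rpow_add (lt_of_lt_of_le one_pos (one_le_base ξ))]; congr 1; ring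

@[simp] theorem lam_zero (ξ : Hor d) : lam 0 ξ = 1 := by simp [lam]

theorem lam_eq_rpow (r : ℝ) (ξ : Hor d) : lam r ξ = lam 1 ξ ^ r := by
  unfold lam; rw [← Real.rpow_mul (le_trans zero_le_one (one_le_base ξ))]; congr 1; ring

theorem one_le_lam (hr : 0 ≤ r) (ξ : Hor d) : 1 ≤ lam r ξ :=
  Real.one_le_rpow (one_le_base ξ) (by positivity)

theorem lam_mono {r' : ℝ} (h : r ≤ r') (ξ : Hor d) : lam r ξ ≤ lam r' ξ :=
  Real.rpow_le_rpow_of_exponent_le (one_le_base ξ) (by linarith)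

theorem lam_le_one (hr : r ≤ 0) (ξ : Hor d) : lam r ξ ≤ 1 := by simpa using lam_mono hr ξ

theorem lam_one (ξ : Hor d) : lam 1 ξ = √(1 + absD ξ ^ 2) := by unfold lam; rw [Real.sqrt_eq_rpow]

theorem absD_le_lam (ξ : Hor d) : absD ξ ≤ lam 1 ξ := by
  rw [lam_one]; exact Real.le_sqrt_of_sq_le (by linarith)

theorem lam_neg_arg (r : ℝ) (ξ : Hor d) : lam r (-ξ) = lam r ξ := by simp [lam, absD]

theorem absD_add_le (ξ η : Hor d) : absD (ξ + η) ≤ absD ξ + absD η := by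
  unfold absD; rw [← mul_add]; gcongr; exact norm_add_le _ _

theorem lam_one_add_le (ξ η : Hor d) : lam 1 (ξ + η) ≤ lam 1 ξ + lam 1 η := by
  have h := absD_add_le ξ η
  have h1 := absD_le_lam ξ
  have h2 := absD_nonneg (ξ + η)
  have h3 : lam 1 η ^ 2 = 1 + absD η ^ 2 := by rw [lam_one, sq_sqrt (by positivity)]
  have h4 : lam 1 ξ ^ 2 = 1 + absD ξ ^ 2 := by rw [lam_one, sq_sqrt (by positivity)]
  rw [lam_one (ξ + η)]; apply Real.sqrt_le_iff.mpr
  have p1 := lam_pos 1 ξ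
  have p2 := lam_pos 1 η
  refine ⟨by positivity, ?_⟩
  nlinarith [absD_le_lam η, absD_nonneg ξ, absD_nonneg η, mul_le_mul h1 (absD_le_lam η) (absD_nonneg η) p1.le]

theorem continuous_lam (r : ℝ) : Continuous (lam (d := d) r) := by
  unfold lam absD; exact Continuous.rpow_const (by fun_prop) (fun ξ => Or.inl (by positivity))

@[fun_prop] theorem measurable_lam (r : ℝ) : Measurable (lam (d := d) r) := (continuous_lam r).measurable

theorem continuous_absD : Continuous (absD (d := d)) := by unfold absD; fun_prop

@[fun_prop] theorem measurable_absD : Measurable (absD (d := d)) := continuous_absD.measurable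

/-- The weight `lam` with values in `[0, ∞]`. -/
def el (r : ℝ) (ξ : Hor d) : ℝ≥0∞ := ofReal (lam r ξ)

@[fun_prop] theorem measurable_el (r : ℝ) : Measurable (el (d := d) r) :=
  ENNReal.measurable_ofReal.comp (measurable_lam r)

theorem el_add (r r' : ℝ) (ξ : Hor d) : el (r + r') ξ = el r ξ * el r' ξ := by
  unfold el; rw [lam_add, ofReal_mul (lam_pos _ _).le]

@[simp] theorem el_zero (ξ : Hor d) : el 0 ξ = 1 := by simp [el]

theorem el_neg_arg (r : ℝ) (ξ : Hor d) : el r (-ξ) = el r ξ := by simp [el, lam_neg_arg]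

theorem el_ne_top (r : ℝ) (ξ : Hor d) : el r ξ ≠ ⊤ := ofReal_ne_top

theorem el_mono {r' : ℝ} (h : r ≤ r') (ξ : Hor d) : el r ξ ≤ el r' ξ :=
  ofReal_le_ofReal (lam_mono h ξ)

theorem el_mul_el_neg (r : ℝ) (ξ : Hor d) : el r ξ * el (-r) ξ = 1 := by rw [← el_add]; simp

theorem enorm_lam (r : ℝ) (ξ : Hor d) : ‖((lam r ξ : ℝ) : ℂ)‖ₑ = el r ξ := by
  rw [el, ← ofReal_norm, norm_real, norm_of_nonneg (lam_pos _ _).le]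

theorem lintegral_el_sq_lt_top (ht : (d : ℝ) / 2 < t) :
  ∫⁻ ξ : Hor d, el (-t) ξ ^ 2 < ⊤ := by
  have h1 : Integrable (fun x : Hor d => (1 + ‖x‖ ^ 2) ^ (-(2 * t) / 2)) :=
    integrable_rpow_neg_one_add_norm_sq (by simpa using by linarith)
  have h2 := h1.lintegral_lt_top
  refine lt_of_le_of_lt (lintegral_mono fun ξ => ?_) h2; unfold el
  rw [← ofReal_pow (lam_pos _ _).le]; apply ofReal_le_ofReal
  have h0 : 0 ≤ t := by
    have : 0 ≤ (d : ℝ) / 2 := by positivity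
    linarith
  rw [pow_two, ← lam_add]; unfold lam
  have e1 : (-t + -t) / 2 = -(2 * t) / 2 := by ring
  rw [e1]; apply Real.rpow_le_rpow_of_nonpos (by positivity) _ (by linarith); unfold absD
  have : 1 ≤ 2 * π := by linarith [Real.pi_gt_three]
  rw [mul_pow]; nlinarith [sq_nonneg ‖ξ‖, mul_le_mul this this zero_le_one (by linarith)]

/-! ### Elementary inequalities between powers -/

theorem rpow_le_of_comparable {a b : ℝ} (ha : 0 < a) (hb : 0 < b) (hc : 1 ≤ c)
  (hab : a ≤ c * b) (hba : b ≤ c * a) (p : ℝ) : a ^ p ≤ c ^ |p| * b ^ p := by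
  have hc0 : 0 < c := by linarith
  rcases le_total 0 p with hp | hp
  · rw [abs_of_nonneg hp, ← mul_rpow hc0.le hb.le]; exact rpow_le_rpow ha.le hab hp
  · rw [abs_of_nonpos hp]
    have h1 := Real.rpow_le_rpow_of_nonpos hb hba hp
    rw [mul_rpow hc0.le ha.le] at h1
    calc a ^ p = c ^ (-p) * (c ^ p * a ^ p) := by rw [← mul_assoc, ← rpow_add hc0]; simp
      _ ≤ _ := by gcongr

theorem abs_rpow_sub_one_le (hs : 0 ≤ s) :
  ∃ C : ℝ, 0 ≤ C ∧ ∀ u : ℝ, 1 / 2 ≤ u → u ≤ 3 / 2 → |u ^ s - 1| ≤ C * |u - 1| := by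
  obtain ⟨n, hn⟩ := exists_nat_ge s
  refine ⟨n * (3 / 2) ^ n, by positivity, fun u h1 h2 => ?_⟩
  have hgeo := (geom_sum_mul u n).symm
  have hsum : ∑ i ∈ range n, u ^ i ≤ n * (3 / 2) ^ n := by
    calc ∑ i ∈ range n, u ^ i ≤ ∑ i ∈ range n, (3 / 2) ^ n := by
          apply sum_le_sum
          intro i hi
          calc u ^ i ≤ (3 / 2) ^ i := by gcongr
            _ ≤ (3 / 2) ^ n := pow_le_pow_right₀ (by norm_num) (Finset.mem_range.mp hi).le
      _ = _ := by simp
  have hsum0 : 0 ≤ ∑ i ∈ range n, u ^ i := sum_nonneg fun i _ => by positivity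
  have key : |u ^ n - 1| ≤ n * (3 / 2) ^ n * |u - 1| := by
    rw [hgeo, abs_mul, abs_of_nonneg hsum0]; gcongr
  refine le_trans ?_ key
  rcases le_total 1 u with hu | hu
  · have a1 := Real.one_le_rpow hu hs
    have a2 : u ^ s ≤ u ^ n := by
      rw [← Real.rpow_natCast]; exact Real.rpow_le_rpow_of_exponent_le hu hn
    rw [abs_of_nonneg (by linarith), abs_of_nonneg (by linarith)]; linarith
  · have a1 := Real.rpow_le_one (by linarith) hu hs
    have a2 : u ^ n ≤ u ^ s := by
      rw [← Real.rpow_natCast]; exact Real.rpow_le_rpow_of_exponent_ge (by linarith) hu hn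
    rw [abs_of_nonpos (by linarith), abs_of_nonpos (by linarith)]; linarith

/-- The symbol of a commutator. -/
theorem abs_rpow_sub_rpow_le (he : 0 ≤ e) (hes : e ≤ s) (he1 : e ≤ 1) :
  ∃ C : ℝ, 0 ≤ C ∧ ∀ x k y : ℝ, 1 ≤ x → 1 ≤ k → 1 ≤ y → x ≤ k + y → y ≤ x + k →
    (|x ^ s - y ^ s| ≤ C * (k ^ e * y ^ (s - e)) ∨ (y ≤ 2 * k ∧ |x ^ s - y ^ s| ≤ C * k ^ s)) := by
  obtain ⟨C, hC0, hC⟩ := abs_rpow_sub_one_le (he.trans hes)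
  have hs := he.trans hes
  refine ⟨max C (3 ^ s), by positivity, fun x k y hx hk hy h1 h2 => ?_⟩
  have hy0 : 0 < y := by linarith
  rcases le_or_gt y (2 * k) with hyk | hyk
  · right
    refine ⟨hyk, ?_⟩
    have e1 : x ^ s ≤ (3 * k) ^ s := rpow_le_rpow (by linarith) (by linarith) hs
    have e2 : y ^ s ≤ (3 * k) ^ s := rpow_le_rpow (by linarith) (by linarith) hs
    have e3 : 0 ≤ x ^ s := by positivity
    have e4 : 0 ≤ y ^ s := by positivity
    rw [mul_rpow (by norm_num) (by linarith)] at e1 e2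
    calc |x ^ s - y ^ s| ≤ 3 ^ s * k ^ s := by rw [abs_le]; constructor <;> linarith
      _ ≤ _ := by gcongr; exact le_max_right _ _
  · left
    have hu := hC (x / y) (by rw [div_le_div_iff₀] <;> linarith) (by rw [div_le_div_iff₀] <;> linarith)
    rw [div_rpow (by linarith) hy0.le] at hu
    have e1 : x ^ s - y ^ s = y ^ s * (x ^ s / y ^ s - 1) := by
      have : y ^ s ≠ 0 := (rpow_pos_of_pos hy0 _).ne'
      field_simp
    have e2 : |x / y - 1| ≤ k / y := by
      rw [div_sub_one hy0.ne', abs_div, abs_of_pos hy0]; gcongr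
      rw [abs_le]; constructor <;> linarith
    have e3 : k / y ≤ (k / y) ^ e := by
      have := Real.rpow_le_rpow_of_exponent_ge (x := k / y) (by positivity)
        ((div_le_one hy0).mpr (by linarith)) he1
      simpa using this
    rw [e1, abs_mul, abs_of_nonneg (by positivity)]
    calc y ^ s * |x ^ s / y ^ s - 1| ≤ y ^ s * (C * |x / y - 1|) := by gcongr
      _ ≤ y ^ s * (C * (k / y) ^ e) := by gcongr; exact e2.trans e3
      _ = C * (k ^ e * y ^ (s - e)) := by
        rw [div_rpow (by linarith) hy0.le, Real.rpow_sub hy0]; ring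
      _ ≤ _ := by gcongr; exact le_max_left _ _

theorem rpow_mul_rpow_le {a b u v : ℝ} (ha : 0 ≤ a) (hb : 0 ≤ b) (hu : 0 < u) (hv : 0 < v) :
  u ^ (-a) * v ^ (-b) ≤ u ^ (-(a + b)) + v ^ (-(a + b)) := by
  rw [neg_add, rpow_add hu, rpow_add hv]
  rcases le_total u v with h | h
  · have := Real.rpow_le_rpow_of_nonpos hu h (neg_nonpos.2 hb)
    exact le_add_of_le_of_nonneg (by gcongr) (by positivity)
  · have := Real.rpow_le_rpow_of_nonpos hv h (neg_nonpos.2 ha)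
    exact le_add_of_nonneg_of_le (by positivity) (by gcongr)

theorem rpow_product_le_of_nonneg {x k y : ℝ} (hr : 0 ≤ r) (hrt : r ≤ t) (hx : 0 < x) (hk : 0 < k)
  (hy : 0 < y) (h : x ≤ k + y) :
  x ^ r * k ^ (-t) * y ^ (-r) ≤ 2 ^ t * (2 * (k ^ (-t) + y ^ (-t))) := by
  have h1 : x ^ r ≤ 2 ^ t * (k ^ r + y ^ r) := by
    refine le_trans ?_ (mul_le_mul_of_nonneg_right (Real.rpow_le_rpow_of_exponent_le one_le_two hrt)
      (by positivity))
    rcases le_total k y with h2 | h2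
    · refine (rpow_le_rpow hx.le (show x ≤ 2 * y by linarith) hr).trans ?_
      rw [mul_rpow zero_le_two hy.le]; gcongr; exact le_add_of_nonneg_left (by positivity)
    · refine (rpow_le_rpow hx.le (show x ≤ 2 * k by linarith) hr).trans ?_
      rw [mul_rpow zero_le_two hk.le]; gcongr; exact le_add_of_nonneg_right (by positivity)
  have h2 := rpow_mul_rpow_le (sub_nonneg.2 hrt) hr hk hy
  have e1 : k ^ r * k ^ (-t) = k ^ (-(t - r)) := by rw [← rpow_add hk]; ring_nf
  have e2 : y ^ r * y ^ (-r) = 1 := by rw [← rpow_add hy, add_neg_cancel, Real.rpow_zero]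
  rw [sub_add_cancel] at h2
  calc _ ≤ 2 ^ t * (k ^ r + y ^ r) * k ^ (-t) * y ^ (-r) := by gcongr
    _ = 2 ^ t * (k ^ r * k ^ (-t) * y ^ (-r) + k ^ (-t) * (y ^ r * y ^ (-r))) := by ring
    _ ≤ _ := by rw [e1, e2]; gcongr; linarith [rpow_pos_of_pos hy (-t)]

/-- The weight of a product in `H^r`, `|r| ≤ t`. -/
theorem rpow_product_le (hr : |r| ≤ t) :
  ∃ C : ℝ, 0 ≤ C ∧ ∀ x k y : ℝ, 1 ≤ x → 1 ≤ k → 1 ≤ y → x ≤ k + y → y ≤ x + k →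
    x ^ r * k ^ (-t) * y ^ (-r) ≤ C * (k ^ (-t) + y ^ (-t) + x ^ (-t)) := by
  refine ⟨2 ^ t * 2, by positivity, fun x k y hx hk hy h1 h2 => ?_⟩
  have hx0 : 0 < x := by linarith
  have hy0 : 0 < y := by linarith
  have hk0 : 0 < k := by linarith
  rw [mul_assoc (2 ^ t)]
  rcases le_total 0 r with h0 | h0
  · refine (rpow_product_le_of_nonneg h0 (abs_le.1 hr).2 hx0 hk0 hy0 h1).trans ?_
    gcongr _ * (_ * ?_); exact le_add_of_nonneg_right (by positivity)
  · have := rpow_product_le_of_nonneg (r := -r) (t := t) (by linarith) (by linarith [(abs_le.1 hr).1])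
      hy0 hk0 hx0 (by linarith)
    rw [neg_neg] at this
    rw [mul_right_comm, mul_comm (x ^ r), mul_right_comm]; refine this.trans ?_; gcongr
    exact le_add_of_nonneg_right (by positivity)

/-- The weight of a product of a factor of order `t - 1` and a factor of order `s` in `H^{s-1}`. -/
theorem rpow_deriv_product_le (hs : 0 ≤ s) (hst : 1 - t ≤ s) :
  ∃ C : ℝ, 0 ≤ C ∧ ∀ x k y : ℝ, 1 ≤ x → 1 ≤ k → 1 ≤ y → x ≤ k + y → y ≤ x + k → k ≤ x + y →
    (x ^ (s - 1) * k ^ (1 - t) * y ^ (-s) ≤ C * (k ^ (-t) + x ^ (-t)) ∨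
      (y ≤ 2 * k ∧ x ^ (s - 1) ≤ C * k ^ (s - 1))) := by
  refine ⟨4 ^ |s - 1| + 2 ^ s, by positivity, fun x k y hx hk hy h1 h2 h3 => ?_⟩
  have hx0 : 0 < x := by linarith
  have hy0 : 0 < y := by linarith
  have hk0 : 0 < k := by linarith
  rcases le_or_gt y (2 * k) with hky | hky
  · by_cases h4 : 1 ≤ s ∨ k ≤ 4 * x
    · refine .inr ⟨hky, le_trans ?_ (mul_le_mul_of_nonneg_right
        (le_add_of_nonneg_right (by positivity)) (by positivity))⟩
      by_cases h5 : 1 ≤ s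
      · rw [abs_of_nonneg (by linarith), ← mul_rpow (by norm_num) hk0.le]
        exact rpow_le_rpow hx0.le (by linarith) (by linarith)
      · exact rpow_le_of_comparable hx0 hk0 (by norm_num) (by linarith) (h4.resolve_left h5) _
    · push Not at h4
      left
      have a1 : y ^ (-s) ≤ 2 ^ s * k ^ (-s) := by
        have := rpow_le_of_comparable hy0 hk0 one_le_two hky (by linarith) (-s)
        rwa [abs_neg, abs_of_nonneg hs] at this
      have a2 := rpow_mul_rpow_le (show 0 ≤ s + t - 1 by linarith) (show 0 ≤ 1 - s by linarith) hk0 hx0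
      rw [show s + t - 1 + (1 - s) = t by ring] at a2
      calc _ ≤ x ^ (s - 1) * k ^ (1 - t) * (2 ^ s * k ^ (-s)) := by gcongr
        _ = 2 ^ s * (k ^ (-(s + t - 1)) * x ^ (-(1 - s))) := by
          rw [show -(s + t - 1) = 1 - t + -s by ring, rpow_add hk0, neg_sub]; ring
        _ ≤ _ := mul_le_mul (le_add_of_nonneg_left (by positivity)) a2 (by positivity) (by positivity)
  · left
    have a1 := rpow_le_of_comparable hx0 hy0 (c := 4) (by norm_num) (by linarith) (by linarith) (s - 1)
    have a2 : y⁻¹ ≤ k⁻¹ := inv_anti₀ hk0 (by linarith)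
    calc _ ≤ 4 ^ |s - 1| * y ^ (s - 1) * k ^ (1 - t) * y ^ (-s) := by gcongr
      _ = 4 ^ |s - 1| * (k ^ (1 - t) * y⁻¹) := by
        rw [Real.rpow_sub_one hy0.ne', rpow_neg hy0.le]
        have := (rpow_pos_of_pos hy0 s).ne'
        field_simp
      _ ≤ 4 ^ |s - 1| * (k ^ (1 - t) * k⁻¹) := by gcongr
      _ = 4 ^ |s - 1| * k ^ (-t) := by rw [← Real.rpow_neg_one k, ← rpow_add hk0]; ring_nf
      _ ≤ _ := mul_le_mul (le_add_of_nonneg_right (by positivity))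
        (le_add_of_nonneg_right (by positivity)) (by positivity) (by positivity)

/-! ### Weighted estimates of convolutions -/

theorem lintegral_mul_sq_le {α : Type*} [MeasurableSpace α] (μ : Measure α) {f g : α → ℝ≥0∞}
  (hf : AEMeasurable f μ) (hg : AEMeasurable g μ) :
  (∫⁻ x, f x * g x ∂μ) ^ 2 ≤ (∫⁻ x, f x ^ 2 ∂μ) * ∫⁻ x, g x ^ 2 ∂μ := by
  have h := ENNReal.lintegral_mul_le_Lp_mul_Lq μ Real.HolderConjugate.two_two hf hg
  simp only [Pi.mul_apply, rpow_two] at h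
  calc (∫⁻ x, f x * g x ∂μ) ^ 2
        ≤ ((∫⁻ x, f x ^ 2 ∂μ) ^ (1 / (2 : ℝ)) * (∫⁻ x, g x ^ 2 ∂μ) ^ (1 / (2 : ℝ))) ^ 2 := by gcongr
    _ = _ := by rw [mul_pow, ← rpow_two, ← rpow_two, ← rpow_mul, ← rpow_mul]; norm_num

theorem add_sq_le_two (a b : ℝ≥0∞) : (a + b) ^ 2 ≤ 2 * (a ^ 2 + b ^ 2) := by
  have := ENNReal.rpow_add_le_mul_rpow_add_rpow a b (p := 2) (by norm_num)
  norm_num at this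
  exact this

theorem lintegral_conv_sq {f g : Hor d → ℝ≥0∞} (hf : Measurable f) (hg : Measurable g) :
  ∫⁻ ξ, ∫⁻ η, (f (ξ - η) * g η) ^ 2 = (∫⁻ k, f k ^ 2) * ∫⁻ η, g η ^ 2 := by
  rw [lintegral_lintegral_swap (by fun_prop)]
  simp_rw [mul_pow]
  have : ∀ η, ∫⁻ ξ, f (ξ - η) ^ 2 * g η ^ 2 = (∫⁻ k, f k ^ 2) * g η ^ 2 := by
    intro η
    rw [lintegral_mul_const _ (by fun_prop), lintegral_sub_right_eq_self (fun k => f k ^ 2) η]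
  simp_rw [this]; rw [lintegral_const_mul _ (by fun_prop)]

theorem lintegral_conv_weight_right {f g : Hor d → ℝ≥0∞} (hw : Measurable w) (hf : Measurable f)
  (hg : Measurable g) :
  ∫⁻ ξ, (∫⁻ η, w η * (f (ξ - η) * g η)) ^ 2
    ≤ (∫⁻ k, w k ^ 2) * ((∫⁻ k, f k ^ 2) * ∫⁻ η, g η ^ 2) := by
  rw [← lintegral_conv_sq hf hg, ← lintegral_const_mul _ (by fun_prop)]
  exact lintegral_mono fun ξ => lintegral_mul_sq_le _ (by fun_prop) (by fun_prop)

theorem lintegral_conv_weight_left {f g : Hor d → ℝ≥0∞} (hw : Measurable w) (hf : Measurable f)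
  (hg : Measurable g) :
  ∫⁻ ξ, (∫⁻ η, w (ξ - η) * (f (ξ - η) * g η)) ^ 2
    ≤ (∫⁻ k, w k ^ 2) * ((∫⁻ k, f k ^ 2) * ∫⁻ η, g η ^ 2) := by
  rw [← lintegral_conv_sq hf hg, ← lintegral_const_mul _ (by fun_prop)]
  refine lintegral_mono fun ξ => ?_
  rw [← lintegral_sub_left_eq_self (fun k => w k ^ 2) ξ]
  exact lintegral_mul_sq_le _ (by fun_prop) (by fun_prop)

theorem lintegral_conv_weight_out {f g : Hor d → ℝ≥0∞} (hw : Measurable w) (hf : Measurable f)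
  (hg : Measurable g) :
  ∫⁻ ξ, (w ξ * ∫⁻ η, f (ξ - η) * g η) ^ 2
    ≤ (∫⁻ k, w k ^ 2) * ((∫⁻ k, f k ^ 2) * ∫⁻ η, g η ^ 2) := by
  rw [← lintegral_mul_const _ (by fun_prop)]; refine lintegral_mono fun ξ => ?_
  rw [mul_pow]; gcongr; rw [← lintegral_sub_left_eq_self (fun k => f k ^ 2) ξ]
  exact lintegral_mul_sq_le _ (by fun_prop) (by fun_prop)

theorem lintegral_conv_weights {f g : Hor d → ℝ≥0∞} (hw : Measurable w) (hf : Measurable f)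
  (hg : Measurable g) :
  ∫⁻ ξ, (∫⁻ η, (w (ξ - η) + w η + w ξ) * (f (ξ - η) * g η)) ^ 2
    ≤ 10 * (∫⁻ k, w k ^ 2) * ((∫⁻ k, f k ^ 2) * ∫⁻ η, g η ^ 2) := by
  have h1 : ∀ ξ, ∫⁻ η, (w (ξ - η) + w η + w ξ) * (f (ξ - η) * g η) =
    ((∫⁻ η, w (ξ - η) * (f (ξ - η) * g η)) + ∫⁻ η, w η * (f (ξ - η) * g η))
      + w ξ * ∫⁻ η, f (ξ - η) * g η := by
    intro ξ
    simp_rw [add_mul]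
    rw [lintegral_add_left (by fun_prop), lintegral_add_left (by fun_prop),
      lintegral_const_mul _ (by fun_prop)]
  have h2 : ∀ a b c : ℝ≥0∞, (a + b + c) ^ 2 ≤ 4 * a ^ 2 + 4 * b ^ 2 + 2 * c ^ 2 := by
    intro a b c
    calc (a + b + c) ^ 2 ≤ 2 * ((a + b) ^ 2 + c ^ 2) := add_sq_le_two _ _
      _ ≤ 2 * (2 * (a ^ 2 + b ^ 2) + c ^ 2) := by gcongr; exact add_sq_le_two _ _
      _ = _ := by ring
  have m1 : Measurable fun ξ => ∫⁻ η, w (ξ - η) * (f (ξ - η) * g η) :=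
    Measurable.lintegral_prod_right' (f := fun p =>
      w (p.1 - p.2) * (f (p.1 - p.2) * g p.2)) (by fun_prop)
  have m2 : Measurable fun ξ => ∫⁻ η, w η * (f (ξ - η) * g η) :=
    Measurable.lintegral_prod_right' (f := fun p => w p.2 * (f (p.1 - p.2) * g p.2)) (by fun_prop)
  calc _ ≤ ∫⁻ ξ, (4 * (∫⁻ η, w (ξ - η) * (f (ξ - η) * g η)) ^ 2
        + 4 * (∫⁻ η, w η * (f (ξ - η) * g η)) ^ 2) + 2 * (w ξ * ∫⁻ η, f (ξ - η) * g η) ^ 2 := by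
        refine lintegral_mono fun ξ => ?_
        rw [h1]; exact h2 _ _ _
    _ = 4 * (∫⁻ ξ, (∫⁻ η, w (ξ - η) * (f (ξ - η) * g η)) ^ 2)
      + 4 * (∫⁻ ξ, (∫⁻ η, w η * (f (ξ - η) * g η)) ^ 2)
      + 2 * ∫⁻ ξ, (w ξ * ∫⁻ η, f (ξ - η) * g η) ^ 2 := by
      rw [lintegral_add_left (by fun_prop), lintegral_add_left (by fun_prop),
        lintegral_const_mul _ (by fun_prop), lintegral_const_mul _ (by fun_prop),
        lintegral_cmul]
    _ ≤ 4 * ((∫⁻ k, w k ^ 2) * ((∫⁻ k, f k ^ 2) * ∫⁻ η, g η ^ 2))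
      + 4 * ((∫⁻ k, w k ^ 2) * ((∫⁻ k, f k ^ 2) * ∫⁻ η, g η ^ 2))
      + 2 * ((∫⁻ k, w k ^ 2) * ((∫⁻ k, f k ^ 2) * ∫⁻ η, g η ^ 2)) := by
      gcongr
      · exact lintegral_conv_weight_left hw hf hg
      · exact lintegral_conv_weight_right hw hf hg
      · exact lintegral_conv_weight_out hw hf hg
    _ = _ := by ring

/-- The constant of the convolution estimates. -/
def convConst (d : ℕ) (t : ℝ) : ℝ := 10 * (∫⁻ ξ : Hor d, el (-t) ξ ^ 2).toReal

theorem convConst_nonneg (t : ℝ) : 0 ≤ convConst d t := by unfold convConst; positivity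

/-- The sum of weights that is allowed in the convolution estimates. -/
def wsum (t : ℝ) (ξ η : Hor d) : ℝ≥0∞ := el (-t) (ξ - η) + el (-t) η + el (-t) ξ

theorem le_wsum_left (t : ℝ) (ξ η : Hor d) : el (-t) (ξ - η) ≤ wsum t ξ η :=
  le_trans (le_add_right le_rfl) (le_add_right le_rfl)

theorem le_wsum_right (t : ℝ) (ξ η : Hor d) : el (-t) η ≤ wsum t ξ η :=
  le_trans (le_add_left le_rfl) (le_add_right le_rfl)

theorem lintegral_sq_le_of_le (ht : (d : ℝ) / 2 < t) (hc : 0 ≤ c)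
  {G : Hor d → Hor d → ℝ≥0∞} {f g : Hor d → ℝ≥0∞} (hf : Measurable f) (hg : Measurable g)
  (hG : ∀ ξ η, G ξ η ≤ ofReal c * (wsum t ξ η * (f (ξ - η) * g η))) :
  ∫⁻ ξ, (∫⁻ η, G ξ η) ^ 2 ≤ ofReal (c ^ 2 * convConst d t) * ((∫⁻ k, f k ^ 2) * ∫⁻ η, g η ^ 2) := by
  have hI := (lintegral_el_sq_lt_top ht).ne
  calc _ ≤ ∫⁻ ξ, (∫⁻ η, ofReal c * (wsum t ξ η * (f (ξ - η) * g η))) ^ 2 :=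
        lintegral_mono fun ξ => pow_le_pow_left' (lintegral_mono fun η => hG ξ η) 2
    _ = ofReal c ^ 2 * ∫⁻ ξ, (∫⁻ η, wsum t ξ η * (f (ξ - η) * g η)) ^ 2 := by
      rw [← lintegral_cmul]; congr 1; ext ξ; rw [lintegral_cmul, mul_pow]
    _ ≤ ofReal c ^ 2 * (10 * (∫⁻ ξ, el (-t) ξ ^ 2) * ((∫⁻ k, f k ^ 2) * ∫⁻ η, g η ^ 2)) := by
      gcongr; exact lintegral_conv_weights (by fun_prop) hf hg
    _ = _ := by
      unfold convConst
      rw [ofReal_mul (by positivity), ofReal_mul (by norm_num),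
        ofReal_toReal hI, ofReal_pow (by positivity)]
      norm_num; ring

theorem lintegral_sq_le_of_le_add (ht : (d : ℝ) / 2 < t) (hc : 0 ≤ c)
  {G : Hor d → Hor d → ℝ≥0∞} {f g f' g' : Hor d → ℝ≥0∞} (hf : Measurable f) (hg : Measurable g)
  (hf' : Measurable f') (hg' : Measurable g')
  (hG : ∀ ξ η, G ξ η ≤ ofReal c * (wsum t ξ η * (f (ξ - η) * g η)) ∨
    G ξ η ≤ ofReal c * (wsum t ξ η * (f' (ξ - η) * g' η))) :
  ∫⁻ ξ, (∫⁻ η, G ξ η) ^ 2 ≤ ofReal (2 * (c ^ 2 * convConst d t)) *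
    ((∫⁻ k, f k ^ 2) * (∫⁻ η, g η ^ 2) + (∫⁻ k, f' k ^ 2) * ∫⁻ η, g' η ^ 2) := by
  have hm : ∀ ξ, Measurable fun η => ofReal c * (wsum t ξ η * (f (ξ - η) * g η)) := by
    intro ξ; unfold wsum; fun_prop
  have hm2 : Measurable fun ξ => ∫⁻ η, ofReal c * (wsum t ξ η * (f (ξ - η) * g η)) :=
    Measurable.lintegral_prod_right' (f := fun p =>
      ofReal c * (wsum t p.1 p.2 * (f (p.1 - p.2) * g p.2))) (by unfold wsum; fun_prop)
  calc _ ≤ ∫⁻ ξ, 2 * ((∫⁻ η, ofReal c * (wsum t ξ η * (f (ξ - η) * g η))) ^ 2 +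
        (∫⁻ η, ofReal c * (wsum t ξ η * (f' (ξ - η) * g' η))) ^ 2) := by
        refine lintegral_mono fun ξ => le_trans (pow_le_pow_left' ?_ 2) (add_sq_le_two _ _)
        rw [← lintegral_add_left (hm ξ)]; refine lintegral_mono fun η => ?_
        rcases hG ξ η with h | h
        · exact h.trans (le_add_right le_rfl)
        · exact h.trans (le_add_left le_rfl)
    _ ≤ 2 * (ofReal (c ^ 2 * convConst d t) * ((∫⁻ k, f k ^ 2) * ∫⁻ η, g η ^ 2) +
      ofReal (c ^ 2 * convConst d t) * ((∫⁻ k, f' k ^ 2) * ∫⁻ η, g' η ^ 2)) := by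
      rw [lintegral_cmul, lintegral_add_left (by fun_prop)]; gcongr
      · exact lintegral_sq_le_of_le ht hc hf hg fun _ _ => le_rfl
      · exact lintegral_sq_le_of_le ht hc hf' hg' fun _ _ => le_rfl
    _ = _ := by rw [ofReal_mul (by norm_num : (0:ℝ) ≤ 2), ofReal_ofNat]; ring

/-- The square of the norm of `lam r F` in `L²`. -/
def wnf (r : ℝ) (F : Hor d → ℂ) : ℝ≥0∞ := ∫⁻ ξ, (el r ξ * ‖F ξ‖ₑ) ^ 2

theorem wnf_mono {r' : ℝ} (h : r ≤ r') (F : Hor d → ℂ) : wnf r F ≤ wnf r' F :=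
  lintegral_mono fun ξ => by gcongr; exact el_mono h ξ

theorem el_eq_ofReal_rpow (r : ℝ) (ξ : Hor d) : el r ξ = ofReal (lam 1 ξ ^ r) := by
  rw [el, lam_eq_rpow]

theorem lam_one_le (ξ : Hor d) : 1 ≤ lam 1 ξ := one_le_lam zero_le_one ξ

theorem lam_one_triangle (ξ η : Hor d) :
  lam 1 ξ ≤ lam 1 (ξ - η) + lam 1 η ∧ lam 1 η ≤ lam 1 ξ + lam 1 (ξ - η) ∧
    lam 1 (ξ - η) ≤ lam 1 ξ + lam 1 η := by
  refine ⟨?_, ?_, ?_⟩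
  · simpa using lam_one_add_le (ξ - η) η
  · have := lam_one_add_le ξ (η - ξ)
    rw [← lam_neg_arg 1 (ξ - η)]; simpa using this
  · have := lam_one_add_le ξ (-η)
    rw [lam_neg_arg] at this
    simpa [sub_eq_add_neg] using this

theorem el_le_of_le {k η : Hor d} (h : lam 1 η ≤ 2 * lam 1 k) {p : ℝ} (hp : 0 ≤ p) :
  el p η ≤ ofReal (2 ^ p) * el p k := by
  have hη := lam_pos 1 η
  have hk := lam_pos 1 k
  rw [el_eq_ofReal_rpow, el_eq_ofReal_rpow, ← ofReal_mul (by positivity),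
    ← mul_rpow (by norm_num) hk.le]
  exact ofReal_le_ofReal (rpow_le_rpow hη.le h hp)

theorem enorm_lam_sub_le (he : 0 ≤ e) (hes : e ≤ s) (he1 : e ≤ 1) :
  ∃ C : ℝ, 0 ≤ C ∧ ∀ ξ η : Hor d, ‖lam s ξ - lam s η‖ₑ ≤ ofReal C * (el e (ξ - η) * el (s - e) η) ∨
    (lam 1 η ≤ 2 * lam 1 (ξ - η) ∧ ‖lam s ξ - lam s η‖ₑ ≤ ofReal C * el s (ξ - η)) := by
  obtain ⟨C, hC0, hC⟩ := abs_rpow_sub_rpow_le he hes he1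
  refine ⟨C, hC0, fun ξ η => ?_⟩
  obtain ⟨t1, t2, t3⟩ := lam_one_triangle ξ η
  have hk := lam_pos 1 (ξ - η)
  have hη := lam_pos 1 η
  rw [← ofReal_norm, norm_eq_abs, lam_eq_rpow s ξ, lam_eq_rpow s η]; simp only [el_eq_ofReal_rpow]
  rw [← ofReal_mul (by positivity), ← ofReal_mul hC0, ← ofReal_mul hC0]
  rcases hC _ _ _ (lam_one_le ξ) (lam_one_le (ξ - η)) (lam_one_le η) t1 t2 with h | ⟨h, h'⟩
  · exact Or.inl (ofReal_le_ofReal h)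
  · exact Or.inr ⟨h, ofReal_le_ofReal h'⟩

theorem mul_el_le_wsum_left (hc : C ≤ c) (ξ η : Hor d) (a f : ℝ≥0∞) :
  ofReal C * (el e (ξ - η) * el (s - e) η) * (el (-t) (ξ - η) * a * f) ≤
    ofReal c * (wsum (t - e) ξ η * (a * (el (s - e) η * f))) := by
  calc _ = ofReal C * ((el e (ξ - η) * el (-t) (ξ - η)) * (a * (el (s - e) η * f))) := by ring
    _ ≤ _ := by rw [← el_add, show e + -t = -(t - e) by ring]; gcongr; exact le_wsum_left _ _ _

theorem mul_el_le_wsum_right {p v T : ℝ} {ξ η : Hor d} (hC : 0 ≤ C) (hc : C * 2 ^ p ≤ c)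
  (hp : 0 ≤ p) (hT : p + v = T) (hle : lam 1 η ≤ 2 * lam 1 (ξ - η)) (a f : ℝ≥0∞) :
  ofReal C * el s (ξ - η) * (a * f) ≤
    ofReal c * (wsum T ξ η * (el (s + p) (ξ - η) * a * (el v η * f))) := by
  calc _ = ofReal C * el s (ξ - η) * a * ((el (-T) η * el p η * el v η) * f) := by
        rw [← el_add, ← el_add, show -T + p + v = 0 by linarith]; simp; ring
    _ ≤ ofReal C * el s (ξ - η) * a *
      ((el (-T) η * (ofReal (2 ^ p) * el p (ξ - η)) * el v η) * f) := by
      gcongr; exact el_le_of_le hle hp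
    _ = ofReal (C * 2 ^ p) * (el (-T) η * (el (s + p) (ξ - η) * a * (el v η * f))) := by
      rw [ofReal_mul hC, el_add]; ring
    _ ≤ _ := by gcongr; exact le_wsum_right _ _ _

theorem mul_insert_el (r : ℝ) (η : Hor d) (w v a f : ℝ≥0∞) :
  w * (v * a * f) = w * v * el (-r) η * (a * (el r η * f)) := by
  calc _ = w * (v * a * f) * (el r η * el (-r) η) := by rw [el_mul_el_neg, mul_one]
    _ = _ := by ring

/-- The commutator estimate for a multiplier of order `s ≤ t`. -/
theorem exists_comm_le (he : 0 ≤ e) (hes : e ≤ s) (he1 : e ≤ 1)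
  (ht : (d : ℝ) / 2 < t - e) (hst : s ≤ t) :
  ∃ C : ℝ, 0 ≤ C ∧ ∀ (m : Hor d → ℝ) (A F : Hor d → ℂ) (h : Hor d → ℝ≥0∞),
    (∀ ξ η, ‖m ξ - m η‖ₑ ≤ ‖lam s ξ - lam s η‖ₑ) → Measurable F → Measurable h →
    (∀ k, ‖A k‖ₑ ≤ el (-t) k * h k) →
    ∫⁻ ξ, (∫⁻ η, ‖m ξ - m η‖ₑ * (‖A (ξ - η)‖ₑ * ‖F η‖ₑ)) ^ 2
      ≤ ofReal C * ((∫⁻ k, h k ^ 2) * wnf (s - e) F) := by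
  obtain ⟨C, hC0, hC⟩ := enorm_lam_sub_le he hes he1
  set c : ℝ := C * 2 ^ (t - s) + C with hc
  have hc0 : 0 ≤ c := by positivity
  refine ⟨c ^ 2 * convConst d (t - e), mul_nonneg (by positivity) (convConst_nonneg _),
    fun m A F h hm hF hh hA => ?_⟩
  refine lintegral_sq_le_of_le ht hc0 hh (by fun_prop) fun ξ η => ?_
  refine le_trans (mul_le_mul' (hm ξ η) (mul_le_l (hA _))) ?_
  rcases hC ξ η with h1 | ⟨hle, h1⟩
  · refine (mul_le_l h1).trans (mul_el_le_wsum_left ?_ _ _ _ _)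
    rw [hc]; nlinarith [rpow_pos_of_pos two_pos (t - s)]
  · rw [mul_assoc]; refine (mul_le_l h1).trans ?_
    have := mul_el_le_wsum_right (p := t - s) (v := s - e) (s := s - t) (T := t - e) (c := c) hC0
      (by rw [hc]; linarith) (by linarith) (by ring) hle (h (ξ - η)) ‖F η‖ₑ
    rw [show s - t + (t - s) = 0 by ring, el_zero, one_mul, sub_eq_add_neg s t, el_add] at this
    exact le_trans (by rw [mul_assoc, mul_assoc, mul_assoc]) this

/-- The commutator estimate for a multiplier of order `s ∈ [t, t + 1/2]`. -/
theorem exists_comm_le_of_ge (he : 0 ≤ e) (hes : e ≤ s) (he1 : e ≤ 1)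
  (ht : (d : ℝ) / 2 < t - e) (hst : s ≤ t + 1 / 2) :
  ∃ C : ℝ, 0 ≤ C ∧ ∀ (m : Hor d → ℝ) (A F : Hor d → ℂ) (h : Hor d → ℝ≥0∞),
    (∀ ξ η, ‖m ξ - m η‖ₑ ≤ ‖lam s ξ - lam s η‖ₑ) → Measurable A → Measurable F → Measurable h →
    (∀ k, ‖A k‖ₑ ≤ el (-t) k * h k) →
    ∫⁻ ξ, (∫⁻ η, ‖m ξ - m η‖ₑ * (‖A (ξ - η)‖ₑ * ‖F η‖ₑ)) ^ 2 ≤ ofReal C *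
      ((∫⁻ k, h k ^ 2) * wnf (s - e) F + wnf (t + 1 / 2) A * wnf (s - e - 1 / 2) F) := by
  obtain ⟨C, hC0, hC⟩ := enorm_lam_sub_le he hes he1
  set p : ℝ := t + 1 / 2 - s with hp
  set c : ℝ := C * 2 ^ p + C with hc
  have hc0 : 0 ≤ c := by positivity
  refine ⟨2 * (c ^ 2 * convConst d (t - e)),
    mul_nonneg (by norm_num) (mul_nonneg (by positivity) (convConst_nonneg _)),
    fun m A F h hm hA' hF hh hA => ?_⟩
  refine lintegral_sq_le_of_le_add ht hc0
    (f' := fun k => el (t + 1 / 2) k * ‖A k‖ₑ) (g' := fun η => el (s - e - 1 / 2) η * ‖F η‖ₑ)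
    hh (by fun_prop) (by fun_prop) (by fun_prop) fun ξ η => ?_
  rcases hC ξ η with h1 | ⟨hle, h1⟩
  · left
    refine (mul_le_mul' ((hm ξ η).trans h1) (mul_le_l (hA _))).trans
      (mul_el_le_wsum_left ?_ _ _ _ _)
    rw [hc]; nlinarith [rpow_pos_of_pos two_pos p]
  · right
    have := mul_el_le_wsum_right (p := p) (v := s - e - 1 / 2) (s := s) (T := t - e) (c := c) hC0
      (by rw [hc]; linarith) (by linarith) (by rw [hp]; ring) hle ‖A (ξ - η)‖ₑ ‖F η‖ₑ
    rw [show s + p = t + 1 / 2 by rw [hp]; ring] at this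
    exact (mul_le_l ((hm ξ η).trans h1)).trans this

/-- The product estimate in `H^r`, `|r| ≤ t`. -/
theorem exists_product_le (hr : |r| ≤ t) (ht : (d : ℝ) / 2 < t) :
  ∃ C : ℝ, 0 ≤ C ∧ ∀ (A F : Hor d → ℂ) (h : Hor d → ℝ≥0∞),
    Measurable F → Measurable h → (∀ k, ‖A k‖ₑ ≤ el (-t) k * h k) →
    ∫⁻ ξ, (∫⁻ η, el r ξ * (‖A (ξ - η)‖ₑ * ‖F η‖ₑ)) ^ 2
      ≤ ofReal C * ((∫⁻ k, h k ^ 2) * wnf r F) := by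
  obtain ⟨C, hC0, hC⟩ := rpow_product_le hr
  refine ⟨C ^ 2 * convConst d t, mul_nonneg (by positivity) (convConst_nonneg _),
    fun A F h hF hh hA => ?_⟩
  refine lintegral_sq_le_of_le ht hC0 hh (by fun_prop) fun ξ η => ?_
  obtain ⟨t1, t2, t3⟩ := lam_one_triangle ξ η
  have key : el r ξ * el (-t) (ξ - η) * el (-r) η ≤ ofReal C * wsum t ξ η := by
    have hk := lam_pos 1 (ξ - η)
    have hη := lam_pos 1 η
    have hξ := lam_pos 1 ξ
    unfold wsum; simp only [el_eq_ofReal_rpow]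
    rw [← ofReal_mul (by positivity), ← ofReal_mul (by positivity),
      ← ofReal_add (by positivity) (by positivity),
      ← ofReal_add (by positivity) (by positivity), ← ofReal_mul hC0]
    exact ofReal_le_ofReal (hC _ _ _ (lam_one_le ξ) (lam_one_le (ξ - η)) (lam_one_le η) t1 t2)
  calc _ ≤ el r ξ * (el (-t) (ξ - η) * h (ξ - η) * ‖F η‖ₑ) := by gcongr; exact hA _
    _ = (el r ξ * el (-t) (ξ - η) * el (-r) η) * (h (ξ - η) * (el r η * ‖F η‖ₑ)) :=
      mul_insert_el _ _ _ _ _ _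
    _ ≤ (ofReal C * wsum t ξ η) * (h (ξ - η) * (el r η * ‖F η‖ₑ)) := by gcongr
    _ = _ := by ring

theorem enorm_deriv_product_le (hs : 0 ≤ s) (hst : 1 - t ≤ s) :
  ∃ C : ℝ, 0 ≤ C ∧ ∀ ξ η : Hor d,
    (el (s - 1) ξ * el (1 - t) (ξ - η) * el (-s) η ≤ ofReal C * wsum t ξ η) ∨
      (lam 1 η ≤ 2 * lam 1 (ξ - η) ∧ el (s - 1) ξ ≤ ofReal C * el (s - 1) (ξ - η)) := by
  obtain ⟨C, hC0, hC⟩ := rpow_deriv_product_le hs hst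
  refine ⟨C, hC0, fun ξ η => ?_⟩
  obtain ⟨t1, t2, t3⟩ := lam_one_triangle ξ η
  have hk := lam_pos 1 (ξ - η)
  have hη := lam_pos 1 η
  have hξ := lam_pos 1 ξ
  rcases hC _ _ _ (lam_one_le ξ) (lam_one_le (ξ - η)) (lam_one_le η) t1 t2 t3 with h | ⟨h, h'⟩
  · left
    refine le_trans ?_ (mul_le_mul_right (a := ofReal C) (b := el (-t) (ξ - η) + el (-t) ξ) ?_)
    · simp only [el_eq_ofReal_rpow]
      rw [← ofReal_mul (by positivity), ← ofReal_mul (by positivity),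
        ← ofReal_add (by positivity) (by positivity), ← ofReal_mul hC0]
      exact ofReal_le_ofReal h
    · unfold wsum; gcongr; exact le_add_right le_rfl
  · right
    refine ⟨h, ?_⟩; simp only [el_eq_ofReal_rpow]; rw [← ofReal_mul hC0]; exact ofReal_le_ofReal h'

/-- The estimate in `H^{s-1}` of a product of a factor of order `t - 1` and a factor of order `s`,
for `s ∈ [t, t + 1/2]`. -/
theorem exists_deriv_product_le_of_ge (hs : 0 ≤ s) (he : 0 ≤ e) (hst : 1 - t ≤ s)
  (hst' : s ≤ t + 1 / 2) (ht : (d : ℝ) / 2 < t - e) :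
  ∃ C : ℝ, 0 ≤ C ∧ ∀ (A F : Hor d → ℂ) (h : Hor d → ℝ≥0∞),
    Measurable A → Measurable F → Measurable h → (∀ k, ‖A k‖ₑ ≤ el (1 - t) k * h k) →
    ∫⁻ ξ, (∫⁻ η, el (s - 1) ξ * (‖A (ξ - η)‖ₑ * ‖F η‖ₑ)) ^ 2 ≤ ofReal C *
      ((∫⁻ k, h k ^ 2) * wnf s F + wnf (t - 1 / 2) A * wnf (s - e - 1 / 2) F) := by
  obtain ⟨C, hC0, hC⟩ := enorm_deriv_product_le hs hst
  set p : ℝ := t + 1 / 2 - s with hp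
  set c : ℝ := C * 2 ^ p + C with hc
  have hc0 : 0 ≤ c := by positivity
  refine ⟨2 * (c ^ 2 * convConst d (t - e)),
    mul_nonneg (by norm_num) (mul_nonneg (by positivity) (convConst_nonneg _)),
    fun A F h hA' hF hh hA => ?_⟩
  refine lintegral_sq_le_of_le_add ht hc0
    (f' := fun k => el (t - 1 / 2) k * ‖A k‖ₑ) (g' := fun η => el (s - e - 1 / 2) η * ‖F η‖ₑ)
    hh (by fun_prop) (by fun_prop) (by fun_prop) fun ξ η => ?_
  rcases hC ξ η with h1 | ⟨hle, h1⟩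
  · left
    refine le_trans (mul_le_r (mul_le_l (hA _))) ?_
    rw [mul_insert_el s η]; refine le_trans (mul_le_l ?_) (mul_assoc _ _ _).le
    refine h1.trans (mul_le_mul' (ofReal_le_ofReal ?_) ?_)
    · rw [hc]; nlinarith [rpow_pos_of_pos two_pos p]
    · unfold wsum; gcongr <;> exact el_mono (by linarith) _
  · right
    have := mul_el_le_wsum_right (p := p) (v := s - e - 1 / 2) (s := s - 1) (T := t - e) (c := c) hC0
      (by rw [hc]; linarith) (by linarith) (by rw [hp]; ring) hle ‖A (ξ - η)‖ₑ ‖F η‖ₑ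
    rw [show s - 1 + p = t - 1 / 2 by rw [hp]; ring] at this
    exact (mul_le_l h1).trans this

/-! ### Multiplication operators on `L²` -/

section MulOp

variable {α : Type*} [MeasurableSpace α] {μ : Measure α}

theorem enorm_sq_eq_lintegral (f : Lp ℂ 2 μ) : ‖f‖ₑ ^ 2 = ∫⁻ x, ‖f x‖ₑ ^ 2 ∂μ := by
  rw [Lp.enorm_def]
  have := eLpNorm_nnreal_pow_eq_lintegral (μ := μ) (f := f) (p := 2) (by norm_num)
  simpa using this

theorem eLpNorm_two_sq {f : α → ℂ} : eLpNorm f 2 μ ^ 2 = ∫⁻ x, ‖f x‖ₑ ^ 2 ∂μ := by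
  have := eLpNorm_nnreal_pow_eq_lintegral (μ := μ) (f := f) (p := 2) (by norm_num)
  simpa using this

theorem memLp_two_iff {f : α → ℂ} (hf : AEStronglyMeasurable f μ) :
  MemLp f 2 μ ↔ ∫⁻ x, ‖f x‖ₑ ^ 2 ∂μ < ⊤ := by
  rw [← eLpNorm_two_sq]; simp [MemLp, hf, lt_top_iff_ne_top]

/-- Measurable and essentially bounded functions. -/
def IsBdd (μ : Measure α) (a : α → ℂ) : Prop :=
  AEStronglyMeasurable a μ ∧ ∃ C : ℝ, ∀ᵐ x ∂μ, ‖a x‖ ≤ C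

theorem IsBdd.memLp {a : α → ℂ} (ha : IsBdd μ a) {f : α → ℂ} (hf : MemLp f 2 μ) :
  MemLp (fun x => a x * f x) 2 μ := by
  obtain ⟨h1, C, hC⟩ := ha
  refine MemLp.of_le_mul (c := C) hf (h1.mul hf.1) ?_
  filter_upwards [hC] with x hx
  rw [norm_mul]; gcongr

theorem IsBdd.mul {a b : α → ℂ} (ha : IsBdd μ a) (hb : IsBdd μ b) :
  IsBdd μ (fun x => a x * b x) := by
  obtain ⟨h1, C, hC⟩ := ha
  obtain ⟨h2, C', hC'⟩ := hb
  refine ⟨h1.mul h2, C * C', ?_⟩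
  filter_upwards [hC, hC'] with x h h'
  rw [norm_mul]; exact mul_le_mul h h' (norm_nonneg _) ((norm_nonneg _).trans h)

theorem IsBdd.add {a b : α → ℂ} (ha : IsBdd μ a) (hb : IsBdd μ b) :
  IsBdd μ (fun x => a x + b x) := by
  obtain ⟨h1, C, hC⟩ := ha
  obtain ⟨h2, C', hC'⟩ := hb
  refine ⟨h1.add h2, C + C', ?_⟩
  filter_upwards [hC, hC'] with x h h'
  exact (norm_add_le _ _).trans (add_le_add h h')

open Classical in
/-- The multiplication by a bounded function in `L²`. -/
def mulOp (μ : Measure α) (a : α → ℂ) : Lp ℂ 2 μ →L[ℂ] Lp ℂ 2 μ :=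
  if ha : IsBdd μ a then LinearMap.mkContinuous
    { toFun := fun f => (ha.memLp (Lp.memLp f)).toLp _
      map_add' := fun f g => by
        rw [← MemLp.toLp_add]; apply MemLp.toLp_congr
        filter_upwards [Lp.coeFn_add f g] with x hx
        simp only [hx, Pi.add_apply, mul_add]
      map_smul' := fun c f => by
        rw [RingHom.id_apply, ← MemLp.toLp_const_smul]; apply MemLp.toLp_congr
        filter_upwards [Lp.coeFn_smul c f] with x hx
        simp only [hx, Pi.smul_apply, smul_eq_mul]; ring }
    ha.2.choose (fun f => by
      apply Lp.norm_le_mul_norm_of_ae_le_mul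
      filter_upwards [ha.2.choose_spec, (ha.memLp (Lp.memLp f)).coeFn_toLp] with x hx h2
      simp only [LinearMap.coe_mk, AddHom.coe_mk]; rw [h2, norm_mul]; gcongr)
  else 0

theorem mulOp_coe {a : α → ℂ} (ha : IsBdd μ a) (f : Lp ℂ 2 μ) :
  mulOp μ a f =ᵐ[μ] fun x => a x * f x := by
  unfold mulOp; rw [dif_pos ha]; exact (ha.memLp (Lp.memLp f)).coeFn_toLp

theorem norm_mulOp_le {a : α → ℂ} (ha : AEStronglyMeasurable a μ)
  (hC : ∀ᵐ x ∂μ, ‖a x‖ ≤ C) (f : Lp ℂ 2 μ) : ‖mulOp μ a f‖ ≤ C * ‖f‖ := by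
  apply Lp.norm_le_mul_norm_of_ae_le_mul
  filter_upwards [hC, mulOp_coe ⟨ha, C, hC⟩ f] with x hx h2
  rw [h2, norm_mul]; gcongr

theorem mulOp_mulOp {a b : α → ℂ} (ha : IsBdd μ a) (hb : IsBdd μ b) (f : Lp ℂ 2 μ) :
  mulOp μ a (mulOp μ b f) = mulOp μ (fun x => a x * b x) f := by
  apply Lp.ext
  filter_upwards [mulOp_coe ha (mulOp μ b f), mulOp_coe hb f, mulOp_coe (ha.mul hb) f]
    with x h1 h2 h3
  rw [h1, h2, h3]; ring

theorem inner_mulOp_left {a : α → ℂ} (ha : IsBdd μ a) (hreal : ∀ x, conj (a x) = a x)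
  (f g : Lp ℂ 2 μ) : inner ℂ (mulOp μ a f) g = inner ℂ f (mulOp μ a g) := by
  rw [L2.inner_def, L2.inner_def]; apply integral_congr_ae
  filter_upwards [mulOp_coe ha f, mulOp_coe ha g] with x h1 h2
  rw [h1, h2]; simp [hreal]; ring

end MulOp

/-! ### Functions on the strip as families of functions of the horizontal variable -/

/-- The Lebesgue measure on `(-1, 0)`. -/
def zvol : Measure ℝ := volume.restrict (Ioo (-1) 0)

instance : IsFiniteMeasure zvol := by unfold zvol; infer_instance

theorem volS_eq : volS d = (volume : Measure (Hor d)).prod zvol := by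
  have : S d = univ ×ˢ Ioo (-1) 0 := by ext p; simp [S]
  rw [volS, zvol, this, Measure.volume_eq_prod, ← Measure.prod_restrict, Measure.restrict_univ]

instance : SFinite (volS d) := by rw [volS_eq]; infer_instance

/-- `L²(ℝ^d)`. -/
abbrev L2H (d : ℕ) : Type := Lp ℂ 2 (volume : Measure (Hor d))

open Classical in
/-- The section at height `z`, as an element of `L²(ℝ^d)`. -/
def sec (u : Amb d → ℂ) (z : ℝ) : L2H d :=
  if h : MemLp (fun X => u (X, z)) 2 volume then h.toLp _ else 0

theorem ae_ae_of_ae_volS {p : Amb d → Prop} (h : ∀ᵐ q ∂volS d, p q) :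
  ∀ᵐ z ∂zvol, ∀ᵐ X : Hor d, p (X, z) := by
  rw [volS_eq] at h
  have h2 := (Measure.measurePreserving_swap).quasiMeasurePreserving.ae h
  exact Measure.ae_ae_of_ae_prod h2

theorem ae_ae_of_ae_volS' {p : Amb d → Prop} (h : ∀ᵐ q ∂volS d, p q) :
  ∀ᵐ X : Hor d, ∀ᵐ z ∂zvol, p (X, z) := by
  rw [volS_eq] at h
  exact Measure.ae_ae_of_ae_prod h

theorem lintegral_volS {f : Amb d → ℝ≥0∞} (hf : AEMeasurable f (volS d)) :
  ∫⁻ p, f p ∂volS d = ∫⁻ z, (∫⁻ X : Hor d, f (X, z)) ∂zvol := by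
  rw [volS_eq] at hf ⊢
  exact lintegral_prod_symm _ hf

theorem lintegral_volS' {f : Amb d → ℝ≥0∞} (hf : AEMeasurable f (volS d)) :
  ∫⁻ p, f p ∂volS d = ∫⁻ X : Hor d, (∫⁻ z, f (X, z) ∂zvol) := by
  rw [volS_eq] at hf ⊢
  exact lintegral_prod _ hf

theorem ae_memLp_sec (hu : MemLp u 2 (volS d)) :
  ∀ᵐ z ∂zvol, MemLp (fun X => u (X, z)) 2 volume := by
  have h1 : ∀ᵐ z ∂zvol, AEStronglyMeasurable (fun X => u (X, z)) volume := by
    have := hu.1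
    rw [volS_eq] at this
    exact this.prodMk_right
  have h2 := (memLp_two_iff hu.1).mp hu
  have hm := (hu.1.enorm).pow_const 2
  rw [lintegral_volS hm] at h2
  have hm2 : AEMeasurable (fun z => ∫⁻ X, ‖u (X, z)‖ₑ ^ 2) zvol := by
    rw [volS_eq] at hm
    exact hm.lintegral_prod_left'
  filter_upwards [h1, ae_lt_top' hm2 h2.ne] with z hz1 hz2
  exact (memLp_two_iff hz1).mpr hz2

theorem sec_coe (h : MemLp (fun X => u (X, z)) 2 volume) :
  sec u z =ᵐ[volume] fun X => u (X, z) := by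
  unfold sec; rw [dif_pos h]; exact h.coeFn_toLp

theorem ae_sec_coe (hu : MemLp u 2 (volS d)) :
  ∀ᵐ z ∂zvol, sec u z =ᵐ[volume] fun X => u (X, z) := by
  filter_upwards [ae_memLp_sec hu] with z hz using sec_coe hz

theorem sec_congr (h : u =ᵐ[volS d] v) : ∀ᵐ z ∂zvol, sec u z = sec v z := by
  filter_upwards [ae_ae_of_ae_volS h] with z hz
  have hz' : (fun X => u (X, z)) =ᵐ[volume] fun X => v (X, z) := hz
  by_cases hm : MemLp (fun X => u (X, z)) 2 volume
  · have hm' := (memLp_congr_ae hz').mp hm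
    unfold sec; rw [dif_pos hm, dif_pos hm']; exact MemLp.toLp_congr _ _ hz
  · have hm' : ¬ MemLp (fun X => v (X, z)) 2 volume := fun h' => hm ((memLp_congr_ae hz').mpr h')
    unfold sec; rw [dif_neg hm, dif_neg hm']

theorem sec_add (u v : L2S d) : ∀ᵐ z ∂zvol, sec (u + v : L2S d) z = sec u z + sec v z := by
  filter_upwards [sec_congr (Lp.coeFn_add u v), ae_memLp_sec (Lp.memLp u), ae_memLp_sec (Lp.memLp v)]
    with z h1 h2 h3
  rw [h1]
  have h4 : MemLp (fun X => (⇑u + ⇑v) (X, z)) 2 volume := h2.add h3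
  unfold sec; rw [dif_pos h2, dif_pos h3, dif_pos h4]; rfl

theorem sec_smul (c : ℂ) (u : L2S d) : ∀ᵐ z ∂zvol, sec (c • u : L2S d) z = c • sec u z := by
  filter_upwards [sec_congr (Lp.coeFn_smul c u), ae_memLp_sec (Lp.memLp u)] with z h1 h2
  rw [h1]
  have h4 : MemLp (fun X => (c • ⇑u) (X, z)) 2 volume := h2.const_smul c
  unfold sec; rw [dif_pos h2, dif_pos h4]; rfl

theorem sec_sub (u v : L2S d) : ∀ᵐ z ∂zvol, sec (u - v : L2S d) z = sec u z - sec v z := by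
  have e : u - v = u + (-1 : ℂ) • v := by simp [sub_eq_add_neg]
  filter_upwards [sec_add u ((-1 : ℂ) • v), sec_smul (-1) v] with z h1 h2
  rw [e, h1, h2]; simp [sub_eq_add_neg]

theorem enorm_sq_sec (hu : MemLp u 2 (volS d)) :
  ∀ᵐ z ∂zvol, ‖sec u z‖ₑ ^ 2 = ∫⁻ X, ‖u (X, z)‖ₑ ^ 2 := by
  filter_upwards [ae_sec_coe hu] with z hz
  rw [enorm_sq_eq_lintegral]; apply lintegral_congr_ae
  filter_upwards [hz] with X hX
  rw [hX]

theorem lintegral_enorm_sq_sec (hu : MemLp u 2 (volS d)) :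
  ∫⁻ z, ‖sec u z‖ₑ ^ 2 ∂zvol = ∫⁻ p, ‖u p‖ₑ ^ 2 ∂volS d := by
  rw [lintegral_volS ((hu.1.enorm).pow_const 2)]; exact lintegral_congr_ae (enorm_sq_sec hu)

theorem aemeasurable_enorm_sec (hu : MemLp u 2 (volS d)) :
  AEMeasurable (fun z => ‖sec u z‖ₑ ^ 2) zvol := by
  have hm := (hu.1.enorm).pow_const 2
  rw [volS_eq] at hm
  exact hm.lintegral_prod_left'.congr ((enorm_sq_sec hu).mono fun z hz => hz.symm)

theorem enorm_sq_eq_sec (u : L2S d) : ‖u‖ₑ ^ 2 = ∫⁻ z, ‖sec u z‖ₑ ^ 2 ∂zvol := by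
  rw [enorm_sq_eq_lintegral, lintegral_enorm_sq_sec (Lp.memLp u)]

theorem eq_of_sec_eq {u v : L2S d} (h : ∀ᵐ z ∂zvol, sec u z = sec v z) : u = v := by
  have : ‖u - v‖ₑ ^ 2 = 0 := by
    rw [enorm_sq_eq_sec]; rw [lintegral_eq_zero_iff' (aemeasurable_enorm_sec (Lp.memLp _))]
    filter_upwards [sec_sub u v, h] with z h1 h2
    rw [h1, h2, sub_self]; simp
  simpa [sub_eq_zero] using this

/-! ### Rectangles span `L²(S)` -/

theorem ae_eq_zero_of_setIntegral_rectangle {w : Amb d → ℂ} (hw : MemLp w 2 (volS d))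
  (h : ∀ (A : Set (Hor d)) (B : Set ℝ), MeasurableSet A → MeasurableSet B → volume A < ⊤ →
    ∫ p in A ×ˢ B, w p ∂volS d = 0) : w =ᵐ[volS d] 0 := by
  have key : ∀ n, w =ᵐ[(volS d).restrict (Metric.ball 0 n ×ˢ univ)] 0 := by
    intro n
    have hfin : volS d (Metric.ball 0 n ×ˢ univ) < ⊤ := by
      rw [volS_eq, Measure.prod_prod]; exact mul_lt_top measure_ball_lt_top (measure_lt_top _ _)
    have hint : Integrable w ((volS d).restrict (Metric.ball 0 n ×ˢ univ)) := by
      have : IsFiniteMeasure ((volS d).restrict (Metric.ball 0 n ×ˢ univ)) := ⟨by simpa using hfin⟩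
      exact (hw.restrict _).integrable (by norm_num)
    have hbm : MeasurableSet (Metric.ball 0 n ×ˢ (univ : Set ℝ)) :=
      measurableSet_ball.prod MeasurableSet.univ
    apply Integrable.ae_eq_zero_of_forall_setIntegral_eq_zero hint
    intro s hs hfs
    clear hfs
    induction s, hs using MeasurableSpace.induction_on_inter generateFrom_prod.symm
      isPiSystem_prod with
    | empty => simp
    | basic t ht =>
      obtain ⟨A, hA, B, hB, rfl⟩ := ht
      rw [Measure.restrict_restrict (MeasurableSet.prod (by exact hA) (by exact hB)), Set.prod_inter_prod, Set.inter_univ]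
      exact h _ _ (MeasurableSet.inter (by exact hA) measurableSet_ball) hB
        (lt_of_le_of_lt (measure_mono Set.inter_subset_right) measure_ball_lt_top)
    | compl t ht hi =>
      have h0 := h (Metric.ball 0 n) univ measurableSet_ball MeasurableSet.univ measure_ball_lt_top
      rw [← integral_add_compl ht hint] at h0
      rwa [hi, zero_add] at h0
    | iUnion f hd hm hi => rw [integral_iUnion hm hd hint.integrableOn]; simp [hi]
  have : ∀ᵐ p ∂volS d, ∀ n : ℕ, p ∈ Metric.ball 0 n ×ˢ univ → w p = 0 := by
    rw [ae_all_iff]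
    intro n; exact (ae_restrict_iff' (measurableSet_ball.prod MeasurableSet.univ)).mp (key n)
  filter_upwards [this] with p hp
  obtain ⟨n, hn⟩ := exists_nat_gt ‖p.1‖
  exact hp n ⟨by simpa using hn, trivial⟩

theorem topologicalClosure_eq_top_of_rectangle {K : Submodule ℂ (L2S d)}
  (h : ∀ (A : Set (Hor d)) (B : Set ℝ), MeasurableSet A → MeasurableSet B →
    ∀ hAB : volS d (A ×ˢ B) ≠ ⊤, volume A < ⊤ →
    ∃ hm : MeasurableSet (A ×ˢ B), indicatorConstLp 2 hm hAB (1 : ℂ) ∈ K) :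
  K.topologicalClosure = ⊤ := by
  rw [Submodule.topologicalClosure_eq_top_iff, Submodule.eq_bot_iff]
  intro w hw; rw [Submodule.mem_orthogonal] at hw
  apply Lp.ext
  refine (ae_eq_zero_of_setIntegral_rectangle (Lp.memLp w) fun A B hA hB hfin => ?_).trans
    (Lp.coeFn_zero _ _ _).symm
  have hAB : volS d (A ×ˢ B) ≠ ⊤ := by
    rw [volS_eq, Measure.prod_prod]; exact mul_ne_top hfin.ne (measure_ne_top _ _)
  obtain ⟨hm, hK⟩ := h A B hA hB hAB hfin
  have := hw _ hK
  rwa [L2.inner_indicatorConstLp_one] at this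

/-! ### Operators that act on the horizontal variable -/

theorem norm_le_of_sec {T : L2H d →L[ℂ] L2H d} {u w : L2S d}
  (h : ∀ᵐ z ∂zvol, sec w z = T (sec u z)) : ‖w‖ ≤ ‖T‖ * ‖u‖ := by
  have : ‖w‖ₑ ^ 2 ≤ (‖T‖ₑ * ‖u‖ₑ) ^ 2 := by
    rw [mul_pow, enorm_sq_eq_sec w, enorm_sq_eq_sec u, ← lintegral_cmul]; apply lintegral_mono_ae
    filter_upwards [h] with z hz
    rw [hz, ← mul_pow]; gcongr; exact T.le_opENorm _
  have h2 := (ENNReal.pow_le_pow_left_iff two_ne_zero).mp this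
  have h3 := toReal_mono (by finiteness) h2
  simpa using h3

theorem sec_indicator {A : Set (Hor d)} {B : Set ℝ} (hA : MeasurableSet A)
  (hm : MeasurableSet (A ×ˢ B)) (hAB : volS d (A ×ˢ B) ≠ ⊤) (hfin : volume A ≠ ⊤) :
  ∀ᵐ z ∂zvol, sec (indicatorConstLp 2 hm hAB (1 : ℂ) : L2S d) z =
    B.indicator (fun _ => indicatorConstLp 2 hA hfin (1 : ℂ)) z := by
  filter_upwards [ae_sec_coe (Lp.memLp (indicatorConstLp 2 hm hAB 1 : L2S d)),
    ae_ae_of_ae_volS (indicatorConstLp_coeFn (c := (1 : ℂ)))]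
    with z h1 h2
  apply Lp.ext
  by_cases hz : z ∈ B
  · rw [indicator_of_mem hz]
    filter_upwards [h1, h2, indicatorConstLp_coeFn (c := (1 : ℂ))] with X e1 e2 e3
    rw [e1, e2, e3]
    by_cases hX : X ∈ A
    · rw [indicator_of_mem hX, indicator_of_mem (show (X, z) ∈ A ×ˢ B from ⟨hX, hz⟩)]
    · rw [indicator_of_notMem hX, indicator_of_notMem (show (X, z) ∉ A ×ˢ B from fun h => hX h.1)]
  · rw [indicator_of_notMem hz]
    filter_upwards [h1, h2, Lp.coeFn_zero ℂ 2 volume] with X e1 e2 e3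
    rw [e1, e2, e3]; simp [Set.indicator, hz]

theorem exists_lift_rectangle (T : L2H d →L[ℂ] L2H d) {A : Set (Hor d)} {B : Set ℝ}
  (hA : MeasurableSet A) (hB : MeasurableSet B)
  (hm : MeasurableSet (A ×ˢ B)) (hAB : volS d (A ×ˢ B) ≠ ⊤) (hfin : volume A ≠ ⊤) :
  ∃ w : L2S d, ∀ᵐ z ∂zvol,
    sec w z = T (sec (indicatorConstLp 2 hm hAB (1 : ℂ) : L2S d) z) := by
  set f := T (indicatorConstLp 2 hA hfin 1) with hf
  have hsm : StronglyMeasurable (fun p : Amb d => B.indicator (fun _ => 1) p.2 * f p.1) := by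
    refine StronglyMeasurable.mul ?_ ((Lp.stronglyMeasurable f).comp_measurable measurable_fst)
    exact (stronglyMeasurable_const.indicator hB).comp_measurable measurable_snd
  have hmem : MemLp (fun p => B.indicator (fun _ => 1) p.2 * f p.1) 2 (volS d) := by
    rw [memLp_two_iff hsm.aestronglyMeasurable]
    have hM := hsm.measurable.enorm.pow_const 2
    rw [lintegral_volS hM.aemeasurable]
    calc _ ≤ ∫⁻ z, ‖f‖ₑ ^ 2 ∂zvol := by
          refine lintegral_mono fun z => ?_
          rw [enorm_sq_eq_lintegral]; refine lintegral_mono fun X => ?_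
          gcongr
          by_cases hz : z ∈ B <;> simp [hz]
      _ < ⊤ := by rw [lintegral_const]; exact mul_lt_top (by finiteness) (measure_lt_top _ _)
  refine ⟨hmem.toLp _, ?_⟩
  filter_upwards [sec_indicator hA hm hAB hfin, sec_congr hmem.coeFn_toLp, ae_sec_coe hmem]
    with z h1 h2 h3
  rw [h1, h2]; apply Lp.ext; refine h3.trans ?_
  by_cases hz : z ∈ B
  · simp only [indicator_of_mem hz, one_mul, ← hf]; rfl
  · simp only [indicator_of_notMem hz, zero_mul, map_zero]; exact (Lp.coeFn_zero _ _ _).symm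

theorem exists_lift_of_tendsto (T : L2H d →L[ℂ] L2H d) {u : ℕ → L2S d} {u' : L2S d}
  (hu : Tendsto u atTop (𝓝 u'))
  (h : ∀ n, ∃ w : L2S d, ∀ᵐ z ∂zvol, sec w z = T (sec (u n) z)) :
  ∃ w : L2S d, ∀ᵐ z ∂zvol, sec w z = T (sec u' z) := by
  choose w hw using h
  have hlip : ∀ n m, ‖w n - w m‖ ≤ ‖T‖ * ‖u n - u m‖ := by
    intro n m; apply norm_le_of_sec
    filter_upwards [hw n, hw m, sec_sub (w n) (w m), sec_sub (u n) (u m)] with z h1 h2 h3 h4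
    rw [h3, h4, h1, h2, map_sub]
  have hc : CauchySeq w := by
    have hcu := hu.cauchySeq
    rw [Metric.cauchySeq_iff] at hcu ⊢
    intro ε hε
    obtain ⟨N, hN⟩ := hcu (ε / (‖T‖ + 1)) (by positivity)
    refine ⟨N, fun m hm n hn => ?_⟩
    have := hN m hm n hn
    rw [dist_eq_norm, lt_div_iff₀ (by positivity)] at this
    rw [dist_eq_norm]; nlinarith [hlip m n, norm_nonneg (u m - u n)]
  obtain ⟨w', hw'⟩ := cauchySeq_tendsto_of_complete hc
  refine ⟨w', ?_⟩
  set F : ℕ → ℝ → ℝ≥0∞ := fun n z =>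
    2 * (‖sec (w' - w n) z‖ₑ ^ 2 + ‖T‖ₑ ^ 2 * ‖sec (u n - u') z‖ₑ ^ 2) with hF
  have hFm : ∀ n, AEMeasurable (F n) zvol := fun n =>
    ((aemeasurable_enorm_sec (Lp.memLp _)).add
      ((aemeasurable_enorm_sec (Lp.memLp _)).const_mul _)).const_mul _
  have hFint : ∀ n, ∫⁻ z, F n z ∂zvol = 2 * (‖w' - w n‖ₑ ^ 2 + ‖T‖ₑ ^ 2 * ‖u n - u'‖ₑ ^ 2) := by
    intro n
    rw [hF, lintegral_cmul, lintegral_add_left' (aemeasurable_enorm_sec (Lp.memLp _)),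
      lintegral_cmul, ← enorm_sq_eq_sec, ← enorm_sq_eq_sec]
  have hlim : Tendsto (fun n => ∫⁻ z, F n z ∂zvol) atTop (𝓝 0) := by
    have e1 : Tendsto (fun n => ‖w' - w n‖ₑ) atTop (𝓝 0) := by
      have := (tendsto_const_nhds (x := w')).sub hw'
      simpa using this.enorm
    have e2 : Tendsto (fun n => ‖u n - u'‖ₑ) atTop (𝓝 0) := by
      have := hu.sub (tendsto_const_nhds (x := u'))
      simpa using this.enorm
    simp_rw [hFint]
    have e3 := ENNReal.Tendsto.const_mul (a := 2) ((ENNReal.Tendsto.pow (n := 2) e1).add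
      (ENNReal.Tendsto.const_mul (a := ‖T‖ₑ ^ 2) (ENNReal.Tendsto.pow (n := 2) e2) (Or.inr (by finiteness))))
      (Or.inr (by norm_num))
    simpa using e3
  have hinf : ∫⁻ z, ⨅ n, F n z ∂zvol = 0 := by
    refine le_antisymm (ge_of_tendsto' hlim fun n => lintegral_mono fun z => iInf_le _ n) (zero_le)
  rw [lintegral_eq_zero_iff' (AEMeasurable.iInf hFm)] at hinf
  have hall : ∀ᵐ z ∂zvol, ∀ n, ‖sec w' z - T (sec u' z)‖ₑ ^ 2 ≤ F n z := by
    rw [ae_all_iff]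
    intro n
    filter_upwards [hw n, sec_sub w' (w n), sec_sub (u n) u'] with z h1 h2 h3
    have : sec w' z - T (sec u' z) = sec (w' - w n) z + T (sec (u n - u' : L2S d) z) := by
      rw [h2, h3, map_sub, h1]; abel
    rw [this, hF]
    calc _ ≤ (‖sec (w' - w n) z‖ₑ + ‖T‖ₑ * ‖sec (u n - u') z‖ₑ) ^ 2 := by
          gcongr; exact (enorm_add_le _ _).trans (add_le_add le_rfl (T.le_opENorm _))
      _ ≤ _ := by refine (add_sq_le_two _ _).trans ?_; rw [mul_pow]
  filter_upwards [hinf, hall] with z h1 h2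
  have h3 : ‖sec w' z - T (sec u' z)‖ₑ ^ 2 ≤ 0 := by
    calc _ ≤ ⨅ n, F n z := le_iInf h2
      _ = 0 := h1
  simpa [sub_eq_zero] using h3

theorem exists_lift (T : L2H d →L[ℂ] L2H d) (u : L2S d) :
  ∃ w : L2S d, ∀ᵐ z ∂zvol, sec w z = T (sec u z) := by
  let K : Submodule ℂ (L2S d) :=
    { carrier := {u | ∃ w : L2S d, ∀ᵐ z ∂zvol, sec w z = T (sec u z)}
      add_mem' := by
        rintro a b ⟨wa, ha⟩ ⟨wb, hb⟩; refine ⟨wa + wb, ?_⟩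
        filter_upwards [ha, hb, sec_add a b, sec_add wa wb] with z h1 h2 h3 h4
        rw [h3, h4, h1, h2, map_add]
      zero_mem' := by
        refine ⟨0, ?_⟩
        filter_upwards [sec_smul 0 0] with z h1
        rw [zero_smul, zero_smul] at h1
        rw [h1, map_zero]
      smul_mem' := by
        rintro c a ⟨wa, ha⟩; refine ⟨c • wa, ?_⟩
        filter_upwards [ha, sec_smul c a, sec_smul c wa] with z h1 h2 h3
        rw [h2, h3, h1, map_smul] }
  have htop : K.topologicalClosure = ⊤ := topologicalClosure_eq_top_of_rectangle
    fun A B hA hB hAB hfin => ⟨hA.prod hB, exists_lift_rectangle T hA hB _ hAB hfin.ne⟩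
  have hu : u ∈ closure K := by rw [← Submodule.topologicalClosure_coe, htop]; trivial
  obtain ⟨x, hx, hlim⟩ := mem_closure_iff_seq_limit.mp hu
  exact exists_lift_of_tendsto T hlim hx

/-- The operator on `L²(S)` that acts as `T` on the horizontal variable. -/
def lift (T : L2H d →L[ℂ] L2H d) : L2S d →L[ℂ] L2S d :=
  LinearMap.mkContinuous
    { toFun := fun u => (exists_lift T u).choose
      map_add' := fun a b => by
        apply eq_of_sec_eq
        filter_upwards [(exists_lift T (a + b)).choose_spec, (exists_lift T a).choose_spec,
          (exists_lift T b).choose_spec, sec_add a b,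
          sec_add (exists_lift T a).choose (exists_lift T b).choose] with z h1 h2 h3 h4 h5
        rw [h5, h1, h2, h3, h4, map_add]
      map_smul' := fun c a => by
        apply eq_of_sec_eq
        filter_upwards [(exists_lift T (c • a)).choose_spec, (exists_lift T a).choose_spec,
          sec_smul c a, sec_smul c (exists_lift T a).choose] with z h1 h2 h3 h4
        rw [RingHom.id_apply, h1, h3, h4, h2, map_smul] }
    ‖T‖ (fun u => norm_le_of_sec (exists_lift T u).choose_spec)

theorem sec_lift (T : L2H d →L[ℂ] L2H d) (u : L2S d) :
  ∀ᵐ z ∂zvol, sec (lift T u) z = T (sec u z) := (exists_lift T u).choose_spec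

theorem lift_comp (T T' : L2H d →L[ℂ] L2H d) (u : L2S d) :
  lift (T ∘L T') u = lift T (lift T' u) := by
  apply eq_of_sec_eq
  filter_upwards [sec_lift (T ∘L T') u, sec_lift T (lift T' u), sec_lift T' u] with z h1 h2 h3
  rw [h1, h2, h3]; rfl

theorem integral_volS {E : Type*} [NormedAddCommGroup E] [NormedSpace ℝ E] {f : Amb d → E}
  (hf : Integrable f (volS d)) :
  ∫ p, f p ∂volS d = ∫ z, (∫ X : Hor d, f (X, z)) ∂zvol := by
  rw [volS_eq] at hf ⊢
  exact integral_prod_symm _ hf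

theorem integral_volS' {E : Type*} [NormedAddCommGroup E] [NormedSpace ℝ E] {f : Amb d → E}
  (hf : Integrable f (volS d)) :
  ∫ p, f p ∂volS d = ∫ X : Hor d, (∫ z, f (X, z) ∂zvol) := by
  rw [volS_eq] at hf ⊢
  exact integral_prod _ hf

theorem inner_eq_integral_sec (u v : L2S d) :
  inner ℂ u v = ∫ z, inner ℂ (sec u z) (sec v z) ∂zvol := by
  rw [L2.inner_def]; rw [integral_volS (L2.integrable_inner u v)]; apply integral_congr_ae
  filter_upwards [ae_sec_coe (Lp.memLp u), ae_sec_coe (Lp.memLp v)] with z h1 h2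
  rw [L2.inner_def]; apply integral_congr_ae
  filter_upwards [h1, h2] with X e1 e2
  rw [e1, e2]

theorem inner_lift_left {T T' : L2H d →L[ℂ] L2H d}
  (h : ∀ f g, inner ℂ (T f) g = inner ℂ f (T' g)) (u v : L2S d) :
  inner ℂ (lift T u) v = inner ℂ u (lift T' v) := by
  rw [inner_eq_integral_sec, inner_eq_integral_sec]; apply integral_congr_ae
  filter_upwards [sec_lift T u, sec_lift T' v] with z h1 h2
  rw [h1, h2, h]

theorem ae_isBdd_sec {a : Amb d → ℂ} (ha : IsBdd (volS d) a) :
  ∀ᵐ z ∂zvol, IsBdd volume (fun X => a (X, z)) := by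
  obtain ⟨h1, C, hC⟩ := ha
  have h1' := h1
  rw [volS_eq] at h1'
  filter_upwards [h1'.prodMk_right, ae_ae_of_ae_volS hC] with z h2 h3
  exact ⟨h2, C, h3⟩

theorem sec_mulOp {a : Amb d → ℂ} (ha : IsBdd (volS d) a) (u : L2S d) :
  ∀ᵐ z ∂zvol, sec (mulOp (volS d) a u) z = mulOp volume (fun X => a (X, z)) (sec u z) := by
  filter_upwards [ae_isBdd_sec ha, ae_sec_coe (Lp.memLp u),
    ae_sec_coe (Lp.memLp (mulOp (volS d) a u)), ae_ae_of_ae_volS (mulOp_coe ha u)] with z h1 h2 h3 h4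
  apply Lp.ext
  filter_upwards [h2, h3, h4, mulOp_coe h1 (sec u z)] with X e1 e2 e3 e4
  rw [e2, e3, e4, e1]

/-! ### The Fourier transform of a product -/

/-- The Fourier transform of `L²(ℝ^d)`. -/
def FT : L2H d →L[ℂ] L2H d :=
  (Lp.fourierTransformₗᵢ (Hor d) ℂ).toContinuousLinearEquiv.toContinuousLinearMap

/-- The inverse Fourier transform of `L²(ℝ^d)`. -/
def FTi : L2H d →L[ℂ] L2H d :=
  (Lp.fourierTransformₗᵢ (Hor d) ℂ).symm.toContinuousLinearEquiv.toContinuousLinearMap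

theorem FT_eq (f : L2H d) : FT f = 𝓕 f := rfl

@[simp] theorem FT_FTi (f : L2H d) : FT (FTi f) = f :=
  (Lp.fourierTransformₗᵢ (Hor d) ℂ).apply_symm_apply f

@[simp] theorem FTi_FT (f : L2H d) : FTi (FT f) = f :=
  (Lp.fourierTransformₗᵢ (Hor d) ℂ).symm_apply_apply f

@[simp] theorem norm_FT (f : L2H d) : ‖FT f‖ = ‖f‖ := Lp.norm_fourier_eq f

@[simp] theorem enorm_FT (f : L2H d) : ‖FT f‖ₑ = ‖f‖ₑ := by
  rw [← ofReal_norm, ← ofReal_norm, norm_FT]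

theorem inner_FT (f g : L2H d) : inner ℂ (FT f) (FT g) = inner ℂ f g := Lp.inner_fourier_eq f g

theorem inner_FT_left (f g : L2H d) : inner ℂ (FT f) g = inner ℂ f (FTi g) := by
  rw [← inner_FT f (FTi g), FT_FTi]

theorem inner_FTi_left (f g : L2H d) : inner ℂ (FTi f) g = inner ℂ f (FT g) := by
  rw [← inner_FT (FTi f) g, FT_FTi]

theorem integral_FT_mul (f : L2H d) (ψ : Sch d) :
  ∫ ξ, FT f ξ * ψ ξ = ∫ X, f X * 𝓕 ψ X := by
  have h := congrArg (fun T => T ψ) (Lp.fourier_toTemperedDistribution_eq f)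
  simp only [TemperedDistribution.fourier_apply, Lp.toTemperedDistribution_apply] at h
  rw [FT_eq]; simp only [smul_eq_mul] at h
  simp_rw [mul_comm _ (ψ _), ← h, mul_comm]

theorem ae_eq_of_integral_schwartz {f g : Hor d → ℂ} (hf : LocallyIntegrable f)
  (hg : LocallyIntegrable g) (h : ∀ ψ : Sch d, ∫ x, f x * ψ x = ∫ x, g x * ψ x) :
  f =ᵐ[volume] g := by
  apply ae_eq_of_integral_contDiff_smul_eq hf hg
  intro φ hφ hc
  have hφ' : ContDiff ℝ ∞ (fun x => (φ x : ℂ)) := ofRealCLM.contDiff.comp hφ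
  have hc' : HasCompactSupport (fun x => (φ x : ℂ)) := hc.comp_left ofReal_zero
  have := h (hc'.toSchwartzMap hφ')
  simp only [HasCompactSupport.toSchwartzMap_toFun] at this
  simp_rw [real_smul, mul_comm _ (f _), mul_comm _ (g _)]; exact this

theorem fourier_compSubConst (ψ : Sch d) (k X : Hor d) :
  𝓕 (ψ.compSubConstCLM ℂ (-k)) X = exp ((2 * π * inner ℝ k X : ℝ) * I) * 𝓕 ψ X := by
  rw [SchwartzMap.fourier_coe, SchwartzMap.fourier_coe, Real.fourier_eq', Real.fourier_eq',
    ← integral_const_mul, ← integral_sub_right_eq_self _ k]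
  congr 1; ext v
  simp only [SchwartzMap.compSubConstCLM_apply, smul_eq_mul, sub_neg_eq_add, sub_add_cancel]
  rw [← mul_assoc, ← exp_add, inner_sub_left]; congr 2; push_cast; ring

/-- Amplitudes `A` whose inverse Fourier transform belongs to `H^t`, `t > d/2`. -/
structure IsAmp (t : ℝ) (A : Hor d → ℂ) (h : Hor d → ℝ≥0∞) : Prop where
  ht : (d : ℝ) / 2 < t
  meas : Measurable A
  meas_h : Measurable h
  le : ∀ k, ‖A k‖ₑ ≤ el (-t) k * h k
  fin : ∫⁻ k, h k ^ 2 ≠ ⊤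

theorem IsAmp.lintegral_conv_lt_top
  (hA : IsAmp t A h) (f : L2H d) :
  ∫⁻ ξ, (∫⁻ η, ‖A (ξ - η)‖ₑ * ‖f η‖ₑ) ^ 2 < ⊤ := by
  have hfm := (measurable_Lp f).enorm
  refine lt_of_le_of_lt (lintegral_mono fun ξ => pow_le_pow_left' (lintegral_mono fun η =>
    (mul_le_mul_left (hA.le _) _).trans (mul_assoc _ _ _).le) 2)
    (lt_of_le_of_lt (lintegral_conv_weight_left (measurable_el (-t)) hA.meas_h hfm) ?_)
  refine mul_lt_top (lintegral_el_sq_lt_top hA.ht) (mul_lt_top hA.fin.lt_top ?_)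
  rw [← enorm_sq_eq_lintegral]; finiteness

theorem IsAmp.integrable (hA : IsAmp t A h) :
  Integrable A := by
  refine ⟨hA.meas.aestronglyMeasurable, ?_⟩
  have h1 : (∫⁻ k, ‖A k‖ₑ) ^ 2 < ⊤ := by
    refine lt_of_le_of_lt (pow_le_pow_left' (lintegral_mono hA.le) 2)
      (lt_of_le_of_lt (lintegral_mul_sq_le _ (by fun_prop) hA.meas_h.aemeasurable) ?_)
    exact mul_lt_top (lintegral_el_sq_lt_top hA.ht) hA.fin.lt_top
  rw [HasFiniteIntegral]
  by_contra hcon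
  rw [not_lt, top_le_iff] at hcon
  rw [hcon] at h1
  simp at h1

theorem isBdd_of_fourierInv {a : Hor d → ℂ} (hA : Integrable A) (ha : ∀ X, a X = 𝓕⁻ A X) :
  IsBdd volume a := by
  have e := funext ha
  have hle : ∀ X, ‖𝓕⁻ A X‖ ≤ ∫ k, ‖A k‖ := by
    intro X; rw [fourierInv_eq']; refine (norm_integral_le_integral_norm _).trans (le_of_eq ?_)
    congr 1; ext v; rw [norm_smul, norm_exp_ofReal_mul_I, one_mul]
  refine ⟨?_, ∫ k, ‖A k‖, .of_forall fun X => by rw [ha]; exact hle X⟩; rw [e]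
  have hc : Continuous (𝓕⁻ A) := by
    rw [Real.fourierInv_eq_fourier_comp_neg]
    exact VectorFourier.fourierIntegral_continuous continuous_fourierChar
      (show Continuous fun p : Hor d × Hor d => inner ℝ p.1 p.2 from continuous_inner) hA.comp_neg
  exact hc.aestronglyMeasurable

theorem IsAmp.ae_integrable_conv
  (hA : IsAmp t A h) (f : L2H d) : ∀ᵐ ξ, Integrable fun η => A (ξ - η) * f η := by
  have hfm := measurable_Lp f
  have hAm := hA.meas
  have hm : Measurable fun ξ => (∫⁻ η, ‖A (ξ - η)‖ₑ * ‖f η‖ₑ) ^ 2 :=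
    (Measurable.lintegral_prod_right' (f := fun p => ‖A (p.1 - p.2)‖ₑ * ‖f p.2‖ₑ)
      (by fun_prop)).pow_const 2
  filter_upwards [ae_lt_top hm (hA.lintegral_conv_lt_top f).ne] with ξ hξ
  refine ⟨by fun_prop, ?_⟩; rw [HasFiniteIntegral]
  simp_rw [enorm_mul]
  by_contra hcon
  rw [not_lt, top_le_iff] at hcon
  rw [hcon] at hξ
  simp at hξ

theorem IsAmp.memLp_conv
  (hA : IsAmp t A h) (f : L2H d) : MemLp (fun ξ => ∫ η, A (ξ - η) * f η) 2 volume := by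
  have hfm := Lp.stronglyMeasurable f
  have hAm := hA.meas.stronglyMeasurable
  have hm : StronglyMeasurable fun ξ => ∫ η, A (ξ - η) * f η :=
    StronglyMeasurable.integral_prod_right' (((hA.meas.comp (measurable_fst.sub measurable_snd)).mul
        (hfm.measurable.comp measurable_snd)).stronglyMeasurable)
  rw [memLp_two_iff hm.aestronglyMeasurable]
  refine lt_of_le_of_lt (lintegral_mono fun ξ => pow_le_pow_left' ?_ 2) (hA.lintegral_conv_lt_top f)
  refine (enorm_integral_le_lintegral_enorm _).trans (le_of_eq ?_)
  simp_rw [enorm_mul]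

/-- The Fourier transform of a product is a convolution. -/
theorem FT_mulOp {a : Hor d → ℂ} (hA : IsAmp t A h)
  (ha : ∀ X, a X = 𝓕⁻ A X) (f : L2H d) :
  FT (mulOp volume a f) =ᵐ[volume] fun ξ => ∫ η, A (ξ - η) * FT f η := by
  have hbd := isBdd_of_fourierInv hA.integrable ha
  have hFm := measurable_Lp (FT f)
  have hAm := hA.meas
  refine ae_eq_of_integral_schwartz ((Lp.memLp _).locallyIntegrable (by norm_num))
    ((hA.memLp_conv (FT f)).locallyIntegrable (by norm_num)) fun ψ => ?_
  have hψm := ψ.continuous.measurable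
  have hfin : ∫⁻ ξ, ∫⁻ η, ‖A (ξ - η) * FT f η * ψ ξ‖ₑ < ⊤ := by
    have h1 : ∫⁻ ξ, ∫⁻ η, ‖A (ξ - η) * FT f η * ψ ξ‖ₑ =
      ∫⁻ ξ, (∫⁻ η, ‖A (ξ - η)‖ₑ * ‖FT f η‖ₑ) * ‖ψ ξ‖ₑ := by
      congr 1; ext ξ; rw [← lintegral_mul_const _ (by fun_prop)]
      simp_rw [enorm_mul]
    have hm : Measurable fun ξ => (∫⁻ η, ‖A (ξ - η)‖ₑ * ‖FT f η‖ₑ) :=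
      Measurable.lintegral_prod_right' (f := fun p => ‖A (p.1 - p.2)‖ₑ * ‖FT f p.2‖ₑ) (by fun_prop)
    have h2 : (∫⁻ ξ, ∫⁻ η, ‖A (ξ - η) * FT f η * ψ ξ‖ₑ) ^ 2 < ⊤ := by
      rw [h1]; refine lt_of_le_of_lt (lintegral_mul_sq_le _ hm.aemeasurable (by fun_prop)) ?_
      refine mul_lt_top (hA.lintegral_conv_lt_top _) ?_
      exact (memLp_two_iff ψ.continuous.aestronglyMeasurable).mp (ψ.memLp 2 volume)
    by_contra hcon
    rw [not_lt, top_le_iff] at hcon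
    rw [hcon] at h2
    simp at h2
  have hint : Integrable (fun p => A (p.1 - p.2) * FT f p.2 * ψ p.1) (volume.prod volume) := by
    refine ⟨by fun_prop, ?_⟩; rw [HasFiniteIntegral, lintegral_prod _ (by fun_prop)]; exact hfin
  have hint' : Integrable (fun p => A p.1 * (FT f p.2 * ψ (p.2 + p.1))) (volume.prod volume) := by
    refine ⟨by fun_prop, ?_⟩; rw [HasFiniteIntegral, lintegral_prod_symm _ (by fun_prop)]
    rw [lintegral_lintegral_swap (by fun_prop)] at hfin
    convert hfin using 1
    congr 1; ext η; rw [← lintegral_sub_right_eq_self _ η]; congr 1; ext ξ; simp [mul_assoc]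
  have hint2 : Integrable (fun p => A p.1 *
    (exp ((2 * π * inner ℝ p.1 p.2 : ℝ) * I) * (f p.2 * 𝓕 ψ p.2)))
    (volume.prod volume) := by
    have hp := hA.integrable.mul_prod ((Lp.memLp f).integrable_mul ((𝓕 ψ).memLp 2 volume))
    refine hp.mono ?_ (.of_forall fun p => ?_)
    · refine (hA.meas.comp measurable_fst).aestronglyMeasurable.mul (AEStronglyMeasurable.mul ?_ ?_)
      · exact Continuous.aestronglyMeasurable (by fun_prop)
      · exact (((Lp.stronglyMeasurable f).comp_measurable measurable_snd).mul
          ((𝓕 ψ).continuous.stronglyMeasurable.comp_measurable measurable_snd)).aestronglyMeasurable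
    · rw [norm_mul, norm_mul, norm_mul, norm_exp_ofReal_mul_I, one_mul, norm_mul,
        Pi.mul_apply, norm_mul]
  calc ∫ ξ, FT (mulOp volume a f) ξ * ψ ξ = ∫ X, a X * f X * 𝓕 ψ X := by
        rw [integral_FT_mul]; apply integral_congr_ae
        filter_upwards [mulOp_coe hbd f] with X hX
        rw [hX]
    _ = ∫ X, ∫ k, A k * (exp ((2 * π * inner ℝ k X : ℝ) * I) * (f X * 𝓕 ψ X)) := by
      congr 1; ext X; rw [ha, fourierInv_eq', mul_assoc, ← integral_mul_const]; congr 1; ext k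
      simp only [smul_eq_mul]; ring
    _ = ∫ k, ∫ X, A k * (exp ((2 * π * inner ℝ k X : ℝ) * I)
      * (f X * 𝓕 ψ X)) := (integral_integral_swap hint2).symm
    _ = ∫ k, ∫ η, A k * (FT f η * ψ (η + k)) := by
      congr 1; ext k; rw [integral_const_mul, integral_const_mul]; congr 1
      have := integral_FT_mul f (ψ.compSubConstCLM ℂ (-k))
      simp only [SchwartzMap.compSubConstCLM_apply, sub_neg_eq_add] at this
      rw [this]; congr 1; ext X; rw [fourier_compSubConst]; ring
    _ = ∫ η, ∫ k, A k * (FT f η * ψ (η + k)) := integral_integral_swap hint'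
    _ = ∫ η, ∫ ξ, A (ξ - η) * FT f η * ψ ξ := by
      congr 1; ext η; rw [← integral_sub_right_eq_self _ η]; congr 1; ext ξ; simp [mul_assoc]
    _ = ∫ ξ, ∫ η, A (ξ - η) * FT f η * ψ ξ := (integral_integral_swap hint).symm
    _ = _ := by congr 1; ext ξ; rw [integral_mul_const]

/-! ### Fourier multipliers -/

/-- The Fourier multiplier `m(D)` on `L²(ℝ^d)`. -/
def fm (m : Hor d → ℝ) : L2H d →L[ℂ] L2H d :=
  FTi ∘L mulOp volume (fun ξ => (m ξ : ℂ)) ∘L FT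

/-- Measurable bounded symbols. -/
def IsSymb (m : Hor d → ℝ) : Prop := Measurable m ∧ ∃ C : ℝ, ∀ ξ, |m ξ| ≤ C

theorem IsSymb.isBdd (hm : IsSymb m) : IsBdd volume (fun ξ => (m ξ : ℂ)) := by
  obtain ⟨h1, C, hC⟩ := hm
  refine ⟨by fun_prop, C, .of_forall fun ξ => ?_⟩; simpa using hC ξ

theorem FT_fm (hm : IsSymb m) (f : L2H d) :
  FT (fm m f) =ᵐ[volume] fun ξ => (m ξ : ℂ) * FT f ξ := by
  have : FT (fm m f) = mulOp volume (fun ξ => (m ξ)) (FT f) := by simp [fm]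
  rw [this]; exact mulOp_coe hm.isBdd _

theorem inner_fm_left (hm : IsSymb m) (f g : L2H d) :
  inner ℂ (fm m f) g = inner ℂ f (fm m g) := by
  simp only [fm, comp_apply]
  rw [inner_FTi_left, inner_mulOp_left hm.isBdd (fun _ => conj_ofReal _), inner_FT_left]

theorem fm_fm {n : Hor d → ℝ} (hm : IsSymb m) (hn : IsSymb n) (f : L2H d) :
  fm m (fm n f) = fm (fun ξ => m ξ * n ξ) f := by
  simp only [fm, comp_apply, FT_FTi]; rw [mulOp_mulOp hm.isBdd hn.isBdd]; congr 2; push_cast; rfl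

theorem enorm_sq_fm (hm : IsSymb m) (f : L2H d) :
  ‖fm m f‖ₑ ^ 2 = ∫⁻ ξ, (‖m ξ‖ₑ * ‖FT f ξ‖ₑ) ^ 2 := by
  rw [← enorm_FT, enorm_sq_eq_lintegral]; apply lintegral_congr_ae
  filter_upwards [FT_fm hm f] with ξ hξ
  rw [hξ, enorm_mul]; congr 2; rw [← ofReal_norm, ← ofReal_norm, norm_real]

/-- The commutator of a Fourier multiplier and a multiplication. -/
def comm (m : Hor d → ℝ) (a : Hor d → ℂ) (f : L2H d) : L2H d :=
  fm m (mulOp volume a f) - mulOp volume a (fm m f)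

theorem enorm_sq_comm_le {a : Hor d → ℂ}
  (hm : IsSymb m) (hA : IsAmp t A h) (ha : ∀ X, a X = 𝓕⁻ A X) (f : L2H d) :
  ‖comm m a f‖ₑ ^ 2 ≤ ∫⁻ ξ, (∫⁻ η, ‖m ξ - m η‖ₑ * (‖A (ξ - η)‖ₑ * ‖FT f η‖ₑ)) ^ 2 := by
  rw [← enorm_FT, enorm_sq_eq_lintegral, comm, map_sub]; apply lintegral_mono_ae
  filter_upwards [Lp.coeFn_sub (FT (fm m (mulOp volume a f))) (FT (mulOp volume a (fm m f))),
    FT_fm hm (mulOp volume a f), FT_mulOp hA ha f, FT_mulOp hA ha (fm m f),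
    hA.ae_integrable_conv (FT f), hA.ae_integrable_conv (FT (fm m f))] with ξ h1 h2 h3 h4 h5 h6
  rw [h1, Pi.sub_apply, h2, h3, h4]
  have e : ∫ η, A (ξ - η) * FT (fm m f) η = ∫ η, A (ξ - η) * ((m η) * FT f η) := by
    apply integral_congr_ae
    filter_upwards [FT_fm hm f] with η hη
    rw [hη]
  have h6' : Integrable fun η => A (ξ - η) * ((m η) * FT f η) := by
    refine h6.congr ?_
    filter_upwards [FT_fm hm f] with η hη
    rw [hη]
  rw [e, ← integral_const_mul, ← integral_sub (h5.const_mul _) h6']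
  refine pow_le_pow_left' ((enorm_integral_le_lintegral_enorm _).trans (lintegral_mono fun η => ?_)) 2
  have : (m ξ) * (A (ξ - η) * FT f η) - A (ξ - η) * ((m η) * FT f η) =
    ((m ξ - m η : ℝ)) * (A (ξ - η) * FT f η) := by push_cast; ring
  rw [this, enorm_mul, enorm_mul]; gcongr; rw [← ofReal_norm, ← ofReal_norm, norm_real]

theorem wnf_mulOp_le {a : Hor d → ℂ} (r : ℝ)
  (hA : IsAmp t A h) (ha : ∀ X, a X = 𝓕⁻ A X) (f : L2H d) :
  wnf r (FT (mulOp volume a f)) ≤ ∫⁻ ξ, (∫⁻ η, el r ξ * (‖A (ξ - η)‖ₑ * ‖FT f η‖ₑ)) ^ 2 := by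
  unfold wnf; apply lintegral_mono_ae
  have hFm := measurable_Lp (FT f)
  have hAm := hA.meas
  filter_upwards [FT_mulOp hA ha f] with ξ h1
  rw [h1, lintegral_const_mul _ (by fun_prop)]; gcongr
  refine (enorm_integral_le_lintegral_enorm _).trans (le_of_eq ?_)
  simp_rw [enorm_mul]

theorem wnf_add_le (r : ℝ) (f g : L2H d) :
  wnf r (FT (f + g)) ≤ 2 * (wnf r (FT f) + wnf r (FT g)) := by
  have hFm := measurable_Lp (FT f)
  unfold wnf; rw [← lintegral_add_left (by fun_prop), ← lintegral_cmul]
  apply lintegral_mono_ae; rw [map_add]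
  filter_upwards [Lp.coeFn_add (FT f) (FT g)] with ξ h1
  rw [h1]; refine le_trans ?_ (add_sq_le_two _ _); rw [← mul_add]; gcongr; exact enorm_add_le _ _

theorem wnf_neg (r : ℝ) (f : L2H d) : wnf r (FT (-f)) = wnf r (FT f) := by
  unfold wnf; apply lintegral_congr_ae; rw [map_neg]
  filter_upwards [Lp.coeFn_neg (FT f)] with ξ h1
  rw [h1]; simp

theorem wnf_sub_le (r : ℝ) (f g : L2H d) :
  wnf r (FT (f - g)) ≤ 2 * (wnf r (FT f) + wnf r (FT g)) := by
  rw [sub_eq_add_neg, ← wnf_neg r g]; exact wnf_add_le r f (-g)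

theorem wnf_zero (f : L2H d) : wnf 0 (FT f) = ‖f‖ₑ ^ 2 := by
  rw [← enorm_FT, enorm_sq_eq_lintegral]; simp [wnf]

/-- The truncation `min (lam s) n` of the symbol `lam s`. -/
def trunc (s : ℝ) (n : ℕ) (ξ : Hor d) : ℝ := min (lam s ξ) n

theorem trunc_nonneg (s : ℝ) (n : ℕ) (ξ : Hor d) : 0 ≤ trunc s n ξ :=
  le_min (lam_pos s ξ).le (Nat.cast_nonneg n)

theorem isSymb_trunc (s : ℝ) (n : ℕ) : IsSymb (trunc (d := d) s n) := by
  refine ⟨(measurable_lam s).min measurable_const, n, fun ξ => ?_⟩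
  rw [abs_of_nonneg (trunc_nonneg s n ξ)]; exact min_le_right _ _

theorem trunc_le (s : ℝ) (n : ℕ) (ξ : Hor d) : trunc s n ξ ≤ lam s ξ := min_le_left _ _

theorem enorm_trunc_le (s : ℝ) (n : ℕ) (ξ : Hor d) : ‖trunc s n ξ‖ₑ ≤ el s ξ := by
  rw [← ofReal_norm, norm_of_nonneg (trunc_nonneg s n ξ)]; exact ofReal_le_ofReal (trunc_le s n ξ)

theorem enorm_trunc_sub_le (s : ℝ) (n : ℕ) (ξ η : Hor d) :
  ‖trunc s n ξ - trunc s n η‖ₑ ≤ ‖lam s ξ - lam s η‖ₑ := by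
  rw [← ofReal_norm, ← ofReal_norm]; apply ofReal_le_ofReal; rw [norm_eq_abs, norm_eq_abs]
  have := abs_min_sub_min_le_max (lam s ξ) n (lam s η) n
  simpa [trunc] using this

theorem enorm_sq_fm_trunc_le (s : ℝ) (n : ℕ) (f : L2H d) :
  ‖fm (trunc s n) f‖ₑ ^ 2 ≤ wnf s (FT f) := by
  rw [enorm_sq_fm (isSymb_trunc s n)]
  exact lintegral_mono fun ξ => by gcongr; exact enorm_trunc_le s n ξ

theorem wnf_eq_iSup (s : ℝ) (f : L2H d) :
  wnf s (FT f) = ⨆ n : ℕ, ‖fm (trunc s n) f‖ₑ ^ 2 := by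
  have hFm := measurable_Lp (FT f)
  have hen : ∀ n (ξ : Hor d), ‖trunc s n ξ‖ₑ = min (el s ξ) n := by
    intro n ξ
    rw [← ofReal_norm, norm_of_nonneg (trunc_nonneg s n ξ), trunc, ENNReal.ofReal_min, el]; simp
  simp_rw [enorm_sq_fm (isSymb_trunc s _), hen]; rw [← lintegral_iSup (by fun_prop)]
  · unfold wnf; congr 1; ext ξ; apply le_antisymm
    · obtain ⟨n, hn⟩ := ENNReal.exists_nat_gt (el_ne_top s ξ)
      refine le_iSup_of_le n ?_; rw [min_eq_left hn.le]
    · refine iSup_le fun n => ?_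
      gcongr; exact min_le_left _ _
  · intro n m hnm ξ
    dsimp only
    gcongr

/-! ### The system `(g, v) ↦ (g + q v, v - q · g)` -/

section Hilbert

variable {V : Type*} [NormedAddCommGroup V] [InnerProductSpace ℂ V]

/-- The map `(g, v) ↦ (g + q v, v - q · g)`. -/
def skewOp (M : Fin d → V →L[ℂ] V) (G : Idx d → V) : Idx d → V :=
  elim (fun i => G (inl i) + M i (G (inr ()))) (fun _ => G (inr ()) - ∑ i, M i (G (inl i)))

theorem re_inner_skewOp {M : Fin d → V →L[ℂ] V}
  (hM : ∀ i x y, inner ℂ (M i x) y = inner ℂ x (M i y)) (G : Idx d → V) :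
  (∑ j, inner ℂ (G j) (skewOp M G j)).re = ∑ j, ‖G j‖ ^ 2 := by
  have hself : ∀ x : V, (inner ℂ x x).re = ‖x‖ ^ 2 := fun x => (norm_sq_eq_re_inner (𝕜 := ℂ) x).symm
  have hskew : ∀ i, (inner ℂ (G (inl i)) (M i (G (inr ())))).re =
    (inner ℂ (G (inr ())) (M i (G (inl i)))).re := by
    intro i; rw [← hM, ← inner_conj_symm]; rfl
  simp only [Fintype.sum_sum_type, skewOp, elim_inl, elim_inr, univ_unique,
    sum_singleton, inner_add_right, inner_sub_right, inner_sum, Complex.add_re,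
    sub_re, re_sum, hself, hskew, sum_add_distrib]
  rw [show default = () from rfl]; ring

theorem sum_norm_sq_le_of_skewOp {M : Fin d → V →L[ℂ] V}
  (hM : ∀ i x y, inner ℂ (M i x) y = inner ℂ x (M i y)) {G W c : Idx d → V}
  (hW : ∀ j, W j = skewOp M G j + c j) :
  ∑ j, ‖G j‖ₑ ^ 2 ≤ 2 * ∑ j, (‖W j‖ₑ ^ 2 + ‖c j‖ₑ ^ 2) := by
  have key : ∑ j, ‖G j‖ ^ 2 ≤ 2 * ∑ j, (‖W j‖ ^ 2 + ‖c j‖ ^ 2) := by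
    have h1 := re_inner_skewOp hM G
    have h2 : (∑ j, inner ℂ (G j) (skewOp M G j)).re ≤
      ∑ j, (‖G j‖ ^ 2 / 2 + (‖W j‖ ^ 2 + ‖c j‖ ^ 2)) := by
      rw [re_sum]; refine sum_le_sum fun j _ => ?_
      have e : skewOp M G j = W j - c j := by rw [hW]; abel
      rw [e]
      have h3 : (inner ℂ (G j) (W j - c j)).re ≤ ‖G j‖ * (‖W j‖ + ‖c j‖) :=
        ((re_le_norm _).trans (norm_inner_le_norm _ _)).trans
          (mul_le_mul_of_nonneg_left (norm_sub_le _ _) (norm_nonneg _))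
      nlinarith [sq_nonneg (‖G j‖ - (‖W j‖ + ‖c j‖)), sq_nonneg (‖W j‖ - ‖c j‖)]
    rw [h1, sum_add_distrib, ← sum_div] at h2
    linarith
  have conv : ∀ x : V, ‖x‖ₑ ^ 2 = ofReal (‖x‖ ^ 2) := fun x => by
    rw [← ofReal_norm, ofReal_pow (norm_nonneg _)]
  simp_rw [conv]; rw [← ofReal_sum_of_nonneg (fun _ _ => by positivity)]
  simp_rw [← ofReal_add (sq_nonneg _) (sq_nonneg _)]
  rw [← ofReal_sum_of_nonneg (fun _ _ => by positivity)]
  have : 2 = ofReal 2 := by simp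
  rw [this, ← ofReal_mul (by norm_num)]; exact ofReal_le_ofReal key

theorem sum_inner_skewOp {M : Fin d → V →L[ℂ] V}
  (hM : ∀ i x y, inner ℂ (M i x) y = inner ℂ x (M i y)) (G χ : Idx d → V) :
  ∑ j, inner ℂ (G j) (skewOp (fun i => -M i) χ j) = ∑ j, inner ℂ (skewOp M G j) (χ j) := by
  simp only [Fintype.sum_sum_type, skewOp, elim_inl, elim_inr, univ_unique,
    sum_singleton, inner_add_right, inner_sub_right, inner_sum, inner_add_left,
    inner_sub_left, sum_inner, neg_apply, inner_neg_right, hM,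
    sum_neg_distrib, sum_add_distrib]
  rw [show default = () from rfl]; ring

end Hilbert

/-- Real coefficients of the horizontal variable with amplitudes in a ball of radius `√K`. -/
structure IsCoefH (t K : ℝ) (q : Fin d → Hor d → ℝ) (Q : Fin d → Hor d → ℂ)
  (h : Hor d → ℝ≥0∞) : Prop where
  amp : ∀ i, IsAmp t (Q i) h
  eq : ∀ i X, (q i X : ℂ) = 𝓕⁻ (Q i) X
  le : ∫⁻ k, h k ^ 2 ≤ ofReal K

/-- The multiplication operators by real coefficients. -/
def mulR {α : Type*} [MeasurableSpace α] (μ : Measure α) (q : Fin d → α → ℝ) (i : Fin d) :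
  Lp ℂ 2 μ →L[ℂ] Lp ℂ 2 μ := mulOp μ fun X => (q i X : ℂ)

section
variable {t K : ℝ} {q : Fin d → Hor d → ℝ} {Q : Fin d → Hor d → ℂ} {h : Hor d → ℝ≥0∞}

theorem IsCoefH.isBdd (hq : IsCoefH t K q Q h) (i : Fin d) : IsBdd volume fun X => (q i X : ℂ) :=
  isBdd_of_fourierInv (hq.amp i).integrable (hq.eq i)

theorem IsCoefH.inner_left (hq : IsCoefH t K q Q h) (i : Fin d) (x y : L2H d) :
  inner ℂ (mulR volume q i x) y = inner ℂ x (mulR volume q i y) :=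
  inner_mulOp_left (hq.isBdd i) (fun _ => conj_ofReal _) x y

theorem IsCoefH.neg (hq : IsCoefH t K q Q h) :
  IsCoefH t K (fun i X => -q i X) (fun i k => -Q i k) h where
  amp i := ⟨(hq.amp i).ht, (hq.amp i).meas.neg, (hq.amp i).meas_h,
    fun k => by rw [enorm_neg]; exact (hq.amp i).le k, (hq.amp i).fin⟩
  eq i X := by push_cast; rw [hq.eq, fourierInv_eq, fourierInv_eq, ← integral_neg]; simp
  le := hq.le

theorem mulR_neg (hq : IsCoefH t K q Q h) (i : Fin d) :
  mulR volume (fun i X => -q i X) i = -mulR volume q i := by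
  ext1 f
  apply Lp.ext
  have e := hq.neg.isBdd i
  filter_upwards [mulOp_coe (hq.isBdd i) f, mulOp_coe e f, Lp.coeFn_neg (mulR volume q i f)]
    with X h1 h2 h3
  rw [neg_apply, h3, Pi.neg_apply, mulR, mulR, h1, h2]; push_cast; ring

theorem mulR_coe (hq : IsCoefH t K q Q h) (i : Fin d) (f : L2H d) :
  mulR volume q i f =ᵐ[volume] fun X => (q i X : ℂ) * f X := mulOp_coe (hq.isBdd i) f

end

/-- The sum of the weighted norms of the components. -/
def wsumH (r : ℝ) (G : Idx d → L2H d) : ℝ≥0∞ := ∑ j, wnf r (FT (G j))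

theorem wsumH_mono {r' : ℝ} (h : r ≤ r') (G : Idx d → L2H d) : wsumH r G ≤ wsumH r' G :=
  sum_le_sum fun _ _ => wnf_mono h _

theorem wnf_le_wsumH (r : ℝ) (G : Idx d → L2H d) (j : Idx d) : wnf r (FT (G j)) ≤ wsumH r G :=
  single_le_sum (f := fun j => wnf r (FT (G j))) (fun _ _ => zero_le) (mem_univ j)

theorem sum_enorm_sq_le {V ι : Type*} [NormedAddCommGroup V] (s : Finset ι) (f : ι → V) :
  ‖∑ i ∈ s, f i‖ₑ ^ 2 ≤ s.card * ∑ i ∈ s, ‖f i‖ₑ ^ 2 := by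
  have conv : ∀ x : V, ‖x‖ₑ ^ 2 = ofReal (‖x‖ ^ 2) := fun x => by
    rw [← ofReal_norm, ofReal_pow (norm_nonneg _)]
  simp_rw [conv]
  rw [← ofReal_sum_of_nonneg (fun _ _ => by positivity), ← ofReal_natCast,
    ← ofReal_mul (by positivity)]
  apply ofReal_le_ofReal
  calc ‖∑ i ∈ s, f i‖ ^ 2 ≤ (∑ i ∈ s, ‖f i‖) ^ 2 := by gcongr; exact norm_sum_le _ _
    _ ≤ _ := sq_sum_le_card_mul_sum_sq

/-- The elliptic estimate for the system, `0 ≤ r ≤ t`: one step of regularity. -/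
theorem exists_skewOp_step (he : 0 ≤ e) (her : e ≤ r) (he1 : e ≤ 1)
  (ht : (d : ℝ) / 2 < t - e) (hrt : r ≤ t) (hK : 0 ≤ K) :
  ∃ C : ℝ, 0 ≤ C ∧ ∀ q Q h, IsCoefH t K q Q h → ∀ G : Idx d → L2H d,
    wsumH r G ≤ ofReal C * (wsumH r (skewOp (mulR volume q) G) + wsumH (r - e) G) := by
  obtain ⟨C, hC0, hC⟩ := exists_comm_le he her he1 ht hrt
  refine ⟨(d + 1) * (2 + 2 * (d + d * d) * (C * K)), by positivity, fun q Q h hq G => ?_⟩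
  set B : ℝ≥0∞ := ofReal (2 + 2 * (d + d * d) * (C * K)) *
    (wsumH r (skewOp (mulR volume q) G) + wsumH (r - e) G) with hB
  have hcomm : ∀ n i j, ‖comm (trunc r n) (fun X => (q i X)) (G j)‖ₑ ^ 2 ≤
    ofReal (C * K) * wsumH (r - e) G := by
    intro n i j; refine (enorm_sq_comm_le (isSymb_trunc r n) (hq.amp i) (hq.eq i) (G j)).trans ?_
    refine (hC (trunc r n) (Q i) (FT (G j)) h (enorm_trunc_sub_le r n)
      (measurable_Lp _) (hq.amp i).meas_h (hq.amp i).le).trans ?_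
    rw [ofReal_mul hC0, mul_assoc]; gcongr
    · exact hq.le
    · exact wnf_le_wsumH _ _ _
  have step : ∀ n, ∑ j, ‖fm (trunc r n) (G j)‖ₑ ^ 2 ≤ B := by
    intro n
    set L := fm (trunc r n)
    let c : Idx d → L2H d := elim (fun i => comm (trunc r n) (fun X => (q i X)) (G (inr ())))
      (fun _ => -∑ i, comm (trunc r n) (fun X => (q i X)) (G (inl i)))
    have h1 := sum_norm_sq_le_of_skewOp (fun i x y => hq.inner_left i x y)
      (G := fun j => L (G j)) (W := fun j => L (skewOp (mulR volume q) G j)) (c := c) (by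
        rintro (i | u)
        · simp only [skewOp, elim_inl, c, comm, mulR, map_add]; abel
        · simp only [skewOp, elim_inr, c, comm, mulR, map_sub, map_sum, sum_sub_distrib]; abel)
    refine h1.trans ?_
    have h2 : ∑ j, ‖c j‖ₑ ^ 2 ≤ ofReal ((d + d * d) * (C * K)) * wsumH (r - e) G := by
      rw [Fintype.sum_sum_type]
      simp only [c, elim_inl, elim_inr, univ_unique, sum_singleton, enorm_neg]
      calc _ ≤ (∑ i, ofReal (C * K) * wsumH (r - e) G)
            + d * ∑ i, ofReal (C * K) * wsumH (r - e) G := by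
            gcongr
            · exact hcomm _ _ _
            · refine (sum_enorm_sq_le _ _).trans ?_; simp only [card_univ, Fintype.card_fin]; gcongr
              exact hcomm _ _ _
        _ = _ := by
          simp only [sum_const, card_univ, Fintype.card_fin, nsmul_eq_mul]
          rw [ofReal_mul (p := d + d * d) (by positivity),
            ofReal_add (by positivity) (by positivity),
            ofReal_mul (p := d) (by positivity), ofReal_natCast]
          ring
    have h3 : ∑ j, ‖L (skewOp (mulR volume q) G j)‖ₑ ^ 2 ≤ wsumH r (skewOp (mulR volume q) G) :=
      sum_le_sum fun j _ => enorm_sq_fm_trunc_le r n _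
    rw [sum_add_distrib]
    calc _ ≤ 2 * (wsumH r (skewOp (mulR volume q) G) +
          ofReal ((d + d * d) * (C * K)) * wsumH (r - e) G) := by gcongr
      _ ≤ B := by
        have hn : 0 ≤ 2 * (d + d * d) * (C * K) := by positivity
        have e2 : 2 ≤ ofReal (2 + 2 * (d + d * d) * (C * K)) := by
          rw [← ofReal_ofNat]; exact ofReal_le_ofReal (by linarith)
        have e3 : 2 * ofReal ((d + d * d) * (C * K)) ≤
          ofReal (2 + 2 * (d + d * d) * (C * K)) := by
          rw [← ofReal_ofNat, ← ofReal_mul (by norm_num)]; exact ofReal_le_ofReal (by linarith)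
        rw [hB, mul_add, mul_add, ← mul_assoc]
        exact add_le_add (mul_le_mul_left e2 _) (mul_le_mul_left e3 _)
  have each : ∀ j, wnf r (FT (G j)) ≤ B := by
    intro j; rw [wnf_eq_iSup]; refine iSup_le fun n => le_trans ?_ (step n)
    exact single_le_sum (f := fun j => ‖fm (trunc r n) (G j)‖ₑ ^ 2) (fun _ _ => zero_le)
      (mem_univ j)
  calc wsumH r G ≤ ∑ j, B := sum_le_sum fun j _ => each j
    _ = _ := by
      simp only [sum_const, card_univ, Fintype.card_sum, Fintype.card_fin,
        Fintype.card_unit, nsmul_eq_mul]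
      rw [hB, ofReal_mul (by positivity),
        ofReal_add (p := d) (by positivity) (by norm_num), ofReal_natCast,
        ofReal_one, mul_assoc]
      push_cast; exact (mul_assoc _ _ _).symm

theorem wsumH_zero_le {q : Fin d → Hor d → ℝ} (hq : IsCoefH t K q Q h) (G : Idx d → L2H d) :
  wsumH 0 G ≤ 2 * wsumH 0 (skewOp (mulR volume q) G) := by
  have h1 := sum_norm_sq_le_of_skewOp (fun i x y => hq.inner_left i x y)
    (G := G) (W := skewOp (mulR volume q) G) (c := 0) (by simp)
  simpa [wsumH, wnf_zero] using h1

/-- The elliptic estimate for the system, `0 ≤ r ≤ t`. -/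
theorem exists_skewOp_le (ht : (d : ℝ) / 2 < t) (hr : 0 ≤ r) (hrt : r ≤ t)
  (hK : 0 ≤ K) :
  ∃ C : ℝ, 0 ≤ C ∧ ∀ q Q h, IsCoefH t K q Q h → ∀ G : Idx d → L2H d,
    wsumH r G ≤ ofReal C * wsumH r (skewOp (mulR volume q) G) := by
  obtain ⟨e, he0, he1, het⟩ : ∃ e, 0 < e ∧ e ≤ 1 ∧ d / 2 < t - e :=
    ⟨min 1 ((t - d / 2) / 2), by apply lt_min <;> linarith, min_le_left _ _, by
      have := min_le_right 1 ((t - d / 2) / 2); linarith⟩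
  have base : ∃ C, 0 ≤ C ∧ ∀ q Q h, IsCoefH t K q Q h → ∀ G : Idx d → L2H d,
    wsumH 0 G ≤ ofReal C * wsumH 0 (skewOp (mulR volume q) G) :=
    ⟨2, by norm_num, fun q Q h hq G => by simpa using wsumH_zero_le hq G⟩
  have ind : ∀ j : ℕ, ∀ r, 0 ≤ r → r ≤ t → r ≤ j * e → ∃ C, 0 ≤ C ∧ ∀ q Q h,
    IsCoefH t K q Q h → ∀ G : Idx d → L2H d,
    wsumH r G ≤ ofReal C * wsumH r (skewOp (mulR volume q) G) := by
    intro j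
    induction j with
    | zero =>
      intro r h0 _ h1
      have : r = 0 := le_antisymm (by simpa using h1) h0
      subst this; exact base
    | succ j ih =>
      intro r h0 h1 h2
      have hmin : min e r ≤ e := min_le_left _ _
      have hmin' : min e r ≤ r := min_le_right _ _
      obtain ⟨C1, hC1, h3⟩ := exists_skewOp_step (d := d) (le_min he0.le h0)
        hmin' (by linarith) (by linarith) h1 hK
      obtain ⟨C2, hC2, h4⟩ := ih (r - min e r) (by linarith) (by linarith [le_min he0.le h0]) (by
        push_cast at h2
        rcases le_total e r with h | h
        · rw [min_eq_left h]; linarith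
        · rw [min_eq_right h, sub_self]; positivity)
      refine ⟨C1 * (1 + C2), by positivity, fun q Q h hq G => ?_⟩
      calc wsumH r G ≤ ofReal C1 * (wsumH r (skewOp (mulR volume q) G) +
            wsumH (r - min e r) G) := h3 q Q h hq G
        _ ≤ ofReal C1 * (wsumH r (skewOp (mulR volume q) G) +
          ofReal C2 * wsumH r (skewOp (mulR volume q) G)) := by
          gcongr; refine (h4 q Q h hq G).trans ?_; gcongr
          exact wsumH_mono (by linarith [le_min he0.le h0]) _
        _ = _ := by rw [ofReal_mul hC1, ofReal_add zero_le_one hC2, ofReal_one]; ring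
  obtain ⟨j, hj⟩ := exists_nat_ge (r / e)
  exact ind j r hr hrt (by rwa [div_le_iff₀ he0] at hj)

theorem wnf_neg_fm_lam (hr : r ≤ 0) (f : L2H d) :
  wnf (-r) (FT (fm (fun ξ => lam (2 * r) ξ) f)) = wnf r (FT f) := by
  have hs : IsSymb (fun ξ : Hor d => lam (2 * r) ξ) :=
    ⟨measurable_lam _, 1, fun ξ => by
      rw [abs_of_nonneg (lam_pos _ _).le]; exact lam_le_one (by linarith) ξ⟩
  unfold wnf; apply lintegral_congr_ae
  filter_upwards [FT_fm hs f] with ξ hξ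
  rw [hξ, enorm_mul, enorm_lam, ← mul_assoc, ← el_add]; congr 3; ring

theorem enorm_inner_le_wnf (r : ℝ) (f g : L2H d) :
  ‖inner ℂ f g‖ₑ ^ 2 ≤ wnf r (FT f) * wnf (-r) (FT g) := by
  have hf := measurable_Lp (FT f)
  have hg := measurable_Lp (FT g)
  rw [← inner_FT, L2.inner_def]
  refine le_trans (pow_le_pow_left' ((enorm_integral_le_lintegral_enorm _).trans (lintegral_mono
      fun ξ => ?_)) 2) (lintegral_mul_sq_le _ (by fun_prop) (by fun_prop))
  calc ‖inner ℂ (FT f ξ) (FT g ξ)‖ₑ ≤ ‖FT f ξ‖ₑ * ‖FT g ξ‖ₑ := by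
        rw [RCLike.inner_apply, enorm_mul, RCLike.enorm_conj, mul_comm]
    _ = (el r ξ * el (-r) ξ) * (‖FT f ξ‖ₑ * ‖FT g ξ‖ₑ) := by rw [el_mul_el_neg, one_mul]
    _ = _ := by ring

theorem sum_mul_sq_le {ι : Type*} (s : Finset ι) (f g : ι → ℝ≥0∞) :
  (∑ i ∈ s, f i * g i) ^ 2 ≤ (∑ i ∈ s, f i ^ 2) * ∑ i ∈ s, g i ^ 2 := by
  have h := ENNReal.inner_le_Lp_mul_Lq s f g Real.HolderConjugate.two_two
  simp only [rpow_two] at h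
  refine (pow_le_pow_left' h 2).trans (le_of_eq ?_)
  rw [mul_pow, ← rpow_two, ← rpow_two, ← rpow_mul, ← rpow_mul]; norm_num

theorem exists_skewOp_eq {q : Fin d → Hor d → ℝ} (hq : IsCoefH t K q Q h) (x : Idx d → L2H d) :
  ∃ χ : Idx d → L2H d, skewOp (mulR volume q) χ = x := by
  set c : Hor d → ℂ := fun X => ((1 + ∑ i, q i X ^ 2 : ℝ) : ℂ)⁻¹ with hc
  have hqm := fun i => by
    have := Complex.continuous_re.comp_aestronglyMeasurable (hq.isBdd i).1
    simpa using this
  have hcb : IsBdd volume c := by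
    refine ⟨?_, 1, .of_forall fun X => ?_⟩
    · have h1 : AEMeasurable (fun X => 1 + ∑ i, q i X ^ 2) volume :=
        aemeasurable_const.add (aemeasurable_fun_sum _ fun i _ => (hqm i).aemeasurable.pow_const 2)
      exact ((measurable_ofReal.comp_aemeasurable h1).inv).aestronglyMeasurable
    · have : 0 ≤ ∑ i, q i X ^ 2 := sum_nonneg fun i _ => sq_nonneg _
      rw [hc, norm_inv, norm_real, norm_of_nonneg (by linarith)]
      exact inv_le_one_of_one_le₀ (by linarith)
  set χz : L2H d := mulOp volume c (x (inr ()) + ∑ i, mulR volume q i (x (inl i))) with hχz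
  refine ⟨elim (fun i => x (inl i) - mulR volume q i χz) (fun _ => χz), ?_⟩
  funext j
  rcases j with i | u
  · simp [skewOp]
  · simp only [skewOp, elim_inl, elim_inr, map_sub, sum_sub_distrib]
    have e : χz + ∑ i, mulR volume q i (mulR volume q i χz) =
      x (inr ()) + ∑ i, mulR volume q i (x (inl i)) := by
      apply Lp.ext
      have hsum := Lp.coeFn_fun_finsetSum Finset.univ fun i => mulR volume q i (mulR volume q i χz)
      have hall : ∀ᵐ X, ∀ i, mulR volume q i (mulR volume q i χz) X = (q i X) ^ 2 * χz X := by
        rw [ae_all_iff]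
        intro i
        filter_upwards [mulR_coe hq i (mulR volume q i χz), mulR_coe hq i χz] with X h1 h2
        rw [h1, h2]; ring
      filter_upwards [Lp.coeFn_add χz (∑ i, mulR volume q i (mulR volume q i χz)), hsum, hall,
        mulOp_coe hcb (x (inr ()) + ∑ i, mulR volume q i (x (inl i)))] with X h1 h2 h3 h4
      rw [h1, Pi.add_apply, h2]
      simp_rw [h3]; rw [← sum_mul, ← hχz] at *
      rw [h4, hc]
      have hne : ((1 + ∑ i, q i X ^ 2 : ℝ) : ℂ) ≠ 0 := by
        have : 0 ≤ ∑ i, q i X ^ 2 := sum_nonneg fun i _ => sq_nonneg _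
        exact_mod_cast (by linarith : (1 + ∑ i, q i X ^ 2 : ℝ) ≠ 0)
      push_cast at hne ⊢
      field_simp
    calc _ = (χz + ∑ i, mulR volume q i (mulR volume q i χz)) -
          ∑ i, mulR volume q i (x (inl i)) := by abel
      _ = x (inr u) := by rw [e]; simp

/-- The elliptic estimate for the system, `|r| ≤ t`. -/
theorem exists_skewOp_le_of_abs_le (ht : (d : ℝ) / 2 < t) (hrt : |r| ≤ t)
  (hK : 0 ≤ K) :
  ∃ C : ℝ, 0 ≤ C ∧ ∀ q Q h, IsCoefH t K q Q h → ∀ G : Idx d → L2H d,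
    wsumH r G ≤ ofReal C * wsumH r (skewOp (mulR volume q) G) := by
  rcases le_total 0 r with h0 | h0
  · exact exists_skewOp_le ht h0 ((le_abs_self r).trans hrt) hK
  obtain ⟨C, hC0, hC⟩ := exists_skewOp_le ht (by linarith) ((neg_le_abs r).trans hrt) hK
  refine ⟨C, hC0, fun q Q h hq G => ?_⟩
  have hs : IsSymb (fun ξ : Hor d => lam (2 * r) ξ) :=
    ⟨measurable_lam _, 1, fun ξ => by
      rw [abs_of_nonneg (lam_pos _ _).le]; exact lam_le_one (by linarith) ξ⟩
  set x : Idx d → L2H d := fun j => fm (fun ξ => lam (2 * r) ξ) (G j) with hx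
  obtain ⟨χ, hχ⟩ := exists_skewOp_eq hq.neg x
  have hneg := funext fun i => mulR_neg hq i
  have hxx : wsumH (-r) x = wsumH r G := sum_congr rfl fun j _ => wnf_neg_fm_lam h0 _
  have hχle : wsumH (-r) χ ≤ ofReal C * wsumH r G := by
    have := hC _ _ h hq.neg χ
    rwa [hχ, hxx] at this
  have hs1 : IsSymb (fun ξ : Hor d => lam r ξ) :=
    ⟨measurable_lam _, 1, fun ξ => by rw [abs_of_nonneg (lam_pos _ _).le]; exact lam_le_one h0 ξ⟩
  have hin : ∀ j, (((wnf r (FT (G j))).toReal) : ℂ) = inner ℂ (G j) (x j) ∧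
    wnf r (FT (G j)) ≠ ⊤ := by
    intro j
    have e1 : x j = fm (fun ξ => lam r ξ) (fm (fun ξ => lam r ξ) (G j)) := by
      rw [fm_fm hs1 hs1, hx]
      have : (fun ξ : Hor d => lam (2 * r) ξ) = fun ξ => lam r ξ * lam r ξ := by
        funext ξ
        rw [← lam_add]; congr 1; ring
      rw [this]
    have e2 : wnf r (FT (G j)) = ‖fm (fun ξ => lam r ξ) (G j)‖ₑ ^ 2 := by
      rw [enorm_sq_fm hs1, wnf]; refine lintegral_congr fun ξ => ?_
      rw [Real.enorm_eq_ofReal (lam_pos _ _).le, el]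
    rw [e1, ← inner_fm_left hs1, inner_self_eq_norm_sq_to_K, e2]
    refine ⟨by simp, pow_ne_top enorm_ne_top⟩
  have hfin : wsumH r G ≠ ⊤ := ENNReal.sum_ne_top.2 fun j _ => (hin j).2
  have hsq : wsumH r G ^ 2 ≤ wsumH r (skewOp (mulR volume q) G) * wsumH (-r) χ := by
    have e1 : (((wsumH r G).toReal : ℝ)) = ∑ j, inner ℂ (skewOp (mulR volume q) G j) (χ j) := by
      rw [← sum_inner_skewOp (fun i x y => hq.inner_left i x y), ← hneg, hχ, wsumH,
        ENNReal.toReal_sum fun j _ => (hin j).2]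
      push_cast; exact sum_congr rfl fun j _ => (hin j).1
    have e2 : wsumH r G = ‖∑ j, inner ℂ (skewOp (mulR volume q) G j) (χ j)‖ₑ := by
      rw [← e1, ← ofReal_norm, norm_real, norm_of_nonneg toReal_nonneg, ofReal_toReal hfin]
    calc wsumH r G ^ 2 ≤ (∑ j, ‖(inner ℂ (skewOp (mulR volume q) G j) (χ j))‖ₑ) ^ 2 := by
          rw [e2]; exact pow_le_pow_left' (enorm_sum_le _ _) 2
      _ ≤ (∑ j, wnf r (FT (skewOp (mulR volume q) G j)) ^ (1 / 2 : ℝ) *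
        wnf (-r) (FT (χ j)) ^ (1 / 2 : ℝ)) ^ 2 := by
        refine pow_le_pow_left' (sum_le_sum fun j _ => ?_) 2
        rw [← ENNReal.mul_rpow_of_nonneg _ _ (by norm_num : (0 : ℝ) ≤ 1 / 2),
          ← ENNReal.rpow_le_rpow_iff (z := 2) (by norm_num), ← rpow_mul]
        have := enorm_inner_le_wnf r (skewOp (mulR volume q) G j) (χ j)
        simpa using this
      _ ≤ _ := by
        refine (sum_mul_sq_le _ _ _).trans (le_of_eq ?_)
        have h2 : ∀ y, (y ^ (1 / 2 : ℝ)) ^ 2 = y := fun y => by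
          rw [← rpow_two, ← rpow_mul]; norm_num
        simp only [h2, wsumH]
  have h4 : wsumH r G * wsumH r G ≤
    wsumH r G * (ofReal C * wsumH r (skewOp (mulR volume q) G)) := by
    rw [← sq]; refine hsq.trans ((mul_le_r hχle).trans (le_of_eq (by ring)))
  rcases eq_or_ne (wsumH r G) 0 with hz | hz
  · rw [hz]; exact zero_le
  · exact (ENNReal.mul_le_mul_iff_right hz hfin).1 h4

/-! ### The gradient and the flux in the unknown `(g, v)` -/

section Hilbert

variable {V : Type*} [NormedAddCommGroup V] [InnerProductSpace ℂ V]

/-- The gradient `(g + q v, J v)`. -/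
def gradOp (M : Fin d → V →L[ℂ] V) (N : V →L[ℂ] V) (G : Idx d → V) : Idx d → V :=
  elim (fun i => G (inl i) + M i (G (inr ()))) (fun _ => N (G (inr ())))

/-- The flux `(J g, v - q · g)`. -/
def fluxOp (M : Fin d → V →L[ℂ] V) (N : V →L[ℂ] V) (G : Idx d → V) : Idx d → V :=
  elim (fun i => N (G (inl i))) (fun _ => G (inr ()) - ∑ i, M i (G (inl i)))

theorem sum_inner_gradOp_fluxOp {M : Fin d → V →L[ℂ] V} {N : V →L[ℂ] V}
  (hM : ∀ i x y, inner ℂ (M i x) y = inner ℂ x (M i y))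
  (hN : ∀ x y, inner ℂ (N x) y = inner ℂ x (N y)) (hMN : ∀ i x, M i (N x) = N (M i x))
  (G : Idx d → V) :
  ∑ j, inner ℂ (gradOp M N G j) (fluxOp M N G j) = ∑ j, inner ℂ (G j) (N (G j)) := by
  simp only [Fintype.sum_sum_type, gradOp, fluxOp, elim_inl, elim_inr, univ_unique,
    sum_singleton, inner_add_left, hM, hN, hMN, sum_add_distrib]
  rw [show default = () from rfl, map_sub, map_sum, inner_sub_right, inner_sum]; ring

theorem norm_add_sq_le_two {V : Type*} [NormedAddCommGroup V] (x y : V) : ‖x + y‖ ^ 2 ≤ 2 * ‖x‖ ^ 2 + 2 * ‖y‖ ^ 2 := by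
  have h := norm_add_le x y
  nlinarith [norm_nonneg (x + y), sq_nonneg (‖x‖ - ‖y‖)]

theorem norm_sum_sq_le {V ι : Type*} [NormedAddCommGroup V] (s : Finset ι) (f : ι → V) :
  ‖∑ i ∈ s, f i‖ ^ 2 ≤ s.card * ∑ i ∈ s, ‖f i‖ ^ 2 :=
  (pow_le_pow_left₀ (norm_nonneg _) (norm_sum_le _ _) 2).trans sq_sum_le_card_mul_sum_sq

theorem sum_norm_gradOp_le {M : Fin d → V →L[ℂ] V} {N : V →L[ℂ] V}
  (hM : ∀ i x, ‖M i x‖ ≤ κ * ‖x‖) (hN : ∀ x, ‖N x‖ ≤ κ * ‖x‖) (G : Idx d → V) :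
  ∑ j, ‖gradOp M N G j‖ ^ 2 ≤ (2 + (2 * d + 1) * κ ^ 2) * ∑ j, ‖G j‖ ^ 2 := by
  simp only [Fintype.sum_sum_type, gradOp, elim_inl, elim_inr, univ_unique, sum_singleton]
  rw [show default = () from rfl]
  have h1 : ∑ i, ‖G (inl i) + M i (G (inr ()))‖ ^ 2 ≤
    ∑ i, (2 * ‖G (inl i)‖ ^ 2 + 2 * (κ ^ 2 * ‖G (inr ())‖ ^ 2)) := by
    refine sum_le_sum fun i _ => (norm_add_sq_le_two _ _).trans ?_
    have := pow_le_pow_left₀ (norm_nonneg _) (hM i (G (inr ()))) 2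
    rw [mul_pow] at this
    linarith
  rw [sum_add_distrib, ← mul_sum] at h1
  simp only [sum_const, card_univ, Fintype.card_fin, nsmul_eq_mul] at h1
  have h2 := pow_le_pow_left₀ (norm_nonneg _) (hN (G (inr ()))) 2
  rw [mul_pow] at h2
  have h3 : 0 ≤ ∑ i, ‖G (inl i)‖ ^ 2 := sum_nonneg fun _ _ => by positivity
  have h4 : 0 ≤ (2 * d + 1) * κ ^ 2 := by positivity
  nlinarith [mul_nonneg h4 h3, sq_nonneg ‖G (inr ())‖]

theorem sum_norm_fluxOp_le {M : Fin d → V →L[ℂ] V} {N : V →L[ℂ] V}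
  (hM : ∀ i x, ‖M i x‖ ≤ κ * ‖x‖) (hN : ∀ x, ‖N x‖ ≤ κ * ‖x‖) (G : Idx d → V) :
  ∑ j, ‖fluxOp M N G j‖ ^ 2 ≤ (2 + (2 * d + 1) * κ ^ 2) * ∑ j, ‖G j‖ ^ 2 := by
  simp only [Fintype.sum_sum_type, fluxOp, elim_inl, elim_inr, univ_unique, sum_singleton]
  rw [show default = () from rfl]
  have h1 : ∑ i, ‖N (G (inl i))‖ ^ 2 ≤ κ ^ 2 * ∑ i, ‖G (inl i)‖ ^ 2 := by
    rw [mul_sum]; refine sum_le_sum fun i _ => ?_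
    rw [← mul_pow]; exact pow_le_pow_left₀ (norm_nonneg _) (hN _) 2
  have h2 : ‖∑ i, M i (G (inl i))‖ ^ 2 ≤ d * (κ ^ 2 * ∑ i, ‖G (inl i)‖ ^ 2) := by
    refine (norm_sum_sq_le _ _).trans ?_; rw [card_univ, Fintype.card_fin]
    refine mul_le_mul_of_nonneg_left ?_ (Nat.cast_nonneg d); rw [mul_sum]
    refine sum_le_sum fun i _ => ?_
    rw [← mul_pow]; exact pow_le_pow_left₀ (norm_nonneg _) (hM i _) 2
  have h5 := norm_add_sq_le_two (G (inr ())) (-∑ i, M i (G (inl i)))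
  rw [norm_neg, ← sub_eq_add_neg] at h5
  have h3 : 0 ≤ ∑ i, ‖G (inl i)‖ ^ 2 := sum_nonneg fun _ _ => by positivity
  have h4 : 0 ≤ (2 * d + 1) * κ ^ 2 := by positivity
  nlinarith [mul_nonneg h4 (sq_nonneg ‖G (inr ())‖)]

/-- Coercivity and continuity, in an abstract form. -/
theorem norm_sq_le_of_coercive {Λ D : ℝ} (hc : 0 < c)
  {x n f α β : V} (hn : ‖n‖ ≤ Λ * ‖x‖) (hf : ‖f‖ ≤ Λ * ‖x‖)
  (hcoer : c * ‖x‖ ^ 2 ≤ (inner ℂ n f : ℂ).re)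
  (hD : |(inner ℂ (n + α) (f + β) : ℂ).re| ≤ D * ‖n + α‖) (hD0 : 0 ≤ D) :
  ‖x‖ ^ 2 ≤ (4 * Λ ^ 2 / c ^ 2 + 2 / c) * (D ^ 2 + 2 * ‖α‖ ^ 2 + ‖β‖ ^ 2) * 2 := by
  have e : (inner ℂ n f) = inner ℂ (n + α) (f + β) - inner ℂ n β - inner ℂ α f - inner ℂ α β := by
    simp only [inner_add_left, inner_add_right]; ring
  have b : ∀ y z : V, |(inner ℂ y z).re| ≤ ‖y‖ * ‖z‖ := fun y z =>
    (abs_re_le_norm _).trans (norm_inner_le_norm _ _)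
  have b1 := b n β
  have b2 := b α f
  have b3 := b α β
  rw [e, sub_re, sub_re, sub_re] at hcoer
  have h1 : ‖n + α‖ ≤ Λ * ‖x‖ + ‖α‖ := (norm_add_le _ _).trans (by linarith)
  have h2 : D * ‖n + α‖ ≤ D * (Λ * ‖x‖ + ‖α‖) := by gcongr
  have h3 : ‖n‖ * ‖β‖ ≤ Λ * ‖x‖ * ‖β‖ := by gcongr
  have h4 : ‖α‖ * ‖f‖ ≤ ‖α‖ * (Λ * ‖x‖) := by gcongr
  have h5 : c * ‖x‖ ^ 2 ≤ Λ * ‖x‖ * (D + ‖α‖ + ‖β‖) + ‖α‖ * (D + ‖β‖) := by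
    have := abs_le.1 hD; have := abs_le.1 b1; have := abs_le.1 b2; have := abs_le.1 b3
    nlinarith
  set X := ‖x‖
  set a := ‖α‖
  set b' := ‖β‖
  set Z := D + a + b'
  have hX : 0 ≤ X := norm_nonneg _
  have ha : 0 ≤ a := norm_nonneg _
  have hb : 0 ≤ b' := norm_nonneg _
  have h6 : Λ * X * Z ≤ c / 2 * X ^ 2 + Λ ^ 2 * Z ^ 2 / (2 * c) := by
    have : 0 ≤ (c * X - Λ * Z) ^ 2 / (2 * c) := by positivity
    have e : (c * X - Λ * Z) ^ 2 / (2 * c) =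
      c / 2 * X ^ 2 + Λ ^ 2 * Z ^ 2 / (2 * c) - Λ * X * Z := by field_simp; ring
    linarith
  have h7 : a * (D + b') ≤ D ^ 2 + 2 * a ^ 2 + b' ^ 2 := by
    nlinarith [sq_nonneg (a - D), sq_nonneg (a - b')]
  have h8 : Z ^ 2 ≤ 4 * (D ^ 2 + 2 * a ^ 2 + b' ^ 2) := by
    nlinarith [sq_nonneg (a - D), sq_nonneg (a - b'), sq_nonneg (D - b')]
  set T := D ^ 2 + 2 * a ^ 2 + b' ^ 2
  have hT : 0 ≤ T := by positivity
  have h9 : Λ ^ 2 * Z ^ 2 / (2 * c) ≤ Λ ^ 2 * (4 * T) / (2 * c) := by gcongr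
  have h10 : c / 2 * X ^ 2 ≤ Λ ^ 2 * (4 * T) / (2 * c) + T := by linarith
  have h11 : X ^ 2 ≤ (2 / c) * (Λ ^ 2 * (4 * T) / (2 * c) + T) := by
    have := mul_le_mul_of_nonneg_left h10 (by positivity : 0 ≤ 2 / c)
    calc X ^ 2 = 2 / c * (c / 2 * X ^ 2) := by field_simp
      _ ≤ _ := this
  refine h11.trans ?_
  have e2 : 2 / c * (Λ ^ 2 * (4 * T) / (2 * c) + T) = (4 * Λ ^ 2 / c ^ 2 + 2 / c) * T := by
    field_simp
  rw [e2]
  have : 0 ≤ (4 * Λ ^ 2 / c ^ 2 + 2 / c) * T := by positivity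
  linarith

theorem exists_coercive_comm_le (V : Type*) [NormedAddCommGroup V] [InnerProductSpace ℂ V] (hc : 0 < c) :
  ∃ C : ℝ, 0 ≤ C ∧ ∀ (M : Fin d → V →L[ℂ] V) (N L : V →L[ℂ] V) (G : Idx d → V) (D η : ℝ),
    (∀ i x y, inner ℂ (M i x) y = inner ℂ x (M i y)) →
    (∀ x y, inner ℂ (N x) y = inner ℂ x (N y)) → (∀ i x, M i (N x) = N (M i x)) →
    (∀ i x, ‖M i x‖ ≤ κ * ‖x‖) → (∀ x, ‖N x‖ ≤ κ * ‖x‖) →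
    (∀ x, c * ‖x‖ ^ 2 ≤ (inner ℂ x (N x) : ℂ).re) → 0 ≤ D → 0 ≤ η →
    |(∑ j, inner ℂ (L (gradOp M N G j)) (L (fluxOp M N G j)) : ℂ).re| ≤
      D * √(∑ j, ‖L (gradOp M N G j)‖ ^ 2) →
    (∀ i j, ‖L (M i (G j)) - M i (L (G j))‖ ^ 2 ≤ η) →
    (∀ j, ‖L (N (G j)) - N (L (G j))‖ ^ 2 ≤ η) →
    ∑ j, (‖L (G j)‖ ^ 2 + ‖L (gradOp M N G j)‖ ^ 2 + ‖L (fluxOp M N G j)‖ ^ 2) ≤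
      C * (D ^ 2 + η) := by
  set Λ2 : ℝ := 2 + (2 * d + 1) * κ ^ 2 with hΛ2
  have hΛ0 : 0 ≤ Λ2 := by positivity
  set A0 : ℝ := (4 * Λ2 / c ^ 2 + 2 / c) * 2 with hA0
  have hA00 : 0 ≤ A0 := by positivity
  set e1 : ℝ := d + 1
  set e2 : ℝ := d + d * d
  refine ⟨(1 + 4 * Λ2) * (A0 * (1 + 2 * e1 + e2)) + 2 * e1 + 2 * e2, by positivity, ?_⟩
  intro M N L G D η hM hN hMN hMκ hNκ hcoer hD0 hη hD hcM hcN
  set LG : Idx d → V := fun j => L (G j) with hLG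
  let x : PiLp 2 fun _ => V := WithLp.toLp 2 LG
  let n : PiLp 2 fun _ => V := WithLp.toLp 2 (gradOp M N LG)
  let f : PiLp 2 fun _ => V := WithLp.toLp 2 (fluxOp M N LG)
  let n' : PiLp 2 fun _ => V := WithLp.toLp 2 fun j => L (gradOp M N G j)
  let f' : PiLp 2 fun _ => V := WithLp.toLp 2 fun j => L (fluxOp M N G j)
  have hnx : ‖n‖ ^ 2 ≤ Λ2 * ‖x‖ ^ 2 := by
    rw [PiLp.norm_sq_eq_of_L2, PiLp.norm_sq_eq_of_L2]; exact sum_norm_gradOp_le hMκ hNκ LG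
  have hfx : ‖f‖ ^ 2 ≤ Λ2 * ‖x‖ ^ 2 := by
    rw [PiLp.norm_sq_eq_of_L2, PiLp.norm_sq_eq_of_L2]; exact sum_norm_fluxOp_le hMκ hNκ LG
  have hα : ‖n' - n‖ ^ 2 ≤ e1 * η := by
    rw [PiLp.norm_sq_eq_of_L2, Fintype.sum_sum_type]
    simp only [n', n, PiLp.sub_apply, gradOp, elim_inl, elim_inr, univ_unique,
      sum_singleton, hLG, map_add, add_sub_add_left_eq_sub]
    calc _ ≤ (∑ i, η) + η := add_le_add (sum_le_sum fun i _ => hcM i _) (hcN _)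
      _ = e1 * η := by simp [e1]; ring
  have hβ : ‖f' - f‖ ^ 2 ≤ e2 * η := by
    rw [PiLp.norm_sq_eq_of_L2, Fintype.sum_sum_type]
    simp only [f', f, PiLp.sub_apply, fluxOp, elim_inl, elim_inr, univ_unique,
      sum_singleton, hLG, map_sub, map_sum]
    calc _ ≤ (∑ i, η) + d * ∑ i, η := by
          refine add_le_add (sum_le_sum fun i _ => hcN _) ?_
          have : ∀ a b b' : V, a - b - (a - b') = b' - b := fun a b b' => by abel
          rw [this, ← sum_sub_distrib]; refine (norm_sum_sq_le _ _).trans ?_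
          rw [card_univ, Fintype.card_fin]
          refine mul_le_mul_of_nonneg_left (sum_le_sum fun i _ => ?_) (Nat.cast_nonneg d)
          rw [norm_sub_rev]; exact hcM i _
      _ = e2 * η := by simp [e2]; ring
  have sq1 : ∀ y : PiLp 2 fun _ : Idx d => V, ‖y‖ ^ 2 ≤ Λ2 * ‖x‖ ^ 2 → ‖y‖ ≤ √Λ2 * ‖x‖ := by
    intro y hy; apply le_of_sq_le_sq _ (by positivity); rwa [mul_pow, sq_sqrt hΛ0]
  have key := norm_sq_le_of_coercive (α := n' - n) (β := f' - f) hc (sq1 n hnx) (sq1 f hfx) (by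
      rw [PiLp.inner_apply, PiLp.norm_sq_eq_of_L2]; simp only [n, f, x]
      rw [sum_inner_gradOp_fluxOp hM hN hMN, re_sum, mul_sum]
      exact sum_le_sum fun j _ => hcoer _) (by
      rw [add_sub_cancel, add_sub_cancel, PiLp.inner_apply, PiLp.norm_eq_of_L2]; exact hD) hD0
  rw [sq_sqrt hΛ0] at key
  have hx : ‖x‖ ^ 2 ≤ A0 * (1 + 2 * e1 + e2) * (D ^ 2 + η) := by
    have hD2 := sq_nonneg D
    have he1 : 0 ≤ e1 := by positivity
    have he2 : 0 ≤ e2 := by positivity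
    calc ‖x‖ ^ 2 ≤ A0 * (D ^ 2 + 2 * ‖n' - n‖ ^ 2 + ‖f' - f‖ ^ 2) := by rw [hA0]; linarith
      _ ≤ A0 * ((1 + 2 * e1 + e2) * (D ^ 2 + η)) := by
        refine mul_le_mul_of_nonneg_left ?_ hA00; nlinarith [mul_nonneg he1 hD2, mul_nonneg he2 hD2]
      _ = _ := by ring
  have hn' : ‖n'‖ ^ 2 ≤ 2 * (Λ2 * ‖x‖ ^ 2) + 2 * (e1 * η) := by
    have := norm_add_sq_le_two n (n' - n)
    rw [add_sub_cancel] at this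
    linarith
  have hf' : ‖f'‖ ^ 2 ≤ 2 * (Λ2 * ‖x‖ ^ 2) + 2 * (e2 * η) := by
    have := norm_add_sq_le_two f (f' - f)
    rw [add_sub_cancel] at this
    linarith
  have hsum : ∑ j, (‖L (G j)‖ ^ 2 + ‖L (gradOp M N G j)‖ ^ 2 + ‖L (fluxOp M N G j)‖ ^ 2) =
    ‖x‖ ^ 2 + ‖n'‖ ^ 2 + ‖f'‖ ^ 2 := by
    rw [PiLp.norm_sq_eq_of_L2, PiLp.norm_sq_eq_of_L2, PiLp.norm_sq_eq_of_L2,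
      ← sum_add_distrib, ← sum_add_distrib]
  rw [hsum]
  have h1 : (1 + 4 * Λ2) * ‖x‖ ^ 2 ≤
    (1 + 4 * Λ2) * (A0 * (1 + 2 * e1 + e2) * (D ^ 2 + η)) := by gcongr
  have he1 : 0 ≤ e1 * D ^ 2 := by positivity
  have he2 : 0 ≤ e2 * D ^ 2 := by positivity
  nlinarith

end Hilbert

/-! ### Weighted norms on the strip -/

/-- The square of the norm of `Λ^s u` in `L²(S)`. -/
def wnS (s : ℝ) (u : L2S d) : ℝ≥0∞ := ∫⁻ z, wnf s (FT (sec u z)) ∂zvol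

theorem wnS_mono (h : r ≤ s) (u : L2S d) : wnS r u ≤ wnS s u := lintegral_mono fun _ => wnf_mono h _

theorem aemeasurable_enorm_clm_sec (T : L2H d →L[ℂ] L2H d) (u : L2S d) :
  AEMeasurable (fun z => ‖T (sec u z)‖ₑ ^ 2) zvol := by
  refine (aemeasurable_enorm_sec (Lp.memLp (lift T u))).congr ?_
  filter_upwards [sec_lift T u] with z hz
  rw [hz]

theorem enorm_sq_lift (T : L2H d →L[ℂ] L2H d) (u : L2S d) :
  ‖lift T u‖ₑ ^ 2 = ∫⁻ z, ‖T (sec u z)‖ₑ ^ 2 ∂zvol := by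
  rw [enorm_sq_eq_sec]; apply lintegral_congr_ae
  filter_upwards [sec_lift T u] with z hz
  rw [hz]

theorem trunc_mono (s : ℝ) {m n : ℕ} (h : m ≤ n) (ξ : Hor d) : trunc s m ξ ≤ trunc s n ξ :=
  min_le_min le_rfl (by exact_mod_cast h)

theorem enorm_sq_fm_le {n : Hor d → ℝ} (hm : IsSymb m) (hn : IsSymb n)
  (h : ∀ ξ, |m ξ| ≤ |n ξ|) (f : L2H d) : ‖fm m f‖ₑ ^ 2 ≤ ‖fm n f‖ₑ ^ 2 := by
  rw [enorm_sq_fm hm, enorm_sq_fm hn]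
  refine lintegral_mono fun ξ => pow_le_pow_left' (mul_le_mul_left ?_ _) 2
  rw [← ofReal_norm, ← ofReal_norm]; exact ofReal_le_ofReal (h ξ)

theorem enorm_sq_fm_trunc_mono (s : ℝ) (f : L2H d) :
  Monotone fun n : ℕ => ‖fm (trunc s n) f‖ₑ ^ 2 := fun m n h =>
  enorm_sq_fm_le (isSymb_trunc s m) (isSymb_trunc s n) (fun ξ => by
    rw [abs_of_nonneg (trunc_nonneg _ _ _), abs_of_nonneg (trunc_nonneg _ _ _)]
    exact trunc_mono s h ξ) f

theorem wnS_eq_iSup (s : ℝ) (u : L2S d) : wnS s u = ⨆ n : ℕ, ‖lift (fm (trunc s n)) u‖ₑ ^ 2 := by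
  simp_rw [enorm_sq_lift, wnS, wnf_eq_iSup]
  exact lintegral_iSup' (fun n => aemeasurable_enorm_clm_sec _ u)
    (.of_forall fun z => enorm_sq_fm_trunc_mono s _)

theorem aemeasurable_wnf_sec (s : ℝ) (u : L2S d) :
  AEMeasurable (fun z => wnf s (FT (sec u z))) zvol := by
  simp_rw [wnf_eq_iSup]; exact AEMeasurable.iSup fun n => aemeasurable_enorm_clm_sec _ u

/-! ### Coefficients on the strip -/

/-- Real coefficients on the strip with amplitudes in a ball of radius `√K`. -/
structure IsCoefS (t K : ℝ) (a : Amb d → ℝ) (A : Amb d → ℂ) (h : Hor d → ℝ≥0∞) : Prop where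
  ht : (d : ℝ) / 2 < t
  aesm : AEStronglyMeasurable (fun p => (a p : ℂ)) (volS d)
  meas : Measurable A
  meas_h : Measurable h
  le : ∀ z ∈ Ioo (-1 : ℝ) 0, ∀ k, ‖A (k, z)‖ₑ ≤ el (-t) k * h k
  eq : ∀ z ∈ Ioo (-1 : ℝ) 0, ∀ X, (a (X, z) : ℂ) = 𝓕⁻ (fun k => A (k, z)) X
  hK : ∫⁻ k, h k ^ 2 ≤ ofReal K
  int : ∫⁻ z, wnf (t + 1 / 2) (fun k => A (k, z)) ∂zvol ≤ ofReal K

theorem ae_zvol_mem : ∀ᵐ z ∂zvol, z ∈ Ioo (-1 : ℝ) 0 := ae_restrict_mem measurableSet_Ioo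

/-- A bound for coefficients. -/
def coefBound (d : ℕ) (t K : ℝ) : ℝ := √((∫⁻ ξ : Hor d, el (-t) ξ ^ 2).toReal * K)

theorem IsAmp.norm_le {a : Hor d → ℂ} (hA : IsAmp t A h)
  (ha : ∀ X, a X = 𝓕⁻ A X) (hK0 : 0 ≤ K) (hK : ∫⁻ k, h k ^ 2 ≤ ofReal K) (X : Hor d) :
  ‖a X‖ ≤ coefBound d t K := by
  have hfin := lintegral_el_sq_lt_top hA.ht
  have h1 : ‖a X‖ₑ ≤ ∫⁻ k, ‖A k‖ₑ := by
    rw [ha, fourierInv_eq']; refine (enorm_integral_le_lintegral_enorm _).trans (le_of_eq ?_)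
    congr 1; ext v; rw [enorm_smul, ← ofReal_norm, norm_exp_ofReal_mul_I, ofReal_one, one_mul]
  have h2 :=
    (pow_le_pow_left' (h1.trans (lintegral_mono hA.le)) 2).trans
      ((lintegral_mul_sq_le _ (by fun_prop) hA.meas_h.aemeasurable).trans (mul_le_r hK))
  rw [coefBound]; apply Real.le_sqrt_of_sq_le
  have h3 := toReal_mono (mul_ne_top hfin.ne ofReal_ne_top) h2
  rw [toReal_pow, toReal_enorm, toReal_mul] at h3
  rwa [ENNReal.toReal_ofReal hK0] at h3

section
variable {t K : ℝ} {a : Amb d → ℝ} {A : Amb d → ℂ} {h : Hor d → ℝ≥0∞}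

theorem IsCoefS.amp (ha : IsCoefS t K a A h) (hz : z ∈ Ioo (-1 : ℝ) 0) :
  IsAmp t (fun k => A (k, z)) h :=
  ⟨ha.ht, ha.meas.comp measurable_prodMk_right, ha.meas_h, ha.le z hz,
    (ha.hK.trans_lt ofReal_lt_top).ne⟩

theorem measurableSet_S : MeasurableSet (S d) :=
  (measurableSet_lt measurable_const measurable_snd).inter
    (measurableSet_lt measurable_snd measurable_const)

theorem ae_volS_mem : ∀ᵐ p ∂volS d, p.2 ∈ Ioo (-1 : ℝ) 0 := ae_restrict_mem measurableSet_S

theorem IsCoefS.norm_le (ha : IsCoefS t K a A h) (hK : 0 ≤ K) :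
  ∀ᵐ p ∂volS d, ‖(a p : ℂ)‖ ≤ coefBound d t K := by
  filter_upwards [ae_volS_mem] with p hp
  exact (ha.amp hp).norm_le (ha.eq _ hp) hK ha.hK p.1

theorem IsCoefS.isBdd (ha : IsCoefS t K a A h) (hK : 0 ≤ K) :
  IsBdd (volS d) (fun p => (a p : ℂ)) := ⟨ha.aesm, _, ha.norm_le hK⟩

theorem exists_commS_le (he : 0 ≤ e) (hes : e ≤ s) (he1 : e ≤ 1)
  (ht : (d : ℝ) / 2 < t - e) (hst : s ≤ t + 1 / 2) (hK : 0 ≤ K) :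
  ∃ C : ℝ, 0 ≤ C ∧ ∀ a A h, IsCoefS t K a A h →
    ∀ (f : L2S d) (E : ℝ≥0∞), (∀ᵐ z ∂zvol, wnf (s - e - 1 / 2) (FT (sec f z)) ≤ E) →
    ∀ n, ‖lift (fm (trunc s n)) (mulOp (volS d) (fun p => (a p : ℂ)) f) -
      mulOp (volS d) (fun p => (a p : ℂ)) (lift (fm (trunc s n)) f)‖ₑ ^ 2 ≤
      ofReal C * (wnS (s - e) f + E) := by
  obtain ⟨C, hC0, hC⟩ := exists_comm_le_of_ge he hes he1 ht hst
  refine ⟨C * K, by positivity, fun a A h ha f E hE n => ?_⟩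
  set L := fm (trunc s n)
  set M := mulOp (volS d) (fun p => (a p))
  have hb := ha.isBdd hK
  calc ‖lift L (M f) - M (lift L f)‖ₑ ^ 2
        = ∫⁻ z, ‖sec (lift L (M f) - M (lift L f)) z‖ₑ ^ 2 ∂zvol := enorm_sq_eq_sec _
    _ ≤ ∫⁻ z, ofReal C * (ofReal K * wnf (s - e) (FT (sec f z)) +
      wnf (t + 1 / 2) (fun k => A (k, z)) * E) ∂zvol := by
      apply lintegral_mono_ae
      filter_upwards [ae_zvol_mem, hE, sec_sub (lift L (M f)) (M (lift L f)), sec_lift L (M f),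
        sec_mulOp hb f, sec_mulOp hb (lift L f), sec_lift L f] with z hz h1 h2 h3 h4 h5 h6
      rw [h2, h3, h4, h5, h6]
      have hamp := ha.amp hz
      refine (enorm_sq_comm_le (isSymb_trunc s n) hamp (ha.eq z hz) (sec f z)).trans ?_
      refine (hC (trunc s n) _ (FT (sec f z)) h (enorm_trunc_sub_le s n) hamp.meas
        (measurable_Lp _) hamp.meas_h hamp.le).trans ?_
      exact mul_le_r (add_le_add (mul_le_mul_left ha.hK _) (mul_le_mul_right h1 _))
    _ = ofReal C * (ofReal K * wnS (s - e) f +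
      (∫⁻ z, wnf (t + 1 / 2) (fun k => A (k, z)) ∂zvol) * E) := by
      have hm1 := aemeasurable_wnf_sec (s - e) f
      have hm2 : Measurable fun z => wnf (t + 1 / 2) (fun k => A (k, z)) := by
        unfold wnf
        refine Measurable.lintegral_prod_right' (f := fun p =>
          (el (t + 1 / 2) p.2 * ‖A (p.2, p.1)‖ₑ) ^ 2) ?_
        have := ha.meas.comp measurable_swap
        exact (((measurable_el _).comp measurable_snd).mul this.enorm).pow_const 2
      rw [lintegral_cmul, lintegral_add_left' (hm1.const_mul _),
        lintegral_cmul, lintegral_mul_const _ hm2, wnS]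
    _ ≤ ofReal C * (ofReal K * wnS (s - e) f + ofReal K * E) :=
      mul_le_r (add_le_add le_rfl (mul_le_mul_left ha.int _))
    _ = _ := by rw [← mul_add, ← mul_assoc, ← ofReal_mul hC0]

theorem commS_zero {a : Amb d → ℝ} {A : Amb d → ℂ}
  (ha : IsCoefS t K a A h) (hK : 0 ≤ K) (f : L2S d) (n : ℕ) :
  lift (fm (trunc 0 n)) (mulOp (volS d) (fun p => (a p : ℂ)) f) =
    mulOp (volS d) (fun p => (a p : ℂ)) (lift (fm (trunc 0 n)) f) := by
  have hb := ha.isBdd hK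
  apply eq_of_sec_eq
  filter_upwards [ae_zvol_mem, sec_lift (fm (trunc 0 n)) (mulOp (volS d) (fun p => (a p)) f),
    sec_mulOp hb f, sec_mulOp hb (lift (fm (trunc 0 n)) f), sec_lift (fm (trunc 0 n)) f]
    with z hz h1 h2 h3 h4
  rw [h1, h2, h3, h4, ← sub_eq_zero, ← enorm_eq_zero, ← pow_eq_zero_iff two_ne_zero,
    ← nonpos_iff_eq_zero]
  refine (enorm_sq_comm_le (isSymb_trunc 0 n) (ha.amp hz) (ha.eq z hz) (sec f z)).trans ?_
  simp [trunc]

end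

/-! ### The regularity estimate -/

/-- The system `(q, J)` of coefficients. -/
structure IsSystem (t K c : ℝ) (q : Fin d → Amb d → ℝ) (J : Amb d → ℝ) : Prop where
  hK : 0 ≤ K
  hc : 0 < c
  hq : ∀ i, ∃ A h, IsCoefS t K (q i) A h
  hJ : ∃ A h, IsCoefS t K (fun p => J p - 1) A h
  le : ∀ᵐ p ∂volS d, c ≤ J p

/-- Multiplication by a real function in `L²(S)`. -/
def mulS (a : Amb d → ℝ) : L2S d →L[ℂ] L2S d := mulOp (volS d) fun p => (a p : ℂ)

/-- The gradient of the unknown `(g, v)`. -/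
def gradS (q : Fin d → Amb d → ℝ) (J : Amb d → ℝ) (G : Idx d → L2S d) : Idx d → L2S d :=
  gradOp (fun i => mulS (q i)) (mulS J) G

/-- The flux of the unknown `(g, v)`. -/
def fluxS (q : Fin d → Amb d → ℝ) (J : Amb d → ℝ) (G : Idx d → L2S d) : Idx d → L2S d :=
  fluxOp (fun i => mulS (q i)) (mulS J) G

/-- The square of the norm of order `r` of the unknown, its gradient and its flux. -/
def wnSum (r : ℝ) (q : Fin d → Amb d → ℝ) (J : Amb d → ℝ) (G : Idx d → L2S d) : ℝ≥0∞ :=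
  ∑ j, (wnS r (G j) + wnS r (gradS q J G j) + wnS r (fluxS q J G j))

section
variable {t K c : ℝ} {q : Fin d → Amb d → ℝ} {J : Amb d → ℝ}

theorem IsSystem.bddq (hS : IsSystem t K c q J) (i : Fin d) :
  IsBdd (volS d) fun p => (q i p : ℂ) := by
  obtain ⟨A, h, hq⟩ := hS.hq i
  exact hq.isBdd hS.hK

theorem IsSystem.bddJ_sub (hS : IsSystem t K c q J) :
  IsBdd (volS d) fun p => ((J p - 1 : ℝ) : ℂ) := by
  obtain ⟨A, h, hJ⟩ := hS.hJ
  exact hJ.isBdd hS.hK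

theorem IsSystem.bddJ (hS : IsSystem t K c q J) : IsBdd (volS d) fun p => (J p : ℂ) := by
  have h1 : IsBdd (volS d) fun _ => 1 := ⟨aestronglyMeasurable_const, 1, by simp⟩
  have := hS.bddJ_sub.add h1
  simpa using this

theorem IsSystem.mulS_J (hS : IsSystem t K c q J) (f : L2S d) :
  mulS J f = f + mulS (fun p => J p - 1) f := by
  apply Lp.ext
  filter_upwards [mulOp_coe hS.bddJ f, mulOp_coe hS.bddJ_sub f,
    Lp.coeFn_add f (mulS (fun p => J p - 1) f)] with p h1 h2 h3
  rw [h3, Pi.add_apply, mulS, mulS, h1, h2]; push_cast; ring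

theorem IsSystem.norm_q_le (hS : IsSystem t K c q J) (i : Fin d) (f : L2S d) :
  ‖mulS (q i) f‖ ≤ (1 + coefBound d t K) * ‖f‖ := by
  obtain ⟨A, h, hq⟩ := hS.hq i
  refine (norm_mulOp_le hq.aesm (hq.norm_le hS.hK) f).trans ?_; gcongr; linarith

theorem IsSystem.norm_J_le (hS : IsSystem t K c q J) (f : L2S d) :
  ‖mulS J f‖ ≤ (1 + coefBound d t K) * ‖f‖ := by
  obtain ⟨A, h, hq⟩ := hS.hJ
  rw [hS.mulS_J, add_mul, one_mul]
  exact (norm_add_le _ _).trans (add_le_add le_rfl (norm_mulOp_le hq.aesm (hq.norm_le hS.hK) f))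

theorem inner_mulS_left {a : Amb d → ℝ} (ha : IsBdd (volS d) fun p => (a p : ℂ)) (x y : L2S d) :
  inner ℂ (mulS a x) y = inner ℂ x (mulS a y) :=
  inner_mulOp_left ha (fun _ => conj_ofReal _) x y

theorem IsSystem.comm_q_J (hS : IsSystem t K c q J) (i : Fin d) (x : L2S d) :
  mulS (q i) (mulS J x) = mulS J (mulS (q i) x) := by
  rw [mulS, mulS, mulOp_mulOp (hS.bddq i) hS.bddJ, mulOp_mulOp hS.bddJ (hS.bddq i)]
  congr 2; funext p; ring

theorem IsSystem.coercive (hS : IsSystem t K c q J) (x : L2S d) :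
  c * ‖x‖ ^ 2 ≤ (inner ℂ x (mulS J x) : ℂ).re := by
  have e : (inner ℂ x (mulS J x)).re = ∫ p, J p * ‖x p‖ ^ 2 ∂volS d := by
    rw [L2.inner_def]
    have hi := L2.integrable_inner (𝕜 := ℂ) x (mulS J x)
    refine (integral_re hi).symm.trans (integral_congr_ae ?_)
    filter_upwards [mulOp_coe hS.bddJ x] with p hp
    rw [mulS, hp, RCLike.inner_apply, mul_assoc, RCLike.mul_conj]; simp [← Complex.ofReal_pow]
  have e2 : ‖x‖ ^ 2 = ∫ p, ‖x p‖ ^ 2 ∂volS d := by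
    rw [← real_inner_self_eq_norm_sq]
    have : (inner ℝ x x) = (inner ℂ x x).re := by
      rw [real_inner_self_eq_norm_sq, inner_self_eq_norm_sq_to_K]; norm_cast
    rw [this, L2.inner_def]
    refine (integral_re (L2.integrable_inner (𝕜 := ℂ) x x)).symm.trans
      (integral_congr_ae (.of_forall fun p => ?_))
    simp only [inner_self_eq_norm_sq_to_K]; norm_cast
  rw [e, e2, ← integral_const_mul]
  have hint := (Lp.memLp x).integrable_norm_pow two_ne_zero
  refine integral_mono_ae (hint.const_mul c) ?_ ?_
  · obtain ⟨h1, C, hC⟩ := hS.bddJ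
    have hm : AEStronglyMeasurable J (volS d) := by
      simpa using Complex.continuous_re.comp_aestronglyMeasurable h1
    refine hint.bdd_mul (c := C) hm ?_
    filter_upwards [hC] with p hp
    simpa using hp
  · filter_upwards [hS.le] with p hp
    gcongr

theorem IsSystem.exists_step (d : ℕ) (hc : 0 < c) :
  ∃ C : ℝ, 0 ≤ C ∧ ∀ q J, IsSystem t K c q J →
  ∀ (G : Idx d → L2S d) (r D η : ℝ), 0 ≤ D → 0 ≤ η →
    (∀ n, |(∑ j, inner ℂ (lift (fm (trunc r n)) (gradS q J G j))
      (lift (fm (trunc r n)) (fluxS q J G j)) : ℂ).re| ≤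
      D * √(∑ j, ‖lift (fm (trunc r n)) (gradS q J G j)‖ ^ 2)) →
    (∀ n i j, ‖lift (fm (trunc r n)) (mulS (q i) (G j)) -
      mulS (q i) (lift (fm (trunc r n)) (G j))‖ₑ ^ 2 ≤ ofReal η) →
    (∀ n j, ‖lift (fm (trunc r n)) (mulS (fun p => J p - 1) (G j)) -
      mulS (fun p => J p - 1) (lift (fm (trunc r n)) (G j))‖ₑ ^ 2 ≤ ofReal η) →
    wnSum r q J G ≤ ofReal (C * (D ^ 2 + η)) := by
  obtain ⟨C, hC0, hC⟩ := exists_coercive_comm_le (L2S d) hc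
  refine ⟨(d + 1) * 3 * C, by positivity, fun q J hS G r D η hD0 hη hD hcM hcN => ?_⟩
  have toReal : ∀ x : L2S d, ‖x‖ₑ ^ 2 ≤ ofReal η → ‖x‖ ^ 2 ≤ η := by
    intro x hx; rw [← ofReal_norm, ← ofReal_pow (norm_nonneg _)] at hx
    exact (ofReal_le_ofReal_iff hη).1 hx
  have key := fun n => hC (fun i => mulS (q i)) (mulS J) (lift (fm (trunc r n))) G D η
    (fun i => inner_mulS_left (hS.bddq i)) (inner_mulS_left hS.bddJ) hS.comm_q_J hS.norm_q_le
    hS.norm_J_le hS.coercive hD0 hη (hD n) (fun i j => toReal _ (hcM n i j)) (fun j => by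
      rw [hS.mulS_J, hS.mulS_J, map_add, add_sub_add_left_eq_sub]; exact toReal _ (hcN n j))
  have fin : ∀ (u : L2S d), (∀ n, ‖lift (fm (trunc r n)) u‖ ^ 2 ≤ C * (D ^ 2 + η)) →
    wnS r u ≤ ofReal (C * (D ^ 2 + η)) := by
    intro u hu; rw [wnS_eq_iSup]; refine iSup_le fun n => ?_
    rw [← ofReal_norm, ← ofReal_pow (norm_nonneg _)]; exact ofReal_le_ofReal (hu n)
  have each := fun n j =>
    (single_le_sum (f := fun j => ‖lift (fm (trunc r n)) (G j)‖ ^ 2 +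
      ‖lift (fm (trunc r n)) (gradS q J G j)‖ ^ 2 + ‖lift (fm (trunc r n)) (fluxS q J G j)‖ ^ 2)
      (fun _ _ => by positivity) (mem_univ j)).trans (key n)
  have pos := fun u : L2S d => sq_nonneg ‖u‖
  set Z := ofReal (C * (D ^ 2 + η)) with hZ
  calc wnSum r q J G ≤ ∑ j, (Z + Z + Z) := by
        refine sum_le_sum fun j _ => add_le_add (add_le_add ?_ ?_) ?_
        all_goals
          refine fin _ fun n => ?_
          linarith [each n j, pos (lift (fm (trunc r n)) (G j)),
            pos (lift (fm (trunc r n)) (gradS q J G j)),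
            pos (lift (fm (trunc r n)) (fluxS q J G j))]
    _ = ofReal ((d + 1) * 3) * Z := by
      simp only [sum_const, card_univ, Fintype.card_sum, Fintype.card_fin,
        Fintype.card_unit, nsmul_eq_mul]
      rw [ofReal_mul (by positivity), ofReal_add (by positivity) (by norm_num)]; simp; ring
    _ = _ := by rw [hZ, ← ofReal_mul (by positivity)]; congr 1; ring

theorem IsSystem.sec_skewOp (hS : IsSystem t K c q J) (G : Idx d → L2S d) :
  ∀ᵐ z ∂zvol, ∀ j, sec (skewOp (fun i => mulS (q i)) G j : L2S d) z =
    skewOp (mulR volume fun i X => q i (X, z)) (fun j => sec (G j) z) j := by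
  have h1 : ∀ᵐ z ∂zvol, ∀ i j, sec (mulS (q i) (G j)) z =
    mulR volume (fun i X => q i (X, z)) i (sec (G j) z) := by
    rw [ae_all_iff]; intro i; rw [ae_all_iff]; intro j; exact sec_mulOp (hS.bddq i) (G j)
  have h2 : ∀ᵐ z ∂zvol, ∀ i, sec (G (inl i) + mulS (q i) (G (inr ()))) z =
    sec (G (inl i)) z + sec (mulS (q i) (G (inr ()))) z := by
    rw [ae_all_iff]; intro i; exact sec_add _ _
  have h3 : ∀ s (f : Fin d → L2S d), ∀ᵐ z ∂zvol,
    sec (∑ i ∈ s, f i : L2S d) z = ∑ i ∈ s, sec (f i) z := by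
    intro s f
    induction s using Finset.induction_on with
    | empty =>
      have := sec_smul 0 (0 : L2S d)
      filter_upwards [this] with z hz
      simpa using hz
    | insert a s ha ih =>
      filter_upwards [ih, sec_add (f a) (∑ i ∈ s, f i)] with z hz h4
      rw [Finset.sum_insert ha, Finset.sum_insert ha, h4, hz]
  filter_upwards [h1, h2, h3 Finset.univ fun i => mulS (q i) (G (inl i)),
    sec_sub (G (inr ())) (∑ i, mulS (q i) (G (inl i)))] with z e1 e2 e3 e4 j
  rcases j with i | u
  · simp only [skewOp, elim_inl]; rw [e2, e1]
  · simp only [skewOp, elim_inr]; rw [e4, e3]; simp only [e1]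

theorem wnS_add_le_wnSum (j : Idx d) :
  wnS r (F j) + wnS r (gradS q J F j) + wnS r (fluxS q J F j) ≤ wnSum r q J F :=
  single_le_sum (f := fun j => wnS r (F j) + wnS r (gradS q J F j) + wnS r (fluxS q J F j))
    (fun _ _ => zero_le) (mem_univ j)

theorem wnS_le_wnSum (j : Idx d) : wnS r (F j) ≤ wnSum r q J F :=
  (le_add_right (le_add_right le_rfl)).trans (wnS_add_le_wnSum j)

theorem wnS_grad_le_wnSum (j : Idx d) : wnS r (gradS q J F j) ≤ wnSum r q J F :=
  (le_add_right (le_add_left le_rfl)).trans (wnS_add_le_wnSum j)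

theorem wnS_flux_le_wnSum (j : Idx d) : wnS r (fluxS q J F j) ≤ wnSum r q J F :=
  (le_add_left le_rfl).trans (wnS_add_le_wnSum j)

theorem wnSum_mono (h : r ≤ s) : wnSum r q J F ≤ wnSum s q J F :=
  sum_le_sum fun _ _ => add_le_add (add_le_add (wnS_mono h _) (wnS_mono h _)) (wnS_mono h _)

theorem IsSystem.exists_isCoefH
  (hS : IsSystem t K c q J) :
  ∃ (A : Fin d → Amb d → ℂ) (h : Hor d → ℝ≥0∞), ∀ z ∈ Ioo (-1 : ℝ) 0,
    IsCoefH t (d * K) (fun i X => q i (X, z)) (fun i k => A i (k, z)) h := by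
  choose A h hq using hS.hq
  refine ⟨A, fun k => (∑ i, h i k ^ 2) ^ (1 / 2 : ℝ), fun z hz => ?_⟩
  have hsq : ∀ k, ((∑ i, h i k ^ 2) ^ (1 / 2 : ℝ)) ^ 2 = ∑ i, h i k ^ 2 := fun k => by
    rw [← rpow_two, ← rpow_mul]; norm_num
  have hle : ∫⁻ k, ((∑ i, h i k ^ 2) ^ (1 / 2 : ℝ)) ^ 2 ≤ ofReal (d * K) := by
    simp_rw [hsq]; rw [lintegral_finsetSum _ fun i _ => (hq i).meas_h.pow_const 2]
    calc _ ≤ ∑ i, ofReal K := sum_le_sum fun i _ => (hq i).hK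
      _ = _ := by simp [ofReal_mul]
  refine ⟨fun i => ?_, fun i X => (hq i).eq z hz X, hle⟩
  refine ⟨(hq i).ht, ((hq i).amp hz).meas, ?_, fun k => (((hq i).amp hz).le k).trans ?_,
    (hle.trans_lt ofReal_lt_top).ne⟩
  · exact (Finset.measurable_fun_sum _ fun i _ => (hq i).meas_h.pow_const 2).pow_const _
  · refine mul_le_r ?_; rw [← ENNReal.rpow_le_rpow_iff (z := 2) (by norm_num), ← rpow_mul]
    norm_num; exact single_le_sum (f := fun i => h i k ^ 2) (fun _ _ => zero_le) (mem_univ i)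

/-- Bounds at almost every height, from the bounds for the horizontal gradient and the vertical
flux. -/
theorem IsSystem.exists_sec_le {C₀ : ℝ} (d : ℕ) (ht : (d : ℝ) / 2 < t) (hr : |r| ≤ t)
  (hK : 0 ≤ K) (hC₀ : 0 ≤ C₀) :
  ∃ C : ℝ, 0 ≤ C ∧ ∀ c q J, IsSystem t K c q J → ∀ (G : Idx d → L2S d) (E : ℝ≥0∞),
    (∀ᵐ z ∂zvol, ∀ j, wnf r (FT (sec (skewOp (fun i => mulS (q i)) G j : L2S d) z)) ≤
      ofReal C₀ * E) →
    ∀ᵐ z ∂zvol, ∀ j, wnf r (FT (sec (G j) z)) ≤ ofReal C * E := by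
  obtain ⟨C, hC0, hC⟩ := exists_skewOp_le_of_abs_le (K := d * K) ht hr (by positivity)
  refine ⟨C * ((d + 1) * C₀), by positivity, fun c q J hS G E hE => ?_⟩
  obtain ⟨A, h, hq⟩ := hS.exists_isCoefH
  filter_upwards [hE, hS.sec_skewOp G, ae_zvol_mem] with z h1 h2 h3 j
  calc wnf r (FT (sec (G j) z)) ≤ wsumH r (fun j => sec (G j) z) :=
        wnf_le_wsumH r (fun j => sec (G j) z) j
    _ ≤ ofReal C * wsumH r (skewOp (mulR volume fun i X => q i (X, z))
      fun j => sec (G j) z) := hC _ _ _ (hq z h3) _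
    _ ≤ ofReal C * ∑ j, ofReal C₀ * E := by
      refine mul_le_r (sum_le_sum fun j _ => ?_); rw [← h2]; exact h1 j
    _ = _ := by
      simp only [sum_const, card_univ, Fintype.card_sum, Fintype.card_fin,
        Fintype.card_unit, nsmul_eq_mul]
      rw [ofReal_mul hC0, ofReal_mul (by positivity), ofReal_add (by positivity) (by norm_num)]
      simp; ring

/-- The regularity estimate. -/
theorem IsSystem.exists_wnSum_le {C₀ : ℝ} (d : ℕ) (ht : (d : ℝ) / 2 < t) (ht2 : 1 / 2 ≤ t)
  (hK : 0 ≤ K) (hc : 0 < c) (hC₀ : 0 ≤ C₀) (hs : 0 ≤ s) (hst : s ≤ t + 1 / 2) :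
  ∃ C : ℝ, 0 ≤ C ∧ ∀ q J, IsSystem t K c q J → ∀ (G : Idx d → L2S d) (D : ℝ), 0 ≤ D →
    (∀ m : Hor d → ℝ, IsSymb m → (∀ ξ, 0 ≤ m ξ) → (∀ ξ, m ξ ≤ lam s ξ) →
      |(∑ j, inner ℂ (lift (fm m) (gradS q J G j)) (lift (fm m) (fluxS q J G j)) : ℂ).re| ≤
        D * √(∑ j, ‖lift (fm m) (gradS q J G j)‖ ^ 2)) →
    (∀ r, ∀ᵐ z ∂zvol, ∀ j, wnf (r - 1 / 2) (FT (sec (skewOp (fun i => mulS (q i)) G j : L2S d) z)) ≤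
        ofReal C₀ * wnSum r q J G) →
    wnSum s q J G ≤ ofReal (C * D ^ 2) := by
  obtain ⟨e, he0, he1, het⟩ : ∃ e, 0 < e ∧ e ≤ 1 ∧ d / 2 < t - e :=
    ⟨min 1 ((t - d / 2) / 2), by apply lt_min <;> linarith, min_le_left _ _, by
      have := min_le_right 1 ((t - d / 2) / 2); linarith⟩
  obtain ⟨C1, hC1, hstep⟩ := IsSystem.exists_step d hc
  have ind : ∀ j : ℕ, ∀ r, 0 ≤ r → r ≤ s → r ≤ j * e → ∃ C, 0 ≤ C ∧ ∀ q J, IsSystem t K c q J →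
    ∀ G D, 0 ≤ D →
    (∀ m, IsSymb m → (∀ ξ, 0 ≤ m ξ) → (∀ ξ, m ξ ≤ lam s ξ) →
      |(∑ j, inner ℂ (lift (fm m) (gradS q J G j)) (lift (fm m) (fluxS q J G j)) : ℂ).re| ≤
        D * √(∑ j, ‖lift (fm m) (gradS q J G j)‖ ^ 2)) →
    (∀ r, ∀ᵐ z ∂zvol, ∀ j, wnf (r - 1 / 2) (FT (sec (skewOp (fun i => mulS (q i)) G j : L2S d) z)) ≤
        ofReal C₀ * wnSum r q J G) →
    wnSum r q J G ≤ ofReal (C * D ^ 2) := by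
    intro j
    induction j with
    | zero =>
      intro r h0 _ h1
      have hr0 := le_antisymm (by simpa using h1) h0
      subst hr0; refine ⟨C1, hC1, fun q J hS G D hD0 hD _ => ?_⟩
      have h2 := hstep q J hS G 0 D 0 hD0 le_rfl
        (fun n => hD _ (isSymb_trunc 0 n) (trunc_nonneg 0 n) fun ξ =>
          (trunc_le 0 n ξ).trans (lam_mono hs ξ))
        (fun n i j => by
          obtain ⟨A, h, hq⟩ := hS.hq i
          rw [mulS, commS_zero hq hK, sub_self]; simp)
        (fun n j => by
          obtain ⟨A, h, hq⟩ := hS.hJ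
          rw [mulS, commS_zero hq hK, sub_self]; simp)
      rwa [add_zero] at h2
    | succ j ih =>
      intro r h0 hrs h2
      set e' := min e r with he'
      have hm1 : e' ≤ e := min_le_left _ _
      have hm2 : e' ≤ r := min_le_right _ _
      have hm0 := le_min he0.le h0
      obtain ⟨C2, hC2, hcm⟩ := exists_commS_le (d := d) hm0 hm2
        (hm1.trans he1) (by linarith) (hrs.trans hst) hK
      obtain ⟨C3, hC3, hsec⟩ := IsSystem.exists_sec_le (r := r - e' - 1 / 2) d ht
        (abs_le.2 ⟨by linarith, by linarith⟩) hK hC₀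
      obtain ⟨C4, hC4, h4⟩ := ih (r - e') (by linarith) (by linarith) (by
        push_cast at h2
        rcases le_total e r with h | h
        · rw [he', min_eq_left h]; linarith
        · rw [he', min_eq_right h, sub_self]; positivity)
      refine ⟨C1 * (1 + C2 * (C4 + C3 * C4)), by positivity, fun q J hS G D hD0 hD hZ => ?_⟩
      have hE := h4 q J hS G D hD0 hD hZ
      have hsec' := hsec c q J hS G (wnSum (r - e') q J G) (hZ (r - e'))
      have hbound : ∀ j, ofReal C2 * (wnS (r - e') (G j) + ofReal C3 * wnSum (r - e') q J G) ≤
        ofReal (C2 * (C4 + C3 * C4) * D ^ 2) := by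
        intro j
        rw [show C2 * (C4 + C3 * C4) * D ^ 2 = C2 * (C4 * D ^ 2 + C3 * (C4 * D ^ 2)) by ring,
          ofReal_mul hC2, ofReal_add (by positivity) (by positivity),
          ofReal_mul hC3]
        exact mul_le_r (add_le_add ((wnS_le_wnSum j).trans hE) (mul_le_r hE))
      have h5 := hstep q J hS G r D (C2 * (C4 + C3 * C4) * D ^ 2) hD0 (by positivity)
        (fun n => hD _ (isSymb_trunc r n) (trunc_nonneg r n) fun ξ =>
          (trunc_le r n ξ).trans (lam_mono hrs ξ))
        (fun n i j => by
          obtain ⟨A, h, hq⟩ := hS.hq i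
          refine (hcm _ A h hq (G j) _ ?_ n).trans (hbound j)
          filter_upwards [hsec'] with z hz using hz j)
        (fun n j => by
          obtain ⟨A, h, hq⟩ := hS.hJ
          refine (hcm _ A h hq (G j) _ ?_ n).trans (hbound j)
          filter_upwards [hsec'] with z hz using hz j)
      refine h5.trans (ofReal_le_ofReal (le_of_eq ?_)); ring
  obtain ⟨j, hj⟩ := exists_nat_ge (s / e)
  exact ind j s hs le_rfl (by rwa [div_le_iff₀ he0] at hj)

end

/-! ### Functions of the vertical variable -/

/-- The integral from `z` to the surface. -/
def up (y : ℝ → ℂ) (z : ℝ) : ℂ := ∫ w in Ioi z, y w ∂zvol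

/-- The integral from the bottom to `z`. -/
def dn (y : ℝ → ℂ) (z : ℝ) : ℂ := ∫ w in Iio z, y w ∂zvol

theorem integral_mul_up {p : ℝ → ℂ} (hp : Integrable p zvol) (hy : Integrable y zvol) :
  ∫ z, p z * up y z ∂zvol = ∫ w, y w * dn p w ∂zvol := by
  have hm : MeasurableSet {x : ℝ × ℝ | x.1 < x.2} := measurableSet_lt measurable_fst measurable_snd
  have hint : Integrable (Function.uncurry fun z w => (Ioi z).indicator (fun w => p z * y w) w)
    (zvol.prod zvol) := by
    refine ((hp.mul_prod hy).indicator hm).congr (.of_forall fun x => ?_)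
    simp only [Set.indicator_apply, Function.uncurry, Set.mem_ofPred_eq, mem_Ioi]
  have h1 : ∀ z, p z * up y z = ∫ w, (Ioi z).indicator (fun w => p z * y w) w ∂zvol := by
    intro z; rw [up, integral_indicator measurableSet_Ioi, integral_const_mul]
  have h2 : ∀ w, y w * dn p w = ∫ z, (Ioi z).indicator (fun w => p z * y w) w ∂zvol := by
    intro w; rw [dn, ← integral_const_mul, ← integral_indicator measurableSet_Iio]; congr 1; ext z
    simp only [Set.indicator_apply, mem_Ioi, Set.mem_Iio, mul_comm]
  simp_rw [h1, h2]; exact integral_integral_swap hint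

theorem enorm_setIntegral_sub_le (hy : Integrable y zvol) {A B : Set ℝ}
  (hA : MeasurableSet A) (hB : MeasurableSet B) :
  ‖(∫ w in A, y w ∂zvol) - ∫ w in B, y w ∂zvol‖ₑ ≤ ∫⁻ w in symmDiff A B, ‖y w‖ₑ ∂zvol := by
  rw [← integral_indicator hA, ← integral_indicator hB,
    ← integral_sub (hy.indicator hA) (hy.indicator hB), ← lintegral_indicator (hA.symmDiff hB)]
  refine (enorm_integral_le_lintegral_enorm _).trans (lintegral_mono fun w => ?_)
  by_cases h1 : w ∈ A <;> by_cases h2 : w ∈ B <;> simp [h1, h2, Set.mem_symmDiff]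

/-- The values of a function are controlled by its norm and the norm of its derivative. -/
theorem ofReal_mul_enorm_sq_le {F : ℂ} {f : ℝ → ℂ} {ℓ : ℝ} (hz : z ∈ Icc (-1 : ℝ) 0)
  (h1 : ℓ ≤ 1 / 2) (hy : AEMeasurable y zvol)
  (h : ∀ᵐ z' ∂zvol, ‖F - f z'‖ₑ ≤ ∫⁻ w in uIoc z z', ‖y w‖ₑ ∂zvol) :
  ofReal ℓ * ‖F‖ₑ ^ 2 ≤ 2 * ∫⁻ w, ‖f w‖ₑ ^ 2 ∂zvol +
    2 * ofReal ℓ ^ 2 * ∫⁻ w, ‖y w‖ₑ ^ 2 ∂zvol := by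
  obtain ⟨a, b, hab, ha, hb, hzz⟩ : ∃ a b : ℝ, b - a = ℓ ∧ -1 ≤ a ∧ b ≤ 0 ∧
    ∀ z' ∈ Ioo a b, uIoc z z' ⊆ Ioc a b := by
    rcases le_total z (-1 / 2) with hz2 | hz2
    · refine ⟨z, z + ℓ, by ring, hz.1, by linarith, fun z' hz' => ?_⟩; rw [uIoc_of_le hz'.1.le]
      exact Set.Ioc_subset_Ioc_right hz'.2.le
    · refine ⟨z - ℓ, z, by ring, by linarith, hz.2, fun z' hz' => ?_⟩; rw [Set.uIoc_of_ge hz'.2.le]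
      exact Set.Ioc_subset_Ioc_left hz'.1.le
  have hvol : zvol (Ioo a b) = ofReal ℓ := by
    rw [zvol, Measure.restrict_apply measurableSet_Ioo,
      Set.inter_eq_left.2 (Set.Ioo_subset_Ioo ha hb), Real.volume_Ioo, hab]
  have hvol' : zvol (Ioc a b) ≤ ofReal ℓ := by
    refine (Measure.restrict_apply_le _ _).trans ?_; rw [Real.volume_Ioc, hab]
  set T := ∫⁻ w, ‖y w‖ₑ ^ 2 ∂zvol
  have hcs : (∫⁻ w in Ioc a b, ‖y w‖ₑ ∂zvol) ^ 2 ≤ ofReal ℓ * T := by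
    have := lintegral_mul_sq_le (zvol.restrict (Ioc a b)) (f := fun _ => 1)
      aemeasurable_const hy.restrict.enorm
    simp only [one_mul, one_pow, lintegral_const, Measure.restrict_apply MeasurableSet.univ,
      Set.univ_inter] at this
    exact this.trans (mul_le_mul' hvol' (setLIntegral_le_lintegral _ _))
  calc ofReal ℓ * ‖F‖ₑ ^ 2 = ∫⁻ _ in Ioo a b, ‖F‖ₑ ^ 2 ∂zvol := by
        rw [setLIntegral_const, hvol, mul_comm]
    _ ≤ ∫⁻ z' in Ioo a b, (2 * ‖f z'‖ₑ ^ 2 + 2 * (ofReal ℓ * T)) ∂zvol := by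
      refine lintegral_mono_ae ?_
      filter_upwards [ae_restrict_of_ae h, ae_restrict_mem measurableSet_Ioo] with z' h2 h3
      have h4 : ‖F‖ₑ ≤ ‖f z'‖ₑ + ∫⁻ w in Ioc a b, ‖y w‖ₑ ∂zvol := by
        calc ‖F‖ₑ = ‖f z' + (F - f z')‖ₑ := by congr 1; ring
          _ ≤ ‖f z'‖ₑ + ‖F - f z'‖ₑ := enorm_add_le _ _
          _ ≤ _ := add_le_add le_rfl (h2.trans (lintegral_mono_set (hzz z' h3)))
      refine (pow_le_pow_left' h4 2).trans ((add_sq_le_two _ _).trans ?_); rw [mul_add]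
      exact add_le_add le_rfl (mul_le_r hcs)
    _ ≤ _ := by
      rw [lintegral_add_right _ measurable_const, setLIntegral_const, hvol, lintegral_cmul]
      refine add_le_add (mul_le_r (setLIntegral_le_lintegral _ _)) (le_of_eq ?_); ring

theorem enorm_up_sub_le (hy : Integrable y zvol) (z z' : ℝ) :
  ‖up y z - up y z'‖ₑ ≤ ∫⁻ w in uIoc z z', ‖y w‖ₑ ∂zvol := by
  refine (enorm_setIntegral_sub_le hy measurableSet_Ioi measurableSet_Ioi).trans
    (lintegral_mono_set fun w hw => ?_)
  rw [Set.mem_symmDiff] at hw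
  simp only [mem_Ioi, not_lt] at hw
  rw [Set.mem_uIoc]
  tauto

theorem enorm_dn_sub_le (hy : Integrable y zvol) (z z' : ℝ) :
  ‖dn y z - dn y z'‖ₑ ≤ ∫⁻ w in uIoc z z', ‖y w‖ₑ ∂zvol := by
  have e : ∀ z, dn y z = ∫ w in Set.Iic z, y w ∂zvol := fun z =>
    setIntegral_congr_set (by
      have : zvol ≪ volume := Measure.absolutelyContinuous_of_le Measure.restrict_le_self
      exact this.ae_eq Iio_ae_eq_Iic)
  rw [e, e]
  refine (enorm_setIntegral_sub_le hy measurableSet_Iic measurableSet_Iic).trans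
    (lintegral_mono_set fun w hw => ?_)
  rw [Set.mem_symmDiff] at hw
  simp only [Set.mem_Iic, not_le] at hw
  rw [Set.mem_uIoc]
  tauto

theorem up_neg_one (y : ℝ → ℂ) : up y (-1) = ∫ w, y w ∂zvol := by
  rw [up, Measure.restrict_eq_self_of_ae_mem]
  filter_upwards [ae_zvol_mem] with z hz using hz.1

/-- The estimate of the trace at the bottom at a fixed frequency. -/
theorem trace_le (hy : Integrable y zvol) {a : ℝ} (ha : 0 ≤ a) :
  ofReal (1 + a) * ‖∫ w, y w ∂zvol‖ₑ ^ 2 ≤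
    3 * (∫⁻ w, ‖y w‖ₑ ^ 2 ∂zvol + ∫⁻ z, ‖(a : ℂ) * up y z‖ₑ ^ 2 ∂zvol) := by
  set Y := ∫⁻ w, ‖y w‖ₑ ^ 2 ∂zvol with hY
  set X := ∫⁻ z, ‖a * up y z‖ₑ ^ 2 ∂zvol with hX
  set t := ∫ w, y w ∂zvol with ht
  have h1 : ‖t‖ₑ ^ 2 ≤ Y := by
    have := lintegral_mul_sq_le zvol (f := fun _ => 1) aemeasurable_const
      hy.aestronglyMeasurable.aemeasurable.enorm
    have hv : zvol univ = 1 := by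
      rw [zvol, Measure.restrict_apply MeasurableSet.univ, Set.univ_inter, Real.volume_Ioo]
      norm_num
    simp only [one_mul, one_pow, lintegral_const, hv] at this
    exact (pow_le_pow_left' (enorm_integral_le_lintegral_enorm _) 2).trans this
  have h2 : ofReal a * ‖t‖ₑ ^ 2 ≤ 2 * (Y + X) := by
    rcases le_total a 2 with h | h
    · calc ofReal a * ‖t‖ₑ ^ 2 ≤ ofReal 2 * Y := mul_le_mul' (ofReal_le_ofReal h) h1
        _ ≤ _ := by rw [ofReal_ofNat]; exact mul_le_r le_self_add
    · have ha0 : 0 < a := by linarith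
      have h3 := ofReal_mul_enorm_sq_le (F := t) ⟨le_rfl, by norm_num⟩
        (one_div_le_one_div_of_le (by norm_num) h) hy.aestronglyMeasurable.aemeasurable
        (.of_forall fun z' => by rw [ht, ← up_neg_one]; exact enorm_up_sub_le hy _ _)
      have e1 : ofReal a ^ 2 * ofReal (1 / a) = ofReal a := by
        rw [← ofReal_pow ha, ← ofReal_mul (by positivity)]; congr 1; field_simp
      have e2 : ofReal a ^ 2 * ofReal (1 / a) ^ 2 = 1 := by
        rw [← mul_pow, ← ofReal_mul ha, mul_one_div_cancel ha0.ne']; simp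
      have e3 : X = ofReal a ^ 2 * ∫⁻ z, ‖up y z‖ₑ ^ 2 ∂zvol := by
        rw [← lintegral_cmul]; refine lintegral_congr fun z => ?_
        rw [enorm_mul, mul_pow, ← ofReal_norm, norm_real, norm_of_nonneg ha]
      calc ofReal a * ‖t‖ₑ ^ 2
            = ofReal a ^ 2 * (ofReal (1 / a) * ‖t‖ₑ ^ 2) := by rw [← mul_assoc, e1]
        _ ≤ _ := mul_le_r h3
        _ = 2 * (ofReal a ^ 2 * ∫⁻ z, ‖up y z‖ₑ ^ 2 ∂zvol) +
          2 * (ofReal a ^ 2 * ofReal (1 / a) ^ 2) * Y := by rw [← hY]; ring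
        _ = 2 * (Y + X) := by rw [e2, ← e3]; ring
  rw [ofReal_add zero_le_one ha, add_mul, ofReal_one, one_mul]
  calc _ ≤ Y + 2 * (Y + X) := add_le_add h1 h2
    _ ≤ Y + X + 2 * (Y + X) := add_le_add le_self_add le_rfl
    _ = _ := by ring

/-! ### The Fourier transform on the strip -/

theorem lift_FT_coe (u : L2S d) : ∀ᵐ z ∂zvol, (fun ξ => lift FT u (ξ, z)) =ᵐ[volume] FT (sec u z) := by
  filter_upwards [ae_sec_coe (Lp.memLp (lift FT u)), sec_lift FT u] with z h1 h2
  rw [← h2]; exact h1.symm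

theorem ae_memLp_vert (hu : MemLp u 2 (volS d)) :
  ∀ᵐ ξ : Hor d, MemLp (fun z => u (ξ, z)) 2 zvol := by
  have hm := hu.1
  rw [volS_eq] at hm
  have h1 : ∫⁻ ξ, (∫⁻ z, ‖u (ξ, z)‖ₑ ^ 2 ∂zvol) < ⊤ := by
    rw [← lintegral_volS' (f := fun p => ‖u p‖ₑ ^ 2) (by exact hu.1.aemeasurable.enorm.pow_const 2)]
    exact (memLp_two_iff hu.1).1 hu
  have h2 := (hm.aemeasurable.enorm.pow_const 2).lintegral_prod_right'
  filter_upwards [hm.prodMk_left, ae_lt_top' h2 h1.ne] with ξ h3 h4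
  rw [memLp_two_iff h3]; exact h4

theorem wnS_eq (r : ℝ) (u : L2S d) :
  wnS r u = ∫⁻ ξ, el r ξ ^ 2 * ∫⁻ z, ‖lift FT u (ξ, z)‖ₑ ^ 2 ∂zvol := by
  have hm := measurable_Lp (lift FT u)
  have hm2 : Measurable fun p => (el r p.1 * ‖lift FT u p‖ₑ) ^ 2 :=
    (((measurable_el r).comp measurable_fst).mul hm.enorm).pow_const 2
  calc wnS r u = ∫⁻ z, (∫⁻ ξ, (el r ξ * ‖lift FT u (ξ, z)‖ₑ) ^ 2) ∂zvol := by
        apply lintegral_congr_ae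
        filter_upwards [lift_FT_coe u] with z hz
        apply lintegral_congr_ae
        filter_upwards [hz] with ξ hξ
        rw [hξ]
    _ = ∫⁻ ξ, (∫⁻ z, (el r ξ * ‖lift FT u (ξ, z)‖ₑ) ^ 2 ∂zvol) := by
      rw [← lintegral_volS hm2.aemeasurable, ← lintegral_volS' hm2.aemeasurable]
    _ = _ := by
      refine lintegral_congr fun ξ => ?_
      simp_rw [mul_pow]; rw [lintegral_const_mul' _ _ (by exact pow_ne_top (el_ne_top r ξ))]

theorem inner_lift_FT (u v : L2S d) : inner ℂ (lift FT u) (lift FT v) = inner ℂ u v := by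
  rw [inner_lift_left (T' := FTi) inner_FT_left, ← lift_comp]; congr 1; apply eq_of_sec_eq
  filter_upwards [sec_lift (FTi ∘L FT) v] with z hz
  rw [hz]; simp

theorem lift_FT_fm (hm : IsSymb m) (u : L2S d) :
  lift FT (lift (fm m) u) =ᵐ[volS d] fun p => (m p.1 : ℂ) * lift FT u p := by
  have hb : IsBdd (volS d) fun p => (m p.1) := by
    obtain ⟨h1, C, hC⟩ := hm
    exact ⟨(measurable_ofReal.comp (h1.comp measurable_fst)).aestronglyMeasurable, C,
      .of_forall fun p => by simpa using hC p.1⟩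
  have e : lift FT (lift (fm m) u) = mulOp (volS d) (fun p => (m p.1)) (lift FT u) := by
    apply eq_of_sec_eq
    filter_upwards [sec_lift FT (lift (fm m) u), sec_lift (fm m) u, sec_mulOp hb (lift FT u),
      sec_lift FT u] with z h1 h2 h3 h4
    rw [h1, h2, h3, h4]; simp [fm]
  rw [e]; exact mulOp_coe hb _

/-- The Fourier transform of the scaled gradient of a function that vanishes at the surface. -/
def IsFourierGrad (μ : ℝ) (W : Idx d → L2S d) : Prop :=
  ∀ i, ∀ᵐ p ∂volS d, lift FT (W (inl i)) p = -(2 * π * √μ * p.1 i * I) *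
    up (fun z => lift FT (W (inr ())) (p.1, z)) p.2

/-- The Fourier transform of a flux without divergence, with vertical component `b` at the
bottom. -/
def IsFourierFlux (μ : ℝ) (b : Hor d → ℂ) (F : Idx d → L2S d) : Prop :=
  ∀ᵐ p ∂volS d, lift FT (F (inr ())) p = b p.1 -
    dn (fun z => ∑ i, (2 * π * √μ * p.1 i * I) * lift FT (F (inl i)) (p.1, z)) p.2

theorem sum_sq_coord (μ : ℝ) (ξ : Hor d) :
  ∑ i, (2 * π * √μ * ξ i) ^ 2 = (√μ * absD ξ) ^ 2 := by
  have : ‖ξ‖ ^ 2 = ∑ i, ξ i ^ 2 := by rw [EuclideanSpace.norm_sq_eq]; simp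
  simp_rw [mul_pow, absD]; rw [← mul_sum, ← this]; ring

theorem enorm_coord_mul (μ : ℝ) (ξ : Hor d) (i : Fin d) (x : ℂ) :
  ‖(2 * π * √μ * ξ i * I) * x‖ₑ ^ 2 = ofReal ((2 * π * √μ * ξ i) ^ 2) * ‖x‖ₑ ^ 2 := by
  have e : (2 * π * √μ * ξ i * I) = ((2 * π * √μ * ξ i : ℝ)) * I := by push_cast; ring
  rw [e, enorm_mul, enorm_mul, ← ofReal_norm, ← ofReal_norm I, norm_real,
    norm_I, ofReal_one, mul_one, mul_pow, ← ofReal_pow (norm_nonneg _),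
    norm_eq_abs, sq_abs]

theorem IsFourierGrad.trace_le (hW : IsFourierGrad μ W) :
  ∀ᵐ ξ : Hor d, ofReal (1 + √μ * absD ξ) * ‖∫ z, lift FT (W (inr ())) (ξ, z) ∂zvol‖ₑ ^ 2 ≤
    3 * ∑ j, ∫⁻ z, ‖lift FT (W j) (ξ, z)‖ₑ ^ 2 ∂zvol := by
  have h1 : ∀ᵐ ξ, ∀ i, ∀ᵐ z ∂zvol, lift FT (W (inl i)) (ξ, z) = -(2 * π * √μ * ξ i * I) *
    up (fun z => lift FT (W (inr ())) (ξ, z)) z := by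
    rw [ae_all_iff]; exact fun i => ae_ae_of_ae_volS' (hW i)
  filter_upwards [h1, ae_memLp_vert (Lp.memLp (lift FT (W (inr ()))))] with ξ h2 h3
  have h4 := FlatStrip.trace_le (h3.integrable one_le_two) (a := √μ * absD ξ)
    (mul_nonneg (sqrt_nonneg _) (absD_nonneg ξ))
  refine h4.trans (mul_le_r (le_of_eq ?_)); rw [Fintype.sum_sum_type, add_comm]
  simp only [univ_unique, sum_singleton]; congr 1
  have hmeas : ∀ i, AEMeasurable (fun z => ‖lift FT (W (inl i)) (ξ, z)‖ₑ ^ 2) zvol :=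
    fun i => ((Lp.stronglyMeasurable (lift FT (W (inl i)))).measurable.comp
      measurable_prodMk_left).enorm.pow_const 2 |>.aemeasurable
  rw [← lintegral_finsetSum' _ fun i _ => hmeas i]; apply lintegral_congr_ae
  filter_upwards [ae_all_iff.2 h2] with z hz
  have e : ∀ i, ‖lift FT (W (inl i)) (ξ, z)‖ₑ ^ 2 = ofReal ((2 * π * √μ * ξ i) ^ 2) *
    ‖up (fun z => lift FT (W (inr ())) (ξ, z)) z‖ₑ ^ 2 := fun i => by
    rw [hz i, neg_mul, enorm_neg, enorm_coord_mul]
  simp_rw [e]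
  rw [← sum_mul, ← ofReal_sum_of_nonneg fun _ _ => sq_nonneg _,
    sum_sq_coord μ, enorm_mul, mul_pow, ← ofReal_norm, norm_real, norm_eq_abs,
    ← ofReal_pow (abs_nonneg _), sq_abs]

/-- The energy identity at a fixed frequency. -/
theorem IsFourierGrad.energy
  (hW : IsFourierGrad μ W) (hF : IsFourierFlux μ b F) :
  ∀ᵐ ξ : Hor d, ∑ j, ∫ z, lift FT (F j) (ξ, z) * conj (lift FT (W j) (ξ, z)) ∂zvol =
    b ξ * conj (∫ z, lift FT (W (inr ())) (ξ, z) ∂zvol) := by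
  have h1 : ∀ᵐ ξ, ∀ i, ∀ᵐ z ∂zvol, lift FT (W (inl i)) (ξ, z) = -(2 * π * √μ * ξ i * I) *
    up (fun z => lift FT (W (inr ())) (ξ, z)) z := by
    rw [ae_all_iff]; exact fun i => ae_ae_of_ae_volS' (hW i)
  have hm : ∀ V : Idx d → L2S d, ∀ᵐ ξ, ∀ j, MemLp (fun z => lift FT (V j) (ξ, z)) 2 zvol := by
    intro V; rw [ae_all_iff]; exact fun j => ae_memLp_vert (Lp.memLp _)
  filter_upwards [h1, ae_ae_of_ae_volS' hF, hm W, hm F] with ξ h2 h3 h4 h5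
  set y : ℝ → ℂ := fun z => lift FT (W (inr ())) (ξ, z) with hy
  set f : Fin d → ℝ → ℂ := fun i z => lift FT (F (inl i)) (ξ, z) with hf
  set p : ℝ → ℂ := fun z => ∑ i, (2 * π * √μ * ξ i * I) * f i z with hp
  have hyi : Integrable y zvol := (h4 _).integrable one_le_two
  have hfi : ∀ i, Integrable (f i) zvol := fun i => (h5 _).integrable one_le_two
  have hpi : Integrable p zvol := integrable_finsetSum _ fun i _ => (hfi i).const_mul _
  have hyc : Integrable (fun z => conj (y z)) zvol := by
    have := conjCLE.toContinuousLinearMap.integrable_comp hyi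
    exact this
  have hupc : ∀ z, up (fun z => conj (y z)) z = conj (up y z) := fun z => integral_conj
  rw [Fintype.sum_sum_type]; simp only [univ_unique, sum_singleton]
  have e1 : ∀ i, ∫ z, lift FT (F (inl i)) (ξ, z) * conj (lift FT (W (inl i)) (ξ, z)) ∂zvol =
    ∫ z, ((2 * π * √μ * ξ i * I) * f i z) * conj (up y z) ∂zvol := by
    intro i; apply integral_congr_ae
    filter_upwards [h2 i] with z hz
    rw [hz]; simp only [map_mul, map_neg, conj_ofReal, Complex.conj_I, map_ofNat, hf]; ring
  have hupb : ∀ z, ‖up y z‖ ≤ ∫ w, ‖y w‖ ∂zvol := fun z =>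
    (norm_integral_le_integral_norm _).trans
      (setIntegral_le_integral hyi.norm (.of_forall fun _ => norm_nonneg _))
  have hupm : AEStronglyMeasurable (up y) zvol := by
    have hym : StronglyMeasurable y := (Lp.stronglyMeasurable (lift FT (W (inr ())))).comp_measurable
      measurable_prodMk_left
    have e : up y = fun z => ∫ w, (if z < w then y w else 0) ∂zvol := by
      funext z
      rw [up, ← integral_indicator measurableSet_Ioi]; congr 1
    rw [e]; refine (StronglyMeasurable.integral_prod_right ?_).aestronglyMeasurable
    exact StronglyMeasurable.ite (measurableSet_lt measurable_fst measurable_snd)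
      (hym.comp_measurable measurable_snd) stronglyMeasurable_const
  have hupi : ∀ g, Integrable g zvol →
    Integrable (fun z => g z * conj (up y z)) zvol := fun g hg =>
    hg.mul_bdd (continuous_conj.comp_aestronglyMeasurable hupm)
      (.of_forall fun z => by simpa using hupb z)
  have e2 : ∑ i, ∫ z, lift FT (F (inl i)) (ξ, z) * conj (lift FT (W (inl i)) (ξ, z)) ∂zvol =
    ∫ z, conj (y z) * dn p z ∂zvol := by
    simp_rw [e1]
    rw [← integral_finsetSum _ fun i _ => hupi _ ((hfi i).const_mul _), ← integral_mul_up hpi hyc]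
    apply integral_congr_ae (.of_forall fun z => ?_); simp only [hp, hupc, sum_mul]
  have hdnb : ∀ z, ‖dn p z‖ ≤ ∫ w, ‖p w‖ ∂zvol := fun z =>
    (norm_integral_le_integral_norm _).trans
      (setIntegral_le_integral hpi.norm (.of_forall fun _ => norm_nonneg _))
  have hpm : StronglyMeasurable p := by
    refine Finset.stronglyMeasurable_fun_sum _ fun i _ => StronglyMeasurable.const_mul ?_ _
    exact (Lp.stronglyMeasurable (lift FT (F (inl i)))).comp_measurable measurable_prodMk_left
  have hdnm : AEStronglyMeasurable (dn p) zvol := by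
    have e : dn p = fun z => ∫ w, (if w < z then p w else 0) ∂zvol := by
      funext z
      rw [dn, ← integral_indicator measurableSet_Iio]; congr 1
    rw [e]; refine (StronglyMeasurable.integral_prod_right ?_).aestronglyMeasurable
    exact StronglyMeasurable.ite (measurableSet_lt measurable_snd measurable_fst)
      (hpm.comp_measurable measurable_snd) stronglyMeasurable_const
  have hdni := hyc.mul_bdd hdnm (.of_forall hdnb)
  have e3 : ∫ z, lift FT (F (inr ())) (ξ, z) * conj (lift FT (W (inr ())) (ξ, z)) ∂zvol =
    b ξ * conj (∫ z, y z ∂zvol) - ∫ z, conj (y z) * dn p z ∂zvol := by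
    rw [← integral_conj, ← integral_const_mul, ← integral_sub (hyc.const_mul _) hdni]
    apply integral_congr_ae
    filter_upwards [h3] with z hz
    rw [hz]; simp only [hy, hp, hf]; ring
  rw [e2]; exact (congrArg _ e3).trans (add_sub_cancel _ _)

theorem integrable_volS_left (h : Integrable f (volS d)) :
  Integrable fun ξ : Hor d => ∫ z, f (ξ, z) ∂zvol := by
  rw [volS_eq] at h
  exact h.integral_prod_left

theorem enorm_lift_FT (u : L2S d) : ‖lift FT u‖ₑ = ‖u‖ₑ := by
  have := inner_lift_FT u u
  rw [inner_self_eq_norm_sq_to_K, inner_self_eq_norm_sq_to_K] at this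
  have h2 : ‖lift FT u‖ ^ 2 = ‖u‖ ^ 2 := by exact_mod_cast this
  rw [← ofReal_norm, ← ofReal_norm, (sq_eq_sq₀ (norm_nonneg _) (norm_nonneg _)).1 h2]

theorem enorm_sq_lift_fm (hm : IsSymb m) (hm0 : ∀ ξ, 0 ≤ m ξ) (u : L2S d) :
  ‖lift (fm m) u‖ₑ ^ 2 = ∫⁻ ξ, ofReal (m ξ) ^ 2 * ∫⁻ z, ‖lift FT u (ξ, z)‖ₑ ^ 2 ∂zvol := by
  have hu := measurable_Lp (lift FT u)
  have hmeas : Measurable fun p => ‖(m p.1) * lift FT u p‖ₑ ^ 2 :=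
    ((measurable_ofReal.comp (hm.1.comp measurable_fst)).mul hu).enorm.pow_const 2
  have h1 : ∫⁻ p, ‖lift FT (lift (fm m) u) p‖ₑ ^ 2 ∂volS d =
    ∫⁻ p, ‖(m p.1) * lift FT u p‖ₑ ^ 2 ∂volS d := by
    apply lintegral_congr_ae
    filter_upwards [lift_FT_fm hm u] with p hp
    rw [hp]
  rw [← enorm_lift_FT, enorm_sq_eq_lintegral, h1, lintegral_volS' hmeas.aemeasurable]
  refine lintegral_congr fun ξ => ?_
  rw [← lintegral_cmul]; refine lintegral_congr fun z => ?_
  rw [enorm_mul, mul_pow, ← ofReal_norm (m ξ : ℂ), norm_real, norm_of_nonneg (hm0 ξ)]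

theorem inner_lift_fm (hm : IsSymb m) (u v : L2S d) :
  inner ℂ (lift (fm m) u) (lift (fm m) v) = ∫ ξ, ((m ξ ^ 2 : ℝ) : ℂ) *
    (∫ z, lift FT v (ξ, z) * conj (lift FT u (ξ, z)) ∂zvol) ∧
  Integrable (fun ξ => ((m ξ ^ 2 : ℝ) : ℂ) *
    (∫ z, lift FT v (ξ, z) * conj (lift FT u (ξ, z)) ∂zvol)) := by
  have hi := L2.integrable_inner (𝕜 := ℂ) (lift FT (lift (fm m) u)) (lift FT (lift (fm m) v))
  have hcongr : (fun p => inner ℂ (lift FT (lift (fm m) u) p) (lift FT (lift (fm m) v) p))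
    =ᵐ[volS d] fun p => ((m p.1 ^ 2 : ℝ)) * (lift FT v p * conj (lift FT u p)) := by
    filter_upwards [lift_FT_fm hm u, lift_FT_fm hm v] with p h1 h2
    rw [h1, h2, RCLike.inner_apply]; simp only [map_mul, conj_ofReal]; push_cast; ring
  have hi' := hi.congr hcongr
  constructor
  · rw [← inner_lift_FT, L2.inner_def, integral_congr_ae hcongr, integral_volS' hi']
    refine integral_congr_ae (.of_forall fun ξ => ?_)
    exact integral_const_mul ((m ξ ^ 2 : ℝ) : ℂ) _
  · refine (integrable_volS_left hi').congr (.of_forall fun ξ => ?_)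
    exact integral_const_mul ((m ξ ^ 2 : ℝ) : ℂ) _

theorem IsFourierGrad.lintegral_trace_le (hW : IsFourierGrad μ W) (hm : IsSymb m) (hm0 : ∀ ξ, 0 ≤ m ξ) :
  ∫⁻ ξ, (ofReal (m ξ * √(1 + √μ * absD ξ)) * ‖∫ z, lift FT (W (inr ())) (ξ, z) ∂zvol‖ₑ) ^ 2 ≤
    3 * ∑ j, ‖lift (fm m) (W j)‖ₑ ^ 2 := by
  have hWm : ∀ j, Measurable fun p => lift FT (W j) p := fun j => measurable_Lp _
  have hmeas2 : ∀ j, Measurable fun ξ => ofReal (m ξ) ^ 2 *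
    ∫⁻ z, ‖lift FT (W j) (ξ, z)‖ₑ ^ 2 ∂zvol := fun j =>
    (hm.1.ennreal_ofReal.pow_const 2).mul ((hWm j).enorm.pow_const 2).lintegral_prod_right'
  simp_rw [enorm_sq_lift_fm hm hm0]
  rw [← lintegral_finsetSum _ fun j _ => hmeas2 j, ← lintegral_cmul]; apply lintegral_mono_ae
  filter_upwards [hW.trace_le] with ξ hξ
  have hpos : 0 ≤ 1 + √μ * absD ξ := by have := mul_nonneg (sqrt_nonneg μ) (absD_nonneg ξ); linarith
  have e2 : ofReal (m ξ * √(1 + √μ * absD ξ)) ^ 2 =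
    ofReal (m ξ) ^ 2 * ofReal (1 + √μ * absD ξ) := by
    rw [ofReal_mul (hm0 ξ), mul_pow, ← ofReal_pow (sqrt_nonneg _), sq_sqrt hpos]
  rw [mul_pow, e2, mul_assoc, ← mul_sum]; refine (mul_le_r hξ).trans (le_of_eq (by ring))

/-- The energy estimate with a Fourier multiplier. -/
theorem IsFourierGrad.enorm_inner_le
  (hW : IsFourierGrad μ W) (hF : IsFourierFlux μ b F) (hb : AEMeasurable b) (hm : IsSymb m) (hm0 : ∀ ξ, 0 ≤ m ξ) (hms : ∀ ξ, m ξ ≤ lam s ξ) :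
  ‖∑ j, inner ℂ (lift (fm m) (W j)) (lift (fm m) (F j))‖ₑ ^ 2 ≤
    (∫⁻ ξ, ‖((lam s ξ * (1 / √(1 + √μ * absD ξ)) : ℝ) : ℂ) * b ξ‖ₑ ^ 2) *
      (3 * ∑ j, ‖lift (fm m) (W j)‖ₑ ^ 2) := by
  set T : Hor d → ℂ := fun ξ => ∫ z, lift FT (W (inr ())) (ξ, z) ∂zvol with hT
  have hTm : StronglyMeasurable T := (Lp.stronglyMeasurable _).integral_prod_right'
  have hmm := hm.1
  have hsum : ∑ j, inner ℂ (lift (fm m) (W j)) (lift (fm m) (F j)) =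
    ∫ ξ, ((m ξ ^ 2 : ℝ)) * (b ξ * conj (T ξ)) := by
    rw [sum_congr rfl fun j _ => (inner_lift_fm hm (W j) (F j)).1,
      ← integral_finsetSum _ fun j _ => (inner_lift_fm hm (W j) (F j)).2]
    apply integral_congr_ae
    filter_upwards [hW.energy hF] with ξ h1
    rw [← mul_sum, h1]
  have hpos : ∀ ξ : Hor d, 0 < 1 + √μ * absD ξ := fun ξ => by
    have := mul_nonneg (sqrt_nonneg μ) (absD_nonneg ξ); linarith
  have htr := hW.lintegral_trace_le hm hm0
  rw [hsum]; refine (pow_le_pow_left' (enorm_integral_le_lintegral_enorm _) 2).trans ?_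
  have hle : ∀ ξ, ‖((m ξ ^ 2 : ℝ)) * (b ξ * conj (T ξ))‖ₑ ≤
    ‖((lam s ξ * (1 / √(1 + √μ * absD ξ)) : ℝ)) * b ξ‖ₑ *
      (ofReal (m ξ * √(1 + √μ * absD ξ)) * ‖T ξ‖ₑ) := by
    intro ξ
    have hsq := sqrt_pos.2 (hpos ξ)
    rw [enorm_mul, enorm_mul, enorm_mul, RCLike.enorm_conj, ← ofReal_norm, norm_real,
      norm_of_nonneg (sq_nonneg _), ← ofReal_norm (((lam s ξ * (1 / √(1 + √μ * absD ξ)) : ℝ) : ℂ)),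
      norm_real, norm_of_nonneg (mul_nonneg (lam_pos s ξ).le (by positivity))]
    calc _ ≤ ofReal ((lam s ξ * (1 / √(1 + √μ * absD ξ))) * (m ξ * √(1 + √μ * absD ξ))) *
          (‖b ξ‖ₑ * ‖T ξ‖ₑ) := by
          refine mul_le_l (ofReal_le_ofReal ?_)
          have : (lam s ξ * (1 / √(1 + √μ * absD ξ))) * (m ξ * √(1 + √μ * absD ξ)) =
            lam s ξ * m ξ := by field_simp
          rw [this, sq]; exact mul_le_mul_of_nonneg_right (hms ξ) (hm0 ξ)
      _ = _ := by rw [ofReal_mul (mul_nonneg (lam_pos s ξ).le (by positivity))]; ring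
  refine (pow_le_pow_left' (lintegral_mono hle) 2).trans
    ((lintegral_mul_sq_le _ ?_ ?_).trans (mul_le_r htr))
  · have h1 : Measurable fun ξ : Hor d => ((lam s ξ * (1 / √(1 + √μ * absD ξ)) : ℝ) : ℂ) := by
      fun_prop
    exact (h1.aemeasurable.mul hb).enorm
  · have h1 : Measurable fun ξ => ofReal (m ξ * √(1 + √μ * absD ξ)) := by fun_prop
    exact (h1.mul hTm.measurable.enorm).aemeasurable

/-- The bound at almost every height, from the bound at almost every frequency. -/
theorem ae_wnf_le_of_ae {u : L2S d} {R : Hor d → ℝ≥0∞} (hR : Measurable R)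
  (h : ∀ᵐ ξ : Hor d, ∀ᵐ z ∂zvol, (el r ξ * ‖lift FT u (ξ, z)‖ₑ) ^ 2 ≤ R ξ) :
  ∀ᵐ z ∂zvol, wnf r (FT (sec u z)) ≤ ∫⁻ ξ, R ξ := by
  have hm :=
    (((measurable_el r).comp measurable_fst).mul (measurable_Lp (lift FT u)).enorm).pow_const 2
  have h' := (Measure.ae_ae_comm (p := fun ξ z => (el r ξ * ‖lift FT u (ξ, z)‖ₑ) ^ 2 ≤ R ξ)
    (measurableSet_le hm (hR.comp measurable_fst))).1 h
  filter_upwards [h', lift_FT_coe u] with z h1 h2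
  unfold wnf; apply lintegral_mono_ae
  filter_upwards [h1, h2] with ξ h3 h4
  rwa [← h4]

theorem el_mul_enorm_sq_le {ξ : Hor d} {F : ℂ} {f : ℝ → ℂ}
  (hz : z ∈ Icc (-1 : ℝ) 0) (hy : AEMeasurable y zvol)
  (h : ∀ᵐ z' ∂zvol, ‖F - f z'‖ₑ ≤ ∫⁻ w in uIoc z z', ‖y w‖ₑ ∂zvol) :
  (el (r - 1 / 2) ξ * ‖F‖ₑ) ^ 2 ≤ 4 * (el r ξ ^ 2 * ∫⁻ w, ‖f w‖ₑ ^ 2 ∂zvol) +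
    el (r - 1) ξ ^ 2 * ∫⁻ w, ‖y w‖ₑ ^ 2 ∂zvol := by
  have hl := lam_one_le ξ
  have h1 := ofReal_mul_enorm_sq_le (ℓ := lam (-1) ξ / 2) hz
    (by have := lam_le_one (r := -1) (by norm_num) ξ; linarith) hy h
  have e1 : 2 * ofReal (lam (-1) ξ / 2) = el (-1) ξ := by
    rw [← ofReal_ofNat, ← ofReal_mul (by norm_num), el]; congr 1; ring
  calc (el (r - 1 / 2) ξ * ‖F‖ₑ) ^ 2
        = el r ξ ^ 2 * (2 * (ofReal (lam (-1) ξ / 2) * ‖F‖ₑ ^ 2)) := by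
          rw [← mul_assoc 2, e1, mul_pow, ← mul_assoc]; congr 1
          rw [sq, sq, ← el_add, ← el_add, ← el_add]; congr 1; ring
    _ ≤ el r ξ ^ 2 * (2 * (2 * ∫⁻ w, ‖f w‖ₑ ^ 2 ∂zvol +
      2 * ofReal (lam (-1) ξ / 2) ^ 2 * ∫⁻ w, ‖y w‖ₑ ^ 2 ∂zvol)) := mul_le_r (mul_le_r h1)
    _ = 4 * (el r ξ ^ 2 * ∫⁻ w, ‖f w‖ₑ ^ 2 ∂zvol) + el r ξ ^ 2 *
      (2 * ofReal (lam (-1) ξ / 2)) ^ 2 * ∫⁻ w, ‖y w‖ₑ ^ 2 ∂zvol := by ring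
    _ = _ := by rw [e1]; congr 2; rw [← mul_pow, ← el_add]; rfl

theorem coord_sq_le (hμ : 0 ≤ μ) (ξ : Hor d) (i : Fin d) :
  el (-1) ξ ^ 2 * ofReal ((2 * π * √μ * ξ i) ^ 2) ≤ ofReal μ := by
  have h1 : (2 * π * √μ * ξ i) ^ 2 ≤ μ * lam 1 ξ ^ 2 := by
    calc (2 * π * √μ * ξ i) ^ 2 ≤ ∑ i, (2 * π * √μ * ξ i) ^ 2 :=
          single_le_sum (f := fun i => (2 * π * √μ * ξ i) ^ 2) (fun _ _ => sq_nonneg _) (mem_univ i)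
      _ = μ * absD ξ ^ 2 := by rw [sum_sq_coord, mul_pow, sq_sqrt hμ]
      _ ≤ _ := by
        have := absD_le_lam ξ
        have := absD_nonneg ξ
        gcongr
  calc _ ≤ el (-1) ξ ^ 2 * ofReal (μ * lam 1 ξ ^ 2) := mul_le_r (ofReal_le_ofReal h1)
    _ = ofReal μ * (el 1 ξ * el (-1) ξ) ^ 2 := by
      rw [ofReal_mul hμ, ofReal_pow (lam_pos 1 ξ).le, el, el]; ring
    _ = _ := by rw [el_mul_el_neg]; simp

theorem measurable_lintegral_vert (u : L2S d) :
  Measurable fun ξ : Hor d => ∫⁻ z, ‖lift FT u (ξ, z)‖ₑ ^ 2 ∂zvol :=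
  ((measurable_Lp (lift FT u)).enorm.pow_const 2).lintegral_prod_right'

theorem IsFourierGrad.ae_wnf_le (hμ : 0 ≤ μ) (hW : IsFourierGrad μ W)
  (r : ℝ) (i : Fin d) :
  ∀ᵐ z ∂zvol, wnf (r - 1 / 2) (FT (sec (W (inl i)) z)) ≤
    ofReal (4 + μ) * (wnS r (W (inl i)) + wnS r (W (inr ()))) := by
  have hmeas1 : ∀ j, Measurable fun ξ : Hor d =>
    el r ξ ^ 2 * ∫⁻ w, ‖lift FT (W j) (ξ, w)‖ₑ ^ 2 ∂zvol := fun j =>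
    ((measurable_el r).pow_const 2).mul (measurable_lintegral_vert _)
  have hmeas : Measurable fun ξ : Hor d =>
    4 * (el r ξ ^ 2 * ∫⁻ w, ‖lift FT (W (inl i)) (ξ, w)‖ₑ ^ 2 ∂zvol) +
      ofReal μ * (el r ξ ^ 2 * ∫⁻ w, ‖lift FT (W (inr ())) (ξ, w)‖ₑ ^ 2 ∂zvol) :=
    ((hmeas1 _).const_mul _).add ((hmeas1 _).const_mul _)
  have hpt : ∀ᵐ ξ, ∀ᵐ z ∂zvol, (el (r - 1 / 2) ξ * ‖lift FT (W (inl i)) (ξ, z)‖ₑ) ^ 2 ≤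
    4 * (el r ξ ^ 2 * ∫⁻ w, ‖lift FT (W (inl i)) (ξ, w)‖ₑ ^ 2 ∂zvol) +
      ofReal μ * (el r ξ ^ 2 * ∫⁻ w, ‖lift FT (W (inr ())) (ξ, w)‖ₑ ^ 2 ∂zvol) := by
    filter_upwards [ae_ae_of_ae_volS' (hW i), ae_memLp_vert (Lp.memLp (lift FT (W (inr ()))))]
      with ξ h1 h2
    set c : ℂ := 2 * π * √μ * ξ i * I
    set y : ℝ → ℂ := fun w => c * lift FT (W (inr ())) (ξ, w)
    have hy : Integrable y zvol := (h2.integrable one_le_two).const_mul _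
    have h3 : ∀ᵐ z ∂zvol, lift FT (W (inl i)) (ξ, z) = -up y z := by
      filter_upwards [h1] with z hz
      rw [hz, neg_mul]; congr 1; exact (integral_const_mul _ _).symm
    filter_upwards [h3, ae_zvol_mem] with z hz hz2
    refine (el_mul_enorm_sq_le ⟨hz2.1.le, hz2.2.le⟩ hy.aestronglyMeasurable.aemeasurable (by
        filter_upwards [h3] with z' hz'
        rw [hz, hz', neg_sub_neg, ← enorm_neg, neg_sub]
        exact enorm_up_sub_le hy _ _)).trans (add_le_add le_rfl ?_)
    have e : ∫⁻ w, ‖y w‖ₑ ^ 2 ∂zvol = ofReal ((2 * π * √μ * ξ i) ^ 2) *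
      ∫⁻ w, ‖lift FT (W (inr ())) (ξ, w)‖ₑ ^ 2 ∂zvol := by
      rw [← lintegral_cmul]; exact lintegral_congr fun w => enorm_coord_mul μ ξ i _
    rw [e, sub_eq_add_neg, el_add, mul_pow]
    calc _ = el r ξ ^ 2 * ((el (-1) ξ ^ 2 * ofReal ((2 * π * √μ * ξ i) ^ 2)) *
          ∫⁻ w, ‖lift FT (W (inr ())) (ξ, w)‖ₑ ^ 2 ∂zvol) := by ring
      _ ≤ el r ξ ^ 2 * (ofReal μ * ∫⁻ w, ‖lift FT (W (inr ())) (ξ, w)‖ₑ ^ 2 ∂zvol) :=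
        mul_le_r (mul_le_l (coord_sq_le hμ ξ i))
      _ = _ := by ring
  filter_upwards [ae_wnf_le_of_ae hmeas hpt] with z hz
  refine hz.trans ?_
  rw [lintegral_add_left ((hmeas1 _).const_mul _), lintegral_cmul,
    lintegral_cmul, ← wnS_eq, ← wnS_eq,
    ofReal_add (by norm_num) hμ, ofReal_ofNat, mul_add, add_mul, add_mul]
  exact add_le_add le_self_add le_add_self

theorem IsFourierFlux.ae_wnf_le (hμ : 0 ≤ μ)
  (hF : IsFourierFlux μ b F) (r : ℝ) :
  ∀ᵐ z ∂zvol, wnf (r - 1 / 2) (FT (sec (F (inr ())) z)) ≤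
    ofReal (4 + d * μ) * (wnS r (F (inr ())) + ∑ i, wnS r (F (inl i))) := by
  have hmeas1 : ∀ j, Measurable fun ξ : Hor d =>
    el r ξ ^ 2 * ∫⁻ w, ‖lift FT (F j) (ξ, w)‖ₑ ^ 2 ∂zvol := fun j =>
    ((measurable_el r).pow_const 2).mul (measurable_lintegral_vert _)
  have hmeas2 : Measurable fun ξ : Hor d => ∑ i, el r ξ ^ 2 *
    ∫⁻ w, ‖lift FT (F (inl i)) (ξ, w)‖ₑ ^ 2 ∂zvol :=
    Finset.measurable_fun_sum _ fun i _ => hmeas1 _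
  have hmeas : Measurable fun ξ : Hor d =>
    4 * (el r ξ ^ 2 * ∫⁻ w, ‖lift FT (F (inr ())) (ξ, w)‖ₑ ^ 2 ∂zvol) +
      ofReal (d * μ) * ∑ i, (el r ξ ^ 2 * ∫⁻ w, ‖lift FT (F (inl i)) (ξ, w)‖ₑ ^ 2 ∂zvol) :=
    ((hmeas1 _).const_mul _).add (hmeas2.const_mul _)
  have hpt : ∀ᵐ ξ, ∀ᵐ z ∂zvol, (el (r - 1 / 2) ξ * ‖lift FT (F (inr ())) (ξ, z)‖ₑ) ^ 2 ≤
    4 * (el r ξ ^ 2 * ∫⁻ w, ‖lift FT (F (inr ())) (ξ, w)‖ₑ ^ 2 ∂zvol) +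
      ofReal (d * μ) * ∑ i, (el r ξ ^ 2 * ∫⁻ w, ‖lift FT (F (inl i)) (ξ, w)‖ₑ ^ 2 ∂zvol) := by
    have hv : ∀ᵐ ξ, ∀ i, MemLp (fun z => lift FT (F (inl i)) (ξ, z)) 2 zvol := by
      rw [ae_all_iff]; exact fun i => ae_memLp_vert (Lp.memLp _)
    filter_upwards [ae_ae_of_ae_volS' hF, hv] with ξ h1 h2
    set y : ℝ → ℂ := fun w => ∑ i, (2 * π * √μ * ξ i * I) * lift FT (F (inl i)) (ξ, w)
    have hy : Integrable y zvol :=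
      integrable_finsetSum _ fun i _ => ((h2 i).integrable one_le_two).const_mul _
    have h3 := h1
    filter_upwards [h3, ae_zvol_mem] with z hz hz2
    refine (el_mul_enorm_sq_le ⟨hz2.1.le, hz2.2.le⟩ hy.aestronglyMeasurable.aemeasurable (by
        filter_upwards [h3] with z' hz'
        rw [hz, hz', sub_sub_sub_cancel_left, ← enorm_neg, neg_sub]
        exact enorm_dn_sub_le hy _ _)).trans (add_le_add le_rfl ?_)
    have hm3 : ∀ i : Fin d, Measurable fun w => ofReal ((2 * π * √μ * ξ i) ^ 2) *
      ‖lift FT (F (inl i)) (ξ, w)‖ₑ ^ 2 := fun i =>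
      (((Lp.stronglyMeasurable (lift FT (F (inl i)))).measurable.comp
        measurable_prodMk_left).enorm.pow_const 2).const_mul _
    have e : ∫⁻ w, ‖y w‖ₑ ^ 2 ∂zvol ≤ d * ∑ i, ofReal ((2 * π * √μ * ξ i) ^ 2) *
      ∫⁻ w, ‖lift FT (F (inl i)) (ξ, w)‖ₑ ^ 2 ∂zvol := by
      calc _ ≤ ∫⁻ w, d * ∑ i, (ofReal ((2 * π * √μ * ξ i) ^ 2) *
            ‖lift FT (F (inl i)) (ξ, w)‖ₑ ^ 2) ∂zvol := by
            refine lintegral_mono fun w => (sum_enorm_sq_le _ _).trans (le_of_eq ?_)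
            rw [card_univ, Fintype.card_fin]; congr 1
            exact sum_congr rfl fun i _ => enorm_coord_mul μ ξ i _
        _ = _ := by
          rw [lintegral_cmul, lintegral_finsetSum _ fun i _ => hm3 i]
          congr 1; exact sum_congr rfl fun i _ => lintegral_cmul
    refine (mul_le_r e).trans ?_
    rw [sub_eq_add_neg, el_add, mul_pow, ofReal_mul (by positivity), ofReal_natCast]
    calc _ = d * ∑ i, el r ξ ^ 2 *
          ((el (-1) ξ ^ 2 * ofReal ((2 * π * √μ * ξ i) ^ 2)) *
          ∫⁻ w, ‖lift FT (F (inl i)) (ξ, w)‖ₑ ^ 2 ∂zvol) := by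
          rw [mul_left_comm, mul_sum]; congr 1; exact sum_congr rfl fun i _ => by ring
      _ ≤ d * ∑ i, el r ξ ^ 2 * (ofReal μ * ∫⁻ w, ‖lift FT (F (inl i)) (ξ, w)‖ₑ ^ 2 ∂zvol) :=
        mul_le_r (sum_le_sum fun i _ => mul_le_r (mul_le_l (coord_sq_le hμ ξ i)))
      _ = _ := by
        rw [mul_assoc, mul_sum (a := ofReal μ)]; congr 1; exact sum_congr rfl fun i _ => by ring
  filter_upwards [ae_wnf_le_of_ae hmeas hpt] with z hz
  refine hz.trans ?_
  rw [lintegral_add_left ((hmeas1 _).const_mul _), lintegral_cmul,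
    lintegral_cmul, lintegral_finsetSum _ fun i _ => hmeas1 _,
    ofReal_add (by norm_num) (by positivity), ofReal_ofNat, mul_add, add_mul, add_mul]
  simp_rw [← wnS_eq]; exact add_le_add le_self_add le_add_self

theorem IsFourierGrad.ae_wnf_skewOp_le
  {G : Idx d → L2S d} (hW : IsFourierGrad μ (gradS q J G))
  (hF : IsFourierFlux μ b (fluxS q J G)) (hμ : 0 ≤ μ) (hμ' : μ ≤ μmax) (r : ℝ) :
  ∀ᵐ z ∂zvol, ∀ j, wnf (r - 1 / 2) (FT (sec (skewOp (fun i => mulS (q i)) G j : L2S d) z)) ≤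
    ofReal ((4 + (d + 1) * μmax) * 2) * wnSum r q J G := by
  have hμm := hμ.trans hμ'
  have hgrad := fun i => hW.ae_wnf_le hμ r i
  filter_upwards [ae_all_iff.2 hgrad, hF.ae_wnf_le hμ r] with z h1 h2 j
  have hd0 : (0 : ℝ) ≤ d := Nat.cast_nonneg d
  have hdm := mul_nonneg hd0 (by linarith)
  have two : ∀ x : ℝ, 0 ≤ x → ofReal (x * 2) = ofReal x * 2 := fun x hx => by
    rw [ofReal_mul hx, ofReal_ofNat]
  have hX : ∀ x : ℝ, x ≤ 4 + (d + 1) * μmax → ofReal x ≤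
    ofReal (4 + (d + 1) * μmax) := fun x hx => ofReal_le_ofReal hx
  rw [two _ (by positivity), mul_assoc]
  rcases j with i | u
  · refine (h1 i).trans (mul_le_mul' (hX _ (by nlinarith)) ?_); rw [two_mul]
    exact add_le_add (wnS_grad_le_wnSum _) (wnS_grad_le_wnSum _)
  · refine h2.trans (mul_le_mul' (hX _ (by nlinarith)) ?_); rw [two_mul]
    refine add_le_add (wnS_flux_le_wnSum _) ?_; rw [wnSum, Fintype.sum_sum_type]
    exact le_add_right (sum_le_sum fun i _ => le_add_self)

/-- The regularity estimate, for the solutions in the Fourier variable. -/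
theorem exists_wnSum_le_of_fourier (d : ℕ) (ht : (d : ℝ) / 2 < t)
  (ht2 : 1 / 2 ≤ t) (hK : 0 ≤ K) (hc : 0 < c) (hμm : 0 ≤ μmax) (hs : 0 ≤ s) (hst : s ≤ t + 1 / 2) :
  ∃ C : ℝ, 0 ≤ C ∧ ∀ μ q J, 0 ≤ μ → μ ≤ μmax →
    IsSystem t K c q J → ∀ (G : Idx d → L2S d) (b : Hor d → ℂ) (D : ℝ), 0 ≤ D →
    IsFourierGrad μ (gradS q J G) → IsFourierFlux μ b (fluxS q J G) → AEMeasurable b →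
    ∫⁻ ξ, ‖((lam s ξ * (1 / √(1 + √μ * absD ξ)) : ℝ) : ℂ) * b ξ‖ₑ ^ 2 ≤ ofReal (D ^ 2) →
    wnSum s q J G ≤ ofReal (C * D ^ 2) := by
  obtain ⟨C, hC0, hC⟩ := IsSystem.exists_wnSum_le d (C₀ := (4 + (d + 1) * μmax) * 2) ht ht2 hK hc
    (by positivity) hs hst
  refine ⟨C * 3, by positivity, fun μ q J hμ hμ' hS G b D hD0 hW hF hb hD => ?_⟩
  have h := hC q J hS G (√3 * D) (by positivity) ?_ ?_
  · rwa [mul_pow, sq_sqrt (by norm_num), ← mul_assoc] at h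
  · intro m hm hm0 hms
    have h1 := (hW.enorm_inner_le hF hb hm hm0 hms).trans (mul_le_l hD)
    have hnn : 0 ≤ ∑ j, ‖lift (fm m) (gradS q J G j)‖ ^ 2 := sum_nonneg fun _ _ => by positivity
    have conv : ∀ x : L2S d, ‖x‖ₑ ^ 2 = ofReal (‖x‖ ^ 2) := fun x => by
      rw [← ofReal_norm, ofReal_pow (norm_nonneg _)]
    have h2 : ‖∑ j, inner ℂ (lift (fm m) (gradS q J G j)) (lift (fm m) (fluxS q J G j))‖ ^ 2 ≤
      (√3 * D * √(∑ j, ‖lift (fm m) (gradS q J G j)‖ ^ 2)) ^ 2 := by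
      rw [mul_pow, mul_pow, sq_sqrt (by norm_num), sq_sqrt hnn]
      simp_rw [conv] at h1
      have e3 : ∀ x : ℝ, 3 * ofReal x = ofReal (3 * x) := fun x => by
        rw [ofReal_mul (by norm_num), ofReal_ofNat]
      rw [← ofReal_sum_of_nonneg (fun _ _ => by positivity), e3, ← ofReal_mul (by positivity), ← ofReal_norm,
        ← ofReal_pow (norm_nonneg _), ofReal_le_ofReal_iff (by positivity)] at h1
      linarith
    exact (abs_re_le_norm _).trans (le_of_sq_le_sq h2 (by positivity))
  · exact hW.ae_wnf_skewOp_le hF hμ hμ'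

/-! ### Vertical integrals of functions on the strip -/

theorem aestronglyMeasurable_prod (h : AEStronglyMeasurable f (volS d)) :
  AEStronglyMeasurable f ((volume : Measure (Hor d)).prod zvol) := volS_eq ▸ h

theorem ae_volS_fst {p : Hor d → Prop} (h : ∀ᵐ X, p X) : ∀ᵐ q ∂volS d, p q.1 := by
  rw [volS_eq]; exact Measure.quasiMeasurePreserving_fst.ae h

theorem memLp_vert_integral (u : L2S d) :
  MemLp (fun X : Hor d => ∫ z, u (X, z) ∂zvol) 2 volume ∧
    ∫⁻ X : Hor d, ‖∫ z, u (X, z) ∂zvol‖ₑ ^ 2 ≤ 3 * ‖u‖ₑ ^ 2 := by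
  have hm := (aestronglyMeasurable_prod (Lp.aestronglyMeasurable u)).integral_prod_right'
  have h2 : ∫⁻ X, ‖∫ z, u (X, z) ∂zvol‖ₑ ^ 2 ≤ 3 * ‖u‖ₑ ^ 2 := by
    rw [enorm_sq_eq_lintegral, lintegral_volS' ((Lp.aestronglyMeasurable u).enorm.pow_const 2),
      ← lintegral_cmul]
    apply lintegral_mono_ae
    filter_upwards [ae_memLp_vert (Lp.memLp u)] with X hX
    simpa using trace_le (hX.integrable one_le_two) le_rfl
  refine ⟨(memLp_two_iff hm).2 (h2.trans_lt ?_), h2⟩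
  exact mul_lt_top (by norm_num) (pow_lt_top enorm_lt_top)

/-- The vertical integral `∫ u(X, z) dz`. -/
def vsum : L2S d →L[ℂ] L2H d :=
  LinearMap.mkContinuous
    { toFun := fun u => (memLp_vert_integral u).1.toLp _
      map_add' := fun u v => by
        rw [← MemLp.toLp_add]; apply MemLp.toLp_congr
        filter_upwards [ae_ae_of_ae_volS' (Lp.coeFn_add u v), ae_memLp_vert (Lp.memLp u),
          ae_memLp_vert (Lp.memLp v)] with X h hu hv
        rw [integral_congr_ae h]
        exact integral_add (hu.integrable one_le_two) (hv.integrable one_le_two)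
      map_smul' := fun c u => by
        rw [RingHom.id_apply, ← MemLp.toLp_const_smul]; apply MemLp.toLp_congr
        filter_upwards [ae_ae_of_ae_volS' (Lp.coeFn_smul c u)] with X h
        rw [integral_congr_ae h]; exact integral_smul c _ }
    2 (fun u => by
      have h := (memLp_vert_integral u).2
      have h1 : ‖(memLp_vert_integral u).1.toLp _‖ₑ ^ 2 ≤ (2 * ‖u‖ₑ) ^ 2 := by
        rw [enorm_sq_eq_lintegral, lintegral_congr_ae (g := fun X : Hor d =>
          ‖∫ z, u (X, z) ∂zvol‖ₑ ^ 2) (by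
            filter_upwards [(memLp_vert_integral u).1.coeFn_toLp] with X hX; rw [hX]), mul_pow]
        refine h.trans (mul_le_l (by norm_num))
      have h2 := (ENNReal.pow_le_pow_left_iff (two_ne_zero)).1 h1
      have e : (2 : ℝ≥0∞) * ‖u‖ₑ = ofReal (2 * ‖u‖) := by
        rw [ofReal_mul (by norm_num), ofReal_norm, ofReal_ofNat]
      rw [e, ← ofReal_norm, ofReal_le_ofReal_iff (by positivity)] at h2
      exact h2)

theorem vsum_coe (u : L2S d) : vsum u =ᵐ[volume] fun X => ∫ z, u (X, z) ∂zvol :=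
  (memLp_vert_integral u).1.coeFn_toLp

theorem memLp_comp_fst (f : L2H d) : MemLp (fun p : Amb d => f p.1) 2 (volS d) := by
  rw [volS_eq]
  have hm : AEStronglyMeasurable (fun p => f p.1) (volume.prod zvol) :=
    (Lp.aestronglyMeasurable f).comp_quasiMeasurePreserving Measure.quasiMeasurePreserving_fst
  rw [memLp_two_iff hm, lintegral_prod _ (hm.enorm.pow_const 2)]; simp only [lintegral_const]
  rw [lintegral_mul_const' _ _ (measure_ne_top _ _), ← enorm_sq_eq_lintegral]
  exact mul_lt_top (pow_lt_top enorm_lt_top) (measure_lt_top _ _)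

theorem sec_toLp_comp_fst (f : L2H d) :
  ∀ᵐ z ∂zvol, sec ((memLp_comp_fst f).toLp _ : L2S d) z = f := by
  filter_upwards [ae_sec_coe (Lp.memLp ((memLp_comp_fst f).toLp _)),
    ae_ae_of_ae_volS (memLp_comp_fst f).coeFn_toLp] with z h1 h2
  apply Lp.ext
  filter_upwards [h1, h2] with X h3 h4
  rw [h3, h4]

theorem inner_vsum (f : L2H d) (u : L2S d) :
  inner ℂ f (vsum u) = inner ℂ ((memLp_comp_fst f).toLp _ : L2S d) u := by
  rw [L2.inner_def, L2.inner_def, integral_volS' (L2.integrable_inner _ _)]; apply integral_congr_ae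
  filter_upwards [vsum_coe u, ae_ae_of_ae_volS' (memLp_comp_fst f).coeFn_toLp] with X h1 h2
  have h3 : ∫ z, inner ℂ ((memLp_comp_fst f).toLp _ (X, z)) (u (X, z)) ∂zvol =
    ∫ z, u (X, z) * conj (f X) ∂zvol := integral_congr_ae (by
    filter_upwards [h2] with z h3
    rw [h3]; rfl)
  rw [h1, h3, integral_mul_const]; rfl

theorem FT_vsum (u : L2S d) : FT (vsum u) = vsum (lift FT u) := by
  refine ext_inner_left ℂ fun f => ?_
  have h1 := (inner_FTi_left f (vsum u)).symm
  rw [h1, inner_vsum, inner_vsum, ← inner_lift_FT]; congr 1; apply eq_of_sec_eq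
  filter_upwards [sec_lift FT ((memLp_comp_fst (FTi f)).toLp _), sec_toLp_comp_fst f,
    sec_toLp_comp_fst (FTi f)] with z h1 h2 h3
  rw [h1, h2, h3, FT_FTi]

/-- The weighted vertical integral `∫ β(z) u(X, z) dz`. -/
def vint (β : ℝ → ℂ) : L2S d →L[ℂ] L2H d := vsum ∘L mulOp (volS d) fun p => β p.2

theorem isBdd_comp_snd (hm : Measurable β) (hC : ∀ z, ‖β z‖ ≤ C) :
  IsBdd (volS d) fun p => β p.2 :=
  ⟨(hm.comp measurable_snd).aestronglyMeasurable, C, .of_forall fun p => hC p.2⟩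

theorem vint_coe (hm : Measurable β) (hC : ∀ z, ‖β z‖ ≤ C) (u : L2S d) :
  vint β u =ᵐ[volume] fun X => ∫ z, β z * u (X, z) ∂zvol := by
  filter_upwards [vsum_coe (mulOp (volS d) (fun p => β p.2) u),
    ae_ae_of_ae_volS' (mulOp_coe (isBdd_comp_snd hm hC) u)] with X h1 h2
  rw [vint, comp_apply, h1, integral_congr_ae h2]

theorem FT_vint (hm : Measurable β) (hC : ∀ z, ‖β z‖ ≤ C) (u : L2S d) :
  FT (vint β u) =ᵐ[volume] fun ξ => ∫ z, β z * lift FT u (ξ, z) ∂zvol := by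
  have hb := isBdd_comp_snd (d := d) hm hC
  have hc : ∀ z (f : L2H d), mulOp volume (fun _ => β z) f = β z • f := fun z f => by
    apply Lp.ext
    filter_upwards [mulOp_coe
      ⟨aestronglyMeasurable_const, C, .of_forall fun _ => hC z⟩ f, Lp.coeFn_smul (β z) f]
      with X h1 h2
    rw [h1, h2, Pi.smul_apply, smul_eq_mul]
  have h : lift FT (mulOp (volS d) (fun p => β p.2) u) =
    mulOp (volS d) (fun p => β p.2) (lift FT u) := by
    apply eq_of_sec_eq
    filter_upwards [sec_lift FT (mulOp (volS d) (fun p => β p.2) u), sec_lift FT u,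
      sec_mulOp hb u, sec_mulOp hb (lift FT u)] with z h1 h2 h3 h4
    rw [h1, h3, h4, h2, hc, hc, map_smul]
  have e : FT (vint β u) = vint β (lift FT u) := by rw [vint, comp_apply, FT_vsum, h]; rfl
  rw [e]; exact vint_coe hm hC _

theorem aestronglyMeasurable_vert (hu : AEStronglyMeasurable u (volS d))
  {R : Set (ℝ × ℝ)} (hR : MeasurableSet R) :
  AEStronglyMeasurable (fun p : Amb d => ∫ w in {w | (p.2, w) ∈ R}, u (p.1, w) ∂zvol) (volS d) := by
  have h1 : StronglyMeasurable fun p : Amb d =>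
    ∫ w in {w | (p.2, w) ∈ R}, hu.mk u (p.1, w) ∂zvol := by
    have e : (fun p => ∫ w in {w | (p.2, w) ∈ R}, hu.mk u (p.1, w) ∂zvol) = fun p =>
      ∫ w, {x : Amb d × ℝ | (x.1.2, x.2) ∈ R}.indicator (fun x => hu.mk u (x.1.1, x.2)) (p, w)
        ∂zvol := by
      funext p
      exact (integral_indicator (hR.preimage measurable_prodMk_left)).symm
    rw [e]; apply StronglyMeasurable.integral_prod_right'
    exact (hu.stronglyMeasurable_mk.comp_measurable (by fun_prop)).indicator
      (hR.preimage (by fun_prop))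
  refine ⟨_, h1, ?_⟩
  have h2 := ae_ae_of_ae_volS' hu.ae_eq_mk
  have h3 := ae_volS_fst h2
  filter_upwards [h3] with p hp
  exact integral_congr_ae (ae_restrict_of_ae hp)

theorem aestronglyMeasurable_up (hu : AEStronglyMeasurable u (volS d)) :
  AEStronglyMeasurable (fun p : Amb d => up (fun z => u (p.1, z)) p.2) (volS d) :=
  aestronglyMeasurable_vert hu (measurableSet_lt measurable_fst measurable_snd)

theorem norm_setIntegral_zvol_sq_le (hy : MemLp y 2 zvol) (A : Set ℝ) :
  ‖∫ w in A, y w ∂zvol‖ₑ ^ 2 ≤ ∫⁻ w, ‖y w‖ₑ ^ 2 ∂zvol := by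
  have h1 : zvol univ ≤ 1 := by simp [zvol]
  calc ‖∫ w in A, y w ∂zvol‖ₑ ^ 2 ≤ (∫⁻ w, 1 * ‖y w‖ₑ ∂zvol) ^ 2 := by
        refine pow_le_pow_left' ((enorm_integral_le_lintegral_enorm _).trans ?_) 2
        simp only [one_mul]; exact setLIntegral_le_lintegral _ _
    _ ≤ (∫⁻ w, 1 ^ 2 ∂zvol) * ∫⁻ w, ‖y w‖ₑ ^ 2 ∂zvol :=
      lintegral_mul_sq_le _ aemeasurable_const hy.1.enorm
    _ ≤ 1 * ∫⁻ w, ‖y w‖ₑ ^ 2 ∂zvol := by refine mul_le_l ?_; simpa using h1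
    _ = _ := one_mul _

theorem lintegral_up_sq_le (hu : MemLp u 2 (volS d)) :
  ∫⁻ p : Amb d, ‖up (fun z => u (p.1, z)) p.2‖ₑ ^ 2 ∂volS d ≤ ∫⁻ p, ‖u p‖ₑ ^ 2 ∂volS d := by
  have h1 : zvol univ ≤ 1 := by simp [zvol]
  rw [lintegral_volS' ((aestronglyMeasurable_up hu.1).enorm.pow_const 2),
    lintegral_volS' (hu.1.enorm.pow_const 2)]
  refine lintegral_mono_ae ?_
  filter_upwards [ae_memLp_vert hu] with X hX
  refine (lintegral_mono fun z => norm_setIntegral_zvol_sq_le hX _).trans ?_; rw [lintegral_const]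
  exact mul_le_of_le_one_right' h1

theorem memLp_up (hu : MemLp u 2 (volS d)) :
  MemLp (fun p : Amb d => up (fun z => u (p.1, z)) p.2) 2 (volS d) := by
  rw [memLp_two_iff (aestronglyMeasurable_up hu.1)]
  exact (lintegral_up_sq_le hu).trans_lt ((memLp_two_iff hu.1).1 hu)

theorem dn_eq_sub_up (hy : Integrable y zvol) (z : ℝ) :
  dn y z = (∫ w, y w ∂zvol) - up y z := by
  have : NullSingletonClass zvol := by unfold zvol; infer_instance
  rw [dn, up, ← integral_Iic_eq_integral_Iio, eq_sub_iff_add_eq, ← Set.compl_Iic]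
  exact integral_add_compl measurableSet_Iic hy

theorem memLp_dn (hu : MemLp u 2 (volS d)) :
  MemLp (fun p : Amb d => dn (fun z => u (p.1, z)) p.2) 2 (volS d) := by
  have h := (memLp_comp_fst (vsum (hu.toLp u))).sub (memLp_up hu)
  refine (memLp_congr_ae ?_).1 h
  filter_upwards [ae_volS_fst (vsum_coe (hu.toLp u)), ae_volS_fst (ae_memLp_vert hu),
    ae_volS_fst (ae_ae_of_ae_volS' hu.coeFn_toLp)] with p h1 h2 h3
  rw [Pi.sub_apply, h1, dn_eq_sub_up (h2.integrable one_le_two), integral_congr_ae h3]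

theorem setIntegral_volS (hf : Integrable f (volS d)) {A : Set (Hor d)} {B : Set ℝ}
  (hA : MeasurableSet A) (hB : MeasurableSet B) :
  ∫ p in A ×ˢ B, f p ∂volS d = ∫ X in A, ∫ z, B.indicator (fun _ => (1 : ℂ)) z * f (X, z) ∂zvol := by
  rw [← integral_indicator (hA.prod hB), integral_volS' (hf.indicator (hA.prod hB)),
    ← integral_indicator hA]
  congr 1; funext X
  by_cases hX : X ∈ A
  · rw [indicator_of_mem hX]; congr 1; funext z
    by_cases hz : z ∈ B <;> simp [hX, hz]
  · simp [hX]

/-! ### Test functions and the closure of their gradients -/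

theorem IsTest.memLp (h : IsTest U φ) :
  MemLp φ 2 (volS d) :=
  (h.1.continuous.memLp_of_hasCompactSupport h.2.1).restrict _

theorem IsTest.pd (h : IsTest U φ) (j : Idx d) :
  IsTest U (pd j φ) :=
  ⟨(h.1.fderiv_right (m := ∞) (by simp)).clm_apply contDiff_const, h.2.1.fderiv_apply ℝ _,
    (tsupport_fderiv_apply_subset ℝ _).trans h.2.2⟩

theorem IsTest.add (h : IsTest U φ) (k : IsTest U ψ) :
  IsTest U (fun p => φ p + ψ p) :=
  ⟨h.1.add k.1, h.2.1.add k.2.1, (tsupport_add φ ψ).trans (Set.union_subset h.2.2 k.2.2)⟩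

theorem IsTest.clm (h : IsTest U φ) (L : ℂ →L[ℝ] ℂ) :
  IsTest U (fun p => L (φ p)) :=
  ⟨L.contDiff.comp h.1, h.2.1.comp_left (map_zero L),
    (closure_mono (Function.support_comp_subset (map_zero L) φ)).trans h.2.2⟩

theorem IsTest.hasFDerivAt (h : IsTest U φ) (p : Amb d) :
  HasFDerivAt φ (fderiv ℝ φ p) p :=
  (h.1.differentiable (by simp) p).hasFDerivAt

theorem pd_clm (h : IsTest U φ) (L : ℂ →L[ℝ] ℂ) (j : Idx d)
  (p : Amb d) : pd j (fun p => L (φ p)) p = L (pd j φ p) := by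
  have := L.hasFDerivAt.comp p (h.hasFDerivAt p)
  exact congrArg (fun T => T (dir j)) this.fderiv

theorem pd_add (h : IsTest U φ) (k : IsTest U ψ) (j : Idx d)
  (p : Amb d) : pd j (fun p => φ p + ψ p) p = pd j φ p + pd j ψ p :=
  congrArg (fun T => T (dir j)) ((h.hasFDerivAt p).add (k.hasFDerivAt p)).fderiv

instance : (volume : Measure (Amb d)).IsAddHaarMeasure :=
  inferInstanceAs ((volume : Measure (Hor d)).prod (volume : Measure ℝ)).IsAddHaarMeasure

instance : IsLocallyFiniteMeasure (volS d) := by unfold volS; infer_instance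

theorem integral_mul_pd (hφ : IsTest U φ)
  (hψ : IsTest (S d) ψ) (j : Idx d) :
  ∫ p, φ p * pd j ψ p ∂volS d = -∫ p, pd j φ p * ψ p ∂volS d := by
  have hi : ∀ {f g : Amb d → ℂ}, Continuous f → Continuous g → HasCompactSupport g →
    Integrable (fun p => f p * g p) := fun hf hg hc =>
    (hf.mul hg).integrable_of_hasCompactSupport hc.mul_left
  have hs : ∀ {f g : Amb d → ℂ}, IsTest (S d) g →
    ∫ p, f p * g p ∂volS d = ∫ p, f p * g p := fun hg =>
    setIntegral_eq_integral_of_forall_compl_eq_zero fun p hp => by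
      rw [image_eq_zero_of_notMem_tsupport fun h => hp (hg.2.2 h), mul_zero]
  rw [hs (hψ.pd j), hs hψ]
  exact integral_mul_fderiv_eq_neg_fderiv_mul_of_integrable
    (hi (hφ.pd j).1.continuous hψ.1.continuous hψ.2.1)
    (hi hφ.1.continuous (hψ.pd j).1.continuous (hψ.pd j).2.1)
    (hi hφ.1.continuous hψ.1.continuous hψ.2.1)
    (fun p _ => (hφ.hasFDerivAt p).differentiableAt)
    (fun p _ => (hψ.hasFDerivAt p).differentiableAt)

theorem isOpen_S : IsOpen (S d) :=
  (isOpen_lt continuous_const continuous_snd).inter (isOpen_lt continuous_snd continuous_const)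

theorem ae_eq_of_integral_test (hf : MemLp f 2 (volS d))
  (hg : MemLp g 2 (volS d))
  (h : ∀ φ, IsTest (S d) φ → ∫ p, f p * φ p ∂volS d = ∫ p, g p * φ p ∂volS d) :
  f =ᵐ[volS d] g := by
  have hl : LocallyIntegrable (fun p => f p - g p) (volS d) := (hf.sub hg).locallyIntegrable (by norm_num)
  have h1 := isOpen_S.ae_eq_zero_of_integral_contDiff_smul_eq_zero
    (hl.locallyIntegrableOn _) (fun ψ h1 h2 h3 => by
      have ht : IsTest (S d) (fun p => (ψ p)) :=
        ⟨ofRealCLM.contDiff.comp h1, h2.comp_left ofReal_zero,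
          (closure_mono (Function.support_comp_subset ofReal_zero ψ)).trans h3⟩
      have hi : ∀ {f : Amb d → ℂ}, MemLp f 2 (volS d) →
        Integrable (fun p => f p * (ψ p)) (volS d) := fun hf => hf.integrable_mul ht.memLp
      rw [← sub_eq_zero.2 (h _ ht), ← integral_sub (hi hf) (hi hg)]
      refine integral_congr_ae (.of_forall fun p => ?_); simp only [real_smul]; ring)
  filter_upwards [h1, ae_volS_mem] with p h2 h3
  exact sub_eq_zero.1 (h2 h3)

theorem continuous_integral_mul (hψ : MemLp ψ 2 (volS d)) :
  Continuous fun f : L2S d => ∫ p, f p * ψ p ∂volS d := by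
  have h : ∀ f, ∫ p, f p * ψ p ∂volS d = inner ℂ (hψ.star.toLp _) f := fun f => by
    rw [L2.inner_def]; apply integral_congr_ae
    filter_upwards [hψ.star.coeFn_toLp] with p hp
    rw [hp, Pi.star_apply, RCLike.inner_apply]; simp
  simp only [h]; fun_prop

/-- The test functions with their gradients. -/
def testGraph (d : ℕ) : Submodule ℂ (GraphSp d) where
  carrier := {x | ∃ φ, IsTestBottom φ ∧ x none =ᵐ[volS d] φ ∧ ∀ j, x (some j) =ᵐ[volS d] pd j φ}
  add_mem' := by
    rintro x y ⟨φ, h1, h2, h3⟩ ⟨ψ, k1, k2, k3⟩; refine ⟨_, IsTest.add h1 k1, ?_, fun j => ?_⟩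
    · exact (Lp.coeFn_add _ _).trans (h2.add k2)
    · exact (Lp.coeFn_add _ _).trans (((h3 j).add (k3 j)).trans
        (.of_forall fun p => (pd_add h1 k1 j p).symm))
  zero_mem' := by
    refine ⟨fun _ => 0, ⟨contDiff_const, HasCompactSupport.zero, ?_⟩, Lp.coeFn_zero _ _ _,
      fun j => (Lp.coeFn_zero _ _ _).trans (.of_forall fun p => ?_)⟩
    · simp [tsupport]
    · simp [pd]
  smul_mem' := by
    rintro c x ⟨φ, h1, h2, h3⟩
    refine ⟨_, IsTest.clm h1 (c • ContinuousLinearMap.id ℝ ℂ), ?_, fun j => ?_⟩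
    · exact (Lp.coeFn_smul _ _).trans (h2.const_smul c)
    · exact (Lp.coeFn_smul _ _).trans (((h3 j).const_smul c).trans
        (.of_forall fun p => (pd_clm h1 (c • ContinuousLinearMap.id ℝ ℂ) j p).symm))

/-- The space `H¹_{0,surf}(S)`, each function coming with its gradient. -/
def H10 (d : ℕ) : Submodule ℂ (GraphSp d) := (testGraph d).topologicalClosure

theorem H10_induction {P : GraphSp d → Prop} (hP : IsClosed {x | P x})
  (h : ∀ φ x, IsTestBottom φ → x none =ᵐ[volS d] φ → (∀ j, x (some j) =ᵐ[volS d] pd j φ) → P x) (hx : x ∈ H10 d) : P x :=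
  closure_minimal (s := (testGraph d : Set (GraphSp d))) (fun y ⟨φ, h1, h2, h3⟩ => h φ y h1 h2 h3)
    hP hx

theorem exists_testGraph (h : IsTestBottom φ) :
  ∃ x ∈ testGraph d, x none =ᵐ[volS d] φ ∧ ∀ j, x (some j) =ᵐ[volS d] pd j φ := by
  let x : GraphSp d := WithLp.toLp 2 fun k =>
    k.elim (IsTest.memLp h).toLp fun j => (IsTest.memLp (IsTest.pd h j)).toLp
  have h1 := (IsTest.memLp h).coeFn_toLp
  have h2 := fun j => (IsTest.memLp (IsTest.pd h j)).coeFn_toLp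
  exact ⟨x, ⟨φ, h, h1, h2⟩, h1, h2⟩

theorem isWeakPartial_of_mem_H10 (hx : x ∈ H10 d) (j : Idx d) :
  IsWeakPartial j (x none) (x (some j)) := by
  refine ⟨Lp.memLp _, fun ψ hψ => ?_⟩
  refine H10_induction (P := fun x => ∫ p, x none p * pd j ψ p ∂volS d =
    -∫ p, x (some j) p * ψ p ∂volS d) (isClosed_eq ?_ ?_) (fun φ x h1 h2 h3 => ?_) hx
  · exact (continuous_integral_mul (hψ.pd j).memLp).comp (PiLp.continuous_apply 2 _ none)
  · exact ((continuous_integral_mul hψ.memLp).comp (PiLp.continuous_apply 2 _ (some j))).neg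
  · exact (integral_congr_ae (h2.mul (ae_eq_refl (pd j ψ)))).trans
      ((integral_mul_pd h1 hψ j).trans (congrArg Neg.neg
        (integral_congr_ae ((h3 j).mul (ae_eq_refl ψ))).symm))

theorem IsWeakPartial.congr {j : Idx d} (h : IsWeakPartial j u g)
  (huv : v =ᵐ[volS d] u) : IsWeakPartial j v g :=
  ⟨h.1, fun ψ hψ => by rw [← h.2 ψ hψ]; exact integral_congr_ae (huv.mul (ae_eq_refl _))⟩

theorem IsWeakPartial.weakPartial_eq {j : Idx d} (h : IsWeakPartial j u g) :
  weakPartial j u =ᵐ[volS d] g := by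
  have h1 : ∃ g, IsWeakPartial j u g := ⟨g, h⟩
  have h2 : IsWeakPartial j u (weakPartial j u) := by
    rw [weakPartial, dif_pos h1]; exact h1.choose_spec
  refine ae_eq_of_integral_test h2.1 h.1 fun φ hφ => ?_
  rw [← neg_inj, ← h2.2 φ hφ, h.2 φ hφ]

theorem eLpNorm_sub_eq {f g : L2S d} (hf : f =ᵐ[volS d] u)
  (hg : g =ᵐ[volS d] v) : eLpNorm (fun p => u p - v p) 2 (volS d) = ‖f - g‖ₑ := by
  rw [Lp.enorm_def]; apply eLpNorm_congr_ae
  filter_upwards [hf, hg, Lp.coeFn_sub f g] with p h1 h2 h3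
  rw [h3, Pi.sub_apply, h1, h2]

theorem tendsto_enorm_sub_iff {f : ℕ → L2S d} {g : L2S d} :
  Tendsto (fun n => ‖f n - g‖ₑ) atTop (𝓝 0) ↔ Tendsto f atTop (𝓝 g) := by
  rw [tendsto_iff_edist_tendsto_0]; simp only [edist_eq_enorm_sub]

theorem tendstoH1_iff {φ : ℕ → Amb d → ℂ} {x : ℕ → GraphSp d} {y : GraphSp d}
  (h1 : ∀ n, x n none =ᵐ[volS d] φ n) (h2 : ∀ n j, x n (some j) =ᵐ[volS d] pd j (φ n))
  (k1 : y none =ᵐ[volS d] u) (k2 : ∀ j, y (some j) =ᵐ[volS d] weakPartial j u) :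
  TendstoH1 φ u ↔ Tendsto x atTop (𝓝 y) := by
  have h : Tendsto x atTop (𝓝 y) ↔ ∀ k, Tendsto (fun n => x n k) atTop (𝓝 (y k)) := by
    rw [← tendsto_pi_nhds]
    constructor
    · intro h; exact ((PiLp.continuous_ofLp 2 _).tendsto y).comp h
    · intro h; exact ((PiLp.continuous_toLp 2 fun _ => L2S d).tendsto _).comp h
  rw [h, Option.forall, TendstoH1]
  simp only [eLpNorm_sub_eq (h1 _) k1, eLpNorm_sub_eq (h2 _ _) (k2 _), tendsto_enorm_sub_iff]

theorem MemH10surf.exists_mem_H10 (h : MemH10surf u) :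
  ∃ x ∈ H10 d, x none =ᵐ[volS d] u ∧ ∀ j, x (some j) =ᵐ[volS d] weakPartial j u := by
  obtain ⟨⟨h1, h2⟩, φ, h3, h4⟩ := h
  have h5 : ∀ j, MemLp (weakPartial j u) 2 (volS d) := fun j => by
    rw [weakPartial, dif_pos (h2 j)]; exact (h2 j).choose_spec.1
  let y : GraphSp d := WithLp.toLp 2 fun k => k.elim h1.toLp fun j => (h5 j).toLp
  choose x hx hx1 hx2 using fun n => exists_testGraph (h3 n)
  have k1 := h1.coeFn_toLp
  have k2 := fun j => (h5 j).coeFn_toLp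
  refine ⟨y, ?_, k1, k2⟩
  exact mem_closure_of_tendsto ((tendstoH1_iff hx1 hx2 k1 k2).1 h4) (.of_forall hx)

theorem weakPartial_of_mem_H10 (hx : x ∈ H10 d)
  (hu : x none =ᵐ[volS d] u) (j : Idx d) : x (some j) =ᵐ[volS d] weakPartial j u :=
  ((isWeakPartial_of_mem_H10 hx j).congr hu.symm).weakPartial_eq.symm

theorem memH10surf_of_mem_H10 (hx : x ∈ H10 d) : MemH10surf (x none) := by
  refine ⟨⟨Lp.memLp _, fun j => ⟨_, isWeakPartial_of_mem_H10 hx j⟩⟩, ?_⟩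
  obtain ⟨y, hy, hy2⟩ := mem_closure_iff_seq_limit.1 hx
  choose φ h1 h2 h3 using hy
  exact ⟨φ, h1, (tendstoH1_iff h2 h3 (ae_eq_refl _)
    (weakPartial_of_mem_H10 hx (ae_eq_refl _))).2 hy2⟩

theorem IsTestBottom.eq_neg_up (h : IsTestBottom φ) (X : Hor d)
  (hz : z ∈ Icc (-1 : ℝ) 0) : φ (X, z) = -up (fun w => pd (inr ()) φ (X, w)) z := by
  have h1 : ∀ w, HasDerivAt (fun w => φ (X, w)) (pd (inr ()) φ (X, w)) w := fun w =>
    (IsTest.hasFDerivAt h (X, w)).comp_hasDerivAt w ((hasDerivAt_const w X).prodMk (hasDerivAt_id w))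
  have h2 := intervalIntegral.integral_eq_sub_of_hasDerivAt (a := z) (b := 0) (fun w _ => h1 w)
    (((IsTest.pd h (inr ())).1.continuous.comp (by fun_prop)).intervalIntegrable _ _)
  have h3 : φ (X, 0) = 0 := image_eq_zero_of_notMem_tsupport fun hm => lt_irrefl (0 : ℝ) (h.2.2 hm)
  rw [h3, zero_sub] at h2
  rw [← neg_neg (φ (X, z)), ← h2, neg_inj, up, zvol, Measure.restrict_restrict measurableSet_Ioi,
    intervalIntegral.integral_of_le hz.2, integral_Ioc_eq_integral_Ioo]
  congr 2; ext w; simp only [Set.mem_inter_iff, mem_Ioi, Set.mem_Ioo]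
  exact ⟨fun hw => ⟨hw.1, hz.1.trans_lt hw.1, hw.2⟩, fun hw => ⟨hw.1, hw.2.2⟩⟩

theorem isBottomTrace_iff (hx : x ∈ H10 d)
  (hu : x none =ᵐ[volS d] u) (τ : L2H d) :
  IsBottomTrace u τ ↔ τ = -vsum (x (some (inr ()))) := by
  have key : ∀ φ (y : GraphSp d), IsTestBottom φ → (∀ j, y (some j) =ᵐ[volS d] pd j φ) → ∀ σ,
    eLpNorm (fun X => φ (X, -1) - σ X) 2 volume = ‖-vsum (y (some (inr ()))) - σ‖ₑ := by
    intro φ y h1 h2 σ; rw [Lp.enorm_def]; apply eLpNorm_congr_ae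
    filter_upwards [Lp.coeFn_sub (-vsum (y (some (inr ())))) σ,
      Lp.coeFn_neg (vsum (y (some (inr ())))), vsum_coe (y (some (inr ()))),
      ae_ae_of_ae_volS' (h2 (inr ()))] with X k1 k2 k3 k4
    rw [k1, Pi.sub_apply, k2, Pi.neg_apply, k3, h1.eq_neg_up X (by simp), up_neg_one,
      integral_congr_ae k4]
  have hk := weakPartial_of_mem_H10 hx hu
  constructor
  · rintro ⟨φ, h1, h2, h3⟩
    choose y hy hy1 hy2 using fun n => exists_testGraph (h1 n)
    have h4 := ((continuous_neg.comp vsum.continuous).tendsto _).comp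
      (((PiLp.continuous_apply 2 _ (some (inr ()))).tendsto x).comp
        ((tendstoH1_iff hy1 hy2 hu hk).1 h2))
    refine tendsto_nhds_unique ?_ h4; rw [tendsto_iff_edist_tendsto_0]
    simp only [key _ _ (h1 _) (hy2 _)] at h3
    simp only [edist_eq_enorm_sub]; exact h3
  · rintro rfl
    obtain ⟨y, hy, hy2⟩ := mem_closure_iff_seq_limit.1 hx
    choose φ h1 h2 h3 using hy
    refine ⟨φ, h1, (tendstoH1_iff h2 h3 hu hk).2 hy2, ?_⟩; simp only [key _ _ (h1 _) (h3 _)]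
    have h4 := ((continuous_neg.comp vsum.continuous).tendsto _).comp
      (((PiLp.continuous_apply 2 _ (some (inr ()))).tendsto x).comp hy2)
    rw [tendsto_iff_edist_tendsto_0] at h4
    simp only [edist_eq_enorm_sub] at h4
    exact h4

theorem bottomTrace_eq (hx : x ∈ H10 d)
  (hu : x none =ᵐ[volS d] u) : bottomTrace u = -vsum (x (some (inr ()))) := by
  have h : ∃ τ, IsBottomTrace u τ := ⟨_, (isBottomTrace_iff hx hu _).2 rfl⟩
  rw [bottomTrace, dif_pos h]; exact (isBottomTrace_iff hx hu _).1 h.choose_spec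

/-! ### The Fourier transform of functions of `H¹_{0,surf}(S)` -/

theorem integral_indicator_mul_up (hy : Integrable y zvol) {B : Set ℝ}
  (hB : MeasurableSet B) :
  ∫ z, B.indicator (fun _ => (1 : ℂ)) z * up y z ∂zvol =
    ∫ z, ((zvol.real (B ∩ Iio z) : ℝ) : ℂ) * y z ∂zvol := by
  rw [integral_mul_up ((integrable_const _).indicator hB) hy]; congr 1; funext z
  rw [mul_comm, dn, integral_indicator_const _ hB, measureReal_restrict_apply hB]; simp

theorem measurable_zvol_Iio (B : Set ℝ) :
  Measurable fun z => ((zvol.real (B ∩ Iio z) : ℝ) : ℂ) := by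
  refine measurable_ofReal.comp (Monotone.measurable fun z w h => ?_)
  exact measureReal_mono (Set.inter_subset_inter_right _ (Set.Iio_subset_Iio h))

theorem norm_zvol_Iio_le (B : Set ℝ) (z : ℝ) : ‖((zvol.real (B ∩ Iio z) : ℝ) : ℂ)‖ ≤ 1 := by
  rw [norm_real, norm_of_nonneg measureReal_nonneg]
  refine (measureReal_mono (Set.subset_univ _)).trans ?_; simp [zvol, measureReal_def]

theorem norm_indicator_one_le (B : Set ℝ) (z : ℝ) : ‖B.indicator (fun _ => (1 : ℂ)) z‖ ≤ 1 :=
  (norm_indicator_le_norm_self _ _).trans (by simp)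

theorem vint_eq_of_mem_H10 (hx : x ∈ H10 d) {B : Set ℝ} (hB : MeasurableSet B) :
  vint (B.indicator fun _ => 1) (x none) =
    -vint (fun z => ((zvol.real (B ∩ Iio z) : ℝ) : ℂ)) (x (some (inr ()))) := by
  have h1 : Measurable (B.indicator fun _ => (1 : ℂ)) := measurable_const.indicator hB
  refine H10_induction (P := fun x : GraphSp d => vint (B.indicator fun _ => 1) (x none) =
    -vint (fun z => ((zvol.real (B ∩ Iio z)) : ℂ)) (x (some (inr ()))))
    (isClosed_eq ?_ ?_) (fun φ x hφ hx1 hx2 => ?_) hx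
  · exact (vint _).continuous.comp (PiLp.continuous_apply 2 _ none)
  · exact ((vint _).continuous.comp (PiLp.continuous_apply 2 _ (some (inr ())))).neg
  · apply Lp.ext
    filter_upwards [vint_coe h1 (norm_indicator_one_le B) (x none),
      vint_coe (measurable_zvol_Iio B) (norm_zvol_Iio_le B) (x (some (inr ()))),
      Lp.coeFn_neg (vint (fun z => ((zvol.real (B ∩ Iio z)) : ℂ)) (x (some (inr ())))),
      ae_ae_of_ae_volS' hx1, ae_ae_of_ae_volS' (hx2 (inr ())),
      ae_memLp_vert (IsTest.memLp (IsTest.pd hφ (inr ())))] with X k1 k2 k3 k4 k5 k6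
    rw [k3, Pi.neg_apply, k1, k2, integral_congr_ae (by
      filter_upwards [k4, ae_zvol_mem] with z h2 h3
      rw [h2, hφ.eq_neg_up X ⟨h3.1.le, h3.2.le⟩, mul_neg]), integral_neg,
      integral_indicator_mul_up (k6.integrable one_le_two) hB]
    congr 1; apply integral_congr_ae
    filter_upwards [k5] with z h2
    rw [h2]

theorem lift_FT_eq_neg_up (hx : x ∈ H10 d) :
  lift FT (x none) =ᵐ[volS d] fun p => -up (fun z => lift FT (x (some (inr ()))) (p.1, z)) p.2 := by
  set U := lift FT (x none) with hU
  set Y := lift FT (x (some (inr ()))) with hY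
  have hm := (Lp.memLp U).add (memLp_up (Lp.memLp Y))
  have h := ae_eq_zero_of_setIntegral_rectangle hm fun A B hA hB hfin => by
    have hAi : MemLp (fun p => A.indicator (fun _ => (1 : ℂ)) p.1) 2 (volS d) := by
      refine (memLp_congr_ae ?_).1 (memLp_comp_fst (indicatorConstLp 2 hA hfin.ne 1))
      exact ae_volS_fst indicatorConstLp_coeFn
    have hi := hAi.integrable_mul hm
    have h0 : ∫ p in A ×ˢ B, (U + fun p : Amb d => up (fun z => Y (p.1, z)) p.2) p ∂volS d =
      ∫ p in A ×ˢ B, A.indicator (fun _ => 1) p.1 *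
        (U + fun p : Amb d => up (fun z => Y (p.1, z)) p.2) p ∂volS d := by
      refine setIntegral_congr_fun (hA.prod hB) fun p hp => ?_
      have h1 := hp.1
      simp [h1]
    rw [h0]; refine (setIntegral_volS hi hA hB).trans ?_
    refine (setIntegral_congr_ae hA (g := fun _ => 0) ?_).trans (by simp)
    have h1 : Measurable (B.indicator fun _ => (1 : ℂ)) := measurable_const.indicator hB
    have h2 := congrArg FT (vint_eq_of_mem_H10 hx hB)
    rw [map_neg] at h2
    filter_upwards [FT_vint h1 (norm_indicator_one_le B) (x none),
      FT_vint (measurable_zvol_Iio B) (norm_zvol_Iio_le B) (x (some (inr ()))),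
      Lp.coeFn_neg (FT (vint (fun z => ((zvol.real (B ∩ Iio z)) : ℂ))
        (x (some (inr ()))))), ae_memLp_vert (Lp.memLp U), ae_memLp_vert (Lp.memLp Y),
      ae_memLp_vert (memLp_up (Lp.memLp Y))] with ξ k1 k2 k3 k4 k5 k6 hξ
    rw [h2, k3, Pi.neg_apply, k2, ← integral_indicator_mul_up (k5.integrable one_le_two) hB] at k1
    have hb : ∀ {f : ℝ → ℂ}, MemLp f 2 zvol →
      Integrable (fun z => B.indicator (fun _ => 1) z * f z) zvol := fun hf =>
      (hf.integrable one_le_two).bdd_mul h1.aestronglyMeasurable (.of_forall (norm_indicator_one_le B))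
    have e : ∀ z, B.indicator (fun _ => 1) z * (A.indicator (fun _ => 1) ξ *
      (U (ξ, z) + up (fun z => Y (ξ, z)) z)) = B.indicator (fun _ => 1) z * U (ξ, z) +
      B.indicator (fun _ => 1) z * up (fun z => Y (ξ, z)) z := fun z => by
      rw [indicator_of_mem hξ, one_mul, mul_add]
    refine (integral_congr_ae (.of_forall e)).trans ?_
    rw [integral_add (hb k4) (hb k6), ← k1, neg_add_cancel]
  filter_upwards [h] with p hp
  exact eq_neg_of_add_eq_zero_left hp

theorem norm_le_of_mem_H10 (hx : x ∈ H10 d) :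
  ‖x none‖ ≤ ‖x (some (inr ()))‖ := by
  have h : ‖x none‖ₑ ^ 2 ≤ ‖x (some (inr ()))‖ₑ ^ 2 := by
    rw [← enorm_lift_FT, ← enorm_lift_FT (x (some (inr ()))), enorm_sq_eq_lintegral,
      enorm_sq_eq_lintegral]
    refine le_trans (le_of_eq (lintegral_congr_ae ?_)) (lintegral_up_sq_le (Lp.memLp _))
    filter_upwards [lift_FT_eq_neg_up hx] with p hp
    rw [hp, enorm_neg]
  have h2 := (ENNReal.pow_le_pow_left_iff (two_ne_zero)).1 h
  rwa [← ofReal_norm, ← ofReal_norm, ofReal_le_ofReal_iff (norm_nonneg _)] at h2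

theorem exists_schwartz_slice (h : HasCompactSupport φ) (hs : ContDiff ℝ ∞ φ) (z : ℝ) :
  ∃ ψ : Sch d, (∀ X, ψ X = φ (X, z)) ∧
    ∀ i X, (LineDeriv.lineDerivOp (EuclideanSpace.single i (1 : ℝ)) ψ : Sch d) X = pd (inl i) φ (X, z) := by
  have h1 :=
    HasCompactSupport.of_support_subset_isCompact (h.isCompact.image continuous_fst)
      fun X hX => ⟨(X, z), subset_tsupport φ hX, rfl⟩
  have h2 : ContDiff ℝ ∞ fun X => φ (X, z) := hs.comp (by fun_prop)
  refine ⟨h1.toSchwartzMap h2, fun X => rfl, fun i X => ?_⟩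
  rw [SchwartzMap.lineDerivOp_apply_eq_fderiv]
  have h3 : HasFDerivAt (fun Y => φ (Y, z))
    ((fderiv ℝ φ (X, z)).comp (ContinuousLinearMap.inl ℝ (Hor d) ℝ)) X :=
    (hs.differentiable (by simp) (X, z)).hasFDerivAt.comp X (hasFDerivAt_prodMk_left X z)
  exact congrArg (fun T => T (EuclideanSpace.single i 1)) h3.fderiv

theorem FT_toLp (ψ : Sch d) : FT (ψ.toLp 2) =ᵐ[volume] ⇑(𝓕 ψ : Sch d) := by
  rw [FT_eq, SchwartzMap.toLp_fourier_eq]; exact (𝓕 ψ).coeFn_toLp 2 volume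

theorem fourier_lineDerivOp_single (ψ : Sch d) (i : Fin d) (ξ : Hor d) :
  (𝓕 (LineDeriv.lineDerivOp (EuclideanSpace.single i (1 : ℝ)) ψ) : Sch d) ξ =
    (2 * π * ξ i * I) * (𝓕 ψ : Sch d) ξ := by
  rw [SchwartzMap.fourier_lineDerivOp_eq, smul_apply,
    SchwartzMap.smulLeftCLM_apply_apply (by fun_prop)]
  simp [EuclideanSpace.inner_single_right]; ring

theorem abs_coord_mul_lam_le (ξ : Hor d) (i : Fin d) : |2 * π * ξ i * lam (-1) ξ| ≤ 1 := by
  have h1 : |ξ i| ≤ ‖ξ‖ := by simpa using PiLp.norm_apply_le ξ i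
  have h2 : |2 * π * ξ i| ≤ absD ξ := by
    rw [abs_mul, abs_of_pos (by positivity : 0 < 2 * π), absD]; gcongr
  have h4 : lam 1 ξ * lam (-1) ξ = 1 := by rw [← lam_add]; norm_num [lam_zero]
  rw [abs_mul, abs_of_pos (lam_pos _ _)]
  exact (mul_le_mul_of_nonneg_right (h2.trans (absD_le_lam ξ)) (lam_pos _ _).le).trans_eq h4

theorem isSymb_coord (i : Fin d) : IsSymb fun ξ : Hor d => 2 * π * ξ i * lam (-1) ξ :=
  ⟨((by fun_prop : Measurable fun ξ => 2 * π * ξ i)).mul (measurable_lam _), 1,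
    fun ξ => abs_coord_mul_lam_le ξ i⟩

theorem isSymb_lam_of_nonpos (hr : r ≤ 0) : IsSymb (lam (d := d) r) :=
  ⟨measurable_lam r, 1, fun ξ => by
    rw [abs_of_pos (lam_pos _ _), ← lam_zero ξ]; exact lam_mono hr ξ⟩

theorem lift_fm_eq_of_mem_H10 (hx : x ∈ H10 d) (i : Fin d) :
  lift (fm (lam (-1))) (x (some (inl i))) =
    I • lift (fm fun ξ => 2 * π * ξ i * lam (-1) ξ) (x none) := by
  refine H10_induction (P := fun x => lift (fm (lam (-1))) (x (some (inl i))) =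
    I • lift (fm fun ξ => 2 * π * ξ i * lam (-1) ξ) (x none))
    (isClosed_eq ?_ ?_) (fun φ x hφ hx1 hx2 => ?_) hx
  · exact (lift _).continuous.comp (PiLp.continuous_apply 2 _ _)
  · exact ((lift (fm fun ξ => 2 * π * ξ i * lam (-1) ξ)).continuous.comp
      (PiLp.continuous_apply 2 (fun _ => L2S d) none)).const_smul I
  · apply eq_of_sec_eq
    filter_upwards [sec_lift (fm (lam (-1))) (x (some (inl i))),
      sec_smul I (lift (fm fun ξ => 2 * π * ξ i * lam (-1) ξ) (x none)),
      sec_lift (fm fun ξ => 2 * π * ξ i * lam (-1) ξ) (x none), sec_congr hx1,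
      sec_congr (hx2 (inl i))] with z h1 h2 h3 h4 h5
    obtain ⟨ψ, k1, k2⟩ := exists_schwartz_slice hφ.2.1 hφ.1 z
    have e : ∀ (χ : Sch d) u, (∀ X, χ X = u (X, z)) → sec u z = χ.toLp 2 := by
      intro χ u h
      have hm := (funext h) ▸ χ.memLp 2
      refine Lp.ext ((sec_coe hm).trans ?_)
      filter_upwards [χ.coeFn_toLp 2 volume] with X hX
      rw [hX, h]
    rw [h1, h2, h3, h4, h5, e _ _ k1, e _ _ (k2 i), ← FTi_FT (fm (lam (-1)) _), ← FTi_FT (I • _)]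
    congr 1; apply Lp.ext; rw [map_smul]
    filter_upwards [FT_fm (isSymb_lam_of_nonpos (by norm_num : (-1 : ℝ) ≤ 0))
      ((LineDeriv.lineDerivOp (EuclideanSpace.single i (1 : ℝ)) ψ).toLp 2),
      FT_fm (isSymb_coord i) (ψ.toLp 2), FT_toLp ψ, FT_toLp (LineDeriv.lineDerivOp
        (EuclideanSpace.single i (1 : ℝ)) ψ),
      Lp.coeFn_smul I (FT (fm (fun ξ => 2 * π * ξ i * lam (-1) ξ) (ψ.toLp 2)))]
      with ξ l1 l2 l3 l4 l5
    rw [l1, l5, Pi.smul_apply, l2, l3, l4, fourier_lineDerivOp_single, smul_eq_mul]; push_cast; ring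

theorem lift_FT_coord_of_mem_H10 (hx : x ∈ H10 d) (i : Fin d) :
  ∀ᵐ p ∂volS d, lift FT (x (some (inl i))) p = (2 * π * p.1 i * I) * lift FT (x none) p := by
  have h := congrArg (lift FT) (lift_fm_eq_of_mem_H10 hx i)
  rw [map_smul] at h
  filter_upwards [lift_FT_fm (isSymb_lam_of_nonpos (by norm_num : (-1 : ℝ) ≤ 0))
    (x (some (inl i))), lift_FT_fm (isSymb_coord i) (x none),
    Lp.coeFn_smul I (lift FT (lift (fm fun ξ => 2 * π * ξ i * lam (-1) ξ) (x none)))]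
    with p h1 h2 h3
  rw [h, h3, Pi.smul_apply, h2, smul_eq_mul] at h1
  have h4 : ((lam (-1) p.1) : ℂ) ≠ 0 := ofReal_ne_zero.2 (lam_pos _ _).ne'
  apply mul_left_cancel₀ h4; rw [← h1]; push_cast; ring

/-- The scaled gradient. -/
def sgrad (μ : ℝ) (x : GraphSp d) (j : Idx d) : L2S d := (scale μ j : ℂ) • x (some j)

theorem isFourierGrad_of_mem_H10 (hx : x ∈ H10 d) (μ : ℝ) :
  IsFourierGrad μ (sgrad μ x) := by
  intro i
  have h1 : sgrad μ x (inr ()) = x (some (inr ())) := by simp [sgrad, scale]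
  rw [h1, sgrad, map_smul]
  filter_upwards [lift_FT_coord_of_mem_H10 hx i, lift_FT_eq_neg_up hx,
    Lp.coeFn_smul ((scale μ (inl i) : ℝ) : ℂ) (lift FT (x (some (inl i))))]
    with p h2 h3 h4
  rw [h4, Pi.smul_apply, h2, h3, smul_eq_mul, scale]; ring

theorem exists_star_mem_H10 (hx : x ∈ H10 d) :
  ∃ y ∈ H10 d, ∀ k, y k =ᵐ[volS d] fun p => conj (x k p) := by
  let c : L2S d →L[ℝ] L2S d := ContinuousLinearMap.compLpL 2 (volS d) conjCLE
  have hc : ∀ f, c f =ᵐ[volS d] fun p => conj (f p) := fun f =>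
    ContinuousLinearMap.coeFn_compLpL _ f
  let T : GraphSp d → GraphSp d := fun x => WithLp.toLp 2 fun k => c (x k)
  have hT : Continuous T := (PiLp.continuous_toLp 2 _).comp
    (continuous_pi fun k => c.continuous.comp (PiLp.continuous_apply 2 _ k))
  refine ⟨T x, ?_, fun k => hc _⟩
  refine H10_induction (P := fun x => T x ∈ H10 d)
    ((Submodule.isClosed_topologicalClosure _).preimage hT) (fun φ x h1 h2 h3 => ?_) hx
  refine Submodule.le_topologicalClosure _ ⟨_, IsTest.clm h1 conjCLE, ?_, fun j => ?_⟩
  · filter_upwards [hc (x none), h2] with p k1 k2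
    exact k1.trans (by rw [k2]; rfl)
  · filter_upwards [hc (x (some j)), h3 j] with p k1 k2
    rw [pd_clm h1]; exact k1.trans (by rw [k2]; rfl)

/-! ### From the variational formulation to the vertical differential equation -/

theorem fourierInv_apply_eq_neg (η : Sch d) (ξ : Hor d) :
  (𝓕⁻ η : Sch d) ξ = (𝓕 η : Sch d) (-ξ) := by
  rw [SchwartzMap.fourierInv_coe, SchwartzMap.fourier_coe, Real.fourierInv_eq_fourier_neg]

theorem ae_eq_zero_of_fourier_eq_zero {g : Hor d → ℂ} (hg : Integrable g)
  (h : ∀ k, ∫ ξ, exp ((-2 * π * inner ℝ ξ k : ℝ) * I) * g ξ = 0) :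
  g =ᵐ[volume] 0 := by
  refine ae_eq_of_integral_schwartz hg.locallyIntegrable (integrable_zero _ _ _).locallyIntegrable
    fun ψ => ?_
  have h1 : 𝓕 g = 0 := by
    funext k
    rw [Real.fourier_eq']; simp only [smul_eq_mul]; exact h k
  have h2 := VectorFourier.integral_fourierIntegral_smul_eq_flip (L := innerₗ (Hor d))
    (ν := volume) continuous_fourierChar continuous_inner hg
    ((𝓕⁻ ψ).integrable)
  have h3 : ∀ ξ, g ξ * ψ ξ = g ξ • 𝓕 (⇑(𝓕⁻ ψ : Sch d)) ξ := fun ξ => by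
    rw [← SchwartzMap.fourier_coe, FourierTransform.fourier_fourierInv_eq, smul_eq_mul]
  simp only [Pi.zero_apply, zero_mul, integral_zero, h3]; refine Eq.trans ?_ (h2.symm.trans ?_)
  · congr 1; funext ξ; congr 2; simp [flip_innerₗ]; rfl
  · change ∫ ξ, 𝓕 g ξ • _ = 0
    simp [h1]

theorem exists_fourierInv_ne_zero (ξ₀ : Hor d) :
  ∃ η : Sch d, HasCompactSupport η ∧ (𝓕⁻ η : Sch d) ξ₀ ≠ 0 := by
  let ρ : ContDiffBump (0 : Hor d) := ⟨1, 2, one_pos, one_lt_two⟩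
  let η₀ : Hor d → ℂ := fun x => (ρ x) * exp ((-(2 * π * inner ℝ x ξ₀) : ℝ) * I)
  have h1 : HasCompactSupport η₀ := (ρ.hasCompactSupport.comp_left ofReal_zero).mul_right
  have h2 : ContDiff ℝ ∞ η₀ := by
    refine (ofRealCLM.contDiff.comp ρ.contDiff).mul ?_
    refine Complex.contDiff_exp.comp ((ofRealCLM.contDiff.comp ?_).mul contDiff_const)
    exact (contDiff_const.mul (contDiff_id.inner ℝ contDiff_const)).neg
  refine ⟨h1.toSchwartzMap h2, h1, ?_⟩
  have h3 : (𝓕⁻ (h1.toSchwartzMap h2)) ξ₀ = ((∫ x, ρ x : ℝ) : ℂ) := by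
    rw [SchwartzMap.fourierInv_coe, fourierInv_eq', ← integral_complex_ofReal]; congr 1; funext x
    simp only [HasCompactSupport.toSchwartzMap_toFun, η₀, smul_eq_mul]
    rw [mul_left_comm, ← exp_add]; push_cast; ring_nf; simp
  rw [h3]; exact ofReal_ne_zero.2 ρ.integral_pos.ne'

theorem ae_eq_zero_of_integral_fourierInv {E : Hor d → ℂ}
  (hE : ∀ ψ : Sch d, Integrable fun ξ => E ξ * ψ ξ)
  (h : ∀ η : Sch d, HasCompactSupport η → ∫ ξ, E ξ * (𝓕⁻ η : Sch d) ξ = 0) :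
  ∀ᵐ ξ, E ξ = 0 := by
  have key : ∀ η : Sch d, HasCompactSupport η → ∀ᵐ ξ, E ξ * (𝓕⁻ η) ξ = 0 := fun η hη => by
    refine ae_eq_zero_of_fourier_eq_zero (hE _) fun k => ?_
    have h1 : HasCompactSupport (η.compSubConstCLM ℂ (-k)) :=
      hη.comp_homeomorph (Homeomorph.subRight (-k))
    rw [← h _ h1]; congr 1; funext ξ
    rw [fourierInv_apply_eq_neg, fourierInv_apply_eq_neg, fourier_compSubConst, mul_left_comm]
    congr 4; rw [inner_neg_right, real_inner_comm]; ring_nf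
  refine measure_null_of_locally_null _ fun ξ₀ _ => ?_
  obtain ⟨η, h1, h2⟩ := exists_fourierInv_ne_zero ξ₀
  refine ⟨{ξ | E ξ ≠ 0} ∩ {ξ | (𝓕⁻ η) ξ ≠ 0}, ?_, ?_⟩
  · refine Filter.inter_mem self_mem_nhdsWithin (mem_nhdsWithin_of_mem_nhds ?_)
    exact (isOpen_ne_fun (𝓕⁻ η).continuous continuous_const).mem_nhds h2
  · refine measure_mono_null (fun ξ hξ => ?_) (key η h1); exact mul_ne_zero hξ.1 hξ.2

theorem exists_vertical_cutoff {f : ℝ → ℝ} (hf : ContDiff ℝ ∞ f) (hc : HasCompactSupport f)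
  (hs : tsupport f ⊆ Ioo (-1) 0) :
  ∃ χ : ℝ → ℂ, ContDiff ℝ ∞ χ ∧ HasCompactSupport χ ∧ tsupport χ ⊆ Iio 0 ∧
    (∀ z ∈ Icc (-1 : ℝ) 0, χ z = -up (fun z => (f z : ℂ)) z) ∧
    ∀ z ∈ Ioo (-1 : ℝ) 0, HasDerivAt χ (f z) z := by
  let g : ℝ → ℂ := fun z => (f z)
  have hg := ofRealCLM.contDiff.comp hf
  let κ : ContDiffBump (0 : ℝ) := ⟨2, 3, two_pos, by norm_num⟩
  let P : ℝ → ℂ := fun z => ∫ w in 0..z, g w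
  have hP : ∀ z, HasDerivAt P (g z) z := fun z => hg.continuous.integral_hasStrictDerivAt 0 z |>.hasDerivAt
  have hPs : ContDiff ℝ ∞ P := by
    rw [contDiff_infty_iff_deriv]; refine ⟨fun z => (hP z).differentiableAt, ?_⟩
    rwa [funext fun z => (hP z).deriv]
  obtain ⟨c, hc1, hc2⟩ : ∃ c < 0, tsupport f ⊆ Set.Iic c := by
    obtain ⟨c, h1, h2⟩ := ((hc.isCompact.insert (-1 / 2))).exists_isMaxOn
      (Set.insert_nonempty _ _) continuous_id.continuousOn
    refine ⟨c, ?_, fun z hz => h2 (Set.mem_insert_of_mem _ hz)⟩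
    rcases h1 with h1 | h1
    · rw [h1]; norm_num
    · exact (hs h1).2
  have hP0 : ∀ z, c < z → P z = 0 := fun z hz => by
    refine intervalIntegral.integral_zero_ae (.of_forall fun w hw => ?_)
    have : c < w := (lt_min hc1 hz).trans hw.1
    have h3 := image_eq_zero_of_notMem_tsupport fun h => (hc2 h).not_gt this
    simp [g, h3]
  have hκ1 : ∀ z, |z| ≤ 2 → κ z = 1 := fun z hz => κ.one_of_mem_closedBall (by simpa using hz)
  refine ⟨fun z => P z * (κ z), hPs.mul (ofRealCLM.contDiff.comp κ.contDiff),
    (κ.hasCompactSupport.comp_left ofReal_zero).mul_left, ?_, fun z hz => ?_, fun z hz => ?_⟩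
  · refine (closure_minimal (fun z hz => ?_) isClosed_Iic).trans (Set.Iic_subset_Iio.2 hc1)
    by_contra h
    exact hz (by simp [hP0 z (not_le.1 h)])
  · have h1 := hκ1 z (abs_le.2 ⟨by linarith [hz.1], by linarith [hz.2]⟩)
    simp only [h1, Complex.ofReal_one, mul_one, P, up]
    rw [intervalIntegral.integral_of_ge hz.2, neg_inj, zvol,
      Measure.restrict_restrict measurableSet_Ioi, integral_Ioc_eq_integral_Ioo]
    congr 2; ext w; simp only [Set.mem_inter_iff, mem_Ioi, Set.mem_Ioo]
    exact ⟨fun hw => ⟨hw.1, hz.1.trans_lt hw.1, hw.2⟩, fun hw => ⟨hw.1, hw.2.2⟩⟩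
  · refine (hP z).congr_of_eventuallyEq ?_
    filter_upwards [isOpen_Ioo.mem_nhds hz] with w hw
    rw [hκ1 w (abs_le.2 ⟨by linarith [hw.1], by linarith [hw.2]⟩)]; simp

theorem ae_eq_zero_of_vert_smooth {w : Amb d → ℂ} (hw : MemLp w 2 (volS d))
  (h : ∀ f : ℝ → ℝ, ContDiff ℝ ∞ f → HasCompactSupport f → tsupport f ⊆ Ioo (-1) 0 →
    ∀ᵐ ξ : Hor d, ∫ z, (f z : ℂ) * w (ξ, z) ∂zvol = 0) : w =ᵐ[volS d] 0 := by
  refine ae_eq_zero_of_setIntegral_rectangle hw fun A B hA hB hfin => ?_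
  have hAi : MemLp (fun p => A.indicator (fun _ => (1 : ℂ)) p.1) 2 (volS d) := by
    refine (memLp_congr_ae ?_).1 (memLp_comp_fst (indicatorConstLp 2 hA hfin.ne 1))
    exact ae_volS_fst indicatorConstLp_coeFn
  have hi := hAi.integrable_mul hw
  have hmul : ∀ {g : ℝ → ℂ}, Measurable g → ∀ {C : ℝ}, (∀ z, ‖g z‖ ≤ C) → Integrable (fun p =>
    g p.2 * (A.indicator (fun _ => 1) p.1 * w p)) (volS d) := fun hg _ hC =>
    hi.bdd_mul (hg.comp measurable_snd).aestronglyMeasurable (.of_forall fun p => hC p.2)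
  have hh : Integrable (fun z => ∫ X, A.indicator (fun _ => 1) X * w (X, z)) zvol := by
    have h1 := hi
    rw [volS_eq] at h1
    exact h1.integral_prod_right
  have h0 := isOpen_Ioo.ae_eq_zero_of_integral_contDiff_smul_eq_zero
    (hh.locallyIntegrable.locallyIntegrableOn _) fun f h1 h2 h3 => by
      obtain ⟨C, hC⟩ := h2.exists_bound_of_continuous h1.continuous
      have h4 := hmul (g := fun z => (f z)) (measurable_ofReal.comp
        h1.continuous.measurable) fun z => by simpa using hC z
      have h5 := integral_volS h4
      rw [integral_volS' h4] at h5
      simp only [integral_const_mul, real_smul] at h5 ⊢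
      rw [← h5]; refine integral_eq_zero_of_ae ?_
      filter_upwards [h f h1 h2 h3] with ξ hξ
      simp only [mul_left_comm (f _ : ℂ), integral_const_mul, hξ, mul_zero, Pi.zero_apply]
  have h6 : ∫ p in A ×ˢ B, w p ∂volS d = ∫ p, B.indicator (fun _ => 1) p.2 *
    (A.indicator (fun _ => 1) p.1 * w p) ∂volS d := by
    rw [← integral_indicator (hA.prod hB)]; congr 1; funext p
    by_cases h1 : p.1 ∈ A <;> by_cases h2 : p.2 ∈ B <;> simp [Set.indicator, h1, h2]
  rw [h6, integral_volS (hmul (measurable_const.indicator hB) (norm_indicator_one_le B))]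
  refine integral_eq_zero_of_ae ?_
  filter_upwards [h0, ae_zvol_mem] with z h1 h2
  simp only [integral_const_mul, h1 h2, mul_zero, Pi.zero_apply]

theorem integral_mul_tensor (u : L2S d) (ψ : Sch d) (hm : Measurable β)
  (hC : ∀ z, ‖β z‖ ≤ C) :
  ∫ p, u p * (ψ p.1 * β p.2) ∂volS d = ∫ ξ, FT (vint β u) ξ * (𝓕⁻ ψ : Sch d) ξ := by
  rw [integral_FT_mul, FourierTransform.fourier_fourierInv_eq]
  have h1 : MemLp (fun p => ψ p.1) 2 (volS d) := by
    refine (memLp_congr_ae ?_).1 (memLp_comp_fst (ψ.toLp 2))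
    exact ae_volS_fst (ψ.coeFn_toLp 2 volume)
  have h2 : Integrable (fun p => u p * (ψ p.1 * β p.2)) (volS d) := by
    have := ((isBdd_comp_snd hm hC).memLp h1)
    exact (Lp.memLp u).integrable_mul (memLp_congr_ae (.of_forall fun p => mul_comm _ _) |>.1 this)
  rw [integral_volS' h2]; apply integral_congr_ae
  filter_upwards [vint_coe hm hC u] with X hX
  rw [hX, ← integral_mul_const]; congr 1; funext z; ring

/-- The variational formulation, where `F` is the flux and `b` the Fourier transform of the datum. -/
def IsWeakFlux (μ : ℝ) (b : Hor d → ℂ) (F : Idx d → L2S d) : Prop :=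
  ∀ x ∈ H10 d, ∑ j, ∫ p, F j p * sgrad μ x j p ∂volS d =
    ∫ ξ, b ξ * FT (vsum (x (some (inr ())))) (-ξ)

theorem isTestBottom_tensor {η : Hor d → ℂ} (hη : ContDiff ℝ ∞ η) (hc : HasCompactSupport η) (hχ : ContDiff ℝ ∞ χ) (hcχ : HasCompactSupport χ) (hs : tsupport χ ⊆ Iio 0) :
  IsTestBottom fun p : Amb d => η p.1 * χ p.2 := by
  refine ⟨(hη.comp contDiff_fst).mul (hχ.comp contDiff_snd),
    HasCompactSupport.of_support_subset_isCompact (hc.isCompact.prod hcχ.isCompact) fun p hp =>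
      ⟨subset_tsupport _ (left_ne_zero_of_mul hp), subset_tsupport _ (right_ne_zero_of_mul hp)⟩, ?_⟩
  refine (closure_minimal (fun p hp => ?_) ((isClosed_tsupport χ).preimage continuous_snd)).trans
    fun p hp => hs hp
  exact subset_tsupport _ (right_ne_zero_of_mul hp)

theorem pd_tensor (η : Sch d) (hχ : ContDiff ℝ ∞ χ) (p : Amb d) :
  (∀ i, pd (inl i) (fun p : Amb d => η p.1 * χ p.2) p =
    (LineDeriv.lineDerivOp (EuclideanSpace.single i (1 : ℝ)) η : Sch d) p.1 * χ p.2) ∧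
  pd (inr ()) (fun p : Amb d => η p.1 * χ p.2) p = η p.1 * deriv χ p.2 := by
  have h1 := (η.differentiableAt.hasFDerivAt).comp p hasFDerivAt_fst
  have h2 := ((hχ.differentiable (by simp) p.2).hasFDerivAt).comp p hasFDerivAt_snd
  have h3 : fderiv ℝ (fun p => η p.1 * χ p.2) p = _ := (h1.mul h2).fderiv
  refine ⟨fun i => ?_, ?_⟩
  · rw [pd, h3, SchwartzMap.lineDerivOp_apply_eq_fderiv]; simp [dir, mul_comm]
  · rw [pd, h3]; simp [dir]

theorem fourierInv_lineDerivOp_single (ψ : Sch d) (i : Fin d) (ξ : Hor d) :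
  (𝓕⁻ (LineDeriv.lineDerivOp (EuclideanSpace.single i (1 : ℝ)) ψ : Sch d) : Sch d) ξ =
    -((2 * π * ξ i * I) * (𝓕⁻ ψ : Sch d) ξ) := by
  rw [fourierInv_apply_eq_neg, fourierInv_apply_eq_neg, fourier_lineDerivOp_single]; simp

theorem integrable_coord_mul_schwartz {f : Hor d → ℂ} (hf : MemLp f 2 volume) (i : Fin d) (ψ : Sch d) :
  Integrable fun ξ => f ξ * ((2 * π * ξ i * I) * ψ ξ) := by
  have h := hf.integrable_mul ((𝓕 (LineDeriv.lineDerivOp (EuclideanSpace.single i (1 : ℝ))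
    (𝓕⁻ ψ : Sch d)) : Sch d).memLp 2 volume)
  refine h.congr (.of_forall fun ξ => ?_)
  simp only [Pi.mul_apply, fourier_lineDerivOp_single, FourierTransform.fourier_fourierInv_eq]

theorem FT_vsum_tensor {η : Sch d}
  (hφ : IsTestBottom fun p : Amb d => η p.1 * χ p.2)
  (hx : x (some (inr ())) =ᵐ[volS d] pd (inr ()) fun p : Amb d => η p.1 * χ p.2) :
  ∀ᵐ ξ, FT (vsum (x (some (inr ())))) (-ξ) = -(χ (-1) * (𝓕⁻ η : Sch d) ξ) := by
  have h1 : vsum (x (some (inr ()))) = (-χ (-1)) • (η.toLp 2 volume) := by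
    apply Lp.ext
    filter_upwards [vsum_coe (x (some (inr ()))), ae_ae_of_ae_volS' hx,
      Lp.coeFn_smul (-χ (-1)) (η.toLp 2), η.coeFn_toLp 2 volume] with X h1 h2 h3 h4
    rw [h1, h3, Pi.smul_apply, h4, integral_congr_ae h2, ← up_neg_one, smul_eq_mul, neg_mul,
      mul_comm, hφ.eq_neg_up X (by simp), neg_neg]
  have h2 : ∀ᵐ ξ, FT (vsum (x (some (inr ())))) ξ = -χ (-1) * (𝓕 η) ξ := by
    rw [h1, map_smul]
    filter_upwards [Lp.coeFn_smul (-χ (-1)) (FT (η.toLp 2)), FT_toLp η] with ξ h3 h4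
    rw [h3, Pi.smul_apply, h4, smul_eq_mul]
  filter_upwards [(Measure.measurePreserving_neg volume).quasiMeasurePreserving.ae h2] with ξ hξ
  rw [hξ, fourierInv_apply_eq_neg, neg_mul]

theorem IsWeakFlux.ae_vert (h : IsWeakFlux μ b F)
  (hb : ∀ ψ : Sch d, Integrable fun ξ => b ξ * ψ ξ) (hχ : ContDiff ℝ ∞ χ)
  (hc : HasCompactSupport χ) (hs : tsupport χ ⊆ Iio 0) :
  ∀ᵐ ξ, FT (vint (deriv χ) (F (inr ()))) ξ -
    ∑ i, FT (vint χ (F (inl i))) ξ * (2 * π * √μ * ξ i * I) +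
    χ (-1) * b ξ = 0 := by
  have hχ' : Continuous (deriv χ) := hχ.continuous_deriv (by simp)
  obtain ⟨C, hC⟩ := hc.exists_bound_of_continuous hχ.continuous
  obtain ⟨C', hC'⟩ := hc.deriv.exists_bound_of_continuous hχ'
  have hm := hχ.continuous.measurable
  have hm' := hχ'.measurable
  have hI : ∀ (f : L2H d) (ψ : Sch d), Integrable fun ξ => f ξ * ψ ξ := fun f ψ =>
    (Lp.memLp f).integrable_mul (ψ.memLp 2)
  have hI2 : ∀ i (ψ : Sch d), Integrable fun ξ =>
    FT (vint χ (F (inl i))) ξ * (2 * π * √μ * ξ i * I) * ψ ξ := fun i ψ => by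
    refine ((integrable_coord_mul_schwartz (Lp.memLp (FT (vint χ (F (inl i))))) i ψ).const_mul
      √μ).congr (.of_forall fun ξ => ?_)
    simp only; ring
  have hI3 := fun ψ =>
    ((hb ψ).const_mul (χ (-1))).congr (.of_forall fun ξ => (mul_assoc _ _ _).symm)
  refine ae_eq_zero_of_integral_fourierInv (fun ψ => ?_) fun η hη => ?_
  · simp only [add_mul, sub_mul, sum_mul]
    exact ((hI _ ψ).sub (integrable_finsetSum _ fun i _ => hI2 i ψ)).add (hI3 ψ)
  · have hφ := isTestBottom_tensor (η.smooth ⊤) hη hχ hc hs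
    obtain ⟨x, hx, hx1, hx2⟩ := exists_testGraph hφ
    have h1 := h x (Submodule.le_topologicalClosure _ hx)
    have e1 : ∫ ξ, b ξ * FT (vsum (x (some (inr ())))) (-ξ) = -∫ ξ, χ (-1) * b ξ * (𝓕⁻ η) ξ := by
      rw [← integral_neg]; apply integral_congr_ae
      filter_upwards [FT_vsum_tensor hφ (hx2 (inr ()))] with ξ hξ
      rw [hξ]; ring
    have e2 : ∫ p, F (inr ()) p * sgrad μ x (inr ()) p ∂volS d =
      ∫ ξ, FT (vint (deriv χ) (F (inr ()))) ξ * (𝓕⁻ η) ξ := by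
      rw [← integral_mul_tensor _ _ hm' hC']; apply integral_congr_ae
      filter_upwards [hx2 (inr ()), Lp.coeFn_smul ((scale μ (inr ()) : ℝ) : ℂ)
        (x (some (inr ())))] with p h2 h3
      rw [sgrad, h3, Pi.smul_apply, h2, (pd_tensor η hχ p).2]; simp [scale]
    have e3 : ∀ i, ∫ p, F (inl i) p * sgrad μ x (inl i) p ∂volS d =
      -∫ ξ, FT (vint χ (F (inl i))) ξ * (2 * π * √μ * ξ i * I) * (𝓕⁻ η) ξ := fun i => by
      have h5 := integral_mul_tensor (F (inl i))
        (LineDeriv.lineDerivOp (EuclideanSpace.single i (1 : ℝ)) η) hm hC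
      rw [← integral_neg]; refine Eq.trans ?_ ((congrArg (fun a => (√μ : ℂ) * a) h5).trans ?_)
      · rw [← integral_const_mul]; apply integral_congr_ae
        filter_upwards [hx2 (inl i), Lp.coeFn_smul ((scale μ (inl i) : ℝ) : ℂ)
          (x (some (inl i)))] with p h2 h3
        rw [sgrad, h3, Pi.smul_apply, h2, (pd_tensor η hχ p).1, smul_eq_mul, scale]; ring
      · rw [← integral_const_mul]; congr 1; funext ξ; rw [fourierInv_lineDerivOp_single]; ring
    rw [Fintype.sum_sum_type, e1] at h1
    simp only [e3, univ_unique, sum_singleton, PUnit.default_eq_unit, e2, sum_neg_distrib] at h1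
    simp only [add_mul, sub_mul, sum_mul]
    refine (integral_add ((hI _ _).sub (integrable_finsetSum _ fun i _ => hI2 i _)) (hI3 _)).trans ?_
    rw [integral_sub' (hI _ _) (integrable_finsetSum _ fun i _ => hI2 i _),
      integral_finsetSum _ fun i _ => hI2 i _]
    linear_combination h1

theorem IsWeakFlux.isFourierFlux (h : IsWeakFlux μ b F)
  (hb : ∀ ψ : Sch d, Integrable fun ξ => b ξ * ψ ξ)
  (hb2 : MemLp (fun ξ => (lam (-1) ξ : ℂ) * b ξ) 2) : IsFourierFlux μ b F := by
  let w : Amb d → ℂ := fun p => (lam (-1) p.1) * lift FT (F (inr ())) p +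
    (∑ i, ((√μ * I) * ((2 * π * p.1 i * lam (-1) p.1 : ℝ))) *
      dn (fun z => lift FT (F (inl i)) (p.1, z)) p.2) - (lam (-1) p.1) * b p.1
  have hl : IsSymb (lam (d := d) (-1)) := isSymb_lam_of_nonpos (by norm_num)
  have hbd : ∀ {m : Hor d → ℝ}, IsSymb m → IsBdd (volS d) fun p => (m p.1) := fun hm =>
    ⟨(measurable_ofReal.comp (hm.1.comp measurable_fst)).aestronglyMeasurable,
      hm.2.choose, .of_forall fun p => by simpa using hm.2.choose_spec p.1⟩
  have hdn : ∀ i, ∀ᵐ ξ, MemLp (fun z => lift FT (F (inl i)) (ξ, z)) 2 zvol := fun i =>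
    ae_memLp_vert (Lp.memLp _)
  have hw : MemLp w 2 (volS d) := by
    refine (((hbd hl).memLp (Lp.memLp _)).add (memLp_finsetSum _ fun i _ => ?_)).sub ?_
    · have h1 := ((hbd (isSymb_coord i)).memLp (memLp_dn (Lp.memLp (lift FT (F (inl i)))))).const_mul
        (√μ * I)
      exact (memLp_congr_ae (.of_forall fun p => (mul_assoc _ _ _).symm)).1 h1
    · refine (memLp_congr_ae ?_).1 (memLp_comp_fst (hb2.toLp _)); exact ae_volS_fst hb2.coeFn_toLp
  have h0 := ae_eq_zero_of_vert_smooth hw fun f h1 h2 h3 => by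
    obtain ⟨χ, k1, k2, k3, k4, k5⟩ := exists_vertical_cutoff h1 h2 h3
    obtain ⟨C, hC⟩ := k2.exists_bound_of_continuous k1.continuous
    have hχ' : Continuous (deriv χ) := k1.continuous_deriv (by simp)
    obtain ⟨C', hC'⟩ := k2.deriv.exists_bound_of_continuous hχ'
    have hfi : ∀ {y : ℝ → ℂ}, Integrable y zvol → Integrable (fun z => (f z) * y z) zvol := by
      intro y hy
      obtain ⟨D, hD⟩ := h2.exists_bound_of_continuous h1.continuous
      exact hy.bdd_mul (measurable_ofReal.comp h1.continuous.measurable).aestronglyMeasurable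
        (.of_forall fun z => by simpa using hD z)
    have hf1 : Integrable (fun z => (f z : ℂ)) zvol := by simpa using hfi (integrable_const 1)
    filter_upwards [h.ae_vert hb k1 k2 k3, FT_vint hχ'.measurable hC' (F (inr ())),
      ae_all_iff.2 fun i => FT_vint k1.continuous.measurable hC (F (inl i)),
      ae_all_iff.2 hdn, ae_memLp_vert (Lp.memLp (lift FT (F (inr ())))),
      ae_all_iff.2 fun i => ae_memLp_vert (memLp_dn (Lp.memLp (lift FT (F (inl i)))))]
      with ξ l1 l2 l3 l4 l5 l6
    have m1 : FT (vint (deriv χ) (F (inr ()))) ξ =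
      ∫ z, (f z) * lift FT (F (inr ())) (ξ, z) ∂zvol := by
      rw [l2]; apply integral_congr_ae
      filter_upwards [ae_zvol_mem] with z hz
      rw [(k5 z hz).deriv]
    have m2 : ∀ i, FT (vint χ (F (inl i))) ξ =
      -∫ z, (f z) * dn (fun z => lift FT (F (inl i)) (ξ, z)) z ∂zvol := fun i => by
      rw [l3, ← integral_mul_up ((l4 i).integrable one_le_two) hf1, ← integral_neg]
      apply integral_congr_ae
      filter_upwards [ae_zvol_mem] with z hz
      rw [k4 z ⟨hz.1.le, hz.2.le⟩]; ring
    have m3 : χ (-1) = -∫ z, (f z : ℂ) ∂zvol := by rw [k4 (-1) (by simp), up_neg_one]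
    rw [m1, m3] at l1
    simp only [m2] at l1
    have hi1 := hfi ((l5.integrable one_le_two).const_mul (lam (-1) ξ))
    have hi2 : ∀ i ∈ Finset.univ, Integrable (fun z => (f z) * (((√μ * I) *
      ((2 * π * ξ i * lam (-1) ξ : ℝ))) *
        dn (fun z => lift FT (F (inl i)) (ξ, z)) z)) zvol := fun i _ =>
      hfi (((l6 i).integrable one_le_two).const_mul _)
    have hi3 := hf1.mul_const ((lam (-1) ξ) * b ξ)
    simp only [w, mul_sub, mul_add, mul_sum]
    refine (integral_sub (hi1.add (integrable_finsetSum _ hi2)) hi3).trans ?_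
    rw [integral_add' hi1 (integrable_finsetSum _ hi2), integral_finsetSum _ hi2,
      integral_mul_const]
    simp only [mul_left_comm (f _ : ℂ), integral_const_mul]
    have l7 := congrArg (fun a => (lam (-1) ξ : ℂ) * a) l1
    simp only [mul_add, mul_sub, mul_sum, mul_zero] at l7
    refine Eq.trans ?_ l7; simp only [sub_eq_add_neg, ← sum_neg_distrib]
    refine congrArg₂ (· + ·) (congrArg₂ (· + ·) rfl (sum_congr rfl fun i _ => ?_)) ?_
    · push_cast; ring
    · ring
  filter_upwards [h0, ae_volS_fst (ae_all_iff.2 hdn)] with p h1 h2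
  have h3 : ((lam (-1) p.1) : ℂ) ≠ 0 := ofReal_ne_zero.2 (lam_pos _ _).ne'
  have h4 : dn (fun z => ∑ i, (2 * π * √μ * p.1 i * I) *
    lift FT (F (inl i)) (p.1, z)) p.2 = ∑ i, (2 * π * √μ * p.1 i * I) *
      dn (fun z => lift FT (F (inl i)) (p.1, z)) p.2 := by
    simp only [dn, ← integral_const_mul]
    exact integral_finsetSum _ fun i _ => (((h2 i).integrable one_le_two).const_mul _).restrict
  rw [h4]; apply mul_left_cancel₀ h3
  have h6 : w p = 0 := h1
  simp only [w] at h6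
  have h5 : ∀ i, (lam (-1) p.1) * ((2 * π * √μ * p.1 i * I) *
    dn (fun z => lift FT (F (inl i)) (p.1, z)) p.2) = ((√μ * I) *
    ((2 * π * p.1 i * lam (-1) p.1 : ℝ))) *
      dn (fun z => lift FT (F (inl i)) (p.1, z)) p.2 := fun i => by push_cast; ring
  rw [mul_sub, mul_sum]; simp only [h5]
  linear_combination h6

/-! ### Fourier transforms of distributions in Sobolev spaces -/

theorem Represents.locallyIntegrable {T : 𝓢'(Hor d, ℂ)} {g : Hor d → ℂ} (h : Represents T g) :
  LocallyIntegrable g := by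
  intro x
  let ρ : ContDiffBump x := ⟨1, 2, one_pos, one_lt_two⟩
  have h1 := ρ.hasCompactSupport.comp_left ofReal_zero
  have h2 := (h (h1.toSchwartzMap (ofRealCLM.contDiff.comp ρ.contDiff))).1
  refine ⟨Metric.closedBall x 1, Metric.closedBall_mem_nhds x one_pos, ?_⟩
  refine h2.integrableOn.congr_fun (fun y hy => ?_) measurableSet_closedBall
  have h3 := ρ.one_of_mem_closedBall hy
  exact (congrArg (fun a : ℝ => g y * a) h3).trans (by simp)

theorem Represents.ae_eq {T : 𝓢'(Hor d, ℂ)} {g g' : Hor d → ℂ} (h : Represents T g)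
  (h' : Represents T g') : g =ᵐ[volume] g' :=
  ae_eq_of_integral_schwartz h.locallyIntegrable h'.locallyIntegrable fun ψ => by
    rw [← (h ψ).2, (h' ψ).2]

theorem Represents.fhat {g : Hor d → ℂ} (h : Represents (𝓕 B) g) :
  Represents (𝓕 B) (fhat B) ∧ fhat B =ᵐ[volume] g := by
  have h1 : ∃ g, Represents (𝓕 B) g := ⟨g, h⟩
  have h2 : Represents (𝓕 B) (FlatStrip.fhat B) := by
    rw [FlatStrip.fhat, dif_pos h1]; exact h1.choose_spec
  exact ⟨h2, h2.ae_eq h⟩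

theorem lam_le_mul_rpow (r : ℝ) (ξ : Hor d) :
  lam r ξ * (1 + ‖ξ‖ ^ 2) ^ (-r / 2) ≤ (1 + (2 * π) ^ 2) ^ |r / 2| := by
  have h0 : 0 < 1 + ‖ξ‖ ^ 2 := by positivity
  have h1 : 0 < 1 + absD ξ ^ 2 := by positivity
  have h2 : 1 + absD ξ ^ 2 ≤ (1 + (2 * π) ^ 2) * (1 + ‖ξ‖ ^ 2) := by
    rw [absD]; nlinarith [sq_nonneg ‖ξ‖, sq_nonneg (2 * π)]
  have h3 : 1 + ‖ξ‖ ^ 2 ≤ (1 + (2 * π) ^ 2) * (1 + absD ξ ^ 2) := by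
    have : ‖ξ‖ ≤ absD ξ := by rw [absD]; nlinarith [Real.pi_gt_three, norm_nonneg ξ]
    nlinarith [sq_nonneg (2 * π), pow_le_pow_left₀ (norm_nonneg ξ) this 2, sq_nonneg (absD ξ),
      mul_nonneg (sq_nonneg (2 * π)) (sq_nonneg (absD ξ))]
  rw [lam, neg_div, rpow_neg h0.le, ← div_eq_mul_inv, ← div_rpow h1.le h0.le]
  rcases le_total 0 (r / 2) with hr | hr
  · rw [abs_of_nonneg hr]; exact rpow_le_rpow (by positivity) ((div_le_iff₀ h0).2 h2) hr
  · rw [abs_of_nonpos hr, ← neg_neg (r / 2), rpow_neg (by positivity), neg_neg,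
      ← Real.inv_rpow (by positivity), inv_div]
    exact rpow_le_rpow (by positivity) ((div_le_iff₀ h1).2 h3) (by linarith)

theorem fhat_of_memSobolev
  (hB : TemperedDistribution.MemSobolev r 2 B) :
  Represents (𝓕 B) (fhat B) ∧ MemLp (fun ξ => (lam r ξ : ℂ) * fhat B ξ) 2 volume := by
  obtain ⟨f', hf'⟩ := TemperedDistribution.memSobolev_iff_exists_smulLeftCLM_fourier.1 hB
  let w : ℝ → Hor d → ℂ := fun r x => (((1 + ‖x‖ ^ 2) ^ (r / 2) : ℝ))
  have hw : ∀ r, (w r).HasTemperateGrowth := fun r => by unfold w; fun_prop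
  have hmul : ∀ x, w r x * w (-r) x = 1 := fun x => by
    simp only [w]; rw [← Complex.ofReal_mul, ← rpow_add (by positivity)]; simp [neg_div]
  have hg : Represents (𝓕 B) fun ξ => w (-r) ξ * f' ξ := fun ψ => by
    have e : ∀ ξ, SchwartzMap.smulLeftCLM ℂ (w (-r)) ψ ξ = w (-r) ξ * ψ ξ := fun ξ => by
      rw [SchwartzMap.smulLeftCLM_apply_apply (hw _), smul_eq_mul]
    have e2 : SchwartzMap.smulLeftCLM ℂ (w r) (SchwartzMap.smulLeftCLM ℂ (w (-r)) ψ) = ψ := by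
      ext ξ
      rw [SchwartzMap.smulLeftCLM_apply_apply (hw _), e, smul_eq_mul, ← mul_assoc, hmul, one_mul]
    have h1 : ∀ ξ, w (-r) ξ * f' ξ * ψ ξ = f' ξ * SchwartzMap.smulLeftCLM ℂ (w (-r)) ψ ξ :=
      fun ξ => by rw [e]; ring
    simp only [h1]
    refine ⟨(Lp.memLp f').integrable_mul ((SchwartzMap.smulLeftCLM ℂ (w (-r)) ψ).memLp 2 volume), ?_⟩
    have h2 := congrArg (fun T => T (SchwartzMap.smulLeftCLM ℂ (w (-r)) ψ)) hf'
    simp only [TemperedDistribution.smulLeftCLM_apply_apply, Lp.toTemperedDistribution_apply] at h2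
    have h3 : 𝓕 B ψ = 𝓕 B (SchwartzMap.smulLeftCLM ℂ (w r) (SchwartzMap.smulLeftCLM ℂ (w (-r)) ψ)) := by
      rw [e2]
    rw [h3]; refine h2.trans (integral_congr_ae (.of_forall fun ξ => ?_))
    simp only [smul_eq_mul, mul_comm]
  refine ⟨hg.fhat.1, ?_⟩
  have hb : IsBdd volume fun ξ => (lam r ξ) * w (-r) ξ := by
    refine ⟨((Complex.continuous_ofReal.comp (continuous_lam r)).mul
      (hw (-r)).1.continuous).aestronglyMeasurable, (1 + (2 * π) ^ 2) ^ |r / 2|,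
      .of_forall fun ξ => ?_⟩
    simp only [w]
    rw [← Complex.ofReal_mul, norm_real, norm_of_nonneg
      (mul_nonneg (lam_pos _ _).le (by positivity))]
    exact lam_le_mul_rpow r ξ
  refine (memLp_congr_ae ?_).1 (hb.memLp (Lp.memLp f'))
  filter_upwards [hg.fhat.2] with ξ hξ
  rw [hξ, mul_assoc]

theorem fhat_toDist (f : Lp ℝ 2 (volume : Measure (Hor d))) :
  fhat (toDist f) =ᵐ[volume] FT (ofRealCLM.compLp f) := by
  refine (Represents.fhat fun ψ => ⟨(Lp.memLp _).integrable_mul (ψ.memLp 2 volume), ?_⟩).2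
  rw [toDist, Lp.fourier_toTemperedDistribution_eq, Lp.toTemperedDistribution_apply, FT_eq]
  simp only [smul_eq_mul, mul_comm]

theorem lintegral_multNorm
  (h : MemLp (fun ξ => (m ξ : ℂ) * fhat B ξ) 2 volume) :
  ∫⁻ ξ, ‖(m ξ : ℂ) * fhat B ξ‖ₑ ^ 2 = ofReal (multNorm m B ^ 2) := by
  have hi := h.integrable_norm_pow two_ne_zero
  rw [multNorm, sq_sqrt (by positivity), ofReal_integral_eq_lintegral_ofReal hi
    (.of_forall fun ξ => by positivity)]
  congr 1; funext ξ; rw [ofReal_pow (norm_nonneg _), ofReal_norm]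

theorem memLp_dataNorm (hμ : 0 < μ)
  (hB : TemperedDistribution.MemSobolev (s - 1 / 2) 2 B) :
  MemLp (fun ξ => ((lam s ξ * (1 / √(1 + √μ * absD ξ)) : ℝ) : ℂ) * fhat B ξ) 2 volume := by
  have h := (fhat_of_memSobolev hB).2
  have hb : IsBdd volume fun ξ : Hor d => ((lam (1 / 2) ξ * (1 / √(1 + √μ * absD ξ)) : ℝ)) := by
    refine ⟨?_, √(1 + 1 / √μ), .of_forall fun ξ => ?_⟩
    · have h1 : Measurable fun ξ : Hor d => 1 / √(1 + √μ * absD ξ) := by unfold absD; fun_prop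
      exact (measurable_ofReal.comp ((measurable_lam _).mul h1)).aestronglyMeasurable
    · have h0 : 0 ≤ absD ξ := by unfold absD; positivity
      have hm := sqrt_pos.2 hμ
      have h1 : 0 < 1 + √μ * absD ξ := by positivity
      rw [norm_real, norm_of_nonneg (mul_nonneg (lam_pos _ _).le (by positivity)),
        mul_one_div, div_le_iff₀ (sqrt_pos.2 h1), ← sqrt_mul (by positivity)]
      apply Real.le_sqrt_of_sq_le; rw [pow_two, ← lam_add]
      have h2 : lam (1 / 2 + 1 / 2) ξ ≤ 1 + absD ξ := by
        norm_num only; rw [lam_one]; exact Real.sqrt_le_iff.2 ⟨by positivity, by nlinarith⟩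
      have h3 : 1 / √μ * (√μ * absD ξ) = absD ξ := by field_simp
      have h4 : 0 ≤ 1 / √μ := by positivity
      nlinarith [mul_nonneg hm.le h0]
  refine (memLp_congr_ae (.of_forall fun ξ => ?_)).1 (hb.memLp h)
  have h1 : lam s ξ = lam (1 / 2) ξ * lam (s - 1 / 2) ξ := by rw [← lam_add]; ring_nf
  simp only [h1]; push_cast; ring

/-! ### The variables `G` and the flux -/

theorem surjective_of_coercive {V : Type*} [NormedAddCommGroup V] [InnerProductSpace ℂ V]
  [CompleteSpace V] {A : V →L[ℂ] V} (hc : 0 < c)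
  (h : ∀ x, c * ‖x‖ ^ 2 ≤ (inner ℂ x (A x) : ℂ).re) : Function.Surjective A := by
  have h1 : ∀ x, ‖x‖ ≤ c⁻¹ * ‖A x‖ := fun x => by
    rcases eq_or_ne x 0 with rfl | hx
    · simp
    have h2 := (h x).trans ((re_le_norm _).trans (norm_inner_le_norm x (A x)))
    have h3 := norm_pos_iff.2 hx
    rw [inv_mul_eq_div, le_div_iff₀ hc]; nlinarith
  have h2 : AntilipschitzWith ⟨c⁻¹, by positivity⟩ A := A.antilipschitz_of_bound h1
  have h3 := h2.isClosed_range A.uniformContinuous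
  have : CompleteSpace A.range := h3.completeSpace_coe
  have h4 : A.rangeᗮ = ⊥ := by
    rw [Submodule.eq_bot_iff]
    intro y hy
    have h5 : inner ℂ y (A y) = 0 := Submodule.inner_left_of_mem_orthogonal (LinearMap.mem_range_self _ y) hy
    have h6 := h y
    rw [h5, zero_re] at h6
    have h7 : ‖y‖ ^ 2 ≤ 0 := by nlinarith [sq_nonneg ‖y‖]
    simpa using le_antisymm h7 (sq_nonneg _)
  rw [Submodule.orthogonal_eq_bot_iff] at h4
  exact LinearMap.range_eq_top.1 h4

/-- The scaled gradient, as an operator. -/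
def sgradL (μ : ℝ) (j : Idx d) : GraphSp d →L[ℂ] L2S d := (scale μ j : ℂ) • PiLp.proj 2 _ (some j)

/-- The variables `v = ∂_z u / J` and `g = √μ ∇_X u - q v`. -/
def gL (μ : ℝ) (q : Fin d → Amb d → ℝ) (J : Amb d → ℝ) : Idx d → GraphSp d →L[ℂ] L2S d :=
  elim (fun i => sgradL μ (inl i) - mulS (q i) ∘L mulS (fun p => (J p)⁻¹) ∘L sgradL μ (inr ()))
    (fun _ => mulS (fun p => (J p)⁻¹) ∘L sgradL μ (inr ()))

/-- The flux, as an operator. -/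
def fluxL (μ : ℝ) (q : Fin d → Amb d → ℝ) (J : Amb d → ℝ) : Idx d → GraphSp d →L[ℂ] L2S d :=
  elim (fun i => mulS J ∘L gL μ q J (inl i))
    (fun _ => gL μ q J (inr ()) - ∑ i, mulS (q i) ∘L gL μ q J (inl i))

theorem fluxL_apply (μ : ℝ) (q : Fin d → Amb d → ℝ) (J : Amb d → ℝ) (x : GraphSp d) :
  (fun j => fluxL μ q J j x) = fluxS q J fun j => gL μ q J j x := by
  funext j
  rcases j with i | _
  · rfl
  · simp [fluxL, fluxS, fluxOp]

theorem sgradL_apply (μ : ℝ) (x : GraphSp d) (j : Idx d) : sgradL μ j x = sgrad μ x j := rfl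

section System

variable {t K c : ℝ} {q : Fin d → Amb d → ℝ} {J : Amb d → ℝ}

theorem IsSystem.bddJ_inv (hS : IsSystem t K c q J) : IsBdd (volS d) fun p => (((J p)⁻¹ : ℝ) : ℂ) := by
  refine ⟨?_, c⁻¹, ?_⟩
  · simp only [ofReal_inv]; exact hS.bddJ.1.inv₀
  · filter_upwards [hS.le] with p hp
    rw [norm_real, norm_of_nonneg (inv_nonneg.2 (hS.hc.le.trans hp))]; exact inv_anti₀ hS.hc hp

theorem IsSystem.gradS_gL (hS : IsSystem t K c q J) (μ : ℝ) (x : GraphSp d) :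
  gradS q J (fun j => gL μ q J j x) = sgrad μ x := by
  funext j
  rcases j with i | _
  · simp [gradS, gradOp, gL, sgradL_apply]
  · have h : ∀ f, mulS J (mulS (fun p => (J p)⁻¹) f) = f := fun f => by
      rw [mulS, mulS, mulOp_mulOp hS.bddJ hS.bddJ_inv]; apply Lp.ext
      filter_upwards [mulOp_coe (hS.bddJ.mul hS.bddJ_inv) f, hS.le] with p h1 h2
      have h3 := (hS.hc.trans_le h2).ne'
      rw [h1, ← Complex.ofReal_mul, mul_inv_cancel₀ h3, Complex.ofReal_one, one_mul]
    simp [gradS, gradOp, gL, sgradL_apply, h]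

theorem IsSystem.fluxL_coe (hS : IsSystem t K c q J) (μ : ℝ) (x : GraphSp d) :
  ∀ᵐ p ∂volS d, (∀ i, fluxL μ q J (inl i) x p =
    J p * sgrad μ x (inl i) p - q i p * sgrad μ x (inr ()) p) ∧
    fluxL μ q J (inr ()) x p = -∑ i, q i p * sgrad μ x (inl i) p +
      ((1 + ∑ i, q i p ^ 2) / J p : ℝ) * sgrad μ x (inr ()) p := by
  have hv := mulOp_coe hS.bddJ_inv (sgrad μ x (inr ()))
  have hqv : ∀ i, mulS (q i) (mulS (fun p => (J p)⁻¹) (sgrad μ x (inr ()))) =ᵐ[volS d] _ :=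
    fun i => mulOp_coe (hS.bddq i) _
  have hg : ∀ i, gL μ q J (inl i) x =ᵐ[volS d] _ := fun i => Lp.coeFn_sub (sgrad μ x (inl i))
    (mulS (q i) (mulS (fun p => (J p)⁻¹) (sgrad μ x (inr ()))))
  have hJ : ∀ i, mulS J (gL μ q J (inl i) x) =ᵐ[volS d] _ := fun i => mulOp_coe hS.bddJ _
  have hq : ∀ i, mulS (q i) (gL μ q J (inl i) x) =ᵐ[volS d] _ := fun i => mulOp_coe (hS.bddq i) _
  have e : fluxL μ q J (inr ()) x = mulS (fun p => (J p)⁻¹) (sgrad μ x (inr ())) -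
    ∑ i, mulS (q i) (gL μ q J (inl i) x) := by
    simp [fluxL, gL, sgradL_apply]
  rw [e]
  filter_upwards [hv, ae_all_iff.2 hqv, ae_all_iff.2 hg, ae_all_iff.2 hJ, ae_all_iff.2 hq, hS.le,
    Lp.coeFn_sub _ (∑ i, mulS (q i) (gL μ q J (inl i) x)),
    Lp.coeFn_finsetSum Finset.univ fun i => mulS (q i) _]
    with p k1 k2 k3 k4 k5 k6 k7 k8
  have h0 := ofReal_ne_zero.2 (hS.hc.trans_le k6).ne'
  have k1' : mulS _ _ p =
    _ * sgrad μ x (inr ()) p := k1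
  have hgi : ∀ i, gL μ q J (inl i) x p = sgrad μ x (inl i) p -
    q i p * _ := fun i => by
    rw [k3 i, Pi.sub_apply, k2 i, k1']
  refine ⟨fun i => ?_, ?_⟩
  · refine (k4 i).trans ?_; rw [hgi]; push_cast; field_simp
  · rw [k7, Pi.sub_apply, k8, k1']; simp only [Finset.sum_apply, k5, hgi, mul_sub, sum_sub_distrib]
    push_cast; rw [add_div, add_mul, sum_div, sum_mul]
    have h1 : ∀ i, (q i p) * (q i p * ((J p : ℂ)⁻¹ * sgrad μ x (inr ()) p)) =
      (q i p) ^ 2 / J p * sgrad μ x (inr ()) p := fun i => by ring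
    ring

theorem IsSystem.coercive_flux (hS : IsSystem t K c q J) (hμ : 0 < μ) :
  ∃ c' : ℝ, 0 < c' ∧ ∀ x ∈ H10 d,
    c' * ‖x‖ ^ 2 ≤ (∑ j, inner ℂ (sgrad μ x j) (fluxL μ q J j x) : ℂ).re := by
  set C := 2 + (2 * d + 1) * (1 + coefBound d t K) ^ 2 with hC
  have hC0 : 0 < C := by positivity
  set m := min 1 μ with hm
  refine ⟨c * C⁻¹ * m / 2, by have := hS.hc; positivity, fun x hx => ?_⟩
  have h1 := sum_inner_gradOp_fluxOp
    (fun i => inner_mulS_left (hS.bddq i)) (inner_mulS_left hS.bddJ) hS.comm_q_J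
    fun j => gL μ q J j x
  have h2 := sum_norm_gradOp_le hS.norm_q_le hS.norm_J_le fun j => gL μ q J j x
  have e1 : gradOp (fun i => mulS (q i)) (mulS J) (fun j => gL μ q J j x) = sgrad μ x :=
    hS.gradS_gL μ x
  have e2 : fluxOp _ (mulS J) _ =
    fun j => fluxL μ q J j x := (fluxL_apply μ q J x).symm
  rw [e1, e2] at h1
  rw [e1, ← hC] at h2
  rw [h1, re_sum]
  have h3 : c * ∑ j, ‖gL μ q J j x‖ ^ 2 ≤
    ∑ j, (inner ℂ (gL μ q J j x) (mulS J (gL μ q J j x))).re := by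
    rw [mul_sum]; exact sum_le_sum fun j _ => hS.coercive _
  refine le_trans ?_ h3
  have h4 : m * ∑ j, ‖x (some j)‖ ^ 2 ≤ ∑ j, ‖sgrad μ x j‖ ^ 2 := by
    rw [mul_sum]; refine sum_le_sum fun j _ => ?_
    rw [sgrad, norm_smul, mul_pow]; refine mul_le_mul_of_nonneg_right ?_ (sq_nonneg _)
    rcases j with i | _
    · simp [scale, sq_sqrt hμ.le, abs_of_nonneg, hm]
    · simp [scale, hm]
  have h5 : ‖x‖ ^ 2 ≤ 2 * ∑ j, ‖x (some j)‖ ^ 2 := by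
    rw [PiLp.norm_sq_eq_of_L2, Fintype.sum_option]
    have h6 := pow_le_pow_left₀ (norm_nonneg _) (norm_le_of_mem_H10 hx) 2
    have h7 := single_le_sum (f := fun j => ‖x (some j)‖ ^ 2) (fun j _ => sq_nonneg _)
      (mem_univ (inr ()))
    linarith
  calc c * C⁻¹ * m / 2 * ‖x‖ ^ 2 ≤ c * C⁻¹ * m / 2 * (2 * ∑ j, ‖x (some j)‖ ^ 2) := by
        have := hS.hc; gcongr
    _ = c * (C⁻¹ * (m * ∑ j, ‖x (some j)‖ ^ 2)) := by ring
    _ ≤ c * _ := by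
      have h8 := hS.hc.le
      exact mul_le_mul_of_nonneg_left (mul_le_mul_of_nonneg_left (h4.trans h2) (by positivity)) h8
    _ = c * ∑ j, ‖gL μ q J j x‖ ^ 2 := by rw [inv_mul_cancel_left₀ hC0.ne']

end System

/-! ### Existence and uniqueness -/

theorem ae_neg {p : Hor d → Prop} (h : ∀ᵐ ξ, p ξ) : ∀ᵐ ξ, p (-ξ) :=
  (Measure.measurePreserving_neg volume).quasiMeasurePreserving.ae h

theorem lintegral_pairing_sq_le (μ : ℝ) (hb : AEStronglyMeasurable b) (hx : x ∈ H10 d) :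
  (∫⁻ ξ, ‖b ξ * FT (vsum (x (some (inr ())))) (-ξ)‖ₑ) ^ 2 ≤
    (∫⁻ ξ, ‖((1 / √(1 + √μ * absD ξ) : ℝ) : ℂ) * b ξ‖ₑ ^ 2) * (3 * ∑ j, ‖sgrad μ x j‖ₑ ^ 2) := by
  set τ := FT (vsum (x (some (inr ())))) with hτ
  have hone : IsSymb fun _ : Hor d => 1 := ⟨measurable_const, 1, by simp⟩
  have h1 := (isFourierGrad_of_mem_H10 hx μ).lintegral_trace_le hone (fun _ => zero_le_one)
  have e1 : sgrad μ x (inr ()) = x (some (inr ())) := by simp [sgrad, scale]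
  have e2 : ∀ u, ‖lift (fm fun _ => 1) u‖ₑ ^ 2 = ‖u‖ₑ ^ 2 := fun u => by
    rw [enorm_sq_lift_fm hone (fun _ => zero_le_one), ← enorm_lift_FT u, enorm_sq_eq_lintegral,
      lintegral_volS' ((Lp.aestronglyMeasurable _).enorm.pow_const 2)]
    simp
  simp only [e2, e1, one_mul] at h1
  have hpos : ∀ ξ : Hor d, 0 < 1 + √μ * absD ξ := fun ξ => by unfold absD; positivity
  have hwm : Measurable fun ξ : Hor d => √(1 + √μ * absD ξ) := by unfold absD; fun_prop
  have h2 : ∫⁻ ξ, (ofReal (√(1 + √μ * absD ξ)) * ‖τ (-ξ)‖ₑ) ^ 2 ≤ 3 * ∑ j, ‖sgrad μ x j‖ₑ ^ 2 := by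
    refine le_trans (le_of_eq ?_) h1; rw [← lintegral_neg_eq_self]
    have h3 : ∀ ξ : Hor d, absD (-ξ) = absD ξ := fun ξ => by simp [absD]
    apply lintegral_congr_ae
    filter_upwards [FT_vsum (x (some (inr ()))) ▸ vsum_coe (lift FT (x (some (inr ()))))] with ξ hξ
    rw [h3, neg_neg, hτ, hξ]
  have h4 : ∀ ξ, ‖b ξ * τ (-ξ)‖ₑ = ‖((1 / √(1 + √μ * absD ξ) : ℝ)) * b ξ‖ₑ *
    (ofReal (√(1 + √μ * absD ξ)) * ‖τ (-ξ)‖ₑ) := fun ξ => by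
    have h5 := sqrt_pos.2 (hpos ξ)
    rw [enorm_mul, enorm_mul, ← ofReal_norm ((1 / √(1 + √μ * absD ξ) : ℝ) : ℂ), norm_real,
      norm_of_nonneg (by positivity), mul_comm (ofReal _) ‖b ξ‖ₑ, mul_assoc,
      ← mul_assoc (ofReal _), ← ofReal_mul (by positivity),
      one_div_mul_cancel h5.ne', ofReal_one, one_mul]
  simp only [h4]; refine (lintegral_mul_sq_le _ ?_ ?_).trans (mul_le_r h2)
  · exact ((measurable_ofReal.comp (measurable_const.div hwm)).aestronglyMeasurable.mul hb).enorm
  · exact hwm.ennreal_ofReal.aemeasurable.mul ((Lp.aestronglyMeasurable τ).comp_quasiMeasurePreserving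
      (Measure.measurePreserving_neg volume).quasiMeasurePreserving).enorm

theorem sum_norm_sgrad_le (hμ : 0 ≤ μ) (x : GraphSp d) :
  ∑ j, ‖sgrad μ x j‖ ^ 2 ≤ (1 + μ) * ‖x‖ ^ 2 := by
  rw [PiLp.norm_sq_eq_of_L2, Fintype.sum_option, mul_add, mul_sum]
  refine le_add_of_nonneg_of_le (by positivity) (sum_le_sum fun j _ => ?_)
  rw [sgrad, norm_smul, mul_pow]; refine mul_le_mul_of_nonneg_right ?_ (sq_nonneg _)
  rcases j with i | _
  · simp [scale, sq_sqrt hμ]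
  · simp [scale, hμ]

theorem exists_functional (hμ : 0 ≤ μ) (hbm : AEStronglyMeasurable b)
  (hb : MemLp (fun ξ => ((1 / √(1 + √μ * absD ξ) : ℝ) : ℂ) * b ξ) 2 volume) :
  ∃ ℓ : H10 d →L[ℂ] ℂ, ∀ y : H10 d, ℓ y = ∫ ξ, b ξ * FT (vsum (y.1 (some (inr ())))) (-ξ) := by
  set D : ℝ≥0∞ := ∫⁻ ξ, ‖((1 / √(1 + √μ * absD ξ) : ℝ)) * b ξ‖ₑ ^ 2 with hD
  have hDt := ((memLp_two_iff hb.1).1 hb).ne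
  have hle : ∀ y : H10 d, (∫⁻ ξ, ‖b ξ * FT (vsum (y.1 (some (inr ())))) (-ξ)‖ₑ) ^ 2 ≤
    ofReal (D.toReal * (3 * ((1 + μ) * ‖y‖ ^ 2))) := fun y => by
    refine (lintegral_pairing_sq_le μ hbm y.2).trans ?_
    rw [ofReal_mul toReal_nonneg, ofReal_toReal hDt, ofReal_mul (by norm_num), ofReal_ofNat]
    refine mul_le_r (mul_le_r ?_)
    refine le_trans (le_of_eq ?_) (ofReal_le_ofReal (sum_norm_sgrad_le hμ y.1))
    rw [ofReal_sum_of_nonneg fun j _ => sq_nonneg _]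
    simp only [ofReal_pow (norm_nonneg _), ofReal_norm]
  have hτm : ∀ f : L2H d, AEStronglyMeasurable fun ξ => f (-ξ) := fun f =>
    (Lp.aestronglyMeasurable f).comp_quasiMeasurePreserving
      (Measure.measurePreserving_neg volume).quasiMeasurePreserving
  have hi : ∀ y : H10 d, Integrable fun ξ => b ξ * FT (vsum (y.1 (some (inr ())))) (-ξ) :=
    fun y => ⟨hbm.mul (hτm _), by
      have h1 := (hle y).trans_lt ofReal_lt_top
      exact ((ENNReal.pow_lt_top_iff).1 h1).resolve_right two_ne_zero⟩
  refine ⟨LinearMap.mkContinuous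
    { toFun := fun y => ∫ ξ, b ξ * FT (vsum (y.1 (some (inr ())))) (-ξ)
      map_add' := fun y y' => ?_
      map_smul' := fun a y => ?_ } (√(D.toReal * (3 * (1 + μ)))) fun y => ?_, fun y => rfl⟩
  · rw [← integral_add (hi y) (hi y')]; apply integral_congr_ae
    filter_upwards [ae_neg (Lp.coeFn_add (FT (vsum (y.1 (some (inr ())))))
      (FT (vsum (y'.1 (some (inr ()))))))] with ξ hξ
    have e : FT (vsum ((y + y').1 (some (inr ())))) = FT (vsum (y.1 (some (inr ())))) +
      FT (vsum (y'.1 (some (inr ())))) := by simp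
    rw [e, hξ, Pi.add_apply, mul_add]
  · rw [RingHom.id_apply, smul_eq_mul, ← integral_const_mul]; apply integral_congr_ae
    filter_upwards [ae_neg (Lp.coeFn_smul a (FT (vsum (y.1 (some (inr ()))))))] with ξ hξ
    have e : FT (vsum ((a • y).1 (some (inr ())))) = a • FT (vsum (y.1 (some (inr ())))) := by simp
    rw [e, hξ, Pi.smul_apply, smul_eq_mul]; ring
  · have h1 := (pow_le_pow_left' (enorm_integral_le_lintegral_enorm
      fun ξ => b ξ * FT (vsum (y.1 (some (inr ())))) (-ξ)) 2).trans (hle y)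
    rw [← ofReal_norm, ← ofReal_pow (norm_nonneg _), ofReal_le_ofReal_iff (by positivity)] at h1
    change ‖∫ ξ, b ξ * FT (vsum (y.1 (some (inr ())))) (-ξ)‖ ≤ _
    rw [← abs_of_nonneg (norm_nonneg y), ← Real.sqrt_sq_eq_abs, ← sqrt_mul (by positivity)]
    apply Real.le_sqrt_of_sq_le; linarith

section System

variable {t K c : ℝ} {q : Fin d → Amb d → ℝ} {J : Amb d → ℝ}

theorem IsSystem.fluxL_star (hS : IsSystem t K c q J) (μ : ℝ) {y : GraphSp d}
  (h : ∀ k, y k =ᵐ[volS d] fun p => conj (x k p)) :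
  ∀ᵐ p ∂volS d, ∀ j, sgrad μ y j p = conj (sgrad μ x j p) ∧
    fluxL μ q J j y p = conj (fluxL μ q J j x p) := by
  have hs : ∀ j, ∀ᵐ p ∂volS d, sgrad μ y j p = conj (sgrad μ x j p) := fun j => by
    filter_upwards [h (some j), Lp.coeFn_smul (scale μ j : ℂ) (x (some j)),
      Lp.coeFn_smul (scale μ j : ℂ) (y (some j))] with p h1 h2 h3
    rw [sgrad, sgrad, h2, h3]; simp [h1]
  filter_upwards [ae_all_iff.2 hs, hS.fluxL_coe μ x, hS.fluxL_coe μ y] with p h1 h2 h3 j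
  refine ⟨h1 j, ?_⟩
  rcases j with i | ⟨⟩
  · rw [h2.1, h3.1, h1, h1]; simp
  · rw [h2.2, h3.2]; simp only [h1, map_add, map_neg, map_sum, map_mul, conj_ofReal]

theorem inner_eq_integral_conj {f g g' : L2S d} (h : g' =ᵐ[volS d] fun p => conj (g p)) :
  inner ℂ g f = ∫ p, g' p * f p ∂volS d := by
  rw [L2.inner_def]; apply integral_congr_ae
  filter_upwards [h] with p hp
  rw [hp, RCLike.inner_apply, mul_comm]

theorem IsSystem.exists_isWeakFlux (hS : IsSystem t K c q J) (hμ : 0 < μ)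
  (hbm : AEStronglyMeasurable b)
  (hb : MemLp (fun ξ => ((1 / √(1 + √μ * absD ξ) : ℝ) : ℂ) * b ξ) 2 volume) :
  ∃ x ∈ H10 d, IsWeakFlux μ b fun j => fluxL μ q J j x := by
  obtain ⟨ℓ, hℓ⟩ := exists_functional hμ.le hbm hb
  have hcomp : CompleteSpace (H10 d) := (testGraph d).isClosed_topologicalClosure.completeSpace_coe
  let A : H10 d →L[ℂ] H10 d := ∑ j, (ContinuousLinearMap.adjoint (sgradL μ j ∘L (H10 d).subtypeL)) ∘L
    (fluxL μ q J j ∘L (H10 d).subtypeL)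
  have hA : ∀ x y : H10 d, inner ℂ y (A x) = ∑ j, inner ℂ (sgrad μ y.1 j) (fluxL μ q J j x.1) :=
    fun x y => by
      simp only [A, sum_apply, inner_sum, comp_apply, ContinuousLinearMap.adjoint_inner_right]; rfl
  obtain ⟨c', hc', hcoer⟩ := hS.coercive_flux hμ
  obtain ⟨X, hX⟩ := surjective_of_coercive hc' (fun x => by
    rw [hA]; exact hcoer x.1 x.2) ((InnerProductSpace.toDual ℂ (H10 d)).symm ℓ)
  have hX2 : ∀ y, ∑ j, inner ℂ (fluxL μ q J j X.1) (sgrad μ y.1 j) = ℓ y := fun y => by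
    rw [← InnerProductSpace.toDual_symm_apply, ← hX, ← inner_conj_symm, hA, map_sum]
    simp only [inner_conj_symm]
  obtain ⟨x, hx, hx2⟩ := exists_star_mem_H10 X.2
  refine ⟨x, hx, fun y hy => ?_⟩; rw [← hℓ ⟨y, hy⟩, ← hX2 ⟨y, hy⟩]
  refine sum_congr rfl fun j _ => (inner_eq_integral_conj ?_).symm
  filter_upwards [hS.fluxL_star μ hx2] with p hp
  exact (hp j).2

theorem IsSystem.eq_of_isWeakFlux (hS : IsSystem t K c q J) (hμ : 0 < μ)
  {y : GraphSp d} (hx : x ∈ H10 d) (hy : y ∈ H10 d)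
  (hbx : IsWeakFlux μ b fun j => fluxL μ q J j x)
  (hby : IsWeakFlux μ b fun j => fluxL μ q J j y) : x = y := by
  obtain ⟨c', hc', hcoer⟩ := hS.coercive_flux hμ
  have hxy := (H10 d).sub_mem hx hy
  obtain ⟨w, hw, hw2⟩ := exists_star_mem_H10 hxy
  have h1 := hcoer _ hxy
  have h2 : ∑ j, inner ℂ (sgrad μ (x - y) j) (fluxL μ q J j (x - y)) = 0 := by
    have h3 : ∀ f j, inner ℂ (sgrad μ (x - y) j) f =
      ∫ p, f p * sgrad μ w j p ∂volS d := fun f j => by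
      rw [inner_eq_integral_conj (g' := sgrad μ w j)]
      · simp only [mul_comm]
      · filter_upwards [hS.fluxL_star μ hw2] with p hp
        exact (hp j).1
    simp only [map_sub, inner_sub_right, sum_sub_distrib]; simp only [h3]
    exact sub_eq_zero.2 ((hbx w hw).trans (hby w hw).symm)
  rw [h2, zero_re] at h1
  have h4 : ‖x - y‖ ^ 2 ≤ 0 := by nlinarith [sq_nonneg ‖x - y‖]
  have h5 : ‖x - y‖ = 0 := by simpa using le_antisymm h4 (sq_nonneg _)
  exact sub_eq_zero.1 (norm_eq_zero.1 h5)

theorem IsSystem.fluxL_matP (hμ : 0 ≤ μ)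
  (hS : IsSystem t K c (fun i p => √μ * pd (inl i) σ p) fun p => 1 + pd (inr ()) σ p)
  (x : GraphSp d) : ∀ᵐ p ∂volS d, ∀ j,
    fluxL μ (fun i p => √μ * pd (inl i) σ p) (fun p => 1 + pd (inr ()) σ p) j x p =
      ∑ i, sgrad μ x i p * (matP μ σ p i j : ℂ) := by
  filter_upwards [hS.fluxL_coe μ x, hS.le] with p h1 h2 j
  have h0 := (hS.hc.trans_le h2).ne'
  rcases j with k | ⟨⟩
  · rw [h1.1, Fintype.sum_sum_type]
    simp only [matP, matQ, Matrix.add_apply, Matrix.fromBlocks_apply₁₁, Matrix.fromBlocks_apply₂₁,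
      Matrix.smul_apply, Matrix.one_apply, Matrix.of_apply, inl.injEq, smul_eq_mul,
      reduceCtorEq, if_false, zero_add, univ_unique, sum_singleton,
      PUnit.default_eq_unit]
    have h3 : ∀ i, sgrad μ x (inl i) p * ((((if i = k then 1 else 0) +
      pd (inr ()) σ p * if i = k then 1 else 0) : ℝ) : ℂ) =
      if i = k then sgrad μ x (inl i) p * (1 + pd (inr ()) σ p) else 0 := fun i => by
      split_ifs <;> simp
    simp only [h3, Finset.sum_ite_eq', mem_univ, if_true]; push_cast; ring
  · rw [h1.2, Fintype.sum_sum_type]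
    simp only [matP, matQ, Matrix.add_apply, Matrix.fromBlocks_apply₁₂, Matrix.fromBlocks_apply₂₂,
      Matrix.one_apply, Matrix.of_apply, reduceCtorEq, if_false, zero_add, if_true,
      univ_unique, sum_singleton, PUnit.default_eq_unit]
    have h3 : (1 + ∑ i, (√μ * pd (inl i) σ p) ^ 2) / (1 + pd (inr ()) σ p) =
      1 + (-pd (inr ()) σ p + μ * ∑ i, pd (inl i) σ p ^ 2) / (1 + pd (inr ()) σ p) := by
      simp only [mul_pow, sq_sqrt hμ, ← mul_sum]; field_simp; ring
    rw [h3, ← sum_neg_distrib]; congr 1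
    · refine sum_congr rfl fun i _ => ?_
      push_cast; ring
    · ring

theorem IsSystem.isVariationalSolution_iff (hμ : 0 ≤ μ)
  (hS : IsSystem t K c (fun i p => √μ * pd (inl i) σ p) fun p => 1 + pd (inr ()) σ p)
  (B : 𝓢'(Hor d, ℂ)) (hx : x ∈ H10 d) (hu : x none =ᵐ[volS d] u)
  (hmem : MemH10surf u) :
  IsVariationalSolution μ (matP μ σ) B u ↔ IsWeakFlux μ (fhat B) fun j =>
    fluxL μ (fun i p => √μ * pd (inl i) σ p) (fun p => 1 + pd (inr ()) σ p) j x := by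
  have hgrad : ∀ {y : GraphSp d} {v : Amb d → ℂ}, y ∈ H10 d → y none =ᵐ[volS d] v →
    ∀ᵐ p ∂volS d, ∀ j, gradMu μ v j p = sgrad μ y j p := fun {y v} hy hv => by
    refine ae_all_iff.2 fun j => ?_
    filter_upwards [weakPartial_of_mem_H10 hy hv j, Lp.coeFn_smul (scale μ j : ℂ) (y (some j))]
      with p h1 h2
    rw [gradMu, ← h1, sgrad, h2, Pi.smul_apply, smul_eq_mul]
  have key : ∀ {y : GraphSp d} {v : Amb d → ℂ}, y ∈ H10 d → y none =ᵐ[volS d] v →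
    (∫ p, ∑ i, gradMu μ u i p * ∑ j, (matP μ σ p i j) * gradMu μ v j p ∂volS d
      = -bracket B (bottomTrace v) ↔
    ∑ j, ∫ p, fluxL μ (fun i p => √μ * pd (inl i) σ p) (fun p => 1 + pd (inr ()) σ p) j x p *
      sgrad μ y j p ∂volS d =
        ∫ ξ, fhat B ξ * FT (vsum (y (some (inr ())))) (-ξ)) := fun {y v} hy hv => by
    have e1 : -bracket B (bottomTrace v) = ∫ ξ, fhat B ξ * FT (vsum (y (some (inr ())))) (-ξ) := by
      rw [bracket, bottomTrace_eq hy hv, ← FT_eq, map_neg, ← integral_neg]; apply integral_congr_ae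
      filter_upwards [ae_neg (Lp.coeFn_neg (FT (vsum (y (some (inr ()))))))] with ξ hξ
      rw [hξ, Pi.neg_apply]; ring
    rw [e1, ← integral_finsetSum _ fun j _ => (Lp.memLp _).integrable_mul (Lp.memLp _)]
    refine Eq.congr (integral_congr_ae ?_) rfl
    filter_upwards [hgrad hx hu, hgrad hy hv, hS.fluxL_matP hμ x] with p h1 h2 h3
    simp only [h1, h2, h3, mul_sum, sum_mul]; rw [Finset.sum_comm]; simp only [mul_assoc]
  constructor
  · exact fun h y hy => (key hy (ae_eq_refl _)).1 (h.2 _ (memH10surf_of_mem_H10 hy))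
  · refine fun h => ⟨hmem, fun v hv => ?_⟩
    obtain ⟨y, hy, h1, -⟩ := hv.exists_mem_H10
    exact (key hy h1).2 (h y hy)

theorem IsSystem.exists_unique_solution (hμ : 0 < μ) (hs : 0 ≤ s)
  (hS : IsSystem t K c (fun i p => √μ * pd (inl i) σ p) fun p => 1 + pd (inr ()) σ p) (hB : TemperedDistribution.MemSobolev (s - 1 / 2) 2 B) :
  ∃ x ∈ H10 d, IsVariationalSolution μ (matP μ σ) B (x none) ∧
    (∀ u, IsVariationalSolution μ (matP μ σ) B u → u =ᵐ[volS d] x none) ∧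
    IsFourierFlux μ (fhat B) (fun j => fluxL μ (fun i p => √μ * pd (inl i) σ p)
      (fun p => 1 + pd (inr ()) σ p) j x) := by
  have hB0 : TemperedDistribution.MemSobolev (0 - 1 / 2) 2 B := hB.mono (by linarith)
  have h1 := fhat_of_memSobolev hB
  have hb := memLp_dataNorm hμ hB0
  simp only [lam_zero, one_mul] at hb
  obtain ⟨x, hx, hx2⟩ := hS.exists_isWeakFlux hμ h1.1.locallyIntegrable.aestronglyMeasurable hb
  have hmem := memH10surf_of_mem_H10 hx
  refine ⟨x, hx, (hS.isVariationalSolution_iff hμ.le B hx (ae_eq_refl _) hmem).2 hx2,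
    fun u hu => ?_, hx2.isFourierFlux (fun ψ => (h1.1 ψ).1)
      (fhat_of_memSobolev (hB.mono (by linarith))).2⟩
  obtain ⟨y, hy, h2, -⟩ := hu.1.exists_mem_H10
  have h3 := (hS.isVariationalSolution_iff hμ.le B hy h2 hu.1).1 hu
  rw [hS.eq_of_isWeakFlux hμ hx hy hx2 h3]; exact h2.symm

end System

/-! ### Vertical increments -/

/-- The Lebesgue measure on the heights `z` such that `z` and `z + τ` belong to `(-1, 0)`. -/
def svol (τ : ℝ) : Measure ℝ := volume.restrict (Ioo (-1) (-τ))

instance (τ : ℝ) : SFinite (svol τ) := by unfold svol; infer_instance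

theorem ae_svol (hτ : 0 < τ) {p : ℝ → Prop} (h : ∀ᵐ z ∂zvol, p z) :
  ∀ᵐ z ∂svol τ, z ∈ Ioo (-1 : ℝ) (-τ) ∧ p z ∧ p (z + τ) := by
  rw [zvol, ae_restrict_iff' measurableSet_Ioo] at h
  rw [svol, ae_restrict_iff' measurableSet_Ioo]
  filter_upwards [h, (measurePreserving_add_right volume τ).quasiMeasurePreserving.ae h]
    with z h1 h2 hz
  exact ⟨hz, h1 ⟨hz.1, by linarith [hz.2]⟩, h2 ⟨by linarith [hz.1], by linarith [hz.2]⟩⟩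

theorem lintegral_svol_add_le (hτ : 0 < τ) (f : ℝ → ℝ≥0∞) :
  ∫⁻ z, f (z + τ) ∂svol τ ≤ ∫⁻ z, f z ∂zvol := by
  rw [svol, zvol, ← lintegral_indicator measurableSet_Ioo, ← lintegral_indicator measurableSet_Ioo,
    ← lintegral_add_right_eq_self ((Ioo (-1) 0).indicator f) τ]
  refine lintegral_mono fun z => ?_
  by_cases hz : z ∈ Ioo (-1) (-τ)
  · rw [indicator_of_mem hz, indicator_of_mem]; exact ⟨by linarith [hz.1], by linarith [hz.2]⟩
  · rw [indicator_of_notMem hz]; exact zero_le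

theorem aemeasurable_svol_add (hτ : 0 < τ) {f : ℝ → ℝ≥0∞} (hf : AEMeasurable f zvol) :
  AEMeasurable (fun z => f (z + τ)) (svol τ) :=
  ⟨fun z => hf.mk f (z + τ), hf.measurable_mk.comp (measurable_add_const τ),
    (ae_svol hτ hf.ae_eq_mk).mono fun _ h => h.2.2⟩

theorem lintegral_sq_uIoc_le (hτ : 0 < τ) {f : ℝ → ℝ≥0∞} (hf : Measurable f) :
  ∫⁻ z, (∫⁻ w in uIoc (z + τ) z, f w ∂zvol) ^ 2 ∂svol τ ≤
    ofReal τ ^ 2 * ∫⁻ w, f w ^ 2 ∂zvol := by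
  have h1 : ∀ z, (∫⁻ w in uIoc (z + τ) z, f w ∂zvol) ^ 2 ≤
    ofReal τ * ∫⁻ w, (Ioc z (z + τ)).indicator (fun w => f w ^ 2) w ∂zvol := by
    intro z; rw [Set.uIoc_comm, uIoc_of_le (by linarith), lintegral_indicator measurableSet_Ioc]
    have h := lintegral_mul_sq_le (zvol.restrict (Ioc z (z + τ)))
      (f := fun _ => 1) aemeasurable_const hf.aemeasurable
    simp only [one_mul, one_pow, lintegral_one, Measure.restrict_apply_univ] at h
    refine h.trans (mul_le_l ?_); refine (Measure.restrict_apply_le _ _).trans ?_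
    rw [Real.volume_Ioc]; simp
  have hm : Measurable (Function.uncurry fun z w =>
    (Ioc z (z + τ)).indicator (fun w => f w ^ 2) w) := by
    have : (Function.uncurry fun z w => (Ioc z (z + τ)).indicator (fun w => f w ^ 2) w) =
      {p : ℝ × ℝ | p.1 < p.2 ∧ p.2 ≤ p.1 + τ}.indicator fun p => f p.2 ^ 2 := by
      ext p; simp [Function.uncurry, Set.indicator_apply]
    rw [this]
    exact ((hf.comp measurable_snd).pow_const 2).indicator
      ((measurableSet_lt measurable_fst measurable_snd).inter
        (measurableSet_le measurable_snd (measurable_fst.add_const τ)))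
  have h2 : ∀ w, ∫⁻ z, (Ioc z (z + τ)).indicator (fun w => f w ^ 2) w ∂svol τ ≤
    ofReal τ * f w ^ 2 := by
    intro w
    have e : ∀ z, (Ioc z (z + τ)).indicator (fun w => f w ^ 2) w =
      (Set.Ico (w - τ) w).indicator (fun _ => f w ^ 2) z := fun z => by
      simp only [Set.indicator_apply, Set.mem_Ioc, Set.mem_Ico, sub_le_iff_le_add]
      exact if_congr and_comm rfl rfl
    simp_rw [e]; rw [lintegral_indicator_const measurableSet_Ico, mul_comm]
    refine mul_le_l ((Measure.restrict_apply_le _ _).trans ?_); rw [Real.volume_Ico]; simp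
  calc _ ≤ ∫⁻ z, ofReal τ *
        ∫⁻ w, (Ioc z (z + τ)).indicator (fun w => f w ^ 2) w ∂zvol ∂svol τ :=
        lintegral_mono h1
    _ = ofReal τ * ∫⁻ w, ∫⁻ z, (Ioc z (z + τ)).indicator (fun w => f w ^ 2) w ∂svol τ ∂zvol := by
      rw [lintegral_cmul, lintegral_lintegral_swap hm.aemeasurable]
    _ ≤ ofReal τ * ∫⁻ w, ofReal τ * f w ^ 2 ∂zvol := mul_le_r (lintegral_mono h2)
    _ = _ := by rw [lintegral_cmul]; ring

/-- The vertical increments of `u` in `L²H^r`. -/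
def incr (τ r : ℝ) (u : L2S d) : ℝ≥0∞ := ∫⁻ z, wnf r (FT (sec u (z + τ) - sec u z)) ∂svol τ

theorem ae_wnf_incr (hτ : 0 < τ) (r : ℝ) (u : L2S d) :
  ∀ᵐ z ∂svol τ, wnf r (FT (sec u (z + τ) - sec u z)) =
    ∫⁻ ξ, (el r ξ * ‖lift FT u (ξ, z + τ) - lift FT u (ξ, z)‖ₑ) ^ 2 := by
  filter_upwards [ae_svol hτ (lift_FT_coe u)] with z ⟨_, h1, h2⟩
  refine lintegral_congr_ae ?_; rw [map_sub]
  filter_upwards [h1, h2, Lp.coeFn_sub (FT (sec u (z + τ))) (FT (sec u z))] with ξ e1 e2 e3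
  rw [e3, Pi.sub_apply, e1, e2]

theorem measurable_incr (τ r : ℝ) (u : L2S d) : Measurable fun p : Amb d =>
  (el r p.1 * ‖lift FT u (p.1, p.2 + τ) - lift FT u (p.1, p.2)‖ₑ) ^ 2 := by
  have h := measurable_Lp (lift FT u)
  exact (((measurable_el r).comp measurable_fst).mul
    ((h.comp (measurable_fst.prodMk (measurable_snd.add_const τ))).sub
      (h.comp (measurable_fst.prodMk measurable_snd))).enorm).pow_const 2

theorem aemeasurable_incr (hτ : 0 < τ) (r : ℝ) (u : L2S d) :
  AEMeasurable (fun z => wnf r (FT (sec u (z + τ) - sec u z))) (svol τ) :=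
  ⟨_, (measurable_incr τ r u).lintegral_prod_left', ae_wnf_incr hτ r u⟩

theorem incr_le_of_vert (hτ : 0 < τ) (r : ℝ) {u : L2S d} {y : Amb d → ℝ≥0∞}
  (hy : Measurable y) {Φ : Hor d → ℝ → ℂ}
  (h : ∀ᵐ ξ : Hor d, (∀ᵐ z ∂zvol, lift FT u (ξ, z) = Φ ξ z) ∧
    ∀ z z', ‖Φ ξ z - Φ ξ z'‖ₑ ≤ ∫⁻ w in uIoc z z', y (ξ, w) ∂zvol) :
  incr τ r u ≤ ofReal τ ^ 2 * ∫⁻ ξ, el r ξ ^ 2 * ∫⁻ w, y (ξ, w) ^ 2 ∂zvol := by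
  rw [incr, lintegral_congr_ae (ae_wnf_incr hτ r u),
    lintegral_lintegral_swap (by exact ((measurable_incr τ r u).comp measurable_swap).aemeasurable),
    ← lintegral_cmul]
  apply lintegral_mono_ae
  filter_upwards [h] with ξ ⟨h1, h2⟩
  calc _ ≤ ∫⁻ z, el r ξ ^ 2 * (∫⁻ w in uIoc (z + τ) z, y (ξ, w) ∂zvol) ^ 2 ∂svol τ := by
        apply lintegral_mono_ae
        filter_upwards [ae_svol hτ h1] with z ⟨_, e1, e2⟩
        rw [e1, e2, mul_pow]; exact mul_le_r (pow_le_pow_left' (h2 _ _) 2)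
    _ ≤ el r ξ ^ 2 * (ofReal τ ^ 2 * ∫⁻ w, y (ξ, w) ^ 2 ∂zvol) := by
      rw [lintegral_const_mul' _ _ (by finiteness [el_ne_top r ξ])]
      exact mul_le_r (lintegral_sq_uIoc_le hτ (hy.comp measurable_prodMk_left))
    _ = _ := by ring

theorem lintegral_coord_le (hμ : 0 ≤ μ) (s : ℝ) (i : Fin d) (u : L2S d) :
  ∫⁻ ξ, el (s - 1) ξ ^ 2 * ∫⁻ w, ‖(2 * π * √μ * ξ i * I) *
    lift FT u (ξ, w)‖ₑ ^ 2 ∂zvol ≤ ofReal μ * wnS s u := by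
  rw [wnS_eq, ← lintegral_cmul]; refine lintegral_mono fun ξ => ?_
  simp_rw [enorm_coord_mul]; rw [lintegral_cmul, sub_eq_add_neg, el_add, mul_pow]
  calc _ = (el (-1) ξ ^ 2 * ofReal ((2 * π * √μ * ξ i) ^ 2)) *
        (el s ξ ^ 2 * ∫⁻ w, ‖lift FT u (ξ, w)‖ₑ ^ 2 ∂zvol) := by ring
    _ ≤ _ := mul_le_l (coord_sq_le hμ ξ i)

theorem IsFourierGrad.incr_le (hμ : 0 ≤ μ) (hW : IsFourierGrad μ W) (hτ : 0 < τ) (s : ℝ) (i : Fin d) :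
  incr τ (s - 1) (W (inl i)) ≤ ofReal τ ^ 2 * (ofReal μ * wnS s (W (inr ()))) := by
  have hm := (Lp.stronglyMeasurable (lift FT (W (inr ())))).measurable
  refine (incr_le_of_vert hτ (s - 1) (y := fun p => ‖(2 * π * √μ * p.1 i * I) *
    lift FT (W (inr ())) p‖ₑ) (by fun_prop) (Φ := fun ξ z =>
      -(2 * π * √μ * ξ i * I) * up (fun z => lift FT (W (inr ())) (ξ, z)) z)
    ?_).trans (mul_le_r (lintegral_coord_le hμ s i _))
  filter_upwards [ae_ae_of_ae_volS' (hW i), ae_memLp_vert (Lp.memLp (lift FT (W (inr ()))))]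
    with ξ h1 h2
  refine ⟨h1, fun z z' => ?_⟩; rw [← mul_sub, enorm_mul, enorm_neg]
  refine (mul_le_r (enorm_up_sub_le (h2.integrable one_le_two) z z')).trans_eq ?_
  simp only [enorm_mul (2 * (π : ℂ) * _ * _ * _)]; rw [lintegral_const_mul' _ _ enorm_ne_top]

theorem IsFourierFlux.incr_le (hμ : 0 ≤ μ)
  (hF : IsFourierFlux μ b F) (hτ : 0 < τ) (s : ℝ) :
  incr τ (s - 1) (F (inr ())) ≤ ofReal τ ^ 2 * (d * ∑ i, ofReal μ * wnS s (F (inl i))) := by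
  have hm := fun i => (Lp.stronglyMeasurable (lift FT (F (inl i)))).measurable
  have hm' : ∀ i, Measurable fun p => (2 * π * √μ * p.1 i * I) *
    lift FT (F (inl i)) p := fun i => by have := hm i; fun_prop
  refine (incr_le_of_vert hτ (s - 1) (y := fun p => ‖∑ i, (2 * π * √μ * p.1 i * I) *
    lift FT (F (inl i)) p‖ₑ) (Finset.measurable_fun_sum _ fun i _ => hm' i).enorm
    (Φ := fun ξ z => b ξ - dn (fun z => ∑ i, (2 * π * √μ * ξ i * I) *
      lift FT (F (inl i)) (ξ, z)) z) ?_).trans (mul_le_r ?_)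
  · have hv : ∀ᵐ ξ, ∀ i, MemLp (fun z => lift FT (F (inl i)) (ξ, z)) 2 zvol := by
      rw [ae_all_iff]; exact fun i => ae_memLp_vert (Lp.memLp _)
    filter_upwards [ae_ae_of_ae_volS' hF, hv] with ξ h1 h2
    refine ⟨h1, fun z z' => ?_⟩; rw [sub_sub_sub_cancel_left, ← enorm_neg, neg_sub]
    exact enorm_dn_sub_le (integrable_finsetSum _ fun i _ =>
      ((h2 i).integrable one_le_two).const_mul _) _ _
  · have hsq := fun i => (hm' i).enorm.pow_const 2
    have hv : ∀ ξ, ∫⁻ w, ‖∑ i, (2 * π * √μ * ξ i * I) *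
      lift FT (F (inl i)) (ξ, w)‖ₑ ^ 2 ∂zvol ≤ d * ∑ i, ∫⁻ w,
        ‖(2 * π * √μ * ξ i * I) * lift FT (F (inl i)) (ξ, w)‖ₑ ^ 2 ∂zvol := by
      intro ξ
      have hw : ∀ i, Measurable fun w => ‖(2 * π * √μ * ξ i * I) *
        lift FT (F (inl i)) (ξ, w)‖ₑ ^ 2 := fun i =>
          (((hm i).comp measurable_prodMk_left).const_mul _).enorm.pow_const 2
      rw [← lintegral_finsetSum _ fun i _ => hw i, ← lintegral_cmul]
      refine lintegral_mono fun w => (sum_enorm_sq_le _ _).trans_eq ?_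
      rw [card_univ, Fintype.card_fin]
    calc ∫⁻ ξ, el (s - 1) ξ ^ 2 * ∫⁻ w, ‖∑ i, (2 * π * √μ * ξ i * I) *
          lift FT (F (inl i)) (ξ, w)‖ₑ ^ 2 ∂zvol
          ≤ ∫⁻ ξ, d * ∑ i, el (s - 1) ξ ^ 2 * ∫⁻ w,
            ‖(2 * π * √μ * ξ i * I) * lift FT (F (inl i)) (ξ, w)‖ₑ ^ 2 ∂zvol := by
            refine lintegral_mono fun ξ => ?_
            simp only [← mul_sum]; rw [mul_left_comm]; exact mul_le_r (hv ξ)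
      _ = d * ∑ i, ∫⁻ ξ, el (s - 1) ξ ^ 2 *
        ∫⁻ w, ‖(2 * π * √μ * ξ i * I) * lift FT (F (inl i)) (ξ, w)‖ₑ ^ 2 ∂zvol := by
        rw [lintegral_cmul, lintegral_finsetSum]
        exact fun i _ => ((measurable_el _).pow_const 2).mul (hsq i).lintegral_prod_right'
      _ ≤ _ := mul_le_r (sum_le_sum fun i _ => lintegral_coord_le hμ s i _)

/-! ### Increments of the solution -/

/-- Control of the vertical increments of an amplitude. -/
structure IsIncrS (t K : ℝ) (A : Amb d → ℂ) (h : Hor d → ℝ≥0∞) : Prop where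
  le : ∀ τ, 0 < τ → ∀ z ∈ Ioo (-1 : ℝ) (-τ), ∀ k,
    ‖A (k, z + τ) - A (k, z)‖ₑ ≤ el (1 - t) k * (ofReal τ * h k)
  int : ∀ τ, 0 < τ → ∫⁻ z, wnf (t - 1 / 2) (fun k => A (k, z + τ) - A (k, z)) ∂svol τ ≤
    ofReal (τ ^ 2 * K)

theorem fourierInv_sub_apply {f g : Hor d → ℂ} (hf : Integrable f) (hg : Integrable g)
  (X : Hor d) : 𝓕⁻ (fun k => f k - g k) X = 𝓕⁻ f X - 𝓕⁻ g X := by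
  rw [Real.fourierInv_eq_fourier_neg, Real.fourierInv_eq_fourier_neg, Real.fourierInv_eq_fourier_neg,
    fourier_eq, fourier_eq, fourier_eq, ← integral_sub
      ((Real.fourierIntegral_convergent_iff _).2 hf) ((Real.fourierIntegral_convergent_iff _).2 hg)]
  simp only [smul_sub]

theorem exists_incr_product_le (hs : 0 ≤ s) (he : 0 ≤ e) (hst : 1 - t ≤ s)
  (hst' : s ≤ t + 1 / 2) (ht : (d : ℝ) / 2 < t - e) (hK : 0 ≤ K) :
  ∃ C : ℝ, 0 ≤ C ∧ ∀ a A h, IsCoefS t K a A h → IsIncrS t K A h → ∀ (f : L2S d) (E : ℝ≥0∞),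
    (∀ᵐ z ∂zvol, wnf (s - e - 1 / 2) (FT (sec f z)) ≤ E) → ∀ τ, 0 < τ →
    ∃ m : ℝ → ℝ≥0∞, AEMeasurable m (svol τ) ∧ (∀ᵐ z ∂svol τ, wnf (s - 1) (FT (mulOp volume
      (fun X => ((a (X, z + τ) : ℂ) - (a (X, z) : ℂ))) (sec f (z + τ)))) ≤ m z) ∧
      ∫⁻ z, m z ∂svol τ ≤ ofReal (C * τ ^ 2) * (wnS s f + E) := by
  obtain ⟨C, hC0, hC⟩ := exists_deriv_product_le_of_ge hs he hst hst' ht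
  refine ⟨C * K, by positivity, fun a A h ha hA f E hE τ hτ => ?_⟩
  have hδ :=
    (ha.meas.comp (measurable_fst.prodMk (measurable_snd.add_const τ))).sub
      (ha.meas.comp (measurable_fst.prodMk measurable_snd))
  have hδw : Measurable fun z => wnf (t - 1 / 2) (fun k => A (k, z + τ) - A (k, z)) := by
    have := ((((measurable_el (t - 1 / 2)).comp measurable_fst).mul hδ.enorm).pow_const
      2).lintegral_prod_left' (μ := volume)
    exact this
  have hfm := aemeasurable_svol_add hτ (aemeasurable_wnf_sec s f)
  refine ⟨fun z => ofReal C * (ofReal (τ ^ 2 * K) * wnf s (FT (sec f (z + τ))) +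
    wnf (t - 1 / 2) (fun k => A (k, z + τ) - A (k, z)) * E),
    ((hfm.const_mul _).add (hδw.mul_const _).aemeasurable).const_mul _, ?_, ?_⟩
  · filter_upwards [ae_svol hτ hE] with z ⟨hz, _, hz2⟩
    have z1 : z ∈ Ioo (-1) 0 := ⟨hz.1, by linarith [hz.2]⟩
    have z2 : z + τ ∈ Ioo (-1) 0 := ⟨by linarith [hz.1], by linarith [hz.2]⟩
    have amp1 := ha.amp z1
    have amp2 := ha.amp z2
    have hamp : IsAmp t (fun k => A (k, z + τ) - A (k, z)) (fun k => 2 * h k) := by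
      refine ⟨ha.ht, amp2.meas.sub amp1.meas, ha.meas_h.const_mul 2, fun k => ?_, ?_⟩
      · refine (enorm_sub_le.trans (add_le_add (amp2.le k) (amp1.le k))).trans_eq ?_; ring
      · simp_rw [mul_pow]; rw [lintegral_cmul]; exact mul_ne_top (by finiteness) amp1.fin
    refine (wnf_mulOp_le (s - 1) hamp (fun X => ?_) _).trans ((hC _ _ (fun k => ofReal τ * h k)
      hamp.meas (measurable_Lp _) (ha.meas_h.const_mul _)
      (hA.le τ hτ z hz)).trans (mul_le_r (add_le_add (mul_le_l ?_) (mul_le_r hz2))))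
    · rw [ha.eq z z1, ha.eq _ z2, fourierInv_sub_apply amp2.integrable amp1.integrable]
    · simp_rw [mul_pow]; rw [lintegral_cmul, ofReal_mul (by positivity), ofReal_pow hτ.le]
      exact mul_le_r ha.hK
  · have h1 := lintegral_svol_add_le hτ fun z => wnf s (FT (sec f z))
    rw [lintegral_cmul, lintegral_add_right' _ (hδw.mul_const _).aemeasurable, lintegral_cmul,
      lintegral_mul_const _ hδw]
    calc _ ≤ ofReal C * (ofReal (τ ^ 2 * K) * wnS s f +
          ofReal (τ ^ 2 * K) * E) :=
          mul_le_r (add_le_add (mul_le_r h1) (mul_le_l (hA.int τ hτ)))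
      _ = _ := by rw [mul_assoc, ofReal_mul hC0]; ring

theorem wnf_sum_le {ι : Type*} (r : ℝ) (S : Finset ι) (f : ι → L2H d) :
  wnf r (FT (∑ i ∈ S, f i)) ≤ S.card * ∑ i ∈ S, wnf r (FT (f i)) := by
  rw [wnf_eq_iSup]; refine iSup_le fun n => ?_
  rw [map_sum]
  exact (sum_enorm_sq_le S _).trans
    (mul_le_r (sum_le_sum fun i _ => enorm_sq_fm_trunc_le r n (f i)))

theorem wsumH_sub_le {M M' : Fin d → L2H d →L[ℂ] L2H d}
  (hM : ∀ G : Idx d → L2H d, wsumH r G ≤ ofReal C * wsumH r (skewOp M G))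
  (G G' : Idx d → L2H d) (D : Idx d → ℝ≥0∞) (m : Fin d → Idx d → ℝ≥0∞)
  (hD : ∀ j, wnf r (FT (skewOp M' G' j - skewOp M G j)) ≤ D j)
  (hm : ∀ i j, wnf r (FT ((M' i - M i) (G' j))) ≤ m i j) :
  wsumH r (fun j => G' j - G j) ≤ ofReal C * (2 * (∑ j, D j + (1 + d) * ∑ i, ∑ j, m i j)) := by
  refine (hM _).trans (mul_le_r ?_)
  have h1 : ∀ i, wnf r (FT (skewOp M (fun j => G' j - G j) (inl i))) ≤
    2 * (D (inl i) + m i (inr ())) := fun i => by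
    have e : skewOp M (fun j => G' j - G j) (inl i) =
      (skewOp M' G' (inl i) - skewOp M G (inl i)) - (M' i - M i) (G' (inr ())) := by
      simp only [skewOp, elim_inl, map_sub, sub_apply]; abel
    rw [e]; exact (wnf_sub_le r _ _).trans (mul_le_r (add_le_add (hD _) (hm _ _)))
  have h2 : wnf r (FT (skewOp M (fun j => G' j - G j) (inr ()))) ≤
    2 * (D (inr ()) + d * ∑ i, m i (inl i)) := by
    have e : skewOp M (fun j => G' j - G j) (inr ()) =
      (skewOp M' G' (inr ()) - skewOp M G (inr ())) + ∑ i, (M' i - M i) (G' (inl i)) := by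
      simp only [skewOp, elim_inr, map_sub, sub_apply, sum_sub_distrib]; abel
    rw [e]; refine (wnf_add_le r _ _).trans (mul_le_r (add_le_add (hD _) ?_))
    refine (wnf_sum_le r _ _).trans ?_; rw [card_univ, Fintype.card_fin]
    exact mul_le_r (sum_le_sum fun i _ => hm _ _)
  have h3 : ∑ i, m i (inr ()) ≤ ∑ i, ∑ j, m i j :=
    sum_le_sum fun i _ => single_le_sum (fun _ _ => zero_le) (mem_univ _)
  have h4 : ∑ i, m i (inl i) ≤ ∑ i, ∑ j, m i j :=
    sum_le_sum fun i _ => single_le_sum (fun _ _ => zero_le) (mem_univ _)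
  rw [wsumH, Fintype.sum_sum_type, Fintype.sum_sum_type]; simp only [univ_unique, sum_singleton]
  calc _ ≤ ∑ i, 2 * (D (inl i) + m i (inr ())) +
        2 * (D (inr ()) + d * ∑ i, m i (inl i)) :=
        add_le_add (sum_le_sum fun i _ => h1 i) h2
    _ = 2 * (∑ i, D (inl i) + D (inr ()) + (∑ i, m i (inr ()) + d * ∑ i, m i (inl i))) := by
      rw [← mul_sum, sum_add_distrib]; ring
    _ ≤ _ := by
      rw [add_mul, one_mul]; exact mul_le_r (add_le_add le_rfl (add_le_add h3 (mul_le_r h4)))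

theorem incr_mono_ae {u : L2S d} {m : ℝ → ℝ≥0∞}
  (h : ∀ᵐ z ∂svol τ, wnf r (FT (sec u (z + τ) - sec u z)) ≤ m z) :
  incr τ r u ≤ ∫⁻ z, m z ∂svol τ := lintegral_mono_ae h

theorem mulOp_sub_left {α : Type*} [MeasurableSpace α] {μ : Measure α} {a b : α → ℂ}
  (ha : IsBdd μ a) (hb : IsBdd μ b) (f : Lp ℂ 2 μ) :
  mulOp μ (fun x => a x - b x) f = mulOp μ a f - mulOp μ b f := by
  have hab : IsBdd μ fun x => a x - b x := by
    obtain ⟨C, hC⟩ := ha.2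
    obtain ⟨C', hC'⟩ := hb.2
    refine ⟨ha.1.sub hb.1, C + C', ?_⟩
    filter_upwards [hC, hC'] with x h1 h2
    exact (norm_sub_le _ _).trans (add_le_add h1 h2)
  apply Lp.ext
  filter_upwards [mulOp_coe hab f, mulOp_coe ha f, mulOp_coe hb f,
    Lp.coeFn_sub (mulOp μ a f) (mulOp μ b f)] with x h1 h2 h3 h4
  rw [h1, h4, Pi.sub_apply, h2, h3, sub_mul]

/-- Control of the vertical increments of the coefficients of a system. -/
def IsIncrSystem (t K : ℝ) (q : Fin d → Amb d → ℝ) (J : Amb d → ℝ) : Prop :=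
  (∀ i, ∃ A h, IsCoefS t K (q i) A h ∧ IsIncrS t K A h) ∧
    ∃ A h, IsCoefS t K (fun p => J p - 1) A h ∧ IsIncrS t K A h

theorem incr_skewOp_le (hμ : 0 ≤ μ) (hμ' : μ ≤ μmax) {G : Idx d → L2S d} (hW : IsFourierGrad μ (gradS q J G))
  (hF : IsFourierFlux μ b (fluxS q J G)) (hτ : 0 < τ) (s : ℝ) (j : Idx d) :
  incr τ (s - 1) (skewOp (fun i => mulS (q i)) G j) ≤
    ofReal τ ^ 2 * ((1 + d) * ofReal μmax * wnSum s q J G) := by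
  have hm := ofReal_le_ofReal hμ'
  rcases j with i | u
  · refine (hW.incr_le hμ hτ s i).trans (mul_le_r (mul_le_mul' ?_ (wnS_grad_le_wnSum _)))
    rw [add_mul, one_mul]; exact hm.trans le_self_add
  · refine (hF.incr_le hμ hτ s).trans (mul_le_r ?_)
    rw [← mul_sum, mul_assoc (1 + (d : ℝ≥0∞))]; refine mul_le_mul' le_add_self (mul_le_mul' hm ?_)
    rw [wnSum, Fintype.sum_sum_type]; exact le_add_right (sum_le_sum fun i _ => le_add_self)

theorem IsSystem.ae_wnf_increment_le {CJ : ℝ}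
  (hCJ : ∀ (A F : Hor d → ℂ) (h : Hor d → ℝ≥0∞),
    Measurable F → Measurable h → (∀ k, ‖A k‖ₑ ≤ el (-t) k * h k) →
    ∫⁻ ξ, (∫⁻ η, el r ξ * (‖A (ξ - η)‖ₑ * ‖F η‖ₑ)) ^ 2 ≤ ofReal CJ * ((∫⁻ k, h k ^ 2) * wnf r F)) (hS : IsSystem t K c q J) (v : L2S d)
  (hτ : 0 < τ) :
  ∀ᵐ z ∂svol τ, wnf r (FT (sec (mulS J v) (z + τ) - sec (mulS J v) z)) ≤
    2 * (wnf r (FT (sec v (z + τ) - sec v z)) + 2 * (ofReal CJ * (ofReal K *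
      wnf r (FT (sec v (z + τ) - sec v z))) + wnf r (FT (mulOp volume (fun X =>
        (((J (X, z + τ) - 1 : ℝ) : ℂ) - ((J (X, z) - 1 : ℝ) : ℂ))) (sec v (z + τ)))))) := by
  obtain ⟨A, h, hA⟩ := hS.hJ
  have h0 : ∀ᵐ z ∂zvol, sec (mulS J v) z = sec v z +
    mulOp volume (fun X => ((J (X, z) - 1 : ℝ))) (sec v z) := by
    rw [hS.mulS_J v]
    filter_upwards [sec_add v (mulS (fun p => J p - 1) v), sec_mulOp hS.bddJ_sub v] with z h1 h2
    rw [h1, mulS, h2]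
  filter_upwards [ae_svol hτ h0] with z ⟨hz, h1, h2⟩
  have z1 : z ∈ Ioo (-1) 0 := ⟨hz.1, by linarith [hz.2]⟩
  have z2 : z + τ ∈ Ioo (-1) 0 := ⟨by linarith [hz.1], by linarith [hz.2]⟩
  have b1 := isBdd_of_fourierInv (hA.amp z1).integrable (hA.eq z z1)
  have b2 := isBdd_of_fourierInv (hA.amp z2).integrable (hA.eq _ z2)
  have e : sec (mulS J v) (z + τ) - sec (mulS J v) z = (sec v (z + τ) - sec v z) +
    (mulOp volume (fun X => ((J (X, z) - 1 : ℝ))) (sec v (z + τ) - sec v z) +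
    mulOp volume (fun X => (((J (X, z + τ) - 1 : ℝ)) - ((J (X, z) - 1 : ℝ)))) (sec v (z + τ))) := by
    rw [mulOp_sub_left b2 b1, h1, h2, map_sub]; abel
  rw [e]
  refine (wnf_add_le r _ _).trans (mul_le_r (add_le_add le_rfl
    ((wnf_add_le r _ _).trans (mul_le_r (add_le_add ?_ le_rfl)))))
  exact (wnf_mulOp_le r (hA.amp z1) (hA.eq z z1) _).trans ((hCJ _ _ h
    (measurable_Lp _) hA.meas_h (hA.amp z1).le).trans
    (mul_le_r (mul_le_l hA.hK)))

theorem IsSystem.exists_incr_le (d : ℕ) (ht : (d : ℝ) / 2 < t)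
  (hK : 0 ≤ K) (hμm : 0 ≤ μmax) (hs : 0 ≤ s) (hs1 : 1 - t ≤ s) (hst : s ≤ t + 1 / 2) :
  ∃ C : ℝ≥0∞, C ≠ ⊤ ∧ ∀ c μ q J, 0 ≤ μ → μ ≤ μmax →
    IsSystem t K c q J → IsIncrSystem t K q J → ∀ (G : Idx d → L2S d) (b : Hor d → ℂ),
    IsFourierGrad μ (gradS q J G) → IsFourierFlux μ b (fluxS q J G) → ∀ τ, 0 < τ → ∀ j,
    incr τ (s - 1) (gradS q J G j) ≤ ofReal τ ^ 2 * (C * wnSum s q J G) := by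
  obtain ⟨e, he, he1, he2⟩ : ∃ e, 0 ≤ e ∧ e ≤ 1 / 2 ∧ d / 2 < t - e :=
    ⟨min (1 / 2) ((t - d / 2) / 2), le_min (by norm_num) (by linarith), min_le_left _ _, by
      linarith [min_le_right (1 / 2) ((t - d / 2) / 2)]⟩
  have hr : |s - 1| ≤ t := abs_le.2 ⟨by linarith, by linarith⟩
  obtain ⟨CE, -, hCE⟩ := IsSystem.exists_sec_le (r := s - e - 1 / 2)
    (C₀ := (4 + (d + 1) * μmax) * 2) d ht (abs_le.2 ⟨by linarith, by linarith⟩) hK (by positivity)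
  obtain ⟨CP, hCP0, hCP⟩ := exists_incr_product_le hs he hs1 hst he2 hK
  obtain ⟨CS, -, hCS⟩ := exists_skewOp_le_of_abs_le (K := d * K) ht hr (by positivity)
  obtain ⟨CJ, -, hCJ⟩ := exists_product_le hr ht
  set B1 : ℝ≥0∞ := (1 + d) * ofReal μmax with hB1
  set B2 : ℝ≥0∞ := ofReal CP * (1 + ofReal CE) with hB2
  set B3 : ℝ≥0∞ := ofReal CS * (2 * ((1 + d) * B1 + (1 + d) * (d * ((1 + d) * B2)))) with hB3
  refine ⟨B1 + 2 * (B3 + 2 * (ofReal CJ * (ofReal K * B3) + B2)), by finiteness,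
    fun c μ q J hμ hμ' hS hI G b hW hF τ hτ j => ?_⟩
  set N := wnSum s q J G with hN
  set a := ofReal τ ^ 2 with ha
  have hskew := incr_skewOp_le hμ hμ' hW hF hτ s
  have hE : ∀ j, ∀ᵐ z ∂zvol, wnf (s - e - 1 / 2) (FT (sec (G j) z)) ≤ ofReal CE * N := by
    rw [← ae_all_iff]; refine hCE c q J hS G N ?_
    filter_upwards [hW.ae_wnf_skewOp_le hF hμ hμ' (s - e)] with z hz j
    exact (hz j).trans (mul_le_r (wnSum_mono (by linarith)))
  have hprod : ∀ f, (∃ A h, IsCoefS t K f A h ∧ IsIncrS t K A h) → ∀ j,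
    ∃ m, AEMeasurable m (svol τ) ∧ (∀ᵐ z ∂svol τ, wnf (s - 1) (FT (mulOp volume
      (fun X => ((f (X, z + τ)) - (f (X, z)))) (sec (G j) (z + τ)))) ≤ m z) ∧
      ∫⁻ z, m z ∂svol τ ≤ a * (B2 * N) := by
    rintro f ⟨A, h, hA, hA'⟩ j
    obtain ⟨m, h1, h2, h3⟩ := hCP f A h hA hA' (G j) _ (hE j) τ hτ
    refine ⟨m, h1, h2, h3.trans ?_⟩; rw [ofReal_mul hCP0, ofReal_pow hτ.le]
    calc _ ≤ ofReal CP * a * (N + ofReal CE * N) := mul_le_r (add_le_add (wnS_le_wnSum j) le_rfl)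
      _ = _ := by rw [hB2]; ring
  rcases j with i | u
  · refine (hskew (inl i)).trans (mul_le_r (mul_le_l ?_)); exact le_self_add
  choose m hm1 hm2 hm3 using fun i => hprod (q i) (hI.1 i)
  obtain ⟨mJ, hJ1, hJ2, hJ3⟩ := hprod _ hI.2 (inr ())
  set D : Idx d → ℝ → ℝ≥0∞ := fun j z => wnf (s - 1) (FT
    (sec (skewOp (fun i => mulS (q i)) G j : L2S d) (z + τ) -
      sec (skewOp (fun i => mulS (q i)) G j : L2S d) z)) with hD
  have hDm : ∀ j, AEMeasurable (D j) (svol τ) := fun j => aemeasurable_incr hτ _ _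
  set Θ : ℝ → ℝ≥0∞ := fun z => ofReal CS * (2 * (∑ j, D j z + (1 + d) * ∑ i, ∑ j, m i j z)) with hΘ
  have hms : AEMeasurable (fun z => ∑ i, ∑ j, m i j z) (svol τ) :=
    aemeasurable_fun_sum _ fun i _ => aemeasurable_fun_sum _ fun j _ => hm1 i j
  have hDs : AEMeasurable (fun z => ∑ j, D j z) (svol τ) := aemeasurable_fun_sum _ fun j _ => hDm j
  have hΘm : AEMeasurable Θ (svol τ) := ((hDs.add (hms.const_mul _)).const_mul _).const_mul _
  have hΘi : ∫⁻ z, Θ z ∂svol τ ≤ a * (B3 * N) := by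
    rw [lintegral_cmul, lintegral_cmul, lintegral_add_left' hDs, lintegral_cmul,
      lintegral_finsetSum' _ fun j _ => hDm j, lintegral_finsetSum' _ fun i _ =>
        aemeasurable_fun_sum _ fun j _ => hm1 i j]
    calc _ ≤ ofReal CS * (2 * (∑ j, a * (B1 * N) +
          (1 + d) * ∑ i, ∑ j, a * (B2 * N))) := by
          refine mul_le_r (mul_le_r (add_le_add
            (sum_le_sum fun j _ => hskew j) (mul_le_r (sum_le_sum fun i _ => ?_))))
          rw [lintegral_finsetSum' _ fun j _ => hm1 i j]; exact sum_le_sum fun j _ => hm3 i j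
      _ = _ := by
        simp only [sum_const, card_univ, Fintype.card_sum, Fintype.card_fin,
          Fintype.card_unit, nsmul_eq_mul, Nat.cast_add, Nat.cast_one, hB3]
        ring
  have hmain : ∀ᵐ z ∂svol τ, wnf (s - 1)
    (FT (sec (G (inr ())) (z + τ) - sec (G (inr ())) z)) ≤ Θ z := by
    obtain ⟨A, h, hq⟩ := hS.exists_isCoefH
    filter_upwards [ae_svol hτ (hS.sec_skewOp G), ae_all_iff.2 fun i => ae_all_iff.2 (hm2 i)]
      with z ⟨hz, h1, h2⟩ h3
    have z1 : z ∈ Ioo (-1) 0 := ⟨hz.1, by linarith [hz.2]⟩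
    have z2 : z + τ ∈ Ioo (-1) 0 := ⟨by linarith [hz.1], by linarith [hz.2]⟩
    refine (wnf_le_wsumH (s - 1) (fun j => sec (G j) (z + τ) - sec (G j) z) (inr ())).trans
      (wsumH_sub_le (hCS _ _ h (hq z z1)) _ _ (fun j => D j z) (fun i j => m i j z)
        (M' := mulR volume fun i X => q i (X, z + τ)) (fun j => ?_) fun i j => ?_)
    · simp only [hD]; rw [h1, h2]
    · rw [sub_apply, mulR, mulR, ← mulOp_sub_left ((hq _ z2).isBdd i) ((hq z z1).isBdd i)]
      exact h3 i j
  have hfin := (hS.ae_wnf_increment_le hCJ (G (inr ())) hτ)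
  clear_value Θ
  calc incr τ (s - 1) (gradS q J G (inr u)) ≤ ∫⁻ z, 2 * (Θ z + 2 * (ofReal CJ *
        (ofReal K * Θ z) + mJ z)) ∂svol τ := by
        refine incr_mono_ae ?_
        filter_upwards [hfin, hmain, hJ2] with z h1 h2 h3
        refine h1.trans (mul_le_r (add_le_add h2 (mul_le_r (add_le_add
          (mul_le_r (mul_le_r h2)) h3))))
    _ = 2 * (∫⁻ z, Θ z ∂svol τ + 2 * (ofReal CJ * (ofReal K *
      ∫⁻ z, Θ z ∂svol τ) + ∫⁻ z, mJ z ∂svol τ)) := by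
      rw [lintegral_cmul, lintegral_add_left' hΘm, lintegral_cmul, lintegral_add_right' _ hJ1,
        lintegral_cmul, lintegral_cmul]
    _ ≤ 2 * (a * (B3 * N) + 2 * (ofReal CJ * (ofReal K *
      (a * (B3 * N))) + a * (B2 * N))) := by gcongr
    _ = a * (2 * (B3 + 2 * (ofReal CJ * (ofReal K * B3) + B2)) * N) := by ring
    _ ≤ _ := mul_le_r (mul_le_l le_add_self)

/-! ### The operators `Λ^r` on the strip -/

theorem hasTemperateGrowth_lam (r : ℝ) :
  (fun ξ : Hor d => (lam r ξ : ℂ)).HasTemperateGrowth := by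
  have h : (fun ξ : Hor d => (lam r ξ : ℂ)) = ofRealCLM ∘
    (fun x => (1 + ‖x‖ ^ 2) ^ (r / 2)) ∘ fun ξ => (2 * π) • ξ := by
    ext ξ; simp [lam, absD, norm_smul, abs_of_pos Real.pi_pos, Function.comp_def]
  rw [h]
  exact ofRealCLM.hasTemperateGrowth.comp
    ((Function.hasTemperateGrowth_one_add_norm_sq_rpow (Hor d) (r / 2)).comp (by fun_prop))

theorem exists_lamX_slice (h : IsTest U φ) (r z : ℝ) :
  ∃ ψ χ : Sch d, (∀ X, ψ X = φ (X, z)) ∧ (∀ ξ, χ ξ = lam r ξ * (𝓕 ψ : Sch d) ξ) ∧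
    ∀ X, lamX r φ (X, z) = (𝓕⁻ χ : Sch d) X := by
  obtain ⟨ψ, h1, -⟩ := exists_schwartz_slice h.2.1 h.1 z
  have e : ∀ ξ, SchwartzMap.smulLeftCLM ℂ (fun ξ => (lam r ξ : ℂ)) (𝓕 ψ) ξ =
    lam r ξ * (𝓕 ψ) ξ := fun ξ =>
    SchwartzMap.smulLeftCLM_apply_apply (hasTemperateGrowth_lam r) _ ξ
  refine ⟨ψ, _, h1, e, fun X => ?_⟩; rw [lamX, SchwartzMap.fourierInv_coe, funext e]
  simp only [SchwartzMap.fourier_coe, ← h1]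

theorem integral_mul_fourierInv_mul (f g : L2H d) {ψ χ : Sch d}
  (hχ : ∀ ξ, χ ξ = lam r ξ * (𝓕 ψ : Sch d) ξ)
  (hg : FT g =ᵐ[volume] fun ξ => lam r ξ * FT f ξ) :
  ∫ X, g X * ψ X = ∫ X, f X * (𝓕⁻ χ : Sch d) X := by
  have hn : ∀ θ ξ, (𝓕⁻ θ : Sch d) (-ξ) = (𝓕 θ : Sch d) ξ := fun θ ξ => by
    rw [fourierInv_apply_eq_neg, neg_neg]
  have h1 : ∀ k (θ : Sch d), ∫ X, k X * θ X = ∫ ξ, FT k ξ * (𝓕⁻ θ) ξ := fun k θ => by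
    rw [integral_FT_mul]; simp
  rw [h1 g, h1 f]; apply integral_congr_ae
  filter_upwards [hg] with ξ hξ
  have e : (𝓕⁻ (𝓕⁻ χ : Sch d)) ξ = χ (-ξ) := by rw [fourierInv_apply_eq_neg]; simp
  rw [hξ, e, hχ, lam_neg_arg, ← fourierInv_apply_eq_neg]; ring

theorem measurable_fourier_slice (h : IsTest U φ) :
  Measurable fun p : Amb d => 𝓕 (fun Y : Hor d => φ (Y, p.2)) p.1 := by
  have hc : Continuous fun q : Amb d × Hor d =>
    fourierChar (-(inner ℝ q.2 q.1.1)) • φ (q.2, q.1.2) := by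
    have := h.1.continuous
    have := continuous_fourierChar
    fun_prop
  have := (hc.stronglyMeasurable.integral_prod_right' (ν := volume)).measurable
  simpa only [fourier_eq] using this

theorem measurable_lamX (h : IsTest U φ) (r : ℝ) :
  Measurable (lamX r φ) := by
  have hm : Measurable fun q : Amb d × Hor d => (fourierChar (inner ℝ q.2 q.1.1) : ℂ) *
    ((lam r q.2) * 𝓕 (fun Y => φ (Y, q.1.2)) q.2) := by
    have h1 := (measurable_fourier_slice h).comp
      (measurable_snd.prodMk (measurable_snd.comp measurable_fst) :
        Measurable fun q : Amb d × Hor d => ((q.2, q.1.2)))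
    have h2 : Continuous fun q : Amb d × Hor d => (fourierChar (inner ℝ q.2 q.1.1) : ℂ) := by
      have := continuous_fourierChar
      fun_prop
    have h3 : Measurable fun q : Amb d × Hor d => (lam r q.2 : ℂ) :=
      (measurable_ofReal.comp (measurable_lam r)).comp measurable_snd
    exact h2.measurable.mul (h3.mul h1)
  have := (hm.stronglyMeasurable.integral_prod_right' (ν := volume)).measurable
  have e : lamX r φ = fun p => ∫ ξ, (fourierChar (inner ℝ ξ p.1) : ℂ) *
    ((lam r ξ) * 𝓕 (fun Y => φ (Y, p.2)) ξ) := by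
    ext p; rw [lamX, fourierInv_eq]; rfl
  rw [e]; exact this

theorem lintegral_fourier_schwartz (ψ : Sch d) :
  ∫⁻ ξ, ‖(𝓕 ψ : Sch d) ξ‖ₑ ^ 2 = ∫⁻ X, ‖ψ X‖ₑ ^ 2 := by
  have h1 := enorm_FT (ψ.toLp 2 volume)
  have h2 := congrArg (· ^ 2) h1
  simp only [enorm_sq_eq_lintegral] at h2
  exact (lintegral_congr_ae ((FT_toLp ψ).fun_comp fun x => ‖x‖ₑ ^ 2)).symm.trans (h2.trans
    (lintegral_congr_ae ((ψ.coeFn_toLp 2 volume).fun_comp fun x => ‖x‖ₑ ^ 2)))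

theorem lintegral_el_fourier_lt_top (n : ℕ) : ∀ φ : Amb d → ℂ, IsTest (S d) φ →
  ∫⁻ p, (el n p.1 * ‖𝓕 (fun Y : Hor d => φ (Y, p.2)) p.1‖ₑ) ^ 2 ∂volS d < ⊤ := by
  have hmm : ∀ (n : ℕ) φ, IsTest (S d) φ → Measurable fun p : Amb d =>
    (el n p.1 * ‖𝓕 (fun Y => φ (Y, p.2)) p.1‖ₑ) ^ 2 := fun n φ h =>
    (((measurable_el _).comp measurable_fst).mul (measurable_fourier_slice h).enorm).pow_const 2
  induction n with
  | zero =>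
    intro φ h; rw [lintegral_volS (hmm 0 φ h).aemeasurable]
    have h1 := (memLp_two_iff (h.memLp).1).1 h.memLp
    rw [lintegral_volS ((h.1.continuous.measurable.enorm.pow_const 2).aemeasurable)] at h1
    refine (lintegral_mono fun z => ?_).trans_lt h1
    obtain ⟨ψ, e, -⟩ := exists_schwartz_slice h.2.1 h.1 z
    simp only [Nat.cast_zero, el_zero, one_mul, ← e]; rw [← lintegral_fourier_schwartz]
    simp only [SchwartzMap.fourier_coe]; rfl
  | succ n ih =>
    intro φ h
    have e : ∀ p : Amb d, (el ((n + 1 : ℕ)) p.1 * ‖𝓕 (fun Y => φ (Y, p.2)) p.1‖ₑ) ^ 2 =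
      (el n p.1 * ‖𝓕 (fun Y => φ (Y, p.2)) p.1‖ₑ) ^ 2 +
      ∑ i, (el n p.1 * ‖𝓕 (fun Y => pd (inl i) φ (Y, p.2)) p.1‖ₑ) ^ 2 := by
      rintro ⟨ξ, z⟩
      obtain ⟨ψ, e1, e2⟩ := exists_schwartz_slice h.2.1 h.1 z
      have e3 : ∀ i, 𝓕 (fun Y => pd (inl i) φ (Y, z)) ξ =
        (2 * π * √1 * ξ i * I) * 𝓕 (fun Y => φ (Y, z)) ξ := fun i => by
        have := fourier_lineDerivOp_single ψ i ξ
        simp only [SchwartzMap.fourier_coe] at this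
        rw [funext fun Y => (e2 i Y).symm, funext fun Y => (e1 Y).symm]; refine this.trans ?_; simp
      have e4 : el 1 ξ ^ 2 = 1 + ∑ i, ofReal ((2 * π * √1 * ξ i) ^ 2) := by
        rw [← ofReal_sum_of_nonneg fun _ _ => by positivity, sum_sq_coord, el, lam_one,
          ← ofReal_pow (sqrt_nonneg _), sq_sqrt (by positivity),
          ofReal_add zero_le_one (by positivity)]
        simp
      simp only [e3, mul_pow (el _ _), enorm_coord_mul]
      rw [Nat.cast_add, Nat.cast_one, el_add, mul_pow, e4, mul_add, mul_one, add_mul,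
        mul_sum, sum_mul]
      simp only [mul_assoc]
    simp_rw [e]
    rw [lintegral_add_left (hmm n φ h), lintegral_finsetSum _ fun i _ => hmm n _ (h.pd _)]
    exact ENNReal.add_lt_top.2 ⟨ih φ h, ENNReal.sum_lt_top.2 fun i _ => ih _ (h.pd _)⟩

theorem IsTest.memLp_lamX (h : IsTest (S d) φ) (r : ℝ) :
  MemLp (lamX r φ) 2 (volS d) := by
  have hm := measurable_lamX h r
  rw [memLp_two_iff hm.aestronglyMeasurable, lintegral_volS (hm.enorm.pow_const 2).aemeasurable]
  have h1 := lintegral_el_fourier_lt_top ⌈r⌉₊ φ h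
  have hm2 : Measurable fun p : Amb d =>
    (el (⌈r⌉₊) p.1 * ‖𝓕 (fun Y => φ (Y, p.2)) p.1‖ₑ) ^ 2 :=
    (((measurable_el _).comp measurable_fst).mul (measurable_fourier_slice h).enorm).pow_const 2
  rw [lintegral_volS hm2.aemeasurable] at h1
  refine (lintegral_mono fun z => ?_).trans_lt h1
  obtain ⟨ψ, χ, e1, e2, e3⟩ := exists_lamX_slice h r z
  simp only [e3]; rw [← lintegral_fourier_schwartz]
  refine lintegral_mono fun ξ => pow_le_pow_left' ?_ 2
  have e4 : (𝓕 (𝓕⁻ χ) : Sch d) ξ = χ ξ := by simp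
  rw [e4, e2, enorm_mul, enorm_lam]; simp only [← e1, SchwartzMap.fourier_coe]
  exact mul_le_l (el_mono (Nat.le_ceil r) ξ)

/-- `Λ^r u`, for `u ∈ L²H^r`. -/
theorem exists_isLam {u : L2S d} (h : wnS r u < ⊤) : ∃ v : L2S d, IsLam r u v ∧
  (∀ᵐ z ∂zvol, FT (sec v z) =ᵐ[volume] fun ξ => lam r ξ * FT (sec u z) ξ) ∧
  ‖v‖ₑ ^ 2 = wnS r u := by
  have hm := measurable_Lp (lift FT u)
  have hlm : Measurable fun p : Amb d => (lam r p.1 : ℂ) * lift FT u p :=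
    ((measurable_ofReal.comp (measurable_lam r)).comp measurable_fst).mul hm
  have hint : ∫⁻ p, ‖(lam r p.1) * lift FT u p‖ₑ ^ 2 ∂volS d = wnS r u := by
    rw [lintegral_volS' (hlm.enorm.pow_const 2).aemeasurable, wnS_eq]
    refine lintegral_congr fun ξ => ?_
    simp only [enorm_mul, enorm_lam, mul_pow]
    rw [lintegral_const_mul' _ _ (by finiteness [el_ne_top r ξ])]
  have hL := (memLp_two_iff hlm.aestronglyMeasurable).2 (hint ▸ h)
  set Y : L2S d := hL.toLp _ with hY
  have hsec : ∀ᵐ z ∂zvol, FT (sec (lift FTi Y) z) =ᵐ[volume]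
    fun ξ => lam r ξ * FT (sec u z) ξ := by
    filter_upwards [sec_lift FTi Y, ae_sec_coe (Lp.memLp Y), ae_ae_of_ae_volS hL.coeFn_toLp,
      lift_FT_coe u] with z h1 h2 h3 h4
    rw [h1, FT_FTi]
    filter_upwards [h2, h3, h4] with ξ e2 e3 e4
    rw [e2, e3, ← e4]
  refine ⟨lift FTi Y, ⟨Lp.memLp _, fun φ hφ => ?_⟩, hsec, ?_⟩
  · rw [integral_volS (f := fun p => lift FTi Y p * φ p)
      ((Lp.memLp (lift FTi Y)).integrable_mul hφ.memLp),
      integral_volS (f := fun p => u p * lamX r φ p) ((Lp.memLp u).integrable_mul (hφ.memLp_lamX r))]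
    apply integral_congr_ae
    filter_upwards [hsec, ae_sec_coe (Lp.memLp u), ae_sec_coe (Lp.memLp (lift FTi Y))]
      with z h1 h2 h3
    obtain ⟨ψ, χ, e1, e2, e3⟩ := exists_lamX_slice hφ r z
    have h4 := integral_mul_fourierInv_mul _ _ e2 h1
    simp only [← e1, e3]; refine ((integral_congr_ae ?_).symm.trans h4).trans (integral_congr_ae ?_)
    · filter_upwards [h3] with X hX; rw [hX]
    · filter_upwards [h2] with X hX; rw [hX]
  · rw [enorm_sq_eq_sec, wnS]; apply lintegral_congr_ae
    filter_upwards [hsec] with z h1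
    rw [← enorm_FT, enorm_sq_eq_lintegral, wnf]; apply lintegral_congr_ae
    filter_upwards [h1] with ξ e
    rw [e, enorm_mul, enorm_lam]

theorem exists_inner_eq {E H : Type*} [AddCommGroup E] [Module ℂ E] [NormedAddCommGroup H]
  [InnerProductSpace ℂ H] [CompleteSpace H] (ι : E →ₗ[ℂ] H) (T : E →ₗ[ℂ] ℂ) (hC : 0 ≤ C)
  (h : ∀ x, ‖T x‖ ≤ C * ‖ι x‖) : ∃ w : H, ‖w‖ ≤ C ∧ ∀ x, T x = inner ℂ w (ι x) := by
  have hker : LinearMap.ker ι ≤ LinearMap.ker T := fun x hx => by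
    have := h x
    rw [LinearMap.mem_ker.1 hx, norm_zero, mul_zero] at this
    exact norm_le_zero_iff.1 this
  let f : LinearMap.range ι →ₗ[ℂ] ℂ :=
    (LinearMap.ker ι).liftQ T hker ∘ₗ ι.quotKerEquivRange.symm.toLinearMap
  have hf : ∀ x, f ⟨ι x, x, rfl⟩ = T x := fun x => by
    have : ι.quotKerEquivRange.symm ⟨ι x, x, rfl⟩ = Submodule.Quotient.mk x := by
      rw [LinearEquiv.symm_apply_eq]; rfl
    simp only [f, LinearMap.comp_apply, LinearEquiv.coe_coe, this]
    exact Submodule.liftQ_apply _ _ _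
  obtain ⟨g, hg, hgn⟩ := exists_extension_norm_eq (LinearMap.range ι) (f.mkContinuous C (by
    rintro ⟨_, x, rfl⟩; rw [hf]; exact h x))
  refine ⟨(InnerProductSpace.toDual ℂ H).symm g, ?_, fun x => ?_⟩
  · rw [LinearIsometryEquiv.norm_map, hgn]; exact LinearMap.mkContinuous_norm_le _ hC _
  · rw [InnerProductSpace.toDual_symm_apply, ← hf]; exact (hg ⟨ι x, x, rfl⟩).symm

/-- The smooth functions with compact support in the strip. -/
def testS (d : ℕ) : Submodule ℂ (Amb d → ℂ) where
  carrier := {φ | IsTest (S d) φ}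
  add_mem' h k := IsTest.add h k
  zero_mem' := ⟨contDiff_const, HasCompactSupport.zero, by simp [tsupport]⟩
  smul_mem' c _ h := IsTest.clm h (c • ContinuousLinearMap.id ℝ ℂ)

theorem exists_repr_of_le {V : L2S d} (hC : 0 ≤ C) (j : Idx d)
  (h : ∀ φ (hφ : IsTest (S d) φ), ‖∫ p, V p * pd j φ p ∂volS d‖ ≤ C * ‖hφ.memLp.toLp φ‖) :
  ∃ V' : L2S d, ‖V'‖ ≤ C ∧ ∀ φ, IsTest (S d) φ →
    ∫ p, V' p * φ p ∂volS d = -∫ p, V p * pd j φ p ∂volS d := by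
  have hi : ∀ φ : testS d, Integrable (fun p => V p * pd j φ.1 p) (volS d) := fun φ =>
    (Lp.memLp V).integrable_mul (φ.2.pd j).memLp
  obtain ⟨w, hw, hw2⟩ := exists_inner_eq (E := testS d)
    { toFun := fun φ => φ.2.memLp.toLp φ.1
      map_add' := fun φ ψ => MemLp.toLp_add _ _
      map_smul' := fun c φ => MemLp.toLp_const_smul c _ }
    { toFun := fun φ => -∫ p, V p * pd j φ.1 p ∂volS d
      map_add' := fun φ ψ => by
        rw [← neg_add, ← integral_add (hi φ) (hi ψ)]; congr 2; ext p
        rw [← mul_add, ← pd_add φ.2 ψ.2]; rfl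
      map_smul' := fun c φ => by
        rw [RingHom.id_apply, smul_eq_mul, mul_neg, ← integral_const_mul]; congr 2; ext p
        rw [mul_left_comm]
        exact congrArg (V p * ·) (pd_clm φ.2 (c • ContinuousLinearMap.id ℝ ℂ) j p) }
    hC (fun φ => by simp only [LinearMap.coe_mk, AddHom.coe_mk, norm_neg]; exact h φ.1 φ.2)
  refine ⟨(conjCLE : ℂ →L[ℝ] ℂ).compLp w, ?_, fun φ hφ => ?_⟩
  · refine (ContinuousLinearMap.norm_compLp_le _ _).trans ?_; rwa [Complex.conjCLE_norm, one_mul]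
  have h1 := hw2 ⟨φ, hφ⟩
  simp only [LinearMap.coe_mk, AddHom.coe_mk] at h1
  rw [h1, L2.inner_def]; apply integral_congr_ae
  filter_upwards [(conjCLE : ℂ →L[ℝ] ℂ).coeFn_compLp w, hφ.memLp.coeFn_toLp] with p h2 h3
  rw [h2, h3, RCLike.inner_apply, mul_comm]; rfl

theorem IsTest.exists_lt (h : IsTest (S d) φ) :
  ∃ η : ℝ, 0 < η ∧ ∀ p, φ p ≠ 0 → -1 < p.2 ∧ p.2 < -η := by
  by_cases hne : (tsupport φ).Nonempty
  · obtain ⟨p₀, hp₀, hmax⟩ := h.2.1.isCompact.exists_isMaxOn hne continuous_snd.continuousOn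
    refine ⟨-p₀.2 / 2, by linarith [(h.2.2 hp₀).2], fun p hp => ?_⟩
    have hp := subset_tsupport φ hp
    exact ⟨(h.2.2 hp).1, by linarith [show p.2 ≤ p₀.2 from hmax hp, (h.2.2 hp₀).2]⟩
  · refine ⟨1, one_pos, fun p hp => (hne ⟨p, subset_tsupport φ hp⟩).elim⟩

/-- Summation by parts for increments. -/
theorem integral_mul_shift_sub (V : L2S d) (h : IsTest (S d) φ)
  (hτ : 0 < τ) (hφ : ∀ p, φ p ≠ 0 → -1 < p.2 ∧ p.2 < -τ) :
  ‖∫ p, V p * (φ (p - (0, τ)) - φ p) ∂volS d‖ₑ ^ 2 ≤ incr τ 0 V * ‖h.memLp.toLp φ‖ₑ ^ 2 := by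
  set V₀ : Amb d → ℂ := (S d).indicator V with hV₀
  have hV₀L := (memLp_indicator_iff_restrict measurableSet_S).2 (Lp.memLp V)
  have hφL : MemLp φ 2 volume := h.1.continuous.memLp_of_hasCompactSupport h.2.1
  have e1 : ∀ f : Amb d → ℂ, ∫ p, V p * f p ∂volS d = ∫ p, V₀ p * f p := fun f => by
    refine (integral_indicator measurableSet_S).symm.trans ?_
    congr 1; ext p; rw [hV₀, Set.indicator_mul_left]
  have hshift : MemLp (fun p => φ (p - (0, τ))) 2 volume :=
    hφL.comp_measurePreserving (measurePreserving_sub_right volume _)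
  have hshift' : MemLp (fun p => V₀ (p + (0, τ))) 2 volume :=
    hV₀L.comp_measurePreserving (measurePreserving_add_right volume _)
  have e2 : ∫ p, V p * (φ (p - (0, τ)) - φ p) ∂volS d = ∫ p, (V₀ (p + (0, τ)) - V₀ p) * φ p := by
    rw [e1]
    simp_rw [mul_sub, sub_mul]
    refine (integral_sub (hV₀L.integrable_mul hshift) (hV₀L.integrable_mul hφL)).trans (Eq.trans ?_
      (integral_sub (hshift'.integrable_mul hφL) (hV₀L.integrable_mul hφL)).symm)
    congr 1
    have := integral_add_right_eq_self (μ := volume) (fun p => V₀ p * φ (p - (0, τ))) (0, τ)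
    simpa using this.symm
  have hm1 : AEMeasurable (fun p => ‖V₀ (p + (0, τ)) - V₀ p‖ₑ)
    (volume.restrict {p : Amb d | -1 < p.2 ∧ p.2 < -τ}) :=
    (hshift'.1.sub hV₀L.1).enorm.restrict
  have hms : MeasurableSet {p : Amb d | -1 < p.2 ∧ p.2 < -τ} :=
    (measurableSet_lt measurable_const measurable_snd).inter
      (measurableSet_lt measurable_snd measurable_const)
  rw [e2]
  calc _ ≤ (∫⁻ p in {p : Amb d | -1 < p.2 ∧ p.2 < -τ}, ‖V₀ (p + (0, τ)) - V₀ p‖ₑ * ‖φ p‖ₑ) ^ 2 := by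
        refine pow_le_pow_left' ((enorm_integral_le_lintegral_enorm _).trans ?_) 2
        rw [← lintegral_indicator hms]; refine lintegral_mono fun p => ?_
        by_cases hp : φ p = 0
        · simp [hp]
        · rw [indicator_of_mem (show p ∈ {p : Amb d | -1 < p.2 ∧ p.2 < -τ} from hφ p hp), enorm_mul]
    _ ≤ _ := lintegral_mul_sq_le _ hm1 h.1.continuous.measurable.enorm.aemeasurable
    _ ≤ _ := by
      refine mul_le_mul' ?_ ?_
      · have hset : volume.restrict {p : Amb d | -1 < p.2 ∧ p.2 < -τ} = volume.prod (svol τ) := by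
          have : {p : Amb d | -1 < p.2 ∧ p.2 < -τ} =
            univ ×ˢ Ioo (-1) (-τ) := by ext p; simp
          rw [this, Measure.volume_eq_prod, ← Measure.prod_restrict, Measure.restrict_univ]; rfl
        rw [hset] at hm1 ⊢
        rw [lintegral_prod_symm _ (hm1.pow_const 2), incr]; apply lintegral_mono_ae
        filter_upwards [ae_svol hτ (ae_sec_coe (Lp.memLp V))] with z ⟨hz, h1, h2⟩
        rw [wnf_zero, enorm_sq_eq_lintegral]; apply lintegral_mono_ae
        filter_upwards [h1, h2, Lp.coeFn_sub (sec V (z + τ)) (sec V z)] with X a1 a2 a3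
        have m1 : ((X, z)) ∈ S d := ⟨hz.1, by show z < 0; linarith [hz.2]⟩
        have m2 : ((X, z + τ)) ∈ S d :=
          ⟨by show -1 < z + τ; linarith [hz.1], by show z + τ < 0; linarith [hz.2]⟩
        rw [a3, Pi.sub_apply, a1, a2, hV₀]; simp [indicator_of_mem m1, indicator_of_mem m2]
      · rw [enorm_sq_eq_lintegral]
        refine le_trans ?_ (lintegral_congr_ae (h.memLp.coeFn_toLp.fun_comp
          fun x => ‖x‖ₑ ^ 2)).symm.le
        refine lintegral_mono_set fun p hp => ⟨hp.1, hp.2.trans (by linarith)⟩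

theorem tendsto_integral_shift_sub (V : L2S d) (h : IsTest (S d) φ) {u : ℕ → ℝ}
  (hu : Tendsto u atTop (𝓝[≠] 0)) (hu1 : ∀ n, |u n| ≤ 1) :
  Tendsto (fun n => (u n : ℂ)⁻¹ * ∫ p, V p * (φ (p - (0, u n)) - φ p) ∂volS d) atTop
    (𝓝 (-∫ p, V p * pd (inr ()) φ p ∂volS d)) := by
  obtain ⟨C, hC⟩ := h.1.lipschitzWith_of_hasCompactSupport h.2.1 (by simp)
  have hK := h.2.1.isCompact.cthickening (r := 1)
  have hlip : ∀ n p, ‖φ (p - (0, u n)) - φ p‖ ≤ C * |u n| := fun n p => by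
    refine (hC.norm_sub_le _ _).trans_eq ?_
    rw [sub_sub_cancel_left, norm_neg, Prod.norm_mk, norm_zero, norm_eq_abs,
      max_eq_right (abs_nonneg _)]
  have hzero : ∀ n p, p ∉ Metric.cthickening 1 (tsupport φ) → φ (p - (0, u n)) - φ p = 0 := by
    intro n p hp
    rw [image_eq_zero_of_notMem_tsupport fun hp' => hp (Metric.self_subset_cthickening _ hp'),
      image_eq_zero_of_notMem_tsupport fun hp' => hp (Metric.mem_cthickening_of_dist_le p _ 1 _ hp' ?_),
      sub_zero]
    rw [dist_eq_norm, sub_sub_cancel, Prod.norm_mk, norm_zero, norm_eq_abs,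
      max_eq_right (abs_nonneg _)]
    exact hu1 n
  simp_rw [← integral_const_mul, ← integral_neg]
  refine tendsto_integral_of_dominated_convergence (fun p => ‖V p‖ * (C *
    (Metric.cthickening 1 (tsupport φ)).indicator (fun _ => 1) p)) (fun n => ?_) ?_
    (fun n => .of_forall fun p => ?_) (.of_forall fun p => ?_)
  · have hc := h.1.continuous
    exact ((Lp.aestronglyMeasurable V).mul
      (by fun_prop : Continuous fun p => φ (p - (0, u n)) - φ p).aestronglyMeasurable).const_mul _
  · have hind : MemLp ((Metric.cthickening 1 (tsupport φ)).indicator fun _ => (1 : ℝ)) 2 (volS d) :=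
      memLp_indicator_const 2 hK.measurableSet 1 (Or.inr hK.measure_lt_top.ne)
    exact (Lp.memLp V).norm.integrable_mul (hind.const_mul _)
  · by_cases hp : p ∈ Metric.cthickening 1 (tsupport φ)
    · rw [indicator_of_mem hp, mul_one, norm_mul, norm_mul, mul_left_comm]
      refine mul_le_mul_of_nonneg_left ?_ (norm_nonneg _); rw [norm_inv, norm_real, norm_eq_abs]
      rcases eq_or_ne (u n) 0 with h0 | h0
      · simp [h0]
      · rw [inv_mul_le_iff₀ (abs_pos.2 h0), mul_comm]; exact hlip n p
    · rw [hzero n p hp, indicator_of_notMem hp]; simp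
  · have h1 := ((h.hasFDerivAt p).hasLineDerivAt (-dir (inr ()))).tendsto_slope_zero.comp hu
    rw [map_neg] at h1
    have h2 := h1.const_mul (V p)
    rw [mul_neg] at h2
    refine h2.congr fun n => ?_
    have e : p + u n • -dir (inr ()) = p - (0, u n) := by simp [dir, sub_eq_add_neg]
    simp only [Function.comp_apply, e, real_smul, ofReal_inv]; ring

/-- Bounded difference quotients have a weak limit. -/
theorem exists_isWeakPartial_of_incr {V : L2S d} (hE : 0 ≤ E)
  (h : ∀ τ, 0 < τ → incr τ 0 V ≤ ofReal τ ^ 2 * ofReal E) :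
  ∃ V' : L2S d, ‖V'‖ ≤ √E ∧ ∀ φ, IsTest (S d) φ →
    ∫ p, V' p * φ p ∂volS d = -∫ p, V p * pd (inr ()) φ p ∂volS d := by
  refine exists_repr_of_le (sqrt_nonneg E) _ fun φ hφ => ?_
  obtain ⟨η, hη, hη2⟩ := hφ.exists_lt
  set u : ℕ → ℝ := fun n => min η 1 / (n + 1) with hu
  have hu0 : ∀ n, 0 < u n := fun n => by positivity
  have hule : ∀ n, u n ≤ min η 1 := fun n => div_le_self (by positivity) (by simp)
  have htend : Tendsto u atTop (𝓝[≠] 0) :=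
    tendsto_nhdsWithin_iff.2 ⟨tendsto_const_div_atTop_nhds_zero_nat (min η 1) |>.comp
      (tendsto_add_atTop_nat 1) |>.congr fun n => by simp [hu], .of_forall fun n => (hu0 n).ne'⟩
  have h1 := (tendsto_integral_shift_sub V hφ htend fun n => by
    rw [abs_of_pos (hu0 n)]; exact (hule n).trans (min_le_right _ _)).norm
  rw [norm_neg] at h1
  refine le_of_tendsto' h1 fun n => ?_
  have h2 := (integral_mul_shift_sub V hφ (hu0 n) fun p hp => ⟨(hη2 p hp).1, (hη2 p hp).2.trans_le
    (neg_le_neg ((hule n).trans (min_le_left _ _)))⟩).trans (mul_le_l (h _ (hu0 n)))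
  rw [← ofReal_norm, ← ofReal_norm, ← ofReal_pow (norm_nonneg _),
    ← ofReal_pow (hu0 n).le, ← ofReal_pow (norm_nonneg _),
    ← ofReal_mul (by positivity), ← ofReal_mul (by positivity),
    ofReal_le_ofReal_iff (by positivity)] at h2
  rw [norm_mul, norm_inv, norm_real, norm_of_nonneg (hu0 n).le, inv_mul_le_iff₀ (hu0 n)]
  refine le_of_sq_le_sq (h2.trans_eq ?_) (by positivity)
  rw [mul_pow, mul_pow, sq_sqrt hE, mul_assoc]

theorem exists_isLamDz {u : L2S d} (hu : wnS r u < ⊤) (hE : 0 ≤ E)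
  (h : ∀ τ, 0 < τ → incr τ r u ≤ ofReal τ ^ 2 * ofReal E) :
  ∃ w : L2S d, IsLamDz r u w ∧ ‖w‖ ≤ √E := by
  obtain ⟨v, hv, hv2, -⟩ := exists_isLam hu
  obtain ⟨w, hw, hw2⟩ := exists_isWeakPartial_of_incr hE (V := v) fun τ hτ => by
    refine le_of_eq_of_le ?_ (h τ hτ); apply lintegral_congr_ae
    filter_upwards [ae_svol hτ hv2] with z ⟨_, h1, h2⟩
    apply lintegral_congr_ae; rw [map_sub, map_sub]
    filter_upwards [h1, h2, Lp.coeFn_sub (FT (sec v (z + τ))) (FT (sec v z)),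
      Lp.coeFn_sub (FT (sec u (z + τ))) (FT (sec u z))] with ξ a1 a2 a3 a4
    rw [a3, a4, Pi.sub_apply, Pi.sub_apply, a1, a2, ← mul_sub, enorm_mul, enorm_lam, el_zero,
      one_mul]
  exact ⟨w, ⟨Lp.memLp w, fun φ hφ => by rw [hw2 φ hφ, hv.2 _ (hφ.pd _)]⟩, hw⟩

/-! ### Coefficients given by a Fourier integral -/

/-- The amplitude of the real part of `𝓕⁻ g`, where `𝓕⁻` acts on the horizontal variable. -/
def hermPart (g : Amb d → ℂ) (p : Amb d) : ℂ := (g p + conj (g (-p.1, p.2))) / 2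

theorem ofReal_re_fourierInv (hg : Integrable fun k : Hor d => g (k, z))
  (X : Hor d) : (((𝓕⁻ (fun k => g (k, z)) X).re : ℝ) : ℂ) = 𝓕⁻ (fun k => hermPart g (k, z)) X := by
  have hg2 : Integrable fun k => fourierChar (inner ℝ k X) •
    conj (g (-k, z)) := by
    have h1 := Complex.conjLIE.integrable_comp_iff.2 hg.comp_neg
    have := (Real.fourierIntegral_convergent_iff (-X)).2 h1
    simpa using this
  have hg1 : Integrable fun k => fourierChar (inner ℝ k X) • g (k, z) := by
    have := (Real.fourierIntegral_convergent_iff (-X)).2 hg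
    simpa using this
  have e : conj (∫ k, fourierChar (inner ℝ k X) • g (k, z)) =
    ∫ k, fourierChar (inner ℝ k X) • conj (g (-k, z)) := by
    rw [← integral_conj, ← integral_neg_eq_self]; congr 1; ext k
    rw [Circle.smul_def, Circle.smul_def, smul_eq_mul, smul_eq_mul, map_mul, inner_neg_left,
      AddChar.map_neg_eq_inv, Circle.coe_inv_eq_conj, Complex.conj_conj]
  rw [Complex.re_eq_add_conj, fourierInv_eq, fourierInv_eq, e, ← integral_add hg1 hg2,
    ← integral_div]
  congr 1; ext k
  rw [hermPart, ← smul_add, Circle.smul_def, Circle.smul_def, smul_eq_mul, smul_eq_mul, mul_div_assoc]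

section Coefficient

/-- Amplitudes dominated by `Λ^n I Y`, where `I` is a localization near the boundary and `Y` is
square integrable with weight. -/
def IsDom (n : ℝ) (I : Amb d → ℝ≥0∞) (Y : Hor d → ℝ≥0∞) (g : Amb d → ℂ) : Prop :=
  Measurable g ∧ ∀ z ∈ Ioo (-1 : ℝ) 0, ∀ k, ‖g (k, z)‖ₑ ≤ el n k * (I (k, z) * Y k)

/-- Localizations of size `1 / Λ` in the vertical direction. -/
structure IsLoc (R : ℝ) (I : Amb d → ℝ≥0∞) : Prop where
  meas : Measurable I
  le : ∀ p, I p ≤ 1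
  even : ∀ k z, I (-k, z) = I (k, z)
  int : ∀ k, ∫⁻ z, I (k, z) ^ 2 ∂zvol ≤ ofReal R * el (-1) k

variable {t n R K : ℝ} {I : Amb d → ℝ≥0∞} {Y : Hor d → ℝ≥0∞} {g g' : Amb d → ℂ}

theorem IsDom.hermPart (hI : IsLoc R I) (h : IsDom n I Y g) :
  IsDom n I (fun k => Y k + Y (-k)) (hermPart g) := by
  refine ⟨?_, fun z hz k => ?_⟩
  · have h1 := h.1.comp (measurable_fst.neg.prodMk measurable_snd : Measurable fun p : Amb d =>
      ((-p.1, p.2) : Amb d))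
    exact (h.1.add (continuous_conj.measurable.comp h1)).div_const 2
  · have h2 := h.2 z hz (-k)
    rw [el_neg_arg, hI.even] at h2
    rw [FlatStrip.hermPart, mul_add, mul_add, div_eq_mul_inv, enorm_mul]
    refine (mul_le_mul' ((enorm_add_le _ _).trans (add_le_add (h.2 z hz k) ?_))
      (show ‖(2 : ℂ)⁻¹‖ₑ ≤ 1 by rw [← ofReal_norm]; norm_num)).trans_eq (mul_one _)
    rwa [← ofReal_norm, RCLike.norm_conj, ofReal_norm]

theorem lintegral_add_neg_le (hY : Measurable Y)
  (hYi : ∫⁻ k, (el (t + 1) k * Y k) ^ 2 ≤ ofReal K) :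
  ∫⁻ k, (el (t + 1) k * (Y k + Y (-k))) ^ 2 ≤ ofReal (4 * K) := by
  have hm : Measurable fun k => (el (t + 1) k * Y k) ^ 2 := ((measurable_el _).mul hY).pow_const 2
  calc _ ≤ ∫⁻ k, 2 * ((el (t + 1) k * Y k) ^ 2 + (el (t + 1) (-k) * Y (-k)) ^ 2) := by
        refine lintegral_mono fun k => ?_
        rw [mul_add, el_neg_arg]; exact add_sq_le_two _ _
    _ = 2 * ((∫⁻ k, (el (t + 1) k * Y k) ^ 2) + ∫⁻ k, (el (t + 1) k * Y k) ^ 2) := by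
      rw [lintegral_cmul, lintegral_add_left hm,
        lintegral_neg_eq_self fun k => (el (t + 1) k * Y k) ^ 2]
    _ ≤ 2 * (ofReal K + ofReal K) := mul_le_r (add_le_add hYi hYi)
    _ = _ := by
      rw [ofReal_mul (by norm_num)]
      have : ofReal 4 = 4 := ofReal_ofNat 4
      rw [this]; ring

theorem IsDom.lintegral_le (hI : IsLoc R I) (hR : 0 ≤ R)
  (hYi : ∫⁻ k, (el (t + 1) k * Y k) ^ 2 ≤ ofReal K) (h : IsDom n I Y g) :
  ∫⁻ k, el (t + 3 / 2 - n) k ^ 2 * ∫⁻ z, ‖g (k, z)‖ₑ ^ 2 ∂zvol ≤ ofReal (R * K) := by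
  rw [ofReal_mul hR]; refine le_trans ?_ (mul_le_r hYi)
  rw [← lintegral_cmul]; refine lintegral_mono fun k => ?_
  have h1 : ∫⁻ z, ‖g (k, z)‖ₑ ^ 2 ∂zvol ≤ (el n k * Y k) ^ 2 * (ofReal R * el (-1) k) := by
    refine le_trans ?_ (mul_le_r (hI.int k))
    have hm : Measurable fun z => I (k, z) ^ 2 := (hI.meas.comp measurable_prodMk_left).pow_const 2
    rw [← lintegral_const_mul _ hm]; apply lintegral_mono_ae
    filter_upwards [ae_zvol_mem] with z hz
    refine (pow_le_pow_left' (h.2 z hz k) 2).trans_eq ?_; ring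
  refine (mul_le_r h1).trans_eq ?_
  have e : el (t + 3 / 2 - n) k ^ 2 * el n k ^ 2 * el (-1) k = el (t + 1) k ^ 2 := by
    simp only [sq, ← el_add]; congr 1; ring
  rw [mul_pow, mul_pow, ← e]; ring

theorem IsDom.enorm_le (hI : IsLoc R I) (h : IsDom n I Y g) (hz : z ∈ Ioo (-1 : ℝ) 0)
  (k : Hor d) : ‖g (k, z)‖ₑ ≤ el (n - 1 - t) k * (el (t + 1) k * Y k) := by
  rw [← mul_assoc, ← el_add, show n - 1 - t + (t + 1) = n by ring]
  exact (h.2 z hz k).trans (mul_le_r ((mul_le_l (hI.le _)).trans_eq (one_mul _)))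

theorem IsDom.integrable (hI : IsLoc R I) (ht : (d : ℝ) / 2 < t) (hY : Measurable Y)
  (hYi : ∫⁻ k, (el (t + 1) k * Y k) ^ 2 ≤ ofReal K) (h : IsDom 1 I Y g)
  (hz : z ∈ Ioo (-1 : ℝ) 0) : IsAmp t (fun k => g (k, z)) fun k => el (t + 1) k * Y k :=
  ⟨ht, h.1.comp measurable_prodMk_right, (measurable_el _).mul hY, fun k => by
    have := h.enorm_le (t := t) hI hz k
    rwa [sub_self, zero_sub] at this, (hYi.trans_lt ofReal_lt_top).ne⟩

theorem enorm_sub_le_of_hasDerivAt {f f' : ℝ → ℂ} (hd : ∀ z, HasDerivAt f (f' z) z)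
  (hc : Continuous f') (hτ : 0 < τ) (hz : z ∈ Ioo (-1 : ℝ) (-τ)) :
  ‖f (z + τ) - f z‖ₑ ≤ ∫⁻ w in uIoc (z + τ) z, ‖f' w‖ₑ ∂zvol := by
  rw [← intervalIntegral.integral_eq_sub_of_hasDerivAt (fun w _ => hd w)
    (hc.intervalIntegrable _ _), intervalIntegral.integral_of_le (by linarith), zvol, Set.uIoc_comm,
    uIoc_of_le (by linarith), Measure.restrict_restrict measurableSet_Ioc,
    Set.inter_eq_self_of_subset_left (show Ioc z (z + τ) ⊆ Ioo (-1) 0 from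
      fun w hw => ⟨hz.1.trans hw.1, by linarith [hw.2, hz.2]⟩)]
  exact enorm_integral_le_lintegral_enorm _

theorem hasDerivAt_hermPart (hd : ∀ k z, HasDerivAt (fun z => g (k, z)) (g' (k, z)) z) (k : Hor d)
  (z : ℝ) : HasDerivAt (fun z => hermPart g (k, z)) (hermPart g' (k, z)) z := by
  have h := (hd (-k) z).hasFDerivAt
  exact ((hd k z).add ((conjCLE.toContinuousLinearMap.hasFDerivAt.comp_hasDerivAt z
    (hd (-k) z)))).div_const 2

theorem exists_isCoefS (ht : (d : ℝ) / 2 < t) (hK : 0 ≤ K) (hR : 0 ≤ R) (hI : IsLoc R I)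
  (hY : Measurable Y) (hYi : ∫⁻ k, (el (t + 1) k * Y k) ^ 2 ≤ ofReal K)
  (hg : IsDom 1 I Y g) (hg' : IsDom 2 I Y g')
  (hd : ∀ k z, HasDerivAt (fun z => g (k, z)) (g' (k, z)) z)
  (hc : ∀ k, Continuous fun z => g' (k, z)) {a : Amb d → ℝ}
  (ham : AEStronglyMeasurable (fun p => (a p : ℂ)) (volS d))
  (ha : ∀ z ∈ Ioo (-1 : ℝ) 0, ∀ X, a (X, z) = (𝓕⁻ (fun k => g (k, z)) X).re) :
  ∃ A h, IsCoefS t ((1 + R) * (4 * K)) a A h ∧ IsIncrS t ((1 + R) * (4 * K)) A h := by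
  have hY2 := hY.add (hY.comp measurable_neg)
  have hYi2 := lintegral_add_neg_le hY hYi
  have hA := hg.hermPart hI
  have hA' := hg'.hermPart hI
  have hle1 : 4 * K ≤ (1 + R) * (4 * K) := le_mul_of_one_le_left (by positivity) (by linarith)
  have hle2 : R * (4 * K) ≤ (1 + R) * (4 * K) :=
    mul_le_mul_of_nonneg_right (by linarith) (by positivity)
  have hsub : ∀ τ, 0 < τ → ∀ z ∈ Ioo (-1) (-τ), ∀ k, ‖hermPart g (k, z + τ) - hermPart g (k, z)‖ₑ ≤
      ∫⁻ w in uIoc (z + τ) z, ‖hermPart g' (k, w)‖ₑ ∂zvol := fun τ hτ z hz k =>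
    enorm_sub_le_of_hasDerivAt (f' := fun z => hermPart g' (k, z)) (hasDerivAt_hermPart hd k)
      (((hc k).add (continuous_conj.comp (hc (-k)))).div_const 2) hτ hz
  have hm2 : ∀ n, ∀ f : Amb d → ℂ, Measurable f → Measurable fun p =>
    (el n p.1 * ‖f p‖ₑ) ^ 2 := fun n f hf =>
    (((measurable_el n).comp measurable_fst).mul hf.enorm).pow_const 2
  refine ⟨hermPart g, fun k => el (t + 1) k * (Y k + Y (-k)), ⟨ht, ham, hA.1,
    (measurable_el _).mul hY2, fun z hz k => ?_, fun z hz X => ?_,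
    hYi2.trans (ofReal_le_ofReal hle1), ?_⟩, ⟨fun τ hτ z hz k => ?_, fun τ hτ => ?_⟩⟩
  · exact (hA.integrable hI ht hY2 hYi2 hz).le k
  · rw [ha z hz, ofReal_re_fourierInv (hg.integrable hI ht hY hYi hz).integrable]
  · have h1 := hA.lintegral_le hI hR hYi2
    refine le_trans (le_of_eq ?_) (h1.trans (ofReal_le_ofReal hle2)); simp only [wnf]
    rw [lintegral_lintegral_swap (by exact ((hm2 _ _ hA.1).comp measurable_swap).aemeasurable)]
    refine lintegral_congr fun k => ?_
    simp only [mul_pow]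
    rw [lintegral_const_mul' _ _ (by finiteness [el_ne_top (t + 1 / 2) k]),
      show t + 3 / 2 - 1 = t + 1 / 2 by ring]
  · calc _ ≤ ∫⁻ w in uIoc (z + τ) z, el (1 - t) k * (el (t + 1) k * (Y k + Y (-k))) ∂zvol := by
          refine (hsub τ hτ z hz k).trans (lintegral_mono_ae ?_)
          filter_upwards [ae_restrict_of_ae ae_zvol_mem] with w hw
          have := hA'.enorm_le (t := t) hI hw k
          rwa [show 2 - 1 - t = 1 - t by ring] at this
      _ ≤ _ := by
        rw [lintegral_const, Measure.restrict_apply_univ, mul_assoc]; refine mul_le_r ?_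
        rw [mul_comm]; refine mul_le_l ((Measure.restrict_apply_le _ _).trans_eq ?_)
        rw [Set.uIoc_comm, uIoc_of_le (by linarith), Real.volume_Ioc, add_sub_cancel_left]
  · have h1 := hA'.lintegral_le hI hR hYi2
    rw [ofReal_mul (by positivity), ofReal_pow hτ.le]
    refine le_trans ?_ (mul_le_r (h1.trans (ofReal_le_ofReal hle2))); simp only [wnf]
    rw [lintegral_lintegral_swap (by
      have h2 := ((hA.1.comp (measurable_fst.prodMk (measurable_snd.add_const τ))).sub
        (hA.1.comp (measurable_fst.prodMk measurable_snd)))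
      exact ((hm2 _ _ h2).comp measurable_swap).aemeasurable),
      ← lintegral_cmul]
    refine lintegral_mono fun k => ?_
    simp only [mul_pow]
    rw [lintegral_const_mul' _ _ (by finiteness [el_ne_top (t - 1 / 2) k]), mul_left_comm,
      show t + 3 / 2 - 2 = t - 1 / 2 by ring]
    refine mul_le_r (le_trans ?_ (lintegral_sq_uIoc_le hτ
      (hA'.1.comp measurable_prodMk_left).enorm))
    apply lintegral_mono_ae
    filter_upwards [ae_svol hτ ae_zvol_mem] with z hz
    exact pow_le_pow_left' (hsub τ hτ z hz.1 k) 2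

end Coefficient

/-! ### The coefficients of the transformed problem -/

section Profile

variable {θ : ℝ → ℝ}

/-- The `n`-th derivative of `z ↦ (z + 1) θ(z κ)`. -/
def prof (θ : ℝ → ℝ) (n : ℕ) (κ z : ℝ) : ℝ :=
  (z + 1) * κ ^ n * iteratedDeriv n θ (z * κ) + n * κ ^ (n - 1) * iteratedDeriv (n - 1) θ (z * κ)

theorem hasDerivAt_iteratedDeriv (hθ : ContDiff ℝ ∞ θ) (n : ℕ) (x : ℝ) :
  HasDerivAt (iteratedDeriv n θ) (iteratedDeriv (n + 1) θ x) x := by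
  rw [iteratedDeriv_succ]
  exact (hθ.differentiable_iteratedDeriv n (by exact_mod_cast WithTop.coe_lt_top _) x).hasDerivAt

theorem hasDerivAt_prof (hθ : ContDiff ℝ ∞ θ) (n : ℕ) (κ z : ℝ) :
  HasDerivAt (prof θ n κ) (prof θ (n + 1) κ z) z := by
  have h := fun m => by
    simpa [Function.comp_def] using
      (hasDerivAt_iteratedDeriv hθ m (z * κ)).comp z ((hasDerivAt_id z).mul_const κ)
  have h1 := ((((hasDerivAt_id z).add_const 1).mul_const (κ ^ n)).mul (h n)).add
    ((h (n - 1)).const_mul (n * κ ^ (n - 1)))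
  refine h1.congr_deriv ?_
  rcases n with _ | n
  · simp [prof]; ring
  · simp [prof]; ring

theorem continuous_prof (hθ : ContDiff ℝ ∞ θ) (n : ℕ) :
  Continuous fun x : ℝ × ℝ => prof θ n x.1 x.2 := by
  have h := fun m => hθ.continuous_iteratedDeriv m (by exact_mod_cast le_top)
  unfold prof; fun_prop

theorem exists_abs_prof_le (hθ : ContDiff ℝ ∞ θ) (hc : HasCompactSupport θ) :
  ∃ C R : ℝ, 0 ≤ C ∧ 0 ≤ R ∧ ∀ n ≤ 2, ∀ κ l z : ℝ, 0 ≤ κ → 1 ≤ l → κ ≤ l → z ∈ Ioo (-1 : ℝ) 0 →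
    |prof θ n κ z| ≤ C * l ^ n ∧ (R < |z * κ| → prof θ n κ z = 0) := by
  have hcs : ∀ m, HasCompactSupport (iteratedDeriv m θ) := fun m => by
    rw [iteratedDeriv_eq_equiv_comp]; exact (hc.iteratedFDeriv m).comp_left (map_zero _)
  choose M hM using fun m => (hθ.continuous_iteratedDeriv m
    (by exact_mod_cast le_top)).bounded_above_of_compact_support (hcs m)
  choose R hR using fun m => (hcs m).isCompact.isBounded.subset_closedBall 0
  have hM' : ∀ m ≤ 2, ∀ x, |iteratedDeriv m θ x| ≤ |M 0| + |M 1| + |M 2| := fun m hm x => by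
    refine (hM m x).trans ?_
    have := abs_nonneg (M 0); have := abs_nonneg (M 1); have := abs_nonneg (M 2)
    interval_cases m
    · linarith [le_abs_self (M 0)]
    · linarith [le_abs_self (M 1)]
    · linarith [le_abs_self (M 2)]
  have hR' : ∀ m ≤ 2, ∀ x, |R 0| + |R 1| + |R 2| < |x| → iteratedDeriv m θ x = 0 := fun m hm x hx => by
    by_contra h0
    have h1 := hR m (subset_tsupport _ h0)
    rw [Metric.mem_closedBall, dist_zero_right, norm_eq_abs] at h1
    have := abs_nonneg (R 0); have := abs_nonneg (R 1); have := abs_nonneg (R 2)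
    interval_cases m
    · linarith [le_abs_self (R 0)]
    · linarith [le_abs_self (R 1)]
    · linarith [le_abs_self (R 2)]
  refine ⟨3 * (|M 0| + |M 1| + |M 2|), |R 0| + |R 1| + |R 2|, by positivity, by positivity,
    fun n hn κ l z hκ hl hκl hz => ⟨?_, fun h => ?_⟩⟩
  · have hp : ∀ m ≤ n, κ ^ m ≤ l ^ n := fun m hm =>
      (pow_le_pow_left₀ hκ hκl m).trans (pow_le_pow_right₀ hl hm)
    have hz1 : |z + 1| ≤ 1 := abs_le.2 ⟨by linarith [hz.1], by linarith [hz.2]⟩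
    have hn' : (n : ℝ) ≤ 2 := by exact_mod_cast hn
    have h1 : |(z + 1) * κ ^ n * iteratedDeriv n θ (z * κ)| ≤ 1 * l ^ n * (|M 0| + |M 1| + |M 2|) := by
      rw [abs_mul, abs_mul, abs_of_nonneg (pow_nonneg hκ n)]
      exact mul_le_mul (mul_le_mul hz1 (hp n le_rfl) (by positivity) zero_le_one) (hM' n hn _)
        (abs_nonneg _) (by positivity)
    have h2 : |n * κ ^ (n - 1) * iteratedDeriv (n - 1) θ (z * κ)| ≤
      2 * l ^ n * (|M 0| + |M 1| + |M 2|) := by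
      rw [abs_mul, abs_mul, abs_of_nonneg (pow_nonneg hκ _), Nat.abs_cast]
      exact mul_le_mul (mul_le_mul hn' (hp _ (by omega)) (by positivity) zero_le_two)
        (hM' _ (by omega) _) (abs_nonneg _) (by positivity)
    exact (abs_add_le _ _).trans ((add_le_add h1 h2).trans_eq (by ring))
  · rw [prof, hR' n hn _ h, hR' (n - 1) (by omega) _ h]; ring

theorem exists_abs_prof_one_sub_le (hθ : IsCutoff θ) :
  ∃ L : ℝ, 0 ≤ L ∧ ∀ κ z : ℝ, 0 ≤ κ → z ∈ Ioo (-1 : ℝ) 0 → |prof θ 1 κ z - 1| ≤ L * κ := by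
  obtain ⟨-, hc, hs, -, h1⟩ := hθ
  have hcont := hs.continuous_deriv (by exact_mod_cast le_top)
  obtain ⟨L, hL⟩ := hcont.bounded_above_of_compact_support hc.deriv
  have hL0 := (norm_nonneg _).trans (hL 0)
  refine ⟨2 * L, by positivity, fun κ z hκ hz => ?_⟩
  have h2 : |θ (z * κ) - 1| ≤ L * κ := by
    have h := Convex.norm_image_sub_le_of_norm_deriv_le (x := 0) (y := z * κ)
      (fun x _ => (hs.differentiable (by simp)) x) (fun x _ => hL x) convex_univ trivial trivial
    rw [h1.self_of_nhds, sub_zero, norm_eq_abs, norm_eq_abs, abs_mul, abs_of_nonneg hκ] at h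
    refine h.trans (mul_le_mul_of_nonneg_left (mul_le_of_le_one_left hκ ?_) hL0)
    exact abs_le.2 ⟨by linarith [hz.1], by linarith [hz.2]⟩
  have h3 : |(z + 1) * κ * deriv θ (z * κ)| ≤ 1 * κ * L := by
    rw [abs_mul, abs_mul, abs_of_nonneg hκ]
    refine mul_le_mul (mul_le_mul_of_nonneg_right ?_ hκ) (hL _) (abs_nonneg _) (by positivity)
    exact abs_le.2 ⟨by linarith [hz.1], by linarith [hz.2]⟩
  have e : prof θ 1 κ z - 1 = (z + 1) * κ * deriv θ (z * κ) + (θ (z * κ) - 1) := by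
    simp [prof, iteratedDeriv_one, iteratedDeriv_zero]; ring
  rw [e]; exact (abs_add_le _ _).trans ((add_le_add h3 h2).trans_eq (by ring))

/-- The amplitude of the `n`-th vertical derivative of `σ`. -/
def amp (θ : ℝ → ℝ) (δ : ℝ) (Z₁ Z₂ : Hor d → ℂ) (n : ℕ) (p : Amb d) : ℂ :=
  (prof θ n (δ * absD p.1) p.2 : ℂ) * Z₁ p.1 +
    (-1) ^ n * (prof θ n (δ * absD p.1) (-1 - p.2) : ℂ) * Z₂ p.1

theorem hasDerivAt_amp (hθ : ContDiff ℝ ∞ θ) (δ : ℝ) (Z₁ Z₂ : Hor d → ℂ) (n : ℕ) (k : Hor d) (z : ℝ) :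
  HasDerivAt (fun z => amp θ δ Z₁ Z₂ n (k, z)) (amp θ δ Z₁ Z₂ (n + 1) (k, z)) z := by
  have h1 := (hasDerivAt_prof hθ n (δ * absD k) z).ofReal_comp.mul_const (Z₁ k)
  have h2 := (((hasDerivAt_prof hθ n (δ * absD k) (-1 - z)).comp z
    ((hasDerivAt_id z).const_sub (-1))).ofReal_comp.const_mul ((-1) ^ n)).mul_const (Z₂ k)
  refine (h1.add h2).congr_deriv ?_; simp only [amp]; push_cast; ring

theorem measurable_amp (hθ : ContDiff ℝ ∞ θ) (δ : ℝ) {Z₁ Z₂ : Hor d → ℂ} (h₁ : Measurable Z₁)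
  (h₂ : Measurable Z₂) (n : ℕ) : Measurable (amp θ δ Z₁ Z₂ n) := by
  have hp := (continuous_prof hθ n).measurable
  have ha : Measurable fun p : Amb d => δ * absD p.1 := by unfold absD; fun_prop
  have e1 := measurable_ofReal.comp (hp.comp (ha.prodMk measurable_snd))
  have e2 := measurable_ofReal.comp (hp.comp (ha.prodMk (measurable_snd.const_sub (-1))))
  exact (e1.mul (h₁.comp measurable_fst)).add ((e2.const_mul ((-1) ^ n)).mul (h₂.comp measurable_fst))

/-- The localization near the surface and the bottom. -/
def loc (R : ℝ) (p : Amb d) : ℝ≥0∞ :=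
  {p : Amb d | |p.2| * lam 1 p.1 ≤ R ∨ |(-1) - p.2| * lam 1 p.1 ≤ R}.indicator 1 p

theorem isLoc_loc (hR : 0 ≤ R) : IsLoc (4 * R) (loc (d := d) R) where
  meas := by
    refine measurable_one.indicator (MeasurableSet.union ?_ ?_)
    · exact measurableSet_le (f := fun p : Amb d => |p.2| * lam 1 p.1) (by fun_prop) measurable_const
    · exact measurableSet_le (f := fun p : Amb d => |(-1) - p.2| * lam 1 p.1) (by fun_prop)
        measurable_const
  le p := Set.indicator_le_self' (by simp) p
  even k z := by simp only [loc, Set.indicator, Set.mem_ofPred_eq, lam_neg_arg, Pi.one_apply]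
  int k := by
    have hl := lam_pos 1 k
    calc _ ≤ ∫⁻ z, (Icc (-(R / lam 1 k)) (R / lam 1 k) ∪
          Icc (-1 - R / lam 1 k) (-1 + R / lam 1 k)).indicator 1 z := by
          refine (lintegral_mono' Measure.restrict_le_self le_rfl).trans (lintegral_mono fun z => ?_)
          by_cases h : |z| * lam 1 k ≤ R ∨ |(-1) - z| * lam 1 k ≤ R
          · rw [indicator_of_mem]
            · exact pow_le_one' (Set.indicator_le_self' (fun _ _ => zero_le_one) _) _
            · rw [← le_div_iff₀ hl, ← le_div_iff₀ hl, abs_le, abs_le] at h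
              exact h.imp id fun h => ⟨by linarith [h.2], by linarith [h.1]⟩
          · rw [loc, indicator_of_notMem (by exact h)]; simp
      _ ≤ ofReal (2 * (R / lam 1 k)) + ofReal (2 * (R / lam 1 k)) := by
        rw [lintegral_indicator_one (measurableSet_Icc.union measurableSet_Icc)]
        refine (measure_union_le _ _).trans_eq ?_; rw [Real.volume_Icc, Real.volume_Icc]
        congr 2 <;> ring
      _ = _ := by
        rw [← ofReal_add (by positivity) (by positivity), el,
          ← ofReal_mul (by positivity), lam_eq_rpow (-1), Real.rpow_neg_one]
        congr 1; ring

theorem IsDom.mono {n n' : ℝ} {I : Amb d → ℝ≥0∞} {Y' : Hor d → ℝ≥0∞}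
  (h : IsDom n I Y g) (hn : n ≤ n') (hY : ∀ k, Y k ≤ Y' k) : IsDom n' I Y' g :=
  ⟨h.1, fun z hz k => (h.2 z hz k).trans (mul_le_mul' (el_mono hn k) (mul_le_r (hY k)))⟩

theorem IsDom.mul_freq {n : ℝ} {I : Amb d → ℝ≥0∞}
  (h : IsDom n I Y g) (hc : |c| ≤ C) (i : Fin d) :
  IsDom (n + 1) I (fun k => ofReal C * Y k)
    (fun p => ((c * (2 * π * p.1 i) : ℝ) * Complex.I : ℂ) * g p) := by
  refine ⟨?_, fun z hz k => ?_⟩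
  · have : Measurable fun p : Amb d => ((c * (2 * π * p.1 i) : ℝ) * Complex.I) := by fun_prop
    exact this.mul h.1
  · have h1 : ‖((c * (2 * π * k i) : ℝ) * Complex.I)‖ₑ ≤ ofReal C * el 1 k := by
      rw [← ofReal_norm, norm_mul, norm_I, mul_one, norm_real, norm_eq_abs, el,
        ← ofReal_mul ((abs_nonneg _).trans hc)]
      refine ofReal_le_ofReal ?_; rw [abs_mul]
      refine mul_le_mul hc (le_trans ?_ (absD_le_lam k)) (abs_nonneg _) ((abs_nonneg _).trans hc)
      rw [abs_mul, abs_of_pos Real.two_pi_pos, absD]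
      exact mul_le_mul_of_nonneg_left (by simpa using PiLp.norm_apply_le k i) (by positivity)
    rw [enorm_mul]; refine (mul_le_mul' h1 (h.2 z hz k)).trans_eq ?_; rw [el_add]; ring

theorem exists_isDom_amp (hθ : ContDiff ℝ ∞ θ) (hc : HasCompactSupport θ) {δ : ℝ} (hδ : 0 < δ) :
  ∃ C R : ℝ, 0 ≤ C ∧ 0 ≤ R ∧ ∀ (Z₁ Z₂ : Hor d → ℂ), Measurable Z₁ → Measurable Z₂ → ∀ n : ℕ, n ≤ 2 →
    IsDom n (loc R) (fun k => ofReal C * (‖Z₁ k‖ₑ + ‖Z₂ k‖ₑ)) (amp θ δ Z₁ Z₂ n) := by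
  obtain ⟨C, R, hC, hR, h⟩ := exists_abs_prof_le hθ hc
  refine ⟨C * (1 + δ) ^ 2, 1 + R / δ, by positivity, by positivity, fun Z₁ Z₂ h₁ h₂ n hn =>
    ⟨measurable_amp hθ δ h₁ h₂ n, fun z hz k => ?_⟩⟩
  have hl := one_le_lam zero_le_one k
  have ha := absD_nonneg k
  have key : ∀ w ∈ Ioo (-1) 0, |w| * lam 1 k ≤ 1 + R / δ ∧
    ‖(prof θ n (δ * absD k) w : ℂ)‖ₑ ≤ el n k * ofReal (C * (1 + δ) ^ 2) ∨
    prof θ n (δ * absD k) w = 0 := fun w hw => by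
    have h3 := h n hn (δ * absD k) ((1 + δ) * lam 1 k) w (by positivity) (by nlinarith)
      (by nlinarith [absD_le_lam k]) hw
    by_cases h4 : R < |w * (δ * absD k)|
    · exact .inr (h3.2 h4)
    refine .inl ⟨?_, ?_⟩
    · rw [abs_mul, abs_of_nonneg (by positivity : 0 ≤ δ * absD k), not_lt] at h4
      have h5 : |w| * absD k ≤ R / δ := by rw [le_div_iff₀ hδ]; linarith
      have h6 : |w| ≤ 1 := abs_le.2 ⟨by linarith [hw.1], by linarith [hw.2]⟩
      have h7 : lam 1 k ≤ 1 + absD k := by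
        rw [lam_one]; exact Real.sqrt_le_iff.2 ⟨by positivity, by nlinarith⟩
      nlinarith [abs_nonneg w]
    · rw [← ofReal_norm, norm_real, norm_eq_abs, el, ← ofReal_mul (lam_pos _ _).le]
      refine ofReal_le_ofReal (h3.1.trans ?_)
      rw [lam_eq_rpow n, Real.rpow_natCast, mul_pow, mul_comm (lam 1 k ^ n), mul_assoc]
      refine mul_le_mul_of_nonneg_left (mul_le_mul_of_nonneg_right ?_ (by positivity)) hC
      exact pow_le_pow_right₀ (by linarith) hn
  have hI : ∀ w ∈ Ioo (-1) 0, (w = z ∨ w = -1 - z) → ‖(prof θ n (δ * absD k) w : ℂ)‖ₑ ≤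
    el n k * ofReal (C * (1 + δ) ^ 2) * loc (1 + R / δ) (k, z) := fun w hw hwz => by
    rcases key w hw with h1 | h1
    · rw [loc, indicator_of_mem, Pi.one_apply, mul_one]
      · exact h1.2
      · rcases hwz with rfl | rfl
        · exact .inl h1.1
        · exact .inr h1.1
    · rw [h1]; simp
  rw [amp]; refine (enorm_add_le _ _).trans ?_; rw [mul_assoc, enorm_mul, enorm_mul, enorm_mul]
  have h8 : ‖(-1 : ℂ) ^ n‖ₑ = 1 := by rw [← ofReal_norm, norm_pow]; simp
  rw [h8, one_mul]
  refine (add_le_add (mul_le_l (hI z hz (.inl rfl))) (mul_le_mul'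
    (hI (-1 - z) ⟨by linarith [hz.2], by linarith [hz.1]⟩ (.inr rfl)) le_rfl)).trans_eq ?_
  ring

end Profile

/-! ### Derivatives of the diffeomorphism -/

section Derivative

variable {t R K : ℝ} {I : Amb d → ℝ≥0∞} {Y : Hor d → ℝ≥0∞} {g g' : Amb d → ℂ}

/-- The phase of the inverse Fourier transform. -/
def phase (k : Hor d) : Amb d →L[ℝ] ℂ :=
  ofRealCLM.comp ((2 * π) • (innerSL ℝ k).comp (ContinuousLinearMap.fst ℝ (Hor d) ℝ))

theorem norm_phase_le (k : Hor d) : ‖phase k‖ ≤ absD k := by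
  refine opNorm_le_bound _ (absD_nonneg k) fun p => ?_
  simp only [phase, comp_apply, smul_apply,
    ContinuousLinearMap.coe_fst', innerSL_apply_apply, Complex.ofRealCLM_apply, norm_real, norm_smul]
  rw [norm_of_nonneg Real.two_pi_pos.le, absD, mul_assoc (2 * π)]
  exact mul_le_mul_of_nonneg_left ((norm_inner_le_norm _ _).trans
    (mul_le_mul_of_nonneg_left (norm_fst_le p) (norm_nonneg _))) Real.two_pi_pos.le

theorem fourierInv_eq_phase (f : Hor d → ℂ) (X : Hor d) (z : ℝ) :
  𝓕⁻ f X = ∫ k, exp (phase k (X, z) * Complex.I) * f k := by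
  rw [fourierInv_eq']; rfl

theorem norm_exp_phase (k : Hor d) (p : Amb d) : ‖exp (phase k p * Complex.I)‖ = 1 :=
  norm_exp_ofReal_mul_I _

theorem hasFDerivAt_phase (hd : ∀ k z, HasDerivAt (fun z => g (k, z)) (g' (k, z)) z) (k : Hor d)
  (p : Amb d) : HasFDerivAt (fun p : Amb d => exp (phase k p * Complex.I) * g (k, p.2))
    (exp (phase k p * Complex.I) • (Complex.I * g (k, p.2)) • phase k +
      (exp (phase k p * Complex.I) * g' (k, p.2)) • ofRealCLM.comp (snd ℝ (Hor d) ℝ)) p := by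
  have h1 := (((phase k).hasFDerivAt (x := p)).mul_const Complex.I).cexp
  have h2 := (hd k p.2).hasFDerivAt.comp p (hasFDerivAt_snd)
  refine (h1.mul h2).congr_fderiv ?_; ext v
  · simp; ring
  · simp; ring

theorem hasFDerivAt_fourierInv (hI : IsLoc R I) (ht : (d : ℝ) / 2 < t) (hY : Measurable Y)
  (hYf : ∀ k, Y k ≠ ⊤) (hYi : ∫⁻ k, (el (t + 1) k * Y k) ^ 2 ≤ ofReal K)
  (hg : IsDom 0 I Y g) (hg' : IsDom 1 I Y g')
  (hd : ∀ k z, HasDerivAt (fun z => g (k, z)) (g' (k, z)) z) {p : Amb d}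
  (hp : p.2 ∈ Ioo (-1 : ℝ) 0) :
  ∃ T : Amb d →L[ℝ] ℂ, HasFDerivAt (fun p : Amb d => 𝓕⁻ (fun k => g (k, p.2)) p.1) T p ∧
    T (dir (inr ())) = 𝓕⁻ (fun k => g' (k, p.2)) p.1 ∧
    ∀ i, T (dir (inl i)) = 𝓕⁻ (fun k => ((2 * π * k i : ℝ) * Complex.I : ℂ) * g (k, p.2)) p.1 := by
  set F' : Amb d → Hor d → Amb d →L[ℝ] ℂ := fun p k =>
    exp (phase k p * Complex.I) • (Complex.I * g (k, p.2)) • phase k +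
      (exp (phase k p * Complex.I) * g' (k, p.2)) • ofRealCLM.comp (snd ℝ (Hor d) ℝ) with hF'
  have hm1 : Measurable fun k => g (k, p.2) := hg.1.comp measurable_prodMk_right
  have hm2 : Measurable fun k => g' (k, p.2) := hg'.1.comp measurable_prodMk_right
  have hph : Continuous (phase (d := d)) := by unfold phase; fun_prop
  have hex : ∀ p, Continuous fun k => exp (phase k p * Complex.I) := fun p => by fun_prop
  have hB : Integrable fun k => 2 * (el 1 k * Y k).toReal := by
    have h1 : IsAmp t (fun k => (((el 1 k * Y k).toReal) : ℂ)) fun k => el (t + 1) k * Y k := by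
      refine ⟨ht, measurable_ofReal.comp ((measurable_el _).mul hY).ennreal_toReal,
        (measurable_el _).mul hY, fun k => ?_, (hYi.trans_lt ofReal_lt_top).ne⟩
      rw [← ofReal_norm, norm_real, norm_of_nonneg toReal_nonneg, ← mul_assoc,
        ← el_add, show -t + (t + 1) = 1 by ring]
      exact ENNReal.ofReal_toReal_le
    simpa using (h1.integrable.re.const_mul 2)
  have hdom : ∀ p : Amb d, p.2 ∈ Ioo (-1) 0 → ∀ k,
    absD k * ‖g (k, p.2)‖ ≤ (el 1 k * Y k).toReal ∧ ‖g' (k, p.2)‖ ≤ (el 1 k * Y k).toReal := by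
    intro p hp k
    have hfin : el 1 k * Y k ≠ ⊤ := mul_ne_top (el_ne_top _ _) (hYf k)
    have hle : ∀ n, el n k * (I (k, p.2) * Y k) ≤ el n k * Y k := fun n =>
      mul_le_r ((mul_le_l (hI.le _)).trans_eq (one_mul _))
    constructor
    · rw [← toReal_enorm, ← ENNReal.toReal_ofReal (absD_nonneg k), ← toReal_mul]
      refine toReal_mono hfin (mul_le_mul' (ofReal_le_ofReal (absD_le_lam k)) ?_)
      exact ((hg.2 _ hp k).trans (hle 0)).trans_eq (by rw [el_zero, one_mul])
    · rw [← toReal_enorm]; exact toReal_mono hfin ((hg'.2 _ hp k).trans (hle 1))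
  have hbound : ∀ p, p.2 ∈ Ioo (-1) 0 → ∀ k,
    ‖F' p k‖ ≤ 2 * (el 1 k * Y k).toReal := fun p hp k => by
    refine (norm_add_le _ _).trans ?_
    rw [norm_smul, norm_smul, norm_smul, norm_mul, norm_mul, norm_exp_phase, norm_I]
    have h2 : ‖ofRealCLM.comp (snd ℝ (Hor d) ℝ)‖ ≤ 1 :=
      opNorm_le_bound _ zero_le_one fun v => by simpa using norm_snd_le v
    have h3 := mul_le_mul_of_nonneg_left (norm_phase_le k) (norm_nonneg (g (k, p.2)))
    have h4 := mul_le_mul_of_nonneg_left h2 (norm_nonneg (g' (k, p.2)))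
    linarith [(hdom p hp k).1, (hdom p hp k).2]
  have hmeas : ∀ z, Measurable fun k => g (k, z) := fun z => hg.1.comp measurable_prodMk_right
  have hF'm : AEStronglyMeasurable (F' p) volume := by
    refine AEStronglyMeasurable.add ?_ ?_
    · exact (hex p).aestronglyMeasurable.smul
        ((hm1.const_mul _).aestronglyMeasurable.smul hph.aestronglyMeasurable)
    · exact ((hex p).aestronglyMeasurable.mul hm2.aestronglyMeasurable).smul
        aestronglyMeasurable_const
  have hFi : Integrable fun k => exp (phase k p * Complex.I) * g (k, p.2) := by
    have h1 : IsDom 1 I Y g := ⟨hg.1, fun z hz k => (hg.2 z hz k).trans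
      (mul_le_l (el_mono zero_le_one k))⟩
    refine (h1.integrable hI ht hY hYi hp).integrable.bdd_mul
      (hex p).aestronglyMeasurable (.of_forall fun k => (norm_exp_phase k p).le)
  have hF'i : Integrable (F' p) := hB.mono' hF'm (.of_forall (hbound p hp))
  have hmain := hasFDerivAt_integral_of_dominated_of_fderiv_le (F' := F')
    ((isOpen_Ioo.preimage continuous_snd).mem_nhds hp)
    (.of_forall fun x => ((hex x).measurable.mul (hmeas _)).aestronglyMeasurable) hFi hF'm
    (.of_forall fun k x hx => hbound x hx k) hB (.of_forall fun k x _ => hasFDerivAt_phase hd k x)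
  refine ⟨_, hmain.congr_of_eventuallyEq (.of_forall fun x => fourierInv_eq_phase _ x.1 x.2), ?_,
    fun i => ?_⟩
  · rw [integral_apply hF'i, fourierInv_eq_phase _ p.1 p.2]; congr 1; ext k; simp [hF', dir, phase]
  · rw [integral_apply hF'i, fourierInv_eq_phase _ p.1 p.2]; congr 1; ext k
    simp [hF', dir, phase, EuclideanSpace.inner_single_right]; ring

theorem pd_of_re_fourierInv (hI : IsLoc R I) (ht : (d : ℝ) / 2 < t) (hY : Measurable Y)
  (hYf : ∀ k, Y k ≠ ⊤) (hYi : ∫⁻ k, (el (t + 1) k * Y k) ^ 2 ≤ ofReal K)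
  (hg : IsDom 0 I Y g) (hg' : IsDom 1 I Y g')
  (hd : ∀ k z, HasDerivAt (fun z => g (k, z)) (g' (k, z)) z)
  (hσ : ∀ z ∈ Ioo (-1 : ℝ) 0, ∀ X, σ (X, z) = (𝓕⁻ (fun k => g (k, z)) X).re)
  (hz : z ∈ Ioo (-1 : ℝ) 0) (X : Hor d) :
  pd (inr ()) σ (X, z) = (𝓕⁻ (fun k => g' (k, z)) X).re ∧ ∀ (c : ℝ) i, c * pd (inl i) σ (X, z) =
    (𝓕⁻ (fun k => ((c * (2 * π * k i) : ℝ) * Complex.I : ℂ) * g (k, z)) X).re := by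
  obtain ⟨T, hT, h1, h2⟩ := hasFDerivAt_fourierInv hI ht hY hYf hYi hg hg' hd (p := (X, z)) hz
  have hev : σ =ᶠ[𝓝 (X, z)] fun p => reCLM (𝓕⁻ (fun k => g (k, p.2)) p.1) := by
    filter_upwards [(isOpen_Ioo.preimage continuous_snd).mem_nhds hz] with p hp
    exact hσ p.2 hp p.1
  have hf := ((reCLM.hasFDerivAt.comp (X, z) hT).congr_of_eventuallyEq hev).fderiv
  refine ⟨?_, fun c i => ?_⟩
  · rw [pd, hf, comp_apply, h1]; rfl
  · rw [pd, hf, comp_apply, h2, Complex.reCLM_apply, ← re_ofReal_mul]; congr 1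
    rw [fourierInv_eq_phase _ X z, fourierInv_eq_phase _ X z, ← integral_const_mul]
    congr 1; ext k; push_cast; ring

end Derivative

theorem fourierInv_FT_ae (u : L2H d) (h : Integrable (FT u)) : 𝓕⁻ (FT u : Hor d → ℂ) =ᵐ[volume] u := by
  have hL : Continuous fun p : Hor d × Hor d => (-innerₗ (Hor d)) p.1 p.2 := continuous_inner.neg
  have hc := VectorFourier.fourierIntegral_continuous continuous_fourierChar hL h
  refine ae_eq_of_integral_schwartz hc.locallyIntegrable
    ((Lp.memLp u).locallyIntegrable one_le_two) fun ψ => ?_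
  have h1 := VectorFourier.integral_fourierIntegral_smul_eq_flip
    continuous_fourierChar hL h (ψ.integrable (μ := volume))
  have h2 : VectorFourier.fourierIntegral fourierChar volume (-innerₗ (Hor d)).flip ψ =
    ((𝓕⁻ ψ : Sch d)) := by
    rw [SchwartzMap.fourierInv_coe]; ext X; rw [fourierInv_eq, VectorFourier.fourierIntegral]
    congr 1; ext k; simp [real_inner_comm]
  rw [h2] at h1
  refine h1.trans ((integral_FT_mul u (𝓕⁻ ψ)).trans ?_); rw [FourierTransform.fourier_fourierInv_eq]

/-! ### The system of the transformed problem -/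

theorem fourierInv_const_mul (c : ℂ) (f : Hor d → ℂ) (X : Hor d) :
  𝓕⁻ (fun k => c * f k) X = c * 𝓕⁻ f X := by
  rw [fourierInv_eq', fourierInv_eq', ← integral_const_mul]
  congr 1; ext k; simp only [smul_eq_mul]; ring

/-- The Fourier transform of `c f`. -/
def modes (c : ℝ) (f : Lp ℝ 2 (volume : Measure (Hor d))) (k : Hor d) : ℂ :=
  c * FT (ofRealCLM.compLp f) k

theorem measurable_modes (c : ℝ) (f : Lp ℝ 2 (volume : Measure (Hor d))) : Measurable (modes c f) :=
  (measurable_Lp _).const_mul _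

theorem lintegral_modes_le {f : Lp ℝ 2 (volume : Measure (Hor d))} (hc : 0 ≤ c)
  (hf : TemperedDistribution.MemSobolev r 2 (toDist f)) (h : c * sobNorm r (toDist f) ≤ R) :
  ∫⁻ k, (el r k * ‖modes c f k‖ₑ) ^ 2 ≤ ofReal (R ^ 2) := by
  have h1 := lintegral_multNorm (fhat_of_memSobolev hf).2
  have h0 : 0 ≤ c * sobNorm r (toDist f) := mul_nonneg hc (sqrt_nonneg _)
  refine le_trans (le_of_eq ?_) (ofReal_le_ofReal (pow_le_pow_left₀ h0 h 2))
  rw [mul_pow, ofReal_mul (by positivity), sobNorm, ← h1, ← lintegral_cmul]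
  refine lintegral_congr_ae ?_
  filter_upwards [fhat_toDist f] with k hk
  rw [hk, modes, enorm_mul, enorm_mul, enorm_lam, ← ofReal_norm, norm_real,
    norm_of_nonneg hc, mul_pow, mul_pow, mul_pow, ofReal_pow hc, ← ofReal_norm]
  ring

theorem mul_smoothing (θ : ℝ → ℝ) (c τ : ℝ) (f : Lp ℝ 2 (volume : Measure (Hor d))) (X : Hor d) :
  c * smoothing θ τ f X = (𝓕⁻ (fun k => (θ (τ * absD k) : ℂ) * modes c f k) X).re := by
  rw [smoothing, ← re_ofReal_mul, ← fourierInv_const_mul, fourierInv_eq', fourierInv_eq']; congr 1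
  refine integral_congr_ae ?_
  filter_upwards [fhat_toDist f] with k hk
  rw [hk, modes, mul_left_comm]

theorem integrable_of_weight (ht : (d : ℝ) / 2 < t) {Z : Hor d → ℂ} (hZ : Measurable Z)
  (h : ∫⁻ k, (el (t + 1) k * ‖Z k‖ₑ) ^ 2 ≤ ofReal K) : Integrable Z :=
  IsAmp.integrable (h := fun k => el (t + 1) k * ‖Z k‖ₑ)
    ⟨ht, hZ, (measurable_el _).mul hZ.enorm, fun k => by
      rw [← mul_assoc, ← el_add, show -t + (t + 1) = 1 by ring]
      exact le_mul_of_one_le_left' (ENNReal.one_le_ofReal.2 (one_le_lam zero_le_one k)),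
      (h.trans_lt ofReal_lt_top).ne⟩

theorem sigma_eq (hθ : IsCutoff θ) {δ ε β : ℝ} {ζ b : Lp ℝ 2 (volume : Measure (Hor d))}
  (h₁ : Integrable (modes ε ζ)) (h₂ : Integrable (modes β b)) (X : Hor d) (z : ℝ) :
  sigma θ δ ε β ζ b (X, z) = (𝓕⁻ (fun k => amp θ δ (modes ε ζ) (modes β b) 0 (k, z)) X).re := by
  obtain ⟨-, hc, hs, he, -⟩ := hθ
  obtain ⟨M, hM⟩ := hs.continuous.bounded_above_of_compact_support hc
  have hi : ∀ τ (Z : Hor d → ℂ), Integrable Z →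
    Integrable fun k => (θ (τ * absD k)) * Z k := fun τ Z hZ => by
    refine hZ.bdd_mul (c := M) (Continuous.aestronglyMeasurable ?_) (.of_forall fun k => ?_)
    · exact Complex.continuous_ofReal.comp (hs.continuous.comp (continuous_absD.const_mul τ))
    · rw [norm_real]; exact hM _
  have e : ∀ k, amp θ δ (modes ε ζ) (modes β b) 0 (k, z) =
    ((z + 1 : ℝ)) * ((θ (δ * z * absD k)) * modes ε ζ k) -
      z * ((θ (δ * (z + 1) * absD k)) * modes β b k) := fun k => by
    have h3 : θ ((-1 - z) * (δ * absD k)) = θ (δ * (z + 1) * absD k) := by rw [← he]; congr 1; ring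
    simp only [amp, prof, iteratedDeriv_zero, h3, show z * (δ * absD k) = δ * z * absD k by ring]
    push_cast; ring
  simp only [e]
  rw [fourierInv_sub_apply ((hi _ _ h₁).const_mul _) ((hi _ _ h₂).const_mul _), fourierInv_const_mul,
    fourierInv_const_mul, sub_re, re_ofReal_mul, re_ofReal_mul,
    ← mul_smoothing, ← mul_smoothing, sigma]
  ring

theorem fourierInv_modes_sub_ae {ε β : ℝ} {ζ b : Lp ℝ 2 (volume : Measure (Hor d))}
  (h : Integrable fun k => modes ε ζ k - modes β b k) :
  ∀ᵐ X, (𝓕⁻ (fun k => modes ε ζ k - modes β b k) X).re = ε * ζ X - β * b X := by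
  set u : L2H d := (ε : ℂ) • ofRealCLM.compLp ζ - (β : ℂ) • ofRealCLM.compLp b with hu
  have e : FT u =ᵐ[volume] fun k => modes ε ζ k - modes β b k := by
    rw [hu, map_sub, map_smul, map_smul]
    filter_upwards [Lp.coeFn_sub ((ε : ℂ) • FT (ofRealCLM.compLp ζ))
      ((β : ℂ) • FT (ofRealCLM.compLp b)), Lp.coeFn_smul (ε : ℂ) (FT (ofRealCLM.compLp ζ)),
      Lp.coeFn_smul (β : ℂ) (FT (ofRealCLM.compLp b))] with k h1 h2 h3
    rw [h1, Pi.sub_apply, h2, h3]; rfl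
  filter_upwards [fourierInv_FT_ae u (h.congr e.symm), Lp.coeFn_sub
    ((ε : ℂ) • ofRealCLM.compLp ζ) ((β : ℂ) • ofRealCLM.compLp b),
    Lp.coeFn_smul (ε : ℂ) (ofRealCLM.compLp ζ), Lp.coeFn_smul (β : ℂ) (ofRealCLM.compLp b),
    ofRealCLM.coeFn_compLp ζ, ofRealCLM.coeFn_compLp b] with X h1 h2 h3 h4 h5 h6
  have e2 : 𝓕⁻ (fun k => modes ε ζ k - modes β b k) X = 𝓕⁻ (FT u : Hor d → ℂ) X := by
    rw [fourierInv_eq', fourierInv_eq']; refine integral_congr_ae ?_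
    filter_upwards [e] with k hk
    rw [hk]
  rw [e2, h1, hu, h2, Pi.sub_apply, h3, h4, Pi.smul_apply, Pi.smul_apply, h5, h6]; simp

theorem lintegral_sq_ofReal_mul_le (hC : 0 ≤ C)
  (h : ∫⁻ k, (el (t + 1) k * Y k) ^ 2 ≤ ofReal K) :
  ∫⁻ k, (el (t + 1) k * (ofReal C * Y k)) ^ 2 ≤ ofReal (C ^ 2 * K) := by
  rw [ofReal_mul (by positivity), ofReal_pow hC]; refine le_trans (le_of_eq ?_) (mul_le_r h)
  rw [← lintegral_cmul]; congr 1; ext k; ring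

theorem norm_fourierInv_amp_sub_le {δ : ℝ} (hθ : ContDiff ℝ ∞ θ)
  (ht : (d : ℝ) / 2 < t) (hK : 0 ≤ K) (hL : 0 ≤ L) (hδ : 0 < δ)
  (hprof : ∀ κ z : ℝ, 0 ≤ κ → z ∈ Ioo (-1 : ℝ) 0 → |prof θ 1 κ z - 1| ≤ L * κ)
  {Z₁ Z₂ : Hor d → ℂ} (h₁ : Measurable Z₁) (h₂ : Measurable Z₂)
  (hY : ∫⁻ k, (el (t + 1) k * (‖Z₁ k‖ₑ + ‖Z₂ k‖ₑ)) ^ 2 ≤ ofReal K)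
  (hz : z ∈ Ioo (-1 : ℝ) 0) (X : Hor d) :
  ‖𝓕⁻ (fun k => amp θ δ Z₁ Z₂ 1 (k, z) - (Z₁ k - Z₂ k)) X‖ ≤ δ * (L * coefBound d t K) := by
  have hm : Measurable fun k => ofReal (L * δ) * (‖Z₁ k‖ₑ + ‖Z₂ k‖ₑ) :=
    (h₁.enorm.add h₂.enorm).const_mul _
  have hi := lintegral_sq_ofReal_mul_le (mul_nonneg hL hδ.le) hY
  have hamp : IsAmp t (fun k => amp θ δ Z₁ Z₂ 1 (k, z) - (Z₁ k - Z₂ k))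
    fun k => el (t + 1) k * (ofReal (L * δ) * (‖Z₁ k‖ₑ + ‖Z₂ k‖ₑ)) := by
    refine ⟨ht, ((measurable_amp hθ δ h₁ h₂ 1).comp measurable_prodMk_right).sub (h₁.sub h₂),
      (measurable_el _).mul hm, fun k => ?_, (hi.trans_lt ofReal_lt_top).ne⟩
    have h3 : ∀ w ∈ Ioo (-1) 0, ‖((prof θ 1 (δ * absD k) w - 1 : ℝ) : ℂ)‖ₑ ≤
      el 1 k * ofReal (L * δ) := fun w hw => by
      rw [← ofReal_norm, norm_real, el, ← ofReal_mul (lam_pos _ _).le]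
      refine ofReal_le_ofReal ((hprof _ w (mul_nonneg hδ.le (absD_nonneg k)) hw).trans ?_)
      rw [← mul_assoc, mul_comm]
      exact mul_le_mul_of_nonneg_right (absD_le_lam k) (mul_nonneg hL hδ.le)
    rw [← mul_assoc, ← el_add, show -t + (t + 1) = 1 by ring, ← mul_assoc, mul_add]
    have e : amp θ δ Z₁ Z₂ 1 (k, z) - (Z₁ k - Z₂ k) = ((prof θ 1 (δ * absD k) z - 1 : ℝ)) * Z₁ k -
        ((prof θ 1 (δ * absD k) (-1 - z) - 1 : ℝ)) * Z₂ k := by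
      simp only [amp]; push_cast; ring
    rw [e]; refine enorm_sub_le.trans (add_le_add ?_ ?_)
    · rw [enorm_mul]; exact mul_le_l (h3 z hz)
    · rw [enorm_mul]; exact mul_le_l (h3 _ ⟨by linarith [hz.2], by linarith [hz.1]⟩)
  refine (hamp.norm_le (fun _ => rfl) (by positivity) hi X).trans_eq ?_
  rw [coefBound, coefBound, mul_left_comm, sqrt_mul (by positivity), Real.sqrt_sq (by positivity)]
  ring

theorem exists_isSystem_sigma (d : ℕ) (ht : (d : ℝ) / 2 < t) (hθ : IsCutoff θ)
  {hmin : ℝ} (μmax Rζ Rb : ℝ) (hmin0 : 0 < hmin) :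
  ∃ δ₀ : ℝ, 0 < δ₀ ∧ ∀ δ : ℝ, 0 < δ → δ ≤ δ₀ → ∃ K : ℝ, 0 ≤ K ∧ ∀ ε β μ : ℝ, 0 < ε → 0 < β → μ ≤ μmax →
  ∀ ζ b : Lp ℝ 2 (volume : Measure (Hor d)), TemperedDistribution.MemSobolev (t + 1) 2 (toDist ζ) →
    TemperedDistribution.MemSobolev (t + 1) 2 (toDist b) → ε * sobNorm (t + 1) (toDist ζ) ≤ Rζ →
    β * sobNorm (t + 1) (toDist b) ≤ Rb → (∀ᵐ X, hmin ≤ ε * ζ X + 1 - β * b X) →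
    IsSystem t K (hmin / 2) (fun i p => √μ * pd (inl i) (sigma θ δ ε β ζ b) p)
      (fun p => 1 + pd (inr ()) (sigma θ δ ε β ζ b) p) ∧
    IsIncrSystem t K (fun i p => √μ * pd (inl i) (sigma θ δ ε β ζ b) p)
      (fun p => 1 + pd (inr ()) (sigma θ δ ε β ζ b) p) := by
  obtain ⟨L, hL, hprof⟩ := exists_abs_prof_one_sub_le hθ
  have hs := hθ.2.2.1
  set K₀ := 2 * (Rζ ^ 2 + Rb ^ 2) with hK₀
  have hcb : 0 ≤ coefBound d t K₀ := sqrt_nonneg _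
  refine ⟨hmin / (2 * (L * coefBound d t K₀) + 1), by positivity, fun δ hδ hδ' => ?_⟩
  obtain ⟨C, R, hC, hR, hD⟩ := exists_isDom_amp hs hθ.2.1 hδ
  set C' := (1 + √μmax) * C with hC'
  refine ⟨(1 + 4 * R) * (4 * (C' ^ 2 * K₀)), by positivity,
    fun ε β μ hε hβ hμ ζ b hζ hb hζR hbR hdepth => ?_⟩
  have h₁ := lintegral_modes_le hε.le hζ hζR
  have h₂ := lintegral_modes_le hβ.le hb hbR
  have m₁ := measurable_modes ε ζ
  have m₂ := measurable_modes β b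
  have i₁ := integrable_of_weight ht m₁ h₁
  have i₂ := integrable_of_weight ht m₂ h₂
  have hsig := sigma_eq hθ (δ := δ) i₁ i₂
  replace hD := hD _ _ m₁ m₂
  set Z₁ := modes ε ζ with hZ₁
  set Z₂ := modes β b with hZ₂
  set σ := sigma θ δ ε β ζ b
  set A := amp θ δ Z₁ Z₂
  have hY₀ : ∫⁻ k, (el (t + 1) k * (‖Z₁ k‖ₑ + ‖Z₂ k‖ₑ)) ^ 2 ≤ ofReal K₀ := by
    have hm : Measurable fun k => (el (t + 1) k * ‖Z₁ k‖ₑ) ^ 2 :=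
      ((measurable_el _).mul m₁.enorm).pow_const 2
    calc _ ≤ ∫⁻ k, 2 * ((el (t + 1) k * ‖Z₁ k‖ₑ) ^ 2 + (el (t + 1) k * ‖Z₂ k‖ₑ) ^ 2) :=
          lintegral_mono fun k => by rw [mul_add]; exact add_sq_le_two _ _
      _ ≤ 2 * (ofReal (Rζ ^ 2) + ofReal (Rb ^ 2)) := by
        rw [lintegral_cmul, lintegral_add_left hm]; exact mul_le_r (add_le_add h₁ h₂)
      _ = _ := by rw [hK₀, ofReal_mul zero_le_two, ofReal_add (by positivity) (by positivity)]; simp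
  set Y : Hor d → ℝ≥0∞ := fun k => ofReal C' * (‖Z₁ k‖ₑ + ‖Z₂ k‖ₑ) with hYdef
  have hY : Measurable Y := (m₁.enorm.add m₂.enorm).const_mul _
  have hYf : ∀ k, Y k ≠ ⊤ := fun k => by finiteness
  have hYi : ∫⁻ k, (el (t + 1) k * Y k) ^ 2 ≤ ofReal (C' ^ 2 * K₀) :=
    lintegral_sq_ofReal_mul_le (by positivity) hY₀
  have hCC : C ≤ C' := le_mul_of_one_le_left hC (by linarith [sqrt_nonneg μmax])
  have hle : ∀ k, ofReal C * (‖Z₁ k‖ₑ + ‖Z₂ k‖ₑ) ≤ Y k := fun k => mul_le_l (ofReal_le_ofReal hCC)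
  have h0 : IsDom 0 (loc R) Y (A 0) := (hD 0 (by norm_num)).mono (by norm_num) hle
  have h1 : IsDom 1 (loc R) Y (A 1) := (hD 1 (by norm_num)).mono (by norm_num) hle
  have h2 : IsDom 2 (loc R) Y (A 2) := (hD 2 le_rfl).mono (by norm_num) hle
  have hfreq : ∀ (n : ℕ), n ≤ 2 → ∀ i, IsDom (n + 1) (loc R) Y
    (fun p => ((√μ * (2 * π * p.1 i) : ℝ) * Complex.I) * A n p) := fun n hn i => by
    refine ((hD n hn).mul_freq (C := 1 + √μmax) ?_ i).mono le_rfl fun k => ?_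
    · rw [abs_of_nonneg (sqrt_nonneg _)]; linarith [Real.sqrt_le_sqrt hμ]
    · rw [← mul_assoc, ← ofReal_mul (by positivity)]
  have hI := isLoc_loc (d := d) hR
  have hd := hasDerivAt_amp hs δ Z₁ Z₂
  have hcont := fun n k => continuous_iff_continuousAt.2 fun z => (hd n k z).continuousAt
  have hpd := fun z hz X => pd_of_re_fourierInv hI ht hY hYf hYi h0 h1 (hd 0) (fun z _ X => hsig X z)
    (z := z) hz X
  have hpm := fun j => measurable_fderiv_apply_const ℝ σ (dir j)
  have hq :=
    fun i => exists_isCoefS ht (by positivity) (by positivity) hI hY hYi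
      (by have := hfreq 0 (by norm_num) i; rwa [Nat.cast_zero, zero_add] at this)
      (by have := hfreq 1 (by norm_num) i; rwa [Nat.cast_one, one_add_one_eq_two] at this)
      (fun k z => (hd 0 k z).const_mul ((√μ * (2 * π * k i) : ℝ) * Complex.I))
      (fun k => (hcont 1 k).const_mul ((√μ * (2 * π * k i) : ℝ) * Complex.I))
      (measurable_ofReal.comp ((hpm _).const_mul _)).aestronglyMeasurable
      fun z hz X => (hpd z hz X).2 √μ i
  have hJ :=
    exists_isCoefS ht (by positivity) (by positivity) hI hY hYi h1 h2 (hd 1) (hcont 2)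
      (measurable_ofReal.comp (((hpm _).const_add 1).sub_const 1)).aestronglyMeasurable
      fun z hz X => by rw [add_sub_cancel_left]; exact (hpd z hz X).1
  refine ⟨⟨by positivity, by positivity, fun i => ?_, ?_, ?_⟩, hq, hJ⟩
  · obtain ⟨A, h, hA, -⟩ := hq i
    exact ⟨A, h, hA⟩
  · obtain ⟨A, h, hA, -⟩ := hJ
    exact ⟨A, h, hA⟩
  have hX : ∀ᵐ X, hmin ≤ 1 + (𝓕⁻ (fun k => Z₁ k - Z₂ k) X).re := by
    filter_upwards [hdepth, fourierInv_modes_sub_ae (i₁.sub i₂)] with X h3 h4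
    rw [hZ₁, hZ₂, h4]; linarith
  have hX' : ∀ᵐ p ∂volS d, hmin ≤ 1 + (𝓕⁻ (fun k => Z₁ k - Z₂ k) p.1).re := by
    rw [volS_eq]; exact Measure.quasiMeasurePreserving_fst.ae hX
  filter_upwards [hX', ae_volS_mem] with p h3 hp
  have h4 := norm_fourierInv_amp_sub_le hs ht (by positivity) hL hδ hprof m₁ m₂ hY₀ hp p.1
  rw [fourierInv_sub_apply (g := fun k => Z₁ k - Z₂ k) (h1.integrable hI ht hY hYi hp).integrable
    (i₁.sub i₂)] at h4
  have h5 := (abs_re_le_norm _).trans h4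
  rw [sub_re] at h5
  have h6 := (le_div_iff₀ (by positivity)).1 hδ'
  have h7 := (hpd p.2 hp p.1).1
  rw [Prod.mk.eta] at h7
  rw [h7]; linarith [(abs_le.1 h5).1]

theorem normL2S_le (h : ∀ j, ‖W j‖ ≤ E) :
  normL2S (fun j => (W j : Amb d → ℂ)) ≤ √(d + 1) * E := by
  have hE := (norm_nonneg _).trans (h (inr ()))
  have e : ∀ j, ∫ p, ‖W j p‖ ^ 2 ∂volS d = ‖W j‖ ^ 2 := fun j => by
    have h1 := congrArg ENNReal.toReal (enorm_sq_eq_lintegral (W j))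
    rw [toReal_pow, toReal_enorm] at h1
    rw [h1, integral_eq_lintegral_of_nonneg_ae (f := fun p => ‖W j p‖ ^ 2) (.of_forall fun p => by positivity)
      ((Lp.stronglyMeasurable _).norm.pow 2).aestronglyMeasurable]
    congr 2; ext p; rw [ofReal_pow (norm_nonneg _), ofReal_norm]
  rw [normL2S, ← Real.sqrt_sq hE, ← sqrt_mul (by positivity)]
  refine Real.sqrt_le_sqrt ((Finset.sum_le_card_nsmul _ _ (E ^ 2) fun j _ => ?_).trans_eq ?_)
  · rw [e]; exact pow_le_pow_left₀ (norm_nonneg _) (h j) 2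
  · simp

theorem gradMu_ae (hx : x ∈ H10 d) (μ : ℝ) (j : Idx d) :
  gradMu μ (x none) j =ᵐ[volS d] sgrad μ x j := by
  filter_upwards [weakPartial_of_mem_H10 hx (ae_eq_refl _) j,
    Lp.coeFn_smul ((scale μ j) : ℂ) (x (some j))] with p h1 h2
  rw [sgrad, h2, gradMu, Pi.smul_apply, h1, smul_eq_mul]

theorem isLam_congr {u' w : Amb d → ℂ} (h : u =ᵐ[volS d] u') (hw : IsLam r u' w) :
  IsLam r u w :=
  ⟨hw.1, fun ϕ hϕ => (hw.2 ϕ hϕ).trans (integral_congr_ae (h.symm.mul (ae_eq_refl (lamX r ϕ))))⟩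

theorem isLamDz_congr {u' w : Amb d → ℂ} (h : u =ᵐ[volS d] u') (hw : IsLamDz r u' w) :
  IsLamDz r u w :=
  ⟨hw.1, fun ϕ hϕ => (hw.2 ϕ hϕ).trans (congrArg Neg.neg (integral_congr_ae
    (h.symm.mul (ae_eq_refl (lamX r (pd (inr ()) ϕ))))))⟩
end FlatStrip
end

open FlatStrip TemperedDistribution
theorem mainTheorem12
    (d : ℕ) (hd : d = 1 ∨ d = 2) (t₀ : ℝ) (ht₀ : (d : ℝ) / 2 < t₀)
    (θ : ℝ → ℝ) (hθ : IsCutoff θ)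
    (hmin μmax Rζ Rb : ℝ) (h_hmin : 0 < hmin) (h_μmax : 0 < μmax) :
    ∃ δ₀ : ℝ, 0 < δ₀ ∧ ∀ δ : ℝ, 0 < δ → δ ≤ δ₀ →
    ∀ s : ℝ, 0 ≤ s → s ≤ t₀ + 1 / 2 →
    ∃ M : ℝ, ∀ ε β μ : ℝ, 0 < ε → ε ≤ 1 → 0 < β → β ≤ 1 → 0 < μ → μ ≤ μmax →
    ∀ ζ b : Lp ℝ 2 (volume : Measure (Hor d)),
      MemSobolev (t₀ + 1) 2 (toDist ζ) → MemSobolev (t₀ + 1) 2 (toDist b) →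
      ε * sobNorm (t₀ + 1) (toDist ζ) ≤ Rζ →
      β * sobNorm (t₀ + 1) (toDist b) ≤ Rb →
      (∀ᵐ X, hmin ≤ ε * ζ X + 1 - β * b X) →
    ∀ B : 𝓢'(Hor d, ℂ), MemSobolev (s - 1 / 2) 2 B →
    ∃ Bd : Amb d → ℂ,
      IsVariationalSolution μ (matP μ (sigma θ δ ε β ζ b)) B Bd ∧
      (∀ u, IsVariationalSolution μ (matP μ (sigma θ δ ε β ζ b)) B u → u =ᵐ[volS d] Bd) ∧
      (∃ W : Idx d → Amb d → ℂ, (∀ j, IsLam s (gradMu μ Bd j) (W j)) ∧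
        normL2S W ≤ M * dataNorm μ s B) ∧
      (max 0 (1 - t₀) ≤ s →
        ∃ W : Idx d → Amb d → ℂ, (∀ j, IsLamDz (s - 1) (gradMu μ Bd j) (W j)) ∧
          normL2S W ≤ M * dataNorm μ s B) := by
  obtain ⟨δ₀, hδ₀, hsys⟩ := exists_isSystem_sigma d ht₀ hθ μmax Rζ Rb h_hmin
  have ht : 1 / 2 ≤ t₀ := by
    have : (1 : ℝ) ≤ d := by rcases hd with rfl | rfl <;> norm_num
    linarith
  refine ⟨δ₀, hδ₀, fun δ hδ hδ' s hs hst => ?_⟩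
  obtain ⟨K, hK, hsys⟩ := hsys δ hδ hδ'
  obtain ⟨C₁, hC₁, hreg⟩ := exists_wnSum_le_of_fourier (K := K) (c := hmin / 2) d ht₀ ht hK (by positivity)
    h_μmax.le hs hst
  obtain ⟨C₂, hC₂, hincr⟩ : ∃ C₂ : ℝ, 0 ≤ C₂ ∧ (max 0 (1 - t₀) ≤ s → ∀ (c μ : ℝ)
      (q : Fin d → Amb d → ℝ) (J : Amb d → ℝ), 0 ≤ μ → μ ≤ μmax →
      IsSystem t₀ K c q J → IsIncrSystem t₀ K q J → ∀ (G : Idx d → L2S d) (b : Hor d → ℂ),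
      IsFourierGrad μ (gradS q J G) → IsFourierFlux μ b (fluxS q J G) → ∀ τ, 0 < τ → ∀ j,
      incr τ (s - 1) (gradS q J G j) ≤
        ENNReal.ofReal τ ^ 2 * (ENNReal.ofReal C₂ * wnSum s q J G)) := by
    by_cases h : max 0 (1 - t₀) ≤ s
    · obtain ⟨C, hC, h'⟩ := IsSystem.exists_incr_le (K := K) d ht₀ hK h_μmax.le hs
        ((le_max_right _ _).trans h) hst
      exact ⟨C.toReal, ENNReal.toReal_nonneg, fun _ => by rwa [ENNReal.ofReal_toReal hC]⟩
    · exact ⟨0, le_rfl, fun h' => (h h').elim⟩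
  refine ⟨√(d + 1) * √((1 + C₂) * C₁), fun ε β μ hε _ hβ _ hμ hμ' ζ b hζ hb hζR hbR hdepth B hB => ?_⟩
  obtain ⟨hS, hI⟩ := hsys ε β μ hε hβ hμ' ζ b hζ hb hζR hbR hdepth
  obtain ⟨x, hx, hsol, huniq, hflux⟩ := hS.exists_unique_solution hμ hs hB
  have hgrad := isFourierGrad_of_mem_H10 hx μ
  rw [← hS.gradS_gL μ x] at hgrad
  rw [fluxL_apply] at hflux
  have hD : 0 ≤ dataNorm μ s B := Real.sqrt_nonneg _
  have hmB := memLp_dataNorm hμ hB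
  have hmeas : AEMeasurable (fhat B) volume :=
    (fhat_of_memSobolev hB).1.locallyIntegrable.aestronglyMeasurable.aemeasurable
  have hsum := hreg μ _ _ hμ.le hμ' hS _ _ _ hD hgrad hflux hmeas (lintegral_multNorm hmB).le
  have hwn : ∀ j, wnS s (sgrad μ x j) ≤ ENNReal.ofReal (C₁ * dataNorm μ s B ^ 2) := fun j => by
    rw [← hS.gradS_gL μ x]
    exact (wnS_grad_le_wnSum j).trans hsum
  have hle : ∀ a, 0 ≤ a → a ≤ (1 + C₂) * C₁ →
      √(a * dataNorm μ s B ^ 2) ≤ √((1 + C₂) * C₁) * dataNorm μ s B := fun a ha h => by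
    rw [Real.sqrt_mul ha, Real.sqrt_sq hD]
    exact mul_le_mul_of_nonneg_right (Real.sqrt_le_sqrt h) hD
  refine ⟨x none, hsol, huniq, ?_, fun hs1 => ?_⟩
  · choose W hW _ hW2 using fun j => exists_isLam ((hwn j).trans_lt ENNReal.ofReal_lt_top)
    refine ⟨fun j => W j, fun j => isLam_congr (gradMu_ae hx μ j) (hW j), ?_⟩
    rw [mul_assoc]
    refine normL2S_le fun j => le_trans ?_ (hle C₁ hC₁ (by nlinarith))
    have h := ENNReal.toReal_mono ENNReal.ofReal_ne_top ((hW2 j).trans_le (hwn j))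
    rw [ENNReal.toReal_pow, toReal_enorm, ENNReal.toReal_ofReal (by positivity)] at h
    exact Real.le_sqrt_of_sq_le h
  · have hlow : ∀ j, wnS (s - 1) (sgrad μ x j) < ⊤ := fun j =>
      (wnS_mono (by linarith) _).trans_lt ((hwn j).trans_lt ENNReal.ofReal_lt_top)
    choose W hW hW2 using fun j => exists_isLamDz (hlow j) (E := C₂ * C₁ * dataNorm μ s B ^ 2)
      (by positivity) fun τ hτ => by
        have h := hincr hs1 _ μ _ _ hμ.le hμ' hS hI _ _ hgrad hflux τ hτ j
        rw [hS.gradS_gL μ x] at h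
        refine h.trans (mul_le_mul' le_rfl ((mul_le_mul' le_rfl hsum).trans_eq ?_))
        rw [← ENNReal.ofReal_mul hC₂, mul_assoc]
    refine ⟨fun j => W j, fun j => isLamDz_congr (gradMu_ae hx μ j) (hW j), ?_⟩
    rw [mul_assoc]
    exact normL2S_le fun j => (hW2 j).trans (hle (C₂ * C₁) (by positivity) (by nlinarith))
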